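/- **Setting.** Let $d\ge 1$ and let $\mathcal V=\mathbb Z^d$ (counting measure) or $\mathcal V=\mathbb R^d$ (Lebesgue measure). Fix Maxwell–Boltzmann, Bose–Einstein or Fermi–Dirac statistics. Let $(\Omega,\mathbb P)$ be a probability space with an ergodic measure preserving action $\tau$ of $\mathbb Z^d$, and let $V_\omega:\mathcal V\to\mathbb R$ be a jointly measurable, locally integrable random potential such that * $V_{\tau_\gamma\omega}(x)=V_\omega(x+\gamma)$ for $\gamma\in\mathbb Z^d$; * (independence at a distance) for some $R_0>0$, $(V_\omega(x))_{x\in A}$ and $(V_\omega(x))_{x\in B}$ are independent whenever $\operatorname{dist}(A,B)>R_0$; * (lower bound) $-\Delta+V_\omega\ge -C$ with $C$ independent of $\omega$; * $\sup_{x\in[0,1)^d\cap\mathcal V}V_\omega(x)\le K(\omega)$ for some $K\in L^2(\Omega)$. Let $W_n:\mathcal V^n\to(-\infty,+\infty]$, $n\in\mathbb N$, be measurable and stable, $W_n\ge -nB$ with $B>0$ independent of $n$, and suppose that one of the following holds: 1. (tempered pair interactions) $W_n(\mathbf x)=\sum_{i<j}U(x^i-x^j)$ with $U(-x)=U(x)$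 and $|U(x)|\le A|x|^{-\lambda}$ for $|x|\ge R_0$, where $R_0>0$ and $\lambda>d$; 2. (compactly supported interactions) the $W_n$ are invariant under simultaneous translation of all particles by vectors of $\mathbb Z^d$, $W_1=0$, and for some $R_0>0$ one has $W_n(\mathbf x)=W_{|I|}(\mathbf x^{I})+W_{|I^c|}(\mathbf x^{I^c})$ for each partition of the particles in two nonempty groups $I,I^c$ with $|x^i-x^j|\ge R_0$ for $i\in I$, $j\in I^c$. For a bounded open $\Lambda\subset\mathcal V$ (a finite set if $\mathcal V=\mathbb Z^d$) let $H_\omega(\Lambda,n)=\sum_{i=1}^n(-\Delta+V_\omega)^{(i)}+W_n$ with Dirichlet boundary condition on the subspace of $L^2(\Lambda^n)$ with the given statistics, defined through its quadratic form on the test functions of finite interaction energy (smooth functions compactly supported in $\Lambda^n$; on $\mathbb Z^d$, functions supported in $\Lambda^n$, extended by zero). Let $E_k(\Lambda,n,\omega)\in(-\infty,+\infty]$, $k\ge1$, be its $k$-th eigenvalue with multiplicity (the $k$-th min-max value of the form, $+\infty$ if there is no $k$-dimensional space of such test functions), and let $E_\omega(\Lambda,n,S)=E_{\exp S}(\Lambda,n,\omega)$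 for $e^S\in\mathbb N$. Say that $\Lambda\to\infty$ (in the sense of Fisher) if $|\Lambda|\to\infty$ and there are $\alpha_0>0$ and a function $\pi$ with $\pi(\alpha)\to0$ as $\alpha\downarrow0$ such that $|\partial_{\alpha\operatorname{diam}\Lambda}\Lambda|\le\pi(\alpha)|\Lambda|$ for all $0<\alpha<\alpha_0$ and all $\Lambda$ of the sequence; here $\partial_h\Lambda$ is the set of points at distance less than $h$ from both $\Lambda$ and its complement. For $\rho>0$, $\sigma\ge0$ define the limiting energy density by $$\mathcal E(\rho,\sigma)=\lim\frac{E_\omega(\Lambda,n,S)}{n}\quad\text{as }\Lambda\to\infty,\ \frac n{|\Lambda|}\to\rho,\ \frac Sn\to\sigma,$$ the limit being a constant, taken in $L^2(\Omega)$, the same along all such sequences; put $\mathcal E(\rho,\sigma)=+\infty$ if there is no such finite limit. Let $\rho_c\in[0,\infty]$ be the supremum of the $\rho>0$ such that $\mathcal E(\rho,\sigma)<\infty$ for all $\sigma\ge0$. **Proposition (energy density properties).** 0. (Existence.) The finite limit $\mathcal E(\rho,\sigma)$ exists if there are $\rho'>\rho$, $\sigma'>\sigma$ and a sequence of cubes of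 integer side $\Lambda_j\to\infty$ with $n_j/|\Lambda_j|\to\rho'$, $S_j/n_j\to\sigma'$ and $E_\omega(\Lambda_j,n_j,S_j)<\infty$ almost surely for all $j$. 1. $\mathcal E$ is a convex function of $(\rho^{-1},\sigma)$ on $\rho>0$, $\sigma\ge0$. 2. $\mathcal E$ is nondecreasing in $\rho$ and in $\sigma$. 3. $\mathcal E$ is continuous on $\{0<\rho<\rho_c\}\times\{\sigma\ge0\}$; more generally, it is continuous on the set of all $(\rho,\sigma)$, $\rho>0$, $\sigma\ge0$, with $\mathcal E(\rho,\sigma)<\infty$. -/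

import Mathlib

open MeasureTheory ProbabilityTheory Filter Topology
open scoped ENNReal

namespace RandomGas

/-! ### Configuration space -/

/-- The two settings: the lattice `ℤ^d` and the continuum `ℝ^d`. -/
inductive Medium
  | lattice
  | continuum

/-- The one-particle configuration space. -/
def Site : Medium → ℕ → Type
  | .lattice, d => Fin d → ℤ
  | .continuum, d => EuclideanSpace ℝ (Fin d)

noncomputable instance : ∀ (𝒢 : Medium) (d : ℕ), NormedAddCommGroup (Site 𝒢 d)
  | .lattice, d => inferInstanceAs (NormedAddCommGroup (Fin d → ℤ))
  | .continuum, d => inferInstanceAs (NormedAddCommGroup (EuclideanSpace ℝ (Fin d)))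

/-- Counting measure on the lattice, Lebesgue measure in the continuum.  The configuration space
`Fin n → Site 𝒢 d` of `n` particles carries the corresponding product measure. -/
noncomputable instance : ∀ (𝒢 : Medium) (d : ℕ), MeasureSpace (Site 𝒢 d)
  | .lattice, d => { toMeasurableSpace := inferInstanceAs (MeasurableSpace (Fin d → ℤ))
                     volume := (Measure.count : Measure (Fin d → ℤ)) }
  | .continuum, d => inferInstanceAs (MeasureSpace (EuclideanSpace ℝ (Fin d)))

/-- The real coordinates of a point. -/
def coord : (𝒢 : Medium) → (d : ℕ) → Site 𝒢 d → Fin d → ℝ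
  | .lattice, d => fun (x : Fin d → ℤ) i => (x i : ℝ)
  | .continuum, d => fun (x : EuclideanSpace ℝ (Fin d)) i => x i

/-- An integer vector as a point of the configuration space. -/
noncomputable def shift : (𝒢 : Medium) → (d : ℕ) → (Fin d → ℤ) → Site 𝒢 d
  | .lattice, _ => fun γ => γ
  | .continuum, d => fun γ => (WithLp.toLp 2 (fun i => (γ i : ℝ)) : EuclideanSpace ℝ (Fin d))

/-- The unit cell `[0, 1)^d`; on the lattice this is the single site `0`. -/
def unitCell (𝒢 : Medium) (d : ℕ) : Set (Site 𝒢 d) :=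
  {x | ∀ i, 0 ≤ coord 𝒢 d x i ∧ coord 𝒢 d x i < 1}

/-- The cube of side `L` with a corner at the origin: `{0, …, L - 1}^d` on the lattice and
`(0, L)^d` in the continuum. -/
def cube : (𝒢 : Medium) → (d : ℕ) → ℕ → Set (Site 𝒢 d)
  | .lattice, d, L => {x : Fin d → ℤ | ∀ i, 0 ≤ x i ∧ x i < L}
  | .continuum, d, L => {x : EuclideanSpace ℝ (Fin d) | ∀ i, 0 < x i ∧ x i < L}

/-! ### Domains tending to infinity -/

/-- The `h`-neighbourhood of the boundary of `Λ`: the points at distance less than `h` both from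
`Λ` and from its complement.  In the continuum this is literally the open `h`-neighbourhood of the
topological boundary (see `collar_eq_thickening_frontier`); this form of the definition also
makes sense on the lattice, where the topological boundary is empty. -/
def collar {X : Type*} [PseudoEMetricSpace X] (h : ℝ) (Λ : Set X) : Set X :=
  Metric.thickening h Λ ∩ Metric.thickening h Λᶜ

theorem collar_eq_thickening_frontier {X : Type*} [NormedAddCommGroup X] [NormedSpace ℝ X]
    (h : ℝ) (Λ : Set X) : collar h Λ = Metric.thickening h (frontier Λ) := by
  ext x
  simp only [collar, Set.mem_inter_iff, Metric.mem_thickening_iff]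
  constructor
  · rintro ⟨⟨y, hy, hxy⟩, z, hz, hxz⟩
    obtain ⟨w, hw, hwf⟩ := isPreconnected_closed_iff.1 (convex_ball x h).isPreconnected
      (closure Λ) (closure Λᶜ) isClosed_closure isClosed_closure
      (fun v _ => (em (v ∈ Λ)).imp (fun hv => subset_closure hv) (fun hv => subset_closure hv))
      ⟨y, by rwa [Metric.mem_ball, dist_comm], subset_closure hy⟩
      ⟨z, by rwa [Metric.mem_ball, dist_comm], subset_closure hz⟩
    rw [← frontier_eq_closure_inter_closure] at hwf
    exact ⟨w, hwf, by rwa [Metric.mem_ball, dist_comm] at hw⟩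
  · rintro ⟨w, hwf, hw⟩
    have hw' : w ∈ Metric.ball x h := by rwa [Metric.mem_ball, dist_comm]
    rw [frontier_eq_closure_inter_closure] at hwf
    obtain ⟨y, hy, hyL⟩ := mem_closure_iff.1 hwf.1 _ Metric.isOpen_ball hw'
    obtain ⟨z, hz, hzL⟩ := mem_closure_iff.1 hwf.2 _ Metric.isOpen_ball hw'
    rw [Metric.mem_ball, dist_comm] at hy hz
    exact ⟨⟨y, hyL, hy⟩, z, hzL, hz⟩

/-- `Λ j` is a sequence of bounded domains that tends to infinity in the sense of Fisher. -/
structure TendsToInfinity {𝒢 : Medium} {d : ℕ} (Λ : ℕ → Set (Site 𝒢 d)) : Prop where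
  isOpen : ∀ j, IsOpen (Λ j)
  isBounded : ∀ j, Bornology.IsBounded (Λ j)
  nonempty : ∀ j, (Λ j).Nonempty
  volume_tendsto : Tendsto (fun j => (volume (Λ j)).toReal) atTop atTop
  shape : ∃ π : ℝ → ℝ, Tendsto π (𝓝[>] 0) (𝓝 0) ∧ ∃ α₀ > 0, ∀ α, 0 < α → α < α₀ → ∀ j,
    volume (collar (α * Metric.diam (Λ j)) (Λ j)) ≤ ENNReal.ofReal (π α) * volume (Λ j)

/-- The thermodynamic limit at density `ρ` and entropy per particle `σ`: `Λ → ∞` in the sense of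
Fisher, `n / |Λ| → ρ` and `S / n → σ`, where the entropies are `S = log k` with `k ∈ {1, 2, …}`. -/
structure IsThermodynamicSequence {𝒢 : Medium} {d : ℕ} (Λ : ℕ → Set (Site 𝒢 d)) (n k : ℕ → ℕ)
    (ρ σ : ℝ) : Prop where
  domains : TendsToInfinity Λ
  density : Tendsto (fun j => (n j : ℝ) / (volume (Λ j)).toReal) atTop (𝓝 ρ)
  index_pos : ∀ j, 1 ≤ k j
  entropy : Tendsto (fun j => Real.log (k j) / (n j : ℝ)) atTop (𝓝 σ)

/-! ### Wave functions and quadratic forms -/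

/-- Maxwell–Boltzmann, Bose–Einstein and Fermi–Dirac statistics. -/
inductive Statistics
  | boltzmann
  | bose
  | fermi

/-- The behaviour of a wave function under permutations of the particles. -/
def HasStatistics {X : Type*} {n : ℕ} (φ : (Fin n → X) → ℂ) : Statistics → Prop
  | .boltzmann => True
  | .bose => ∀ (π : Equiv.Perm (Fin n)) (x : Fin n → X), φ (fun i => x (π i)) = φ x
  | .fermi => ∀ (π : Equiv.Perm (Fin n)) (x : Fin n → X),
      φ (fun i => x (π i)) = ((Equiv.Perm.sign π : ℤ) : ℂ) * φ x

/-- Smoothness of a wave function (no condition on the lattice). -/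
def IsSmooth : (𝒢 : Medium) → (d n : ℕ) → ((Fin n → Site 𝒢 d) → ℂ) → Prop
  | .lattice, _, _ => fun _ => True
  | .continuum, d, n => fun (φ : (Fin n → EuclideanSpace ℝ (Fin d)) → ℂ) => ContDiff ℝ ((⊤ : ℕ∞) : WithTop ℕ∞) φ

/-- Test functions of `n` particles in `Λ`: smooth functions with compact support in `Λ^n`, which
is the Dirichlet condition.  On the lattice: functions with finite support contained in `Λ^n`. -/
structure IsTestFunction {𝒢 : Medium} {d : ℕ} (Λ : Set (Site 𝒢 d)) (n : ℕ)
    (φ : (Fin n → Site 𝒢 d) → ℂ) : Prop where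
  smooth : IsSmooth 𝒢 d n φ
  compact : HasCompactSupport φ
  support : tsupport φ ⊆ {x | ∀ i, x i ∈ Λ}

/-- `|∇φ(x)|²`, the density of `⟨-Δφ, φ⟩`.  On the lattice it is the sum of the squared
forward differences in all `n d` coordinate directions. -/
noncomputable def gradSq : (𝒢 : Medium) → (d n : ℕ) → ((Fin n → Site 𝒢 d) → ℂ) →
    (Fin n → Site 𝒢 d) → ℝ
  | .lattice, d, n => fun (φ : (Fin n → Fin d → ℤ) → ℂ) (x : Fin n → Fin d → ℤ) =>
      ∑ i : Fin n, ∑ l : Fin d, ‖φ (x + Pi.single i (Pi.single l 1)) - φ x‖ ^ 2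
  | .continuum, d, n => fun (φ : (Fin n → EuclideanSpace ℝ (Fin d)) → ℂ)
        (x : Fin n → EuclideanSpace ℝ (Fin d)) =>
      ∑ i : Fin n, ∑ l : Fin d,
        ‖fderiv ℝ φ x (Pi.single i (EuclideanSpace.single l (1 : ℝ)))‖ ^ 2

/-- `‖φ‖²` in `L²`. -/
noncomputable def normSq {𝒢 : Medium} {d n : ℕ} (φ : (Fin n → Site 𝒢 d) → ℂ) : ℝ :=
  ∫ x, ‖φ x‖ ^ 2

/-- The quadratic form `⟨∑ᵢ (-Δ + v)^{(i)} φ, φ⟩` of `n` noninteracting particles in the external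
potential `v`. -/
noncomputable def freeForm {𝒢 : Medium} {d n : ℕ} (v : Site 𝒢 d → ℝ)
    (φ : (Fin n → Site 𝒢 d) → ℂ) : ℝ :=
  (∫ x, gradSq 𝒢 d n φ x) + ∫ x, (∑ i, v (x i)) * ‖φ x‖ ^ 2

/-- `∫ w⁺ |φ|²`, with values in `[0, ∞]`; here `w⁺` is the positive part of `w`. -/
noncomputable def posPartForm {𝒢 : Medium} {d n : ℕ} (w : (Fin n → Site 𝒢 d) → EReal)
    (φ : (Fin n → Site 𝒢 d) → ℂ) : ℝ≥0∞ :=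
  ∫⁻ x, (w x).toENNReal * ‖φ x‖ₑ ^ 2

/-- The interaction energy `∫ w |φ|²`, used where `∫ w⁺ |φ|²` and `∫ w⁻ |φ|²` are finite. -/
noncomputable def interactionForm {𝒢 : Medium} {d n : ℕ} (w : (Fin n → Site 𝒢 d) → EReal)
    (φ : (Fin n → Site 𝒢 d) → ℂ) : ℝ :=
  (posPartForm w φ).toReal - (posPartForm (fun x => -w x) φ).toReal

/-! ### The model -/

/-- The data of the model: the random potential `V_ω`, the interaction potentials `W_n`, with
values in `(-∞, ∞]`, and the statistics. -/
structure Model (𝒢 : Medium) (d : ℕ) (Ω : Type*) where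
  potential : Ω → Site 𝒢 d → ℝ
  interaction : (n : ℕ) → (Fin n → Site 𝒢 d) → EReal
  statistics : Statistics

variable {𝒢 : Medium} {d : ℕ} {Ω : Type*}

/-- `E_k(Λ, n, ω)`: the `k`-th eigenvalue (`k ≥ 1`, in increasing order and with multiplicity) of the
Hamiltonian `∑ᵢ (-Δ + V_ω)^{(i)} + W_n` of `n` particles in `Λ` with Dirichlet boundary condition,
acting on the subspace of `L²(Λ^n)` with the prescribed statistics.  The Hamiltonian is the one
defined by its quadratic form on test functions of finite interaction energy, and `E_k` is its
`k`-th min-max value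
`inf {e : ⟨Hφ, φ⟩ ≤ e ‖φ‖² for all φ in some k-dimensional space of test functions}`.
It is `+∞` if fewer than `k` linearly independent test functions have finite interaction energy,
as may happen for hard cores. -/
noncomputable def Model.eigenvalue (M : Model 𝒢 d Ω) (Λ : Set (Site 𝒢 d)) (n k : ℕ) (ω : Ω) :
    EReal :=
  ⨅ (e : ℝ) (_ : ∃ F : Submodule ℂ ((Fin n → Site 𝒢 d) → ℂ), Module.finrank ℂ F = k ∧
    ∀ φ ∈ F, IsTestFunction Λ n φ ∧ HasStatistics φ M.statistics ∧
      posPartForm (M.interaction n) φ ≠ ⊤ ∧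
      freeForm (M.potential ω) φ + interactionForm (M.interaction n) φ ≤ e * normSq φ), (e : EReal)

/-- `-Δ + V_ω ≥ -C` with a constant that does not depend on `ω`. -/
def Model.IsLowerBounded (M : Model 𝒢 d Ω) : Prop :=
  ∃ C > 0, ∀ ω, ∀ φ : (Fin 1 → Site 𝒢 d) → ℂ, IsTestFunction Set.univ 1 φ →
    -C * normSq φ ≤ freeForm (M.potential ω) φ

/-- Independence at a distance of the random potential. -/
def Model.IsIndependentAtDistance [MeasurableSpace Ω] (M : Model 𝒢 d Ω) (P : Measure Ω) : Prop :=
  ∃ R₀ > 0, ∀ A B : Set (Site 𝒢 d), (∀ x ∈ A, ∀ y ∈ B, R₀ < dist x y) →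
    IndepFun (fun ω (x : A) => M.potential ω x) (fun ω (y : B) => M.potential ω y) P

/-- The random potential is `ℤ^d`-covariant: `V_{τ_γ ω}(x) = V_ω(x + γ)`. -/
def Model.IsCovariant [AddAction (Fin d → ℤ) Ω] (M : Model 𝒢 d Ω) : Prop :=
  ∀ (γ : Fin d → ℤ) (ω : Ω) (x : Site 𝒢 d),
    M.potential (γ +ᵥ ω) x = M.potential ω (x + shift 𝒢 d γ)

/-- Stability: `W_n ≥ -n B`. -/
def Model.IsStable (M : Model 𝒢 d Ω) : Prop :=
  ∃ B : ℝ, 0 < B ∧ ∀ (n : ℕ) (x : Fin n → Site 𝒢 d),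
    ((-(n * B) : ℝ) : EReal) ≤ M.interaction n x

/-- Tempered, translation invariant, symmetric pair interactions: `W_n = ∑_{i < j} U(xⁱ - xʲ)` and
`|U(x)| ≤ A |x|^{-λ}` for `|x| ≥ R₀`, where `λ > d`. -/
def Model.IsTemperedPair (M : Model 𝒢 d Ω) : Prop :=
  ∃ U : Site 𝒢 d → EReal, (∀ x, U (-x) = U x) ∧
    (∀ (n : ℕ) (x : Fin n → Site 𝒢 d), M.interaction n x =
      ∑ p : Fin n × Fin n with p.1 < p.2, U (x p.1 - x p.2)) ∧
    ∃ R₀ A lam : ℝ, 0 < R₀ ∧ (d : ℝ) < lam ∧ ∀ x, R₀ ≤ ‖x‖ →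
      ((-(A * ‖x‖ ^ (-lam)) : ℝ) : EReal) ≤ U x ∧ U x ≤ ((A * ‖x‖ ^ (-lam) : ℝ) : EReal)

/-- Compactly supported interactions: for each partition of the particles in two nonempty groups `I`
and `Iᶜ` at mutual distance at least `R₀` one has `W_n(x) = W_{|I|}(x^I) + W_{|Iᶜ|}(x^{Iᶜ})`. -/
def Model.IsCompactlySupported (M : Model 𝒢 d Ω) : Prop :=
  ∃ R₀ > 0, ∀ (n : ℕ) (I : Finset (Fin n)), I.Nonempty → Iᶜ.Nonempty →
    ∀ x : Fin n → Site 𝒢 d, (∀ i ∈ I, ∀ j ∈ Iᶜ, R₀ ≤ dist (x i) (x j)) →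
      M.interaction n x = M.interaction I.card (fun i => x (I.orderEmbOfFin rfl i)) +
        M.interaction Iᶜ.card (fun i => x (Iᶜ.orderEmbOfFin rfl i))

/-- The interactions are invariant under integer translations. -/
def Model.IsTranslationInvariant (M : Model 𝒢 d Ω) : Prop :=
  ∀ (n : ℕ) (γ : Fin d → ℤ) (x : Fin n → Site 𝒢 d),
    M.interaction n (fun i => x i + shift 𝒢 d γ) = M.interaction n x

/-- There are no self-interactions: `W_1 = 0`. -/
def Model.HasNoSelfInteraction (M : Model 𝒢 d Ω) : Prop :=
  ∀ x : Fin 1 → Site 𝒢 d, M.interaction 1 x = 0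

/-! ### The limiting energy density -/

variable [MeasurableSpace Ω]

/-- Convergence in `L²(Ω)` of the extended-real random variables `X j`, almost surely finite
for large `j`, to the constant `e`. -/
def TendstoL2 (P : Measure Ω) (X : ℕ → Ω → EReal) (e : ℝ) : Prop :=
  (∀ᶠ j in atTop, ∀ᵐ ω ∂P, X j ω ≠ ⊤ ∧ X j ω ≠ ⊥) ∧
    Tendsto (fun j => eLpNorm (fun ω => (X j ω).toReal - e) 2 P) atTop (𝓝 0)

/-- The energy per particle `E_ω(Λ, n, S) / n` converges in `L²(Ω)` to `e` as `Λ → ∞`,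
`n / |Λ| → ρ`, `S / n → σ`. -/
def Model.HasThermodynamicLimit (M : Model 𝒢 d Ω) (P : Measure Ω) (ρ σ e : ℝ) : Prop :=
  ∀ (Λ : ℕ → Set (Site 𝒢 d)) (n k : ℕ → ℕ), IsThermodynamicSequence Λ n k ρ σ →
    TendstoL2 P (fun j ω => M.eigenvalue (Λ j) (n j) (k j) ω / ((n j : ℝ) : EReal)) e

/-- The limiting energy density `𝓔(ρ, σ)`: the thermodynamic limit of the energy per particle, and
`+∞` if there is no finite limit. -/
noncomputable def Model.energyDensity (M : Model 𝒢 d Ω) (P : Measure Ω) (ρ σ : ℝ) : EReal :=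
  ⨅ (e : ℝ) (_ : M.HasThermodynamicLimit P ρ σ e), (e : EReal)

/-- The critical density `ρ_c ∈ [0, ∞]`: the supremum of the densities `ρ` such that `𝓔(ρ, σ)` is
finite for all `σ ≥ 0`. -/
noncomputable def Model.criticalDensity (M : Model 𝒢 d Ω) (P : Measure Ω) : ℝ≥0∞ :=
  sSup {r | ∃ ρ : ℝ, 0 < ρ ∧ r = ENNReal.ofReal ρ ∧ ∀ σ, 0 ≤ σ → M.energyDensity P ρ σ < ⊤}

end RandomGas

open RandomGas

namespace RandomGas

/-! ### The one-particle space -/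

/-! The energy is subadditive in a form that also keeps track of the entropy. If two groups of
particles live in regions at distance greater than the range `r₀`, the tensor products of two trial
spaces, (anti)symmetrised over the choices of the particles in the first group, form a trial space
for all particles. Dimensions multiply, so entropies `log k` add, and energies add up to the tails
of the interaction (`HasTrialSpace.combine`). For cubes of side `L` separated by corridors of width
`r`, with at most `m` particles per cube, the tails cost at most `m * tailBound d C lam r` per
particle, however many cubes there are (`sum_tail_le`, `HasTrialSpace.cells`). A corridor
proportional to `L` makes this cost of order `L ^ (d - λ)` and changes the density by a factor close
to one.

The theorem is therefore reduced to one deterministic quantity. `Model.HasBound` says that a single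
cube, corridor included, has density above `ρ`, entropy per particle above `σ`, and mean energy per
particle plus tail below `g`; `Model.bound` is the infimum of such `g`. It is the limit. From above,
`Λ` is filled with copies of a block and a few single particles. Copies in different cells are
independent, so the variance of their total energy is of order `n`, and the energy per particle lies
below variables that converge in mean square to a number below `g` (`exists_upper_bound`). From
below, `Λ` is completed to a cube by efficient blocks. Fisher's condition keeps that cube comparable
with `Λ`, and a mean energy in `Λ` that is too small would produce a cube that beats the bound
(`exists_lower_bound`). Upper bounds in mean square and a lower bound for the means alone already
give convergence in `L²`, because the energy per particle is bounded below uniformly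
(`tendsto_integral_sub_sq`).

The properties of the limit are read off from `HasBound`. Mixing blocks of two kinds in the right
proportion averages energy, entropy and volume per particle, whence convexity in `(ρ⁻¹, σ)`
(`hasBound_mix`). Monotonicity is immediate. The inequalities in `HasBound` are strict, so a bound
survives a small increase of `ρ` and `σ`; convexity gives continuity from the left
(`exists_not_hasBound`); with monotonicity this is continuity wherever the density is finite, and it
is finite exactly where some block exists (`energyDensity_lt_top_iff`).

The randomness needs three facts about a single eigenvalue. Its finiteness does not depend on `ω`
(`eigenvalue_lt_top_iff`); it is square integrable, by the bound `K` from above and by stability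
from below (`memLp_eigenvalue`); and it is measurable, up to null sets, with respect to the values
of the potential in the domain, so that eigenvalues of distant domains are independent
(`measurable_eigenvalue_comap`). -/

instance : ∀ (𝒢 : Medium) (d : ℕ), BorelSpace (Site 𝒢 d)
  | .lattice, d => inferInstanceAs (BorelSpace (Fin d → ℤ))
  | .continuum, d => inferInstanceAs (BorelSpace (EuclideanSpace ℝ (Fin d)))

instance : ∀ (𝒢 : Medium) (d : ℕ), SecondCountableTopology (Site 𝒢 d)
  | .lattice, d => inferInstanceAs (SecondCountableTopology (Fin d → ℤ))
  | .continuum, d => inferInstanceAs (SecondCountableTopology (EuclideanSpace ℝ (Fin d)))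

instance : ∀ (𝒢 : Medium) (d : ℕ), ProperSpace (Site 𝒢 d)
  | .lattice, d => inferInstanceAs (ProperSpace (Fin d → ℤ))
  | .continuum, d => inferInstanceAs (ProperSpace (EuclideanSpace ℝ (Fin d)))

noncomputable instance (d : ℕ) : NormedSpace ℝ (Site .continuum d) :=
  inferInstanceAs (NormedSpace ℝ (EuclideanSpace ℝ (Fin d)))

theorem isSmooth_continuum_iff {d n : ℕ} {φ : (Fin n → Site .continuum d) → ℂ} :
    IsSmooth .continuum d n φ ↔ ContDiff ℝ ((⊤ : ℕ∞) : WithTop ℕ∞) φ := Iff.rfl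

instance (d : ℕ) : DiscreteTopology (Site .lattice d) :=
  inferInstanceAs (DiscreteTopology (Fin d → ℤ))

theorem count_preimage_add_left {G : Type*} [AddGroup G] [MeasurableSpace G]
    [MeasurableSingletonClass G] (g : G) (s : Set G) :
    Measure.count ((g + ·) ⁻¹' s) = Measure.count s := by
  rw [← Measure.count_injective_image (add_right_injective g) ((g + ·) ⁻¹' s),
    Set.image_preimage_eq _ (AddGroup.addLeft_bijective g).surjective]

/-- Translation invariance, finiteness on compact sets and positivity on open sets are all that is
used of the measure, so lattice and continuum can be treated together from here on. -/
instance : ∀ (𝒢 : Medium) (d : ℕ), (volume : Measure (Site 𝒢 d)).IsAddHaarMeasure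
  | .lattice, d =>
    { lt_top_of_isCompact := fun {K} hK => by
        have : K.Finite := hK.finite_of_discrete
        exact Measure.count_apply_lt_top.2 this
      map_add_left_eq_self := fun g => by
        ext s hs
        rw [Measure.map_apply (measurable_const_add g) hs]
        change Measure.count _ = Measure.count _
        exact count_preimage_add_left g s
      open_pos := fun U hU hne => by
        change Measure.count U ≠ 0
        exact Measure.count_ne_zero hne }
  | .continuum, d => inferInstanceAs
      ((volume : Measure (EuclideanSpace ℝ (Fin d))).IsAddHaarMeasure)

instance (𝒢 : Medium) (d : ℕ) : SigmaFinite (volume : Measure (Site 𝒢 d)) := inferInstance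

variable {𝒢 : Medium} {d : ℕ}

@[simp] theorem coord_add (x y : Site 𝒢 d) (i : Fin d) :
    coord 𝒢 d (x + y) i = coord 𝒢 d x i + coord 𝒢 d y i := by
  cases 𝒢
  · exact Int.cast_add _ _
  · rfl

@[simp] theorem coord_sub (x y : Site 𝒢 d) (i : Fin d) :
    coord 𝒢 d (x - y) i = coord 𝒢 d x i - coord 𝒢 d y i := by
  cases 𝒢
  · exact Int.cast_sub _ _
  · rfl

@[simp] theorem coord_shift (γ : Fin d → ℤ) (i : Fin d) :
    coord 𝒢 d (shift 𝒢 d γ) i = γ i := by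
  cases 𝒢 <;> rfl

theorem abs_coord_le_norm (x : Site 𝒢 d) (i : Fin d) : |coord 𝒢 d x i| ≤ ‖x‖ := by
  cases 𝒢
  · have := norm_le_pi_norm (G := fun _ : Fin d => ℤ) x i
    rwa [Int.norm_eq_abs] at this
  · exact PiLp.norm_apply_le (p := 2) (β := fun _ : Fin d => ℝ) x i

/-- The factor `d` is crude but serves the sup norm of the lattice and the Euclidean norm alike. -/
theorem norm_le_of_abs_coord_le (x : Site 𝒢 d) {M : ℝ} (h : ∀ i, |coord 𝒢 d x i| ≤ M)
    (hd : 1 ≤ d) : ‖x‖ ≤ d * M := by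
  have hM : 0 ≤ M := (abs_nonneg _).trans (h ⟨0, hd⟩)
  have hd' : (1 : ℝ) ≤ d := by exact_mod_cast hd
  cases 𝒢
  · refine ((pi_norm_le_iff_of_nonneg (G := fun _ : Fin d => ℤ) hM).2 fun i => ?_).trans
      (le_mul_of_one_le_left hM hd')
    rw [Int.norm_eq_abs]; exact h i
  · refine (EuclideanSpace.norm_eq (𝕜 := ℝ) (n := Fin d) x).le.trans ?_
    rw [Real.sqrt_le_left (by positivity)]
    calc ∑ i, ‖x.ofLp i‖ ^ 2 ≤ ∑ _i : Fin d, M ^ 2 :=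
          Finset.sum_le_sum fun i _ => pow_le_pow_left₀ (norm_nonneg _) (h i) 2
      _ = d * M ^ 2 := by simp
      _ ≤ (d * M) ^ 2 := by nlinarith [sq_nonneg M]

theorem continuous_coord (i : Fin d) : Continuous (fun x : Site 𝒢 d => coord 𝒢 d x i) := by
  refine Metric.continuous_iff.2 fun x ε hε => ⟨ε, hε, fun y hy => ?_⟩
  rw [Real.dist_eq, ← coord_sub]
  rw [dist_eq_norm] at hy
  exact (abs_coord_le_norm _ _).trans_lt hy

theorem measurable_coord (i : Fin d) : Measurable (fun x : Site 𝒢 d => coord 𝒢 d x i) :=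
  (continuous_coord i).measurable

theorem shift_add (γ η : Fin d → ℤ) : shift 𝒢 d (γ + η) = shift 𝒢 d γ + shift 𝒢 d η := by
  cases 𝒢
  · rfl
  · refine PiLp.ext fun i => ?_
    exact Int.cast_add _ _

/-- The half-open box with sides `[a i, b i)`. -/
def box (𝒢 : Medium) (d : ℕ) (a b : Fin d → ℝ) : Set (Site 𝒢 d) :=
  {x | ∀ i, a i ≤ coord 𝒢 d x i ∧ coord 𝒢 d x i < b i}

theorem measurableSet_box (a b : Fin d → ℝ) : MeasurableSet (box 𝒢 d a b) := by
  simp only [box, Set.ofPred_forall]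
  exact MeasurableSet.iInter fun i => (measurableSet_le measurable_const (measurable_coord i)).inter
    (measurableSet_lt (measurable_coord i) measurable_const)

theorem volume_box_continuum (a b : Fin d → ℝ) :
    volume (box .continuum d a b) = ∏ i, ENNReal.ofReal (b i - a i) := by
  have h := (PiLp.volume_preserving_ofLp (Fin d)).measure_preimage
    (s := Set.univ.pi fun i => Set.Ico (a i) (b i))
    (MeasurableSet.univ_pi fun i => measurableSet_Ico).nullMeasurableSet
  rw [Real.volume_pi_Ico] at h
  rw [← h]
  congr 1
  ext x
  exact ⟨fun h i _ => h i, fun h i => h i (Set.mem_univ i)⟩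

theorem volume_box_lattice (a b : Fin d → ℝ) :
    volume (box .lattice d a b) = ∏ i, ((⌈b i⌉ - ⌈a i⌉).toNat : ℝ≥0∞) := by
  have : box .lattice d a b =
      ((Fintype.piFinset fun i => Finset.Ico ⌈a i⌉ ⌈b i⌉ : Finset (Fin d → ℤ)) : Set (Fin d → ℤ)) := by
    refine Set.ext fun (x : Fin d → ℤ) => Iff.symm ?_
    refine (Finset.mem_coe.trans Fintype.mem_piFinset).trans (forall_congr' fun i => ?_)
    rw [Finset.mem_Ico, Int.ceil_le, Int.lt_ceil]
    rfl
  rw [this]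
  refine (Measure.count_apply_finset (α := Fin d → ℤ) _).trans ?_
  simp [Fintype.card_piFinset]

/-- Integer corners and half-open sides are what make the two media agree. The cells are chosen
half-open for this reason. -/
theorem volume_box_int (a b : Fin d → ℤ) (hab : ∀ i, a i ≤ b i) :
    volume (box 𝒢 d (fun i => a i) (fun i => b i)) = ENNReal.ofReal (∏ i, ((b i : ℝ) - a i)) := by
  rw [ENNReal.ofReal_prod_of_nonneg fun i _ => sub_nonneg.2 (by exact_mod_cast hab i)]
  cases 𝒢
  · rw [volume_box_lattice]
    refine Finset.prod_congr rfl fun i _ => ?_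
    rw [Int.ceil_intCast, Int.ceil_intCast, ← ENNReal.ofReal_natCast]
    congr 1
    have : (((b i - a i).toNat : ℤ) : ℝ) = ((b i - a i : ℤ) : ℝ) := by
      rw [Int.toNat_of_nonneg (sub_nonneg.2 (hab i))]
    push_cast at this ⊢
    exact this
  · rw [volume_box_continuum]

/-! ### Derivatives -/

/-- The `l`-th unit vector. -/
noncomputable def unitVec (𝒢 : Medium) (d : ℕ) (l : Fin d) : Site 𝒢 d :=
  match 𝒢 with
  | .lattice => (Pi.single l 1 : Fin d → ℤ)
  | .continuum => (EuclideanSpace.single l (1 : ℝ) : EuclideanSpace ℝ (Fin d))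

/-- The partial derivative (forward difference on the lattice) of a wave function in the `l`-th
coordinate of the `i`-th particle. -/
noncomputable def deriv1 : (𝒢 : Medium) → (d n : ℕ) → Fin n → Fin d →
    ((Fin n → Site 𝒢 d) → ℂ) → (Fin n → Site 𝒢 d) → ℂ
  | .lattice, d, n => fun i l (φ : (Fin n → Fin d → ℤ) → ℂ) (x : Fin n → Fin d → ℤ) =>
      φ (x + Pi.single i (Pi.single l 1)) - φ x
  | .continuum, d, n => fun i l (φ : (Fin n → EuclideanSpace ℝ (Fin d)) → ℂ)
        (x : Fin n → EuclideanSpace ℝ (Fin d)) =>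
      fderiv ℝ φ x (Pi.single i (EuclideanSpace.single l (1 : ℝ)))

theorem gradSq_eq {n : ℕ} (φ : (Fin n → Site 𝒢 d) → ℂ) (x : Fin n → Site 𝒢 d) :
    gradSq 𝒢 d n φ x = ∑ i, ∑ l, ‖deriv1 𝒢 d n i l φ x‖ ^ 2 := by
  cases 𝒢 <;> rfl

/-- Test functions with support in a region of the configuration space. -/
def testSubmodule {n : ℕ} (D : Set (Fin n → Site 𝒢 d)) :
    Submodule ℂ ((Fin n → Site 𝒢 d) → ℂ) where
  carrier := {φ | IsSmooth 𝒢 d n φ ∧ HasCompactSupport φ ∧ tsupport φ ⊆ D}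
  add_mem' := by
    rintro φ ψ ⟨h1, h2, h3⟩ ⟨h4, h5, h6⟩
    refine ⟨?_, h2.add h5, (tsupport_add φ ψ).trans (Set.union_subset h3 h6)⟩
    cases 𝒢
    · trivial
    · exact (isSmooth_continuum_iff.1 h1).add (isSmooth_continuum_iff.1 h4)
  zero_mem' := by
    refine ⟨?_, HasCompactSupport.zero, ?_⟩
    · cases 𝒢
      · trivial
      · exact isSmooth_continuum_iff.2 contDiff_const
    · rw [tsupport_zero]; exact Set.empty_subset _
  smul_mem' := by
    rintro c φ ⟨h1, h2, h3⟩
    refine ⟨?_, h2.smul_left (f := fun _ => c), (tsupport_smul_subset_right (fun _ => c) φ).trans h3⟩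
    cases 𝒢
    · trivial
    · exact isSmooth_continuum_iff.2 (contDiff_const.smul (isSmooth_continuum_iff.1 h1))

/-! ### Test functions and integrability of their energy densities -/

section Test

variable {n : ℕ} {D : Set (Fin n → Site 𝒢 d)} {φ ψ : (Fin n → Site 𝒢 d) → ℂ}

theorem testSubmodule_mono {D' : Set (Fin n → Site 𝒢 d)} (h : D ⊆ D') :
    testSubmodule D ≤ testSubmodule D' := fun _ hφ => ⟨hφ.1, hφ.2.1, hφ.2.2.trans h⟩

theorem mem_testSubmodule_univ (hφ : φ ∈ testSubmodule D) : φ ∈ testSubmodule (Set.univ) :=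
  testSubmodule_mono (Set.subset_univ _) hφ

theorem continuous_of_mem_test (hφ : φ ∈ testSubmodule D) : Continuous φ := by
  cases 𝒢
  · exact continuous_of_discreteTopology
  · exact (isSmooth_continuum_iff.1 hφ.1).continuous

/-- The partial derivative at `x` depends on the restriction of `φ` to a line. -/
theorem deriv1_eq_of_line {m : ℕ} {φ : (Fin n → Site 𝒢 d) → ℂ} {ψ : (Fin m → Site 𝒢 d) → ℂ}
    (hφ : IsSmooth 𝒢 d n φ) (hψ : IsSmooth 𝒢 d m ψ) (i : Fin n) (j : Fin m) (l : Fin d)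
    (x : Fin n → Site 𝒢 d) (y : Fin m → Site 𝒢 d)
    (h : ∀ v : Site 𝒢 d, φ (x + Pi.single i v) = ψ (y + Pi.single j v)) :
    deriv1 𝒢 d n i l φ x = deriv1 𝒢 d m j l ψ y := by
  cases 𝒢
  · have h0 := h 0
    rw [Pi.single_zero, Pi.single_zero, add_zero, add_zero] at h0
    exact congr_arg₂ (· - ·) (h (unitVec .lattice d l)) h0
  -- Smoothness turns the Fréchet derivative into a line derivative, which sees only the restriction
  -- to the line.
  · have e1 := ((isSmooth_continuum_iff.1 hφ).differentiable (by simp) x).lineDeriv_eq_fderiv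
      (v := Pi.single i (unitVec .continuum d l))
    have e2 := ((isSmooth_continuum_iff.1 hψ).differentiable (by simp) y).lineDeriv_eq_fderiv
      (v := Pi.single j (unitVec .continuum d l))
    refine e1.symm.trans (Eq.trans ?_ e2)
    unfold lineDeriv
    congr 1
    funext t
    rw [← Pi.single_smul, ← Pi.single_smul]
    exact h _

theorem deriv1_add (hφ : φ ∈ testSubmodule D) (hψ : ψ ∈ testSubmodule D) (i : Fin n) (l : Fin d) :
    deriv1 𝒢 d n i l (φ + ψ) = deriv1 𝒢 d n i l φ + deriv1 𝒢 d n i l ψ := by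
  funext x
  cases 𝒢
  · exact add_sub_add_comm _ _ _ _
  · have e1 := (isSmooth_continuum_iff.1 hφ.1).differentiable (by simp) x
    have e2 := (isSmooth_continuum_iff.1 hψ.1).differentiable (by simp) x
    have := fderiv_add e1 e2
    exact congr_arg (fun A : _ →L[ℝ] ℂ => A (Pi.single i (unitVec .continuum d l))) this

theorem deriv1_smul (hφ : φ ∈ testSubmodule D) (c : ℂ) (i : Fin n) (l : Fin d) :
    deriv1 𝒢 d n i l (c • φ) = c • deriv1 𝒢 d n i l φ := by
  funext x
  cases 𝒢
  · exact (mul_sub _ _ _).symm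
  · have e1 := (isSmooth_continuum_iff.1 hφ.1).differentiable (by simp) x
    have := fderiv_const_smul e1 c
    exact congr_arg (fun A : _ →L[ℝ] ℂ => A (Pi.single i (unitVec .continuum d l))) this

/-- The partial derivatives as linear maps on test functions. -/
noncomputable def derivₗ (D : Set (Fin n → Site 𝒢 d)) (i : Fin n) (l : Fin d) :
    testSubmodule D →ₗ[ℂ] ((Fin n → Site 𝒢 d) → ℂ) where
  toFun φ := deriv1 𝒢 d n i l φ
  map_add' φ ψ := deriv1_add φ.2 ψ.2 i l
  map_smul' c φ := deriv1_smul φ.2 c i l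

theorem deriv1_sum {ι : Type*} (s : Finset ι) (f : ι → (Fin n → Site 𝒢 d) → ℂ)
    (hf : ∀ a ∈ s, f a ∈ testSubmodule D) (i : Fin n) (l : Fin d) :
    deriv1 𝒢 d n i l (∑ a ∈ s, f a) = ∑ a ∈ s, deriv1 𝒢 d n i l (f a) := by
  classical
  induction s using Finset.induction_on with
  | empty =>
    exact (derivₗ D i l).map_zero
  | insert a s ha ih =>
    rw [Finset.sum_insert ha, Finset.sum_insert ha, deriv1_add (hf a (Finset.mem_insert_self _ _))
      (Submodule.sum_mem _ fun b hb => hf b (Finset.mem_insert_of_mem hb)),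
      ih fun b hb => hf b (Finset.mem_insert_of_mem hb)]

theorem norm_unitVec (l : Fin d) : ‖unitVec 𝒢 d l‖ = 1 := by
  cases 𝒢
  · refine (Pi.norm_single (G := fun _ : Fin d => ℤ) (1 : ℤ)).trans ?_
    simp
  · exact (PiLp.norm_single 2 (fun _ : Fin d => ℝ) l (1 : ℝ)).trans (by simp)

/-- A derivative does not leave the support, but a forward difference reaches one lattice step
beyond it; the distance 1 covers both. This step is why separations greater than 2 are required
below. -/
theorem exists_mem_tsupport_of_deriv1_ne {i : Fin n} {l : Fin d}
    {x : Fin n → Site 𝒢 d} (h : deriv1 𝒢 d n i l φ x ≠ 0) :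
    ∃ z ∈ tsupport φ, ∀ j, dist (x j) (z j) ≤ 1 := by
  cases 𝒢
  · by_cases hx : φ x = 0
    · refine ⟨x + Pi.single i (unitVec .lattice d l), subset_tsupport _ fun h' => h ?_, fun j => ?_⟩
      · exact (congr_arg₂ _ h' hx).trans (sub_zero 0)
      · rw [Pi.add_apply, dist_self_add_right]
        rcases eq_or_ne j i with rfl | hj
        · rw [Pi.single_eq_same, norm_unitVec]
        · rw [Pi.single_eq_of_ne hj, norm_zero]; exact zero_le_one
    · exact ⟨x, subset_tsupport _ hx, fun j => by simp⟩
  · refine ⟨x, ?_, fun j => by simp⟩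
    refine support_fderiv_subset ℝ (f := φ) fun h' => h ?_
    exact congr_arg (fun A : (Fin n → Site .continuum d) →L[ℝ] ℂ =>
      A (Pi.single i (unitVec .continuum d l))) h'

theorem continuous_deriv1 (hφ : φ ∈ testSubmodule D) (i : Fin n) (l : Fin d) :
    Continuous (deriv1 𝒢 d n i l φ) := by
  cases 𝒢
  · exact continuous_of_discreteTopology
  · exact ((isSmooth_continuum_iff.1 hφ.1).continuous_fderiv (by simp)).clm_apply continuous_const

theorem hasCompactSupport_deriv1 (hφ : φ ∈ testSubmodule D) (i : Fin n) (l : Fin d) :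
    HasCompactSupport (deriv1 𝒢 d n i l φ) := by
  refine HasCompactSupport.intro (K := Metric.cthickening 1 (tsupport φ)) ?_ fun x hx => ?_
  · exact IsCompact.cthickening hφ.2.1
  · by_contra h
    obtain ⟨z, hz, hd⟩ := exists_mem_tsupport_of_deriv1_ne h
    exact hx (Metric.mem_cthickening_of_dist_le x z 1 _ hz ((dist_pi_le_iff zero_le_one).2 hd))

theorem integrable_normSq_of_hasCompactSupport {f : (Fin n → Site 𝒢 d) → ℂ} (hf : Continuous f)
    (hc : HasCompactSupport f) : Integrable (fun x => ‖f x‖ ^ 2) := by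
  refine Continuous.integrable_of_hasCompactSupport (by fun_prop) ?_
  exact hc.comp_left (g := fun z : ℂ => ‖z‖ ^ 2) (by simp)

theorem integrable_normSq (hφ : φ ∈ testSubmodule D) : Integrable (fun x => ‖φ x‖ ^ 2) :=
  integrable_normSq_of_hasCompactSupport (continuous_of_mem_test hφ) hφ.2.1

theorem integrable_gradSq (hφ : φ ∈ testSubmodule D) : Integrable (gradSq 𝒢 d n φ) := by
  have : gradSq 𝒢 d n φ = fun x => ∑ i, ∑ l, ‖deriv1 𝒢 d n i l φ x‖ ^ 2 := funext (gradSq_eq φ)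
  rw [this]
  exact integrable_finsetSum _ fun i _ => integrable_finsetSum _ fun l _ =>
    integrable_normSq_of_hasCompactSupport (continuous_deriv1 hφ i l) (hasCompactSupport_deriv1 hφ i l)

/-- A compact set of configurations lies in a product of balls, and there the other factors only
contribute their finite measure. -/
theorem locallyIntegrable_comp_eval {v : Site 𝒢 d → ℝ} (hv : LocallyIntegrable v volume)
    (i : Fin n) : LocallyIntegrable (fun x : Fin n → Site 𝒢 d => v (x i)) volume := by
  rw [MeasureTheory.locallyIntegrable_iff]
  intro K hK
  obtain ⟨R, hR⟩ := hK.isBounded.subset_closedBall (0 : Fin n → Site 𝒢 d)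
  let S : Set (Site 𝒢 d) := Metric.closedBall 0 R
  have hS : IsCompact S := isCompact_closedBall 0 R
  refine IntegrableOn.mono_set (t := Set.univ.pi fun _ => S) ?_ fun x hx j _ => ?_
  · rw [IntegrableOn, volume_pi, Measure.restrict_pi_pi]
    have : IsFiniteMeasure ((volume : Measure (Site 𝒢 d)).restrict S) :=
      ⟨by rw [Measure.restrict_apply_univ]; exact hS.measure_lt_top⟩
    exact integrable_comp_eval (μ := fun _ : Fin n => volume.restrict S) (i := i)
      (hv.integrableOn_isCompact hS)
  · have := hR hx
    rw [mem_closedBall_zero_iff] at this ⊢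
    exact (norm_le_pi_norm x j).trans this

theorem integrable_potential_eval {v : Site 𝒢 d → ℝ} (hv : LocallyIntegrable v volume)
    {f : (Fin n → Site 𝒢 d) → ℂ} (hf : Continuous f) (hc : HasCompactSupport f) (i : Fin n) :
    Integrable (fun x => v (x i) * ‖f x‖ ^ 2) := by
  have := (locallyIntegrable_comp_eval (n := n) hv i).integrable_smul_right_of_hasCompactSupport
    (g := fun x => ‖f x‖ ^ 2) (by fun_prop) (hc.comp_left (g := fun z : ℂ => ‖z‖ ^ 2) (by simp))
  exact this

theorem integrable_potential {v : Site 𝒢 d → ℝ} (hv : LocallyIntegrable v volume)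
    (hφ : φ ∈ testSubmodule D) : Integrable (fun x => (∑ i, v (x i)) * ‖φ x‖ ^ 2) := by
  simp only [Finset.sum_mul]
  exact integrable_finsetSum _ fun i _ =>
    integrable_potential_eval hv (continuous_of_mem_test hφ) hφ.2.1 i

theorem mem_test_of_isTestFunction {Λ : Set (Site 𝒢 d)} (h : IsTestFunction Λ n φ) :
    φ ∈ testSubmodule {x : Fin n → Site 𝒢 d | ∀ i, x i ∈ Λ} := ⟨h.smooth, h.compact, h.support⟩

theorem isTestFunction_of_mem {Λ : Set (Site 𝒢 d)}
    (h : φ ∈ testSubmodule {x : Fin n → Site 𝒢 d | ∀ i, x i ∈ Λ}) : IsTestFunction Λ n φ :=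
  ⟨h.1, h.2.1, h.2.2⟩

end Test

end RandomGas

namespace RandomGas

variable {𝒢 : Medium} {d : ℕ}

/-! ### Splitting the particles in two groups -/

section Merge

variable {X : Type*} {a b n : ℕ}

/-- The configuration of `n` particles composed of configurations of two groups of particles. -/
def merge (e : Fin a ⊕ Fin b ≃ Fin n) (x : Fin a → X) (y : Fin b → X) : Fin n → X :=
  fun i => Sum.elim x y (e.symm i)

variable (e : Fin a ⊕ Fin b ≃ Fin n)

@[simp] theorem merge_inl (x : Fin a → X) (y : Fin b → X) (i : Fin a) :
    merge e x y (e (Sum.inl i)) = x i := by simp [merge]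

@[simp] theorem merge_inr (x : Fin a → X) (y : Fin b → X) (i : Fin b) :
    merge e x y (e (Sum.inr i)) = y i := by simp [merge]

theorem merge_restrict (z : Fin n → X) :
    merge e (fun i => z (e (Sum.inl i))) (fun j => z (e (Sum.inr j))) = z := by
  funext i
  obtain ⟨s, rfl⟩ := e.surjective i
  cases s <;> simp

/-- Transfers every statement about slices in the first group to the second group. -/
theorem merge_swap (x : Fin a → X) (y : Fin b → X) :
    merge ((Equiv.sumComm (Fin b) (Fin a)).trans e) y x = merge e x y := by
  funext i
  obtain ⟨s, rfl⟩ := e.surjective i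
  cases s <;> simp [merge]

theorem merge_add_single_left [AddCommGroup X] (x : Fin a → X) (y : Fin b → X) (i : Fin a) (v : X) :
    merge e (x + Pi.single i v) y = merge e x y + Pi.single (e (Sum.inl i)) v := by
  funext j
  obtain ⟨s, rfl⟩ := e.surjective j
  cases s with
  | inl k =>
    rw [merge_inl, Pi.add_apply, Pi.add_apply, merge_inl]
    by_cases h : k = i
    · subst h; simp
    · rw [Pi.single_eq_of_ne h, Pi.single_eq_of_ne (by simpa using h)]
  | inr k => rw [merge_inr, Pi.add_apply, merge_inr, Pi.single_eq_of_ne (by simp), add_zero]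

theorem continuous_merge [TopologicalSpace X] :
    Continuous (fun p : (Fin a → X) × (Fin b → X) => merge e p.1 p.2) := by
  refine continuous_pi fun i => ?_
  obtain ⟨s, rfl⟩ := e.surjective i
  cases s <;> simp only [merge_inl, merge_inr] <;> fun_prop

theorem merge_eq_comp [MeasurableSpace X] :
    (fun p : (Fin a → X) × (Fin b → X) => merge e p.1 p.2) =
      (MeasurableEquiv.piCongrLeft (fun _ : Fin n => X) e) ∘
        (MeasurableEquiv.sumPiEquivProdPi (δ := Fin a) (δ' := Fin b) (fun _ => X)).symm := by
  funext p i
  obtain ⟨s, rfl⟩ := e.surjective i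
  rw [Function.comp_apply, MeasurableEquiv.coe_piCongrLeft, Equiv.piCongrLeft_apply_apply]
  cases s <;> simp [merge] <;> rfl

theorem measurePreserving_merge [MeasureSpace X] [SigmaFinite (volume : Measure X)] :
    MeasurePreserving (fun p : (Fin a → X) × (Fin b → X) => merge e p.1 p.2) := by
  rw [merge_eq_comp]
  exact (volume_measurePreserving_piCongrLeft (fun _ : Fin n => X) e).comp
    (volume_measurePreserving_sumPiEquivProdPi_symm (ι := Fin a) (ι' := Fin b) (fun _ => X))

theorem measurableEmbedding_merge [MeasurableSpace X] :
    MeasurableEmbedding (fun p : (Fin a → X) × (Fin b → X) => merge e p.1 p.2) := by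
  rw [merge_eq_comp]
  exact (MeasurableEquiv.measurableEmbedding _).comp (MeasurableEquiv.measurableEmbedding _)

variable [MeasureSpace X] [SigmaFinite (volume : Measure X)]

theorem integral_merge (f : (Fin n → X) → ℝ) :
    ∫ z, f z = ∫ p : (Fin a → X) × (Fin b → X), f (merge e p.1 p.2) :=
  ((measurePreserving_merge e).integral_comp (measurableEmbedding_merge e) f).symm

theorem integrable_merge {f : (Fin n → X) → ℝ} (hf : Integrable f) :
    Integrable (fun p : (Fin a → X) × (Fin b → X) => f (merge e p.1 p.2)) :=
  ((measurePreserving_merge e).integrable_comp_emb (measurableEmbedding_merge e)).2 hf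

theorem lintegral_merge (f : (Fin n → X) → ℝ≥0∞) :
    ∫⁻ z, f z = ∫⁻ p : (Fin a → X) × (Fin b → X), f (merge e p.1 p.2) :=
  ((measurePreserving_merge e).lintegral_comp_emb (measurableEmbedding_merge e) f).symm

end Merge

/-! ### Slices of a wave function and Fubini's theorem for the quadratic forms -/

section Split

variable {a b n : ℕ} (e : Fin a ⊕ Fin b ≃ Fin n) {D : Set (Fin n → Site 𝒢 d)}
  {φ : (Fin n → Site 𝒢 d) → ℂ} {v : Site 𝒢 d → ℝ}

theorem slice_mem (hφ : φ ∈ testSubmodule D) (y : Fin b → Site 𝒢 d) :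
    (fun x => φ (merge e x y)) ∈ testSubmodule {x : Fin a → Site 𝒢 d | merge e x y ∈ tsupport φ} := by
  have hcont : Continuous (fun x : Fin a → Site 𝒢 d => merge e x y) :=
    (continuous_merge e).comp (by fun_prop : Continuous fun x => (x, y))
  have hsup : tsupport (fun x => φ (merge e x y)) ⊆ {x | merge e x y ∈ tsupport φ} :=
    tsupport_comp_subset_preimage φ hcont
  refine ⟨?_, ?_, hsup⟩
  · cases 𝒢
    · trivial
    · refine isSmooth_continuum_iff.2 ((isSmooth_continuum_iff.1 hφ.1).comp ?_)
      refine contDiff_pi.2 fun i => ?_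
      obtain ⟨s, rfl⟩ := e.surjective i
      cases s with
      | inl k => simp only [merge_inl]; exact contDiff_apply ℝ _ k
      | inr k => simp only [merge_inr]; exact contDiff_const
  · have hK : IsCompact ((fun z : Fin n → Site 𝒢 d => fun i => z (e (Sum.inl i))) '' tsupport φ) :=
      hφ.2.1.image (by fun_prop)
    refine HasCompactSupport.intro hK fun x hx => ?_
    by_contra h
    exact hx ⟨merge e x y, subset_tsupport _ h, by simp⟩

theorem deriv1_slice (hφ : φ ∈ testSubmodule D) (x : Fin a → Site 𝒢 d) (y : Fin b → Site 𝒢 d)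
    (i : Fin a) (l : Fin d) :
    deriv1 𝒢 d a i l (fun x => φ (merge e x y)) x =
      deriv1 𝒢 d n (e (Sum.inl i)) l φ (merge e x y) :=
  deriv1_eq_of_line (slice_mem e hφ y).1 hφ.1 _ _ _ _ _ fun v => by rw [merge_add_single_left]

/-- The energy density of the `i`-th particle in the external potential `v`. -/
noncomputable def particleDensity (v : Site 𝒢 d → ℝ) (φ : (Fin n → Site 𝒢 d) → ℂ)
    (z : Fin n → Site 𝒢 d) (i : Fin n) : ℝ :=
  ∑ l, ‖deriv1 𝒢 d n i l φ z‖ ^ 2 + v (z i) * ‖φ z‖ ^ 2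

theorem integrable_particleDensity (hv : LocallyIntegrable v volume) (hφ : φ ∈ testSubmodule D)
    (i : Fin n) : Integrable (fun z => particleDensity v φ z i) :=
  (integrable_finsetSum _ fun l _ => integrable_normSq_of_hasCompactSupport
    (continuous_deriv1 hφ i l) (hasCompactSupport_deriv1 hφ i l)).add
    (integrable_potential_eval hv (continuous_of_mem_test hφ) hφ.2.1 i)

theorem freeForm_eq_integral (hv : LocallyIntegrable v volume) (hφ : φ ∈ testSubmodule D) :
    freeForm v φ = ∫ z, ∑ i, particleDensity v φ z i := by
  rw [freeForm, ← integral_add (integrable_gradSq hφ) (integrable_potential hv hφ)]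
  congr 1
  funext z
  rw [gradSq_eq, Finset.sum_mul, ← Finset.sum_add_distrib]
  rfl

/-- The energy in the external potential of the first group of particles. -/
noncomputable def groupForm (e : Fin a ⊕ Fin b ≃ Fin n) (v : Site 𝒢 d → ℝ)
    (φ : (Fin n → Site 𝒢 d) → ℂ) : ℝ :=
  ∫ z, ∑ i : Fin a, particleDensity v φ z (e (Sum.inl i))

/-- Fubini: the derivatives and potentials of the particles in the first group are those of the
slice at fixed positions of the second. -/
theorem freeForm_slice (hv : LocallyIntegrable v volume) (hφ : φ ∈ testSubmodule D) :
    Integrable (fun y => freeForm v (fun x => φ (merge e x y))) ∧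
      ∫ y, freeForm v (fun x => φ (merge e x y)) = groupForm e v φ := by
  have hint := integrable_merge e (integrable_finsetSum Finset.univ fun (i : Fin a) _ =>
    integrable_particleDensity hv hφ (e (Sum.inl i)))
  have key : ∀ y, freeForm v (fun x => φ (merge e x y)) =
      ∫ x, ∑ i : Fin a, particleDensity v φ (merge e x y) (e (Sum.inl i)) := by
    intro y
    rw [freeForm_eq_integral hv (slice_mem e hφ y)]
    congr 1
    funext x
    refine Finset.sum_congr rfl fun i _ => ?_
    simp only [particleDensity, deriv1_slice e hφ, merge_inl]
  simp only [key]
  refine ⟨hint.integral_prod_right, ?_⟩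
  rw [groupForm, integral_merge e]
  exact (integral_prod_symm _ hint).symm

theorem freeForm_split (hv : LocallyIntegrable v volume) (hφ : φ ∈ testSubmodule D) :
    freeForm v φ = (∫ y, freeForm v (fun x => φ (merge e x y))) +
      ∫ x, freeForm v (fun y => φ (merge e x y)) := by
  rw [(freeForm_slice e hv hφ).2]
  have h2 := (freeForm_slice ((Equiv.sumComm (Fin b) (Fin a)).trans e) hv hφ).2
  simp only [merge_swap] at h2
  rw [h2, groupForm, groupForm, ← integral_add
    (integrable_finsetSum _ fun i _ => integrable_particleDensity hv hφ _)
    (integrable_finsetSum _ fun i _ => integrable_particleDensity hv hφ _),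
    freeForm_eq_integral hv hφ]
  congr 1
  funext z
  rw [← Equiv.sum_comp e, Fintype.sum_sum_type]
  rfl

theorem integrable_freeForm_slice_right (hv : LocallyIntegrable v volume)
    (hφ : φ ∈ testSubmodule D) : Integrable (fun x => freeForm v (fun y => φ (merge e x y))) := by
  have h2 := (freeForm_slice ((Equiv.sumComm (Fin b) (Fin a)).trans e) hv hφ).1
  simpa only [merge_swap] using h2

theorem slice_right_mem (hφ : φ ∈ testSubmodule D) (x : Fin a → Site 𝒢 d) :
    (fun y => φ (merge e x y)) ∈ testSubmodule {y : Fin b → Site 𝒢 d | merge e x y ∈ tsupport φ} := by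
  have := slice_mem ((Equiv.sumComm (Fin b) (Fin a)).trans e) hφ x
  simpa only [merge_swap] using this

theorem normSq_slice (hφ : φ ∈ testSubmodule D) :
    Integrable (fun y => normSq (fun x => φ (merge e x y))) ∧
      ∫ y, normSq (fun x => φ (merge e x y)) = normSq φ := by
  have hint := integrable_merge e (integrable_normSq hφ)
  refine ⟨hint.integral_prod_right, ?_⟩
  rw [normSq, integral_merge e]
  exact (integral_prod_symm _ hint).symm

theorem normSq_slice_right (hφ : φ ∈ testSubmodule D) :
    Integrable (fun x => normSq (fun y => φ (merge e x y))) ∧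
      ∫ x, normSq (fun y => φ (merge e x y)) = normSq φ := by
  have := normSq_slice ((Equiv.sumComm (Fin b) (Fin a)).trans e) hφ
  simpa only [merge_swap] using this

end Split

/-- One particle is split off at a time, and the one-particle bound is integrated over the positions
of the others. -/
theorem freeForm_lower_bound {v : Site 𝒢 d → ℝ} (hv : LocallyIntegrable v volume) {C : ℝ}
    (hC : ∀ φ : (Fin 1 → Site 𝒢 d) → ℂ, IsTestFunction Set.univ 1 φ → -C * normSq φ ≤ freeForm v φ)
    (n : ℕ) : ∀ φ : (Fin n → Site 𝒢 d) → ℂ, φ ∈ testSubmodule Set.univ →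
      -(C * n) * normSq φ ≤ freeForm v φ := by
  induction n with
  | zero =>
    intro φ hφ
    rw [freeForm_eq_integral hv hφ]
    simp
  | succ n ih =>
    intro φ hφ
    let e : Fin 1 ⊕ Fin n ≃ Fin (n + 1) := finSumFinEquiv.trans (finCongr (add_comm 1 n))
    rw [freeForm_split e hv hφ]
    have h1 : -C * normSq φ ≤ ∫ y, freeForm v (fun x => φ (merge e x y)) := by
      rw [← (normSq_slice e hφ).2, ← integral_const_mul]
      refine integral_mono ((normSq_slice e hφ).1.const_mul _) (freeForm_slice e hv hφ).1 fun y => ?_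
      have := mem_testSubmodule_univ (slice_mem e hφ y)
      exact hC _ ⟨this.1, this.2.1, by simp⟩
    have h2 : -(C * n) * normSq φ ≤ ∫ x, freeForm v (fun y => φ (merge e x y)) := by
      rw [← (normSq_slice_right e hφ).2, ← integral_const_mul]
      refine integral_mono ((normSq_slice_right e hφ).1.const_mul _)
        (integrable_freeForm_slice_right e hv hφ) fun x => ?_
      exact ih _ (mem_testSubmodule_univ (slice_right_mem e hφ x))
    push_cast
    linarith

end RandomGas

namespace RandomGas

variable {𝒢 : Medium} {d : ℕ}

/-! ### The interaction energy -/

/-- The interaction energy `∫ (w + n B) |φ|²`, shifted so that it is nonnegative. -/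
noncomputable def shiftedForm {n : ℕ} (B : ℝ) (w : (Fin n → Site 𝒢 d) → EReal)
    (φ : (Fin n → Site 𝒢 d) → ℂ) : ℝ≥0∞ :=
  ∫⁻ x, (w x + ((n * B : ℝ) : EReal)).toENNReal * ‖φ x‖ₑ ^ 2

theorem normSq_nonneg {n : ℕ} (φ : (Fin n → Site 𝒢 d) → ℂ) : 0 ≤ normSq φ :=
  integral_nonneg fun _ => sq_nonneg _

theorem lintegral_enorm_sq {n : ℕ} {φ : (Fin n → Site 𝒢 d) → ℂ}
    (hφ : φ ∈ testSubmodule Set.univ) : ∫⁻ x, ‖φ x‖ₑ ^ 2 = ENNReal.ofReal (normSq φ) := by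
  rw [normSq, ofReal_integral_eq_lintegral_ofReal (integrable_normSq hφ)
    (ae_of_all _ fun _ => sq_nonneg _)]
  congr 1
  funext x
  rw [ENNReal.ofReal_pow (norm_nonneg _), ofReal_norm]

/-- The identity `w⁺ + c = (w + c) + w⁻` in `[0, ∞]`, arranged without subtraction so that it also
holds at `w = ∞`. It lets one nonnegative integral replace the difference of the two parts of the
interaction. -/
theorem toENNReal_shift {w : EReal} {c : ℝ} (hc : 0 ≤ c) (hw : ((-c : ℝ) : EReal) ≤ w) :
    w.toENNReal + ENNReal.ofReal c = (w + c).toENNReal + (-w).toENNReal := by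
  induction w with
  | bot => exact absurd hw (by simp)
  | top => simp
  | coe r =>
    have hr : -c ≤ r := by exact_mod_cast hw
    rw [← EReal.coe_add, ← EReal.coe_neg]
    simp only [EReal.toENNReal_of_ne_top (EReal.coe_ne_top _), EReal.toReal_coe]
    rcases le_total 0 r with h | h
    · rw [← ENNReal.ofReal_add h hc, ENNReal.ofReal_of_nonpos (p := -r) (by linarith), add_zero]
    · rw [ENNReal.ofReal_of_nonpos h, ← ENNReal.ofReal_add (by linarith) (by linarith)]
      rw [add_neg_cancel_comm, zero_add]

section Interaction

variable {n : ℕ} {B : ℝ} {w : (Fin n → Site 𝒢 d) → EReal} {φ : (Fin n → Site 𝒢 d) → ℂ}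

theorem posPartForm_add (hB : 0 ≤ B) (hw : Measurable w) (hst : ∀ x, ((-(n * B) : ℝ) : EReal) ≤ w x)
    (hφ : φ ∈ testSubmodule Set.univ) :
    posPartForm w φ + ENNReal.ofReal (n * B * normSq φ) =
      shiftedForm B w φ + posPartForm (fun x => -w x) φ := by
  have hm : Measurable fun x => ‖φ x‖ₑ ^ 2 := (continuous_of_mem_test hφ).measurable.enorm.pow_const 2
  rw [posPartForm, posPartForm, shiftedForm, ENNReal.ofReal_mul (by positivity),
    ← lintegral_enorm_sq hφ, ← lintegral_const_mul _ hm, ← lintegral_add_left (by fun_prop),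
    ← lintegral_add_left (by fun_prop)]
  congr 1
  funext x
  rw [← add_mul, ← add_mul, toENNReal_shift (by positivity) (hst x)]

theorem negPartForm_le (hB : 0 ≤ B) (hst : ∀ x, ((-(n * B) : ℝ) : EReal) ≤ w x)
    (hφ : φ ∈ testSubmodule Set.univ) :
    posPartForm (fun x => -w x) φ ≤ ENNReal.ofReal (n * B * normSq φ) := by
  have hm : Measurable fun x => ‖φ x‖ₑ ^ 2 := (continuous_of_mem_test hφ).measurable.enorm.pow_const 2
  rw [posPartForm, ENNReal.ofReal_mul (by positivity), ← lintegral_enorm_sq hφ,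
    ← lintegral_const_mul _ hm]
  gcongr with x
  have h1 : -w x ≤ ((n * B : ℝ) : EReal) := by
    rw [EReal.neg_le, ← EReal.coe_neg]; exact hst x
  refine (EReal.toENNReal_le_toENNReal h1).trans ?_
  rw [EReal.toENNReal_of_ne_top (EReal.coe_ne_top _), EReal.toReal_coe]

theorem shiftedForm_ne_top_iff (hB : 0 ≤ B) (hw : Measurable w)
    (hst : ∀ x, ((-(n * B) : ℝ) : EReal) ≤ w x) (hφ : φ ∈ testSubmodule Set.univ) :
    posPartForm w φ ≠ ⊤ ↔ shiftedForm B w φ ≠ ⊤ := by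
  have h := posPartForm_add hB hw hst hφ
  have h2 := ((negPartForm_le hB hst hφ).trans_lt ENNReal.ofReal_lt_top).ne
  constructor
  · intro h1 h3
    rw [h3, top_add] at h
    exact ENNReal.add_ne_top.2 ⟨h1, ENNReal.ofReal_ne_top⟩ h
  · intro h1 h3
    rw [h3, top_add] at h
    exact ENNReal.add_ne_top.2 ⟨h1, h2⟩ h.symm

theorem interactionForm_eq (hB : 0 ≤ B) (hw : Measurable w)
    (hst : ∀ x, ((-(n * B) : ℝ) : EReal) ≤ w x) (hφ : φ ∈ testSubmodule Set.univ)
    (h1 : posPartForm w φ ≠ ⊤) :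
    interactionForm w φ = (shiftedForm B w φ).toReal - n * B * normSq φ := by
  have h := posPartForm_add hB hw hst hφ
  have h2 := ((negPartForm_le hB hst hφ).trans_lt ENNReal.ofReal_lt_top).ne
  have h3 := (shiftedForm_ne_top_iff hB hw hst hφ).1 h1
  have := congr_arg ENNReal.toReal h
  rw [ENNReal.toReal_add h1 ENNReal.ofReal_ne_top, ENNReal.toReal_add h3 h2,
    ENNReal.toReal_ofReal (mul_nonneg (by positivity) (normSq_nonneg φ))] at this
  rw [interactionForm]
  linarith

end Interaction

/-- There is a `k`-dimensional space of test functions supported in the region `D` of the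
configuration space on which the Hamiltonian is at most `e`. -/
def HasTrialSpace {n : ℕ} (v : Site 𝒢 d → ℝ) (w : (Fin n → Site 𝒢 d) → EReal) (s : Statistics)
    (B : ℝ) (D : Set (Fin n → Site 𝒢 d)) (k : ℕ) (e : ℝ) : Prop :=
  ∃ F : Submodule ℂ ((Fin n → Site 𝒢 d) → ℂ), Module.finrank ℂ F = k ∧
    ∀ φ ∈ F, φ ∈ testSubmodule D ∧ HasStatistics φ s ∧ shiftedForm B w φ ≠ ⊤ ∧
      freeForm v φ + (shiftedForm B w φ).toReal ≤ (e + n * B) * normSq φ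

/-! ### Monotonicity of trial spaces -/

section TrialSpace

variable {n : ℕ} {v : Site 𝒢 d → ℝ} {w : (Fin n → Site 𝒢 d) → EReal} {s : Statistics}
    {B : ℝ} {D D' : Set (Fin n → Site 𝒢 d)} {k k' : ℕ} {e e' : ℝ}

theorem HasTrialSpace.mono_set (h : HasTrialSpace v w s B D k e) (hD : D ⊆ D') :
    HasTrialSpace v w s B D' k e := by
  obtain ⟨F, hF, H⟩ := h
  exact ⟨F, hF, fun φ hφ => ⟨testSubmodule_mono hD (H φ hφ).1, (H φ hφ).2⟩⟩

theorem HasTrialSpace.mono_energy (h : HasTrialSpace v w s B D k e) (he : e ≤ e') :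
    HasTrialSpace v w s B D k e' := by
  obtain ⟨F, hF, H⟩ := h
  refine ⟨F, hF, fun φ hφ => ⟨(H φ hφ).1, (H φ hφ).2.1, (H φ hφ).2.2.1, (H φ hφ).2.2.2.trans ?_⟩⟩
  exact mul_le_mul_of_nonneg_right (by linarith) (normSq_nonneg φ)

/-- Any `k` linearly independent vectors of the larger space span a subspace on which the same
inequality holds. -/
theorem HasTrialSpace.mono_index (h : HasTrialSpace v w s B D k' e) (hk : k ≤ k') :
    HasTrialSpace v w s B D k e := by
  obtain ⟨F, hF, H⟩ := h
  obtain ⟨t, ht, hli⟩ := exists_finset_linearIndependent_of_le_finrank (R := ℂ) (M := F) (hF ▸ hk)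
  refine ⟨(Submodule.span ℂ (t : Set F)).map F.subtype, ?_, fun φ hφ => H φ ?_⟩
  · rw [Submodule.finrank_map_subtype_eq,
      finrank_span_finset_eq_card hli, ht]
  · exact Submodule.map_subtype_le F _ hφ

end TrialSpace

/-- With the interaction shifted by `n B` nothing negative is left in it, and the eigenvalues are
accessible through `HasTrialSpace` alone. -/
theorem eigenvalue_eq_iInf {Ω : Type*} (M : Model 𝒢 d Ω) {B : ℝ} (hB : 0 ≤ B) {n : ℕ}
    (hw : Measurable (M.interaction n))
    (hst : ∀ x, ((-(n * B) : ℝ) : EReal) ≤ M.interaction n x)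
    (Λ : Set (Site 𝒢 d)) (k : ℕ) (ω : Ω) :
    M.eigenvalue Λ n k ω = ⨅ (e : ℝ) (_ : HasTrialSpace (M.potential ω) (M.interaction n)
      M.statistics B {x | ∀ i, x i ∈ Λ} k e), (e : EReal) := by
  rw [Model.eigenvalue]
  congr 1
  funext e
  have : (∃ F : Submodule ℂ ((Fin n → Site 𝒢 d) → ℂ), Module.finrank ℂ F = k ∧
    ∀ φ ∈ F, IsTestFunction Λ n φ ∧ HasStatistics φ M.statistics ∧
      posPartForm (M.interaction n) φ ≠ ⊤ ∧
      freeForm (M.potential ω) φ + interactionForm (M.interaction n) φ ≤ e * normSq φ) ↔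
      HasTrialSpace (M.potential ω) (M.interaction n) M.statistics B {x | ∀ i, x i ∈ Λ} k e := by
    refine exists_congr fun F => and_congr_right fun _ => forall₂_congr fun φ _ => ?_
    constructor
    · rintro ⟨h1, h2, h3, h4⟩
      have ht := mem_testSubmodule_univ (mem_test_of_isTestFunction h1)
      rw [interactionForm_eq hB hw hst ht h3] at h4
      refine ⟨mem_test_of_isTestFunction h1, h2, (shiftedForm_ne_top_iff hB hw hst ht).1 h3, ?_⟩
      linarith
    · rintro ⟨h1, h2, h3, h4⟩
      have ht := mem_testSubmodule_univ h1
      have h3' := (shiftedForm_ne_top_iff hB hw hst ht).2 h3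
      refine ⟨isTestFunction_of_mem h1, h2, h3', ?_⟩
      rw [interactionForm_eq hB hw hst ht h3']
      linarith
  simp only [this]

/-! ### Combining two groups of particles -/

/-- The character of the permutation group that belongs to the statistics. -/
noncomputable def statChar : Statistics → ℤˣ →* ℂ
  | .fermi => (Int.castRingHom ℂ).toMonoidHom.comp (Units.coeHom ℤ)
  | _ => 1

theorem statChar_mul_self (s : Statistics) (u : ℤˣ) : statChar s u * statChar s u = 1 := by
  rw [← map_mul, Int.units_mul_self, map_one]

theorem norm_statChar (s : Statistics) (u : ℤˣ) : ‖statChar s u‖ = 1 := by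
  have := congr_arg norm (statChar_mul_self s u)
  rw [norm_mul, norm_one] at this
  nlinarith [norm_nonneg (statChar s u)]

/-- Boltzmann statistics are exempt: their character is trivial by convention, but no symmetry is
demanded. -/
theorem hasStatistics_of_statChar {X : Type*} {n : ℕ} {φ : (Fin n → X) → ℂ} {s : Statistics}
    (h : s ≠ .boltzmann → ∀ (π : Equiv.Perm (Fin n)) x,
      φ (fun i => x (π i)) = statChar s (Equiv.Perm.sign π) * φ x) : HasStatistics φ s := by
  cases s with
  | boltzmann => trivial
  | bose => exact fun π x => (h (by simp) π x).trans (one_mul _)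
  | fermi => exact h (by simp)

theorem HasStatistics.apply_perm {X : Type*} {n : ℕ} {φ : (Fin n → X) → ℂ} {s : Statistics}
    (h : HasStatistics φ s) (hs : s ≠ .boltzmann) (π : Equiv.Perm (Fin n)) (x : Fin n → X) :
      φ (fun i => x (π i)) = statChar s (Equiv.Perm.sign π) * φ x := by
  cases s with
  | boltzmann => exact absurd rfl hs
  | bose => exact (h π x).trans (one_mul _).symm
  | fermi => exact h π x

section Sym

variable {X : Type*} {a b n : ℕ}

/-- The choices of the particles that form the first group. -/
abbrev Choice (a n : ℕ) := {I : Finset (Fin n) // I.card = a}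

theorem Choice.card_compl (h : a + b = n) (I : Choice a n) : (I.1ᶜ).card = b := by
  rw [Finset.card_compl, I.2, Fintype.card_fin]; omega

/-- The order preserving numbering of the two groups. -/
def Choice.equiv (h : a + b = n) (I : Choice a n) : Fin a ⊕ Fin b ≃ Fin n :=
  finSumEquivOfFinset I.2 (I.card_compl h)

theorem Choice.equiv_inl_mem (h : a + b = n) (I : Choice a n) (i : Fin a) :
    I.equiv h (Sum.inl i) ∈ I.1 := by
  rw [Choice.equiv, finSumEquivOfFinset_inl]; exact Finset.orderEmbOfFin_mem _ _ _

theorem Choice.equiv_inr_notMem (h : a + b = n) (I : Choice a n) (i : Fin b) :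
    I.equiv h (Sum.inr i) ∉ I.1 := by
  rw [Choice.equiv, finSumEquivOfFinset_inr]
  exact Finset.mem_compl.1 (Finset.orderEmbOfFin_mem _ _ _)

theorem Choice.exists_inl (h : a + b = n) (I : Choice a n) {j : Fin n} (hj : j ∈ I.1) :
    ∃ i, I.equiv h (Sum.inl i) = j := by
  obtain ⟨t, rfl⟩ := (I.equiv h).surjective j
  cases t with
  | inl i => exact ⟨i, rfl⟩
  | inr i => exact absurd hj (I.equiv_inr_notMem h i)

theorem Choice.exists_inr (h : a + b = n) (I : Choice a n) {j : Fin n} (hj : j ∉ I.1) :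
    ∃ i, I.equiv h (Sum.inr i) = j := by
  obtain ⟨t, rfl⟩ := (I.equiv h).surjective j
  cases t with
  | inl i => exact absurd (I.equiv_inl_mem h i) hj
  | inr i => exact ⟨i, rfl⟩

/-- The sign of the shuffle that belongs to a choice. -/
def Choice.sign (h : a + b = n) (I : Choice a n) : ℤˣ :=
  Equiv.Perm.sign ((finSumFinEquiv.trans (finCongr h)).symm.trans (I.equiv h))

/-- A function of two groups of particles as a function of all particles. -/
def pull (e : Fin a ⊕ Fin b ≃ Fin n) (f : (Fin a → X) → (Fin b → X) → ℂ) (z : Fin n → X) : ℂ :=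
  f (fun i => z (e (Sum.inl i))) (fun j => z (e (Sum.inr j)))

@[simp] theorem pull_merge (e : Fin a ⊕ Fin b ≃ Fin n) (f : (Fin a → X) → (Fin b → X) → ℂ)
    (x : Fin a → X) (y : Fin b → X) : pull e f (merge e x y) = f x y := by
  simp [pull]

/-- The (anti)symmetrization of a function of two groups of particles. -/
noncomputable def symm2 (s : Statistics) (h : a + b = n) (f : (Fin a → X) → (Fin b → X) → ℂ) :
    (Fin n → X) → ℂ :=
  ∑ I : Choice a n, statChar s (I.sign h) • pull (I.equiv h) f

/-- Carried by `π`, the numbering of `I` becomes that of `J` after a permutation of the labels of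
the two groups. Signs are multiplicative and invariant under the relabelling `e0`. -/
theorem Choice.sign_map (h : a + b = n) (I J : Choice a n) (π : Equiv.Perm (Fin n)) :
    Equiv.Perm.sign π * I.sign h =
      J.sign h * Equiv.Perm.sign (((I.equiv h).trans π).trans (J.equiv h).symm) := by
  let e0 : Fin a ⊕ Fin b ≃ Fin n := finSumFinEquiv.trans (finCongr h)
  let τ := ((I.equiv h).trans π).trans (J.equiv h).symm
  have h1 : Equiv.Perm.sign ((e0.symm.trans τ).trans e0) = Equiv.Perm.sign τ :=
    Equiv.Perm.sign_symm_trans_trans τ e0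
  have h2 : π * (e0.symm.trans (I.equiv h)) =
      (e0.symm.trans (J.equiv h)) * ((e0.symm.trans τ).trans e0) := by
    ext i; simp [τ]
  have h3 := congr_arg Equiv.Perm.sign h2
  rw [map_mul, map_mul, h1] at h3
  exact h3

/-- A sum over the choices, rather than over all permutations, suffices because `f` already has the
right symmetry in each group. A permutation `π` moves the summand of `I` to that of `π(I)`, up to
permutations inside the groups, and the signs of the shuffles make up for the rest. -/
theorem hasStatistics_symm2 (s : Statistics) (h : a + b = n) {f : (Fin a → X) → (Fin b → X) → ℂ}
    (h1 : ∀ y, HasStatistics (fun x => f x y) s) (h2 : ∀ x, HasStatistics (f x) s) :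
    HasStatistics (symm2 s h f) s := by
  refine hasStatistics_of_statChar fun hs π z => ?_
  simp only [symm2, Finset.sum_apply, Pi.smul_apply, smul_eq_mul, Finset.mul_sum]
  let E : Choice a n ≃ Choice a n := (Equiv.finsetCongr π).subtypeEquiv fun I => by simp
  refine Fintype.sum_equiv E _ _ fun I => ?_
  have hmem : ∀ j, π j ∈ (E I).1 ↔ j ∈ I.1 := fun j => by simp [E]
  set J := E I with hJ
  set τ : Equiv.Perm (Fin a ⊕ Fin b) := ((I.equiv h).trans π).trans (J.equiv h).symm with hτ
  -- As `π` maps `I` onto `J`, the relabelling preserves the first group and is a pair of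
  -- permutations.
  obtain ⟨⟨τ1, τ2⟩, hτ12⟩ := Equiv.Perm.mem_sumCongrHom_range_of_perm_mapsTo_inl (σ := τ) (by
    rintro _ ⟨i, rfl⟩
    obtain ⟨j, hj⟩ := J.exists_inl h ((hmem _).2 (I.equiv_inl_mem h i))
    exact ⟨j, by simp [hτ, ← hj]⟩)
  have hτz : ∀ t, π (I.equiv h t) = J.equiv h (τ t) := fun t => by simp [hτ]
  have hτ12' : Equiv.sumCongr τ1 τ2 = τ := hτ12
  have hs1 : Equiv.Perm.sign τ = Equiv.Perm.sign τ1 * Equiv.Perm.sign τ2 := by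
    rw [← hτ12']; exact Equiv.Perm.sign_sumCongr τ1 τ2
  have hL : ∀ i, π (I.equiv h (Sum.inl i)) = J.equiv h (Sum.inl (τ1 i)) := fun i => by
    rw [hτz, ← hτ12']; rfl
  have hR : ∀ i, π (I.equiv h (Sum.inr i)) = J.equiv h (Sum.inr (τ2 i)) := fun i => by
    rw [hτz, ← hτ12']; rfl
  have e1 : pull (I.equiv h) f (fun i => z (π i)) =
      statChar s (Equiv.Perm.sign τ) * pull (J.equiv h) f z := by
    rw [hs1, map_mul]
    simp only [pull, hL, hR]
    rw [(h1 _).apply_perm hs τ1 (fun i => z (J.equiv h (Sum.inl i))),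
      (h2 _).apply_perm hs τ2 (fun i => z (J.equiv h (Sum.inr i)))]
    ring
  rw [e1]
  have e2 := congr_arg (statChar s) (Choice.sign_map h I J π)
  rw [map_mul, map_mul] at e2
  have e3 := statChar_mul_self s (Equiv.Perm.sign τ)
  have e4 := statChar_mul_self s (Equiv.Perm.sign π)
  -- The characters take square roots of one as values, so each factor can be moved to the other
  -- side.
  have e5 : statChar s (I.sign h) * statChar s (Equiv.Perm.sign τ) =
      statChar s (Equiv.Perm.sign π) * statChar s (J.sign h) := by
    calc _ = (statChar s (Equiv.Perm.sign π) * statChar s (Equiv.Perm.sign π)) *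
          (statChar s (I.sign h) * statChar s (Equiv.Perm.sign τ)) := by rw [e4, one_mul]
      _ = statChar s (Equiv.Perm.sign π) * (statChar s (Equiv.Perm.sign π) * statChar s (I.sign h)) *
          statChar s (Equiv.Perm.sign τ) := by ring
      _ = statChar s (Equiv.Perm.sign π) * (statChar s (J.sign h) *
            (statChar s (Equiv.Perm.sign τ) * statChar s (Equiv.Perm.sign τ))) := by rw [e2]; ring
      _ = _ := by rw [e3, mul_one]
  rw [← mul_assoc, e5, mul_assoc]

end Sym

end RandomGas

namespace RandomGas

variable {𝒢 : Medium} {d : ℕ}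

theorem norm_sq_sum_of_disjoint {ι : Type*} [Fintype ι] (f : ι → ℂ)
    (h : ∀ i j, f i ≠ 0 → f j ≠ 0 → i = j) : ‖∑ i, f i‖ ^ 2 = ∑ i, ‖f i‖ ^ 2 := by
  by_cases h0 : ∀ i, f i = 0
  · simp [h0]
  · push Not at h0
    obtain ⟨i, hi⟩ := h0
    have hz : ∀ j, j ≠ i → f j = 0 := fun j hj => by
      by_contra hne; exact hj (h j i hne hi)
    rw [Fintype.sum_eq_single i fun j hj => hz j hj,
      Fintype.sum_eq_single i fun j hj => by rw [hz j hj]; simp]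

/-! ### Tensor products of trial spaces of two distant groups -/

section TwoGroups

variable {a b n : ℕ} {h : a + b = n} {v : Site 𝒢 d → ℝ} {s : Statistics} {B : ℝ}
  {wa : (Fin a → Site 𝒢 d) → EReal} {wb : (Fin b → Site 𝒢 d) → EReal}
  {wn : (Fin n → Site 𝒢 d) → EReal}
  {D₁ : Set (Fin a → Site 𝒢 d)} {D₂ : Set (Fin b → Site 𝒢 d)}
  {f : (Fin a → Site 𝒢 d) → (Fin b → Site 𝒢 d) → ℂ}

theorem tensor_mem (e : Fin a ⊕ Fin b ≃ Fin n) {φ : (Fin a → Site 𝒢 d) → ℂ}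
    {ψ : (Fin b → Site 𝒢 d) → ℂ} (hφ : φ ∈ testSubmodule D₁) (hψ : ψ ∈ testSubmodule D₂) :
    pull e (fun x y => φ x * ψ y) ∈ testSubmodule {z : Fin n → Site 𝒢 d |
      (fun i => z (e (Sum.inl i))) ∈ D₁ ∧ (fun j => z (e (Sum.inr j))) ∈ D₂} := by
  have hl : Continuous (fun (z : Fin n → Site 𝒢 d) => fun i => z (e (Sum.inl i))) := by fun_prop
  have hr : Continuous (fun (z : Fin n → Site 𝒢 d) => fun i => z (e (Sum.inr i))) := by fun_prop
  have hsup : tsupport (pull e fun x y => φ x * ψ y) ⊆ {z : Fin n → Site 𝒢 d |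
      (fun i => z (e (Sum.inl i))) ∈ tsupport φ ∧ (fun j => z (e (Sum.inr j))) ∈ tsupport ψ} := by
    refine closure_minimal (fun z hz => ?_)
      (((isClosed_tsupport φ).preimage hl).inter ((isClosed_tsupport ψ).preimage hr))
    have := mul_ne_zero_iff.1 (show φ _ * ψ _ ≠ 0 from hz)
    exact ⟨subset_tsupport _ this.1, subset_tsupport _ this.2⟩
  refine ⟨?_, ?_, hsup.trans fun z hz => ⟨hφ.2.2 hz.1, hψ.2.2 hz.2⟩⟩
  · cases 𝒢
    · trivial
    · refine isSmooth_continuum_iff.2 (ContDiff.mul ((isSmooth_continuum_iff.1 hφ.1).comp ?_)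
        ((isSmooth_continuum_iff.1 hψ.1).comp ?_))
      · exact contDiff_pi.2 fun i => contDiff_apply ℝ _ _
      · exact contDiff_pi.2 fun i => contDiff_apply ℝ _ _
  · have hK : IsCompact ((fun p : (Fin a → Site 𝒢 d) × (Fin b → Site 𝒢 d) => merge e p.1 p.2) ''
        (tsupport φ ×ˢ tsupport ψ)) :=
      (IsCompact.prod hφ.2.1 hψ.2.1).image (continuous_merge e)
    refine hK.of_isClosed_subset (isClosed_tsupport _) fun z hz => ?_
    exact ⟨(_, _), hsup hz, merge_restrict e z⟩

/-- Wave functions of two groups of particles: products of functions in two given spaces, and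
their linear combinations. -/
structure IsTwoGroup (F₁ : Submodule ℂ ((Fin a → Site 𝒢 d) → ℂ))
    (F₂ : Submodule ℂ ((Fin b → Site 𝒢 d) → ℂ)) (f : (Fin a → Site 𝒢 d) → (Fin b → Site 𝒢 d) → ℂ) :
    Prop where
  left : ∀ y, (fun x => f x y) ∈ F₁
  right : ∀ x, f x ∈ F₂

/-- Two different choices of equal size disagree about some particle `j`, which would be near the
region of the first group for one choice and near that of the second group for the other. Its two
positions are at distance at most 2, less than the separation. -/
theorem sep_unique {r : ℝ} (hr : 2 < r)
    (hsep : ∀ x ∈ D₁, ∀ y ∈ D₂, ∀ i j, r ≤ dist (x i) (y j)) {I J : Choice a n}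
    {z z' z'' : Fin n → Site 𝒢 d} (h1 : ∀ j, dist (z j) (z' j) ≤ 1) (h2 : ∀ j, dist (z j) (z'' j) ≤ 1)
    (hI : (fun i => z' (I.equiv h (Sum.inl i))) ∈ D₁)
    (hJ : (fun i => z'' (J.equiv h (Sum.inr i))) ∈ D₂) : I = J := by
  by_contra hne
  have : ¬ I.1 ⊆ J.1 := fun hs => hne (Subtype.ext
    (Finset.eq_of_subset_of_card_le hs (by rw [I.2, J.2])))
  obtain ⟨j, hjI, hjJ⟩ := Finset.not_subset.1 this
  obtain ⟨i, hi⟩ := I.exists_inl h hjI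
  obtain ⟨i', hi'⟩ := J.exists_inr h hjJ
  have h3 := hsep _ hI _ hJ i i'
  simp only [hi, hi'] at h3
  have h4 := dist_triangle (z' j) (z j) (z'' j)
  have h5 := h1 j
  rw [dist_comm] at h5
  linarith [h2 j]

theorem toENNReal_split {wn wa wb : EReal} {ca cb err : ℝ}
    (ha : ((-ca : ℝ) : EReal) ≤ wa) (hb : ((-cb : ℝ) : EReal) ≤ wb)
    (hw : wn ≤ wa + wb + (err : EReal)) :
    (wn + ((ca + cb : ℝ) : EReal)).toENNReal ≤
      (wa + (ca : EReal)).toENNReal + (wb + (cb : EReal)).toENNReal + ENNReal.ofReal err := by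
  induction wa with
  | bot => exact absurd ha (by simp)
  | top => simp
  | coe p =>
  induction wb with
  | bot => exact absurd hb (by simp)
  | top => simp
  | coe q =>
    have hp : -ca ≤ p := by exact_mod_cast ha
    have hq : -cb ≤ q := by exact_mod_cast hb
    have : wn + ((ca + cb : ℝ) : EReal) ≤ (((p + ca) + (q + cb) + err : ℝ) : EReal) := by
      refine (add_le_add_left hw _).trans (le_of_eq ?_)
      norm_cast
      ring
    refine (EReal.toENNReal_le_toENNReal this).trans ?_
    rw [← EReal.coe_add, ← EReal.coe_add]
    simp only [EReal.toENNReal_of_ne_top (EReal.coe_ne_top _), EReal.toReal_coe]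
    refine ENNReal.ofReal_add_le.trans ?_
    gcongr
    exact ENNReal.ofReal_add_le

/-- The energy of two distant groups of particles. -/
theorem pull_energy_le (hv : LocallyIntegrable v volume) {e₁ e₂ err : ℝ} (herr : 0 ≤ err)
    {F₁ : Submodule ℂ ((Fin a → Site 𝒢 d) → ℂ)} {F₂ : Submodule ℂ ((Fin b → Site 𝒢 d) → ℂ)}
    (hwa : Measurable wa) (hwb : Measurable wb)
    (hsta : ∀ x, ((-(a * B) : ℝ) : EReal) ≤ wa x) (hstb : ∀ x, ((-(b * B) : ℝ) : EReal) ≤ wb x)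
    (H₁ : ∀ φ ∈ F₁, φ ∈ testSubmodule D₁ ∧ HasStatistics φ s ∧ shiftedForm B wa φ ≠ ⊤ ∧
      freeForm v φ + (shiftedForm B wa φ).toReal ≤ (e₁ + a * B) * normSq φ)
    (H₂ : ∀ φ ∈ F₂, φ ∈ testSubmodule D₂ ∧ HasStatistics φ s ∧ shiftedForm B wb φ ≠ ⊤ ∧
      freeForm v φ + (shiftedForm B wb φ).toReal ≤ (e₂ + b * B) * normSq φ)
    (hab : a + b = n) (e : Fin a ⊕ Fin b ≃ Fin n)
    (hw : ∀ x ∈ D₁, ∀ y ∈ D₂, wn (merge e x y) ≤ wa x + wb y + (err : EReal))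
    (hf : IsTwoGroup F₁ F₂ f) (hft : pull e f ∈ testSubmodule Set.univ) :
    shiftedForm B wn (pull e f) ≠ ⊤ ∧ freeForm v (pull e f) + (shiftedForm B wn (pull e f)).toReal ≤
      (e₁ + e₂ + err + n * B) * normSq (pull e f) := by
  have hfm : Measurable fun p : (Fin a → Site 𝒢 d) × (Fin b → Site 𝒢 d) => ‖f p.1 p.2‖ₑ ^ 2 := by
    have := ((continuous_of_mem_test hft).comp (continuous_merge e)).measurable.enorm.pow_const 2
    simpa [Function.comp_def] using this
  have hG₁ : Integrable (fun y => (e₁ + a * B) * normSq (fun x => f x y) - freeForm v fun x => f x y) := by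
    have h1 := (normSq_slice e hft).1.const_mul (e₁ + a * B)
    have h2 := (freeForm_slice e hv hft).1
    simp only [pull_merge] at h1 h2
    exact h1.sub h2
  have hG₂ : Integrable (fun x => (e₂ + b * B) * normSq (f x) - freeForm v (f x)) := by
    have h1 := (normSq_slice_right e hft).1.const_mul (e₂ + b * B)
    have h2 := integrable_freeForm_slice_right e hv hft
    simp only [pull_merge] at h1 h2
    exact h1.sub h2
  -- Every slice is in the trial space, so its interaction energy is at most what the trial
  -- inequality leaves after the free energy. These remainders are real integrals and can be added
  -- up.
  have hp₁ : ∀ y, (shiftedForm B wa fun x => f x y) ≤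
      ENNReal.ofReal ((e₁ + a * B) * normSq (fun x => f x y) - freeForm v fun x => f x y) := fun y => by
    obtain ⟨-, -, h3, h4⟩ := H₁ _ (hf.left y)
    rw [← ENNReal.ofReal_toReal h3]
    exact ENNReal.ofReal_le_ofReal (by linarith)
  have hp₂ : ∀ x, (shiftedForm B wb (f x)) ≤
      ENNReal.ofReal ((e₂ + b * B) * normSq (f x) - freeForm v (f x)) := fun x => by
    obtain ⟨-, -, h3, h4⟩ := H₂ _ (hf.right x)
    rw [← ENNReal.ofReal_toReal h3]
    exact ENNReal.ofReal_le_ofReal (by linarith)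
  have hn₁ : ∀ y, 0 ≤ (e₁ + a * B) * normSq (fun x => f x y) - freeForm v fun x => f x y := fun y => by
    obtain ⟨-, -, h3, h4⟩ := H₁ _ (hf.left y)
    linarith [ENNReal.toReal_nonneg (a := shiftedForm B wa fun x => f x y)]
  have hn₂ : ∀ x, 0 ≤ (e₂ + b * B) * normSq (f x) - freeForm v (f x) := fun x => by
    obtain ⟨-, -, h3, h4⟩ := H₂ _ (hf.right x)
    linarith [ENNReal.toReal_nonneg (a := shiftedForm B wb (f x))]
  set G₁ := ∫ y, ((e₁ + a * B) * normSq (fun x => f x y) - freeForm v fun x => f x y) with hG₁d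
  set G₂ := ∫ x, ((e₂ + b * B) * normSq (f x) - freeForm v (f x)) with hG₂d
  -- The free energy is the sum of the contributions of the two groups, so the integrated remainders
  -- add up without loss.
  have hsum : G₁ + G₂ + freeForm v (pull e f) = (e₁ + e₂ + n * B) * normSq (pull e f) := by
    have h1 := (normSq_slice e hft)
    have h2 := (normSq_slice_right e hft)
    have h3 := (freeForm_slice e hv hft).1
    have h4 := integrable_freeForm_slice_right e hv hft
    have h5 := freeForm_split e hv hft
    simp only [pull_merge] at h1 h2 h3 h4 h5
    rw [hG₁d, hG₂d, integral_sub (h1.1.const_mul _) h3, integral_sub (h2.1.const_mul _) h4,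
      integral_const_mul, integral_const_mul, h1.2, h2.2, h5,
      show (n : ℝ) = a + b by rw [← hab]; push_cast; rfl]
    ring
  have hG₁n : 0 ≤ G₁ := integral_nonneg hn₁
  have hG₂n : 0 ≤ G₂ := integral_nonneg hn₂
  have hma : Measurable fun p : (Fin a → Site 𝒢 d) × (Fin b → Site 𝒢 d) =>
      (wa p.1 + ((a * B : ℝ) : EReal)).toENNReal * ‖f p.1 p.2‖ₑ ^ 2 := by fun_prop
  have hmb : Measurable fun p : (Fin a → Site 𝒢 d) × (Fin b → Site 𝒢 d) =>
      (wb p.2 + ((b * B : ℝ) : EReal)).toENNReal * ‖f p.1 p.2‖ₑ ^ 2 := by fun_prop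
  -- The pointwise bound for the interaction is needed only where `f` does not vanish, hence only on
  -- `D₁ × D₂`. Tonelli then integrates each of its parts slice by slice.
  have hmain : shiftedForm B wn (pull e f) ≤
      ENNReal.ofReal G₁ + ENNReal.ofReal G₂ + ENNReal.ofReal (err * normSq (pull e f)) := by
    calc shiftedForm B wn (pull e f)
        = ∫⁻ p : (Fin a → Site 𝒢 d) × (Fin b → Site 𝒢 d),
          (wn (merge e p.1 p.2) + ((n * B : ℝ) : EReal)).toENNReal * ‖f p.1 p.2‖ₑ ^ 2 := by
            rw [shiftedForm, lintegral_merge e]; simp only [pull_merge]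
      _ ≤ ∫⁻ p : (Fin a → Site 𝒢 d) × (Fin b → Site 𝒢 d),
          ((wa p.1 + ((a * B : ℝ) : EReal)).toENNReal * ‖f p.1 p.2‖ₑ ^ 2 +
          (wb p.2 + ((b * B : ℝ) : EReal)).toENNReal * ‖f p.1 p.2‖ₑ ^ 2 +
          ENNReal.ofReal err * ‖f p.1 p.2‖ₑ ^ 2) := by
            refine lintegral_mono fun p => ?_
            by_cases h0 : f p.1 p.2 = 0
            · simp [h0]
            · have hx : p.1 ∈ D₁ := (H₁ _ (hf.left p.2)).1.2.2 (subset_tsupport _ h0)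
              have hy : p.2 ∈ D₂ := (H₂ _ (hf.right p.1)).1.2.2 (subset_tsupport _ h0)
              rw [← add_mul, ← add_mul]
              gcongr
              have := toENNReal_split (hsta p.1) (hstb p.2) (hw _ hx _ hy)
              rwa [← add_mul, show ((a : ℝ) + b) = n by rw [← hab]; push_cast; rfl] at this
      _ = (∫⁻ y, shiftedForm B wa fun x => f x y) + (∫⁻ x, shiftedForm B wb (f x)) +
          ENNReal.ofReal (err * normSq (pull e f)) := by
            rw [lintegral_add_left (by fun_prop), lintegral_add_left hma]
            congr 1
            · congr 1
              · exact lintegral_prod_symm _ hma.aemeasurable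
              · exact lintegral_prod _ hmb.aemeasurable
            · rw [lintegral_const_mul _ hfm, ENNReal.ofReal_mul herr, ← lintegral_enorm_sq hft,
                lintegral_merge e]
              simp only [pull_merge]
      _ ≤ _ := by
            rw [hG₁d, hG₂d, ofReal_integral_eq_lintegral_ofReal hG₁ (ae_of_all _ hn₁),
              ofReal_integral_eq_lintegral_ofReal hG₂ (ae_of_all _ hn₂)]
            gcongr with y x
            · exact hp₁ y
            · exact hp₂ x
  have hN := normSq_nonneg (pull e f)
  rw [← ENNReal.ofReal_add hG₁n hG₂n, ← ENNReal.ofReal_add (by positivity) (by positivity)] at hmain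
  refine ⟨(hmain.trans_lt ENNReal.ofReal_lt_top).ne, ?_⟩
  have h6 := ENNReal.toReal_le_of_le_ofReal (by positivity) hmain
  linarith

variable {D : Set (Fin n → Site 𝒢 d)}

/-- The energy of the (anti)symmetrization of a wave function of two distant groups. -/
theorem symm2_energy (hv : LocallyIntegrable v volume) (hab : a + b = n) (hwn : Measurable wn)
    {r : ℝ} (hr : 2 < r) (hsep : ∀ x ∈ D₁, ∀ y ∈ D₂, ∀ i j, r ≤ dist (x i) (y j))
    (hft : ∀ e : Fin a ⊕ Fin b ≃ Fin n, pull e f ∈ testSubmodule {z : Fin n → Site 𝒢 d |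
      (fun i => z (e (Sum.inl i))) ∈ D₁ ∧ (fun j => z (e (Sum.inr j))) ∈ D₂}) :
    symm2 s hab f ∈ testSubmodule Set.univ ∧
    (∀ z, ‖symm2 s hab f z‖ ^ 2 = ∑ I : Choice a n, ‖pull (I.equiv hab) f z‖ ^ 2) ∧
    normSq (symm2 s hab f) = ∑ I : Choice a n, normSq (pull (I.equiv hab) f) ∧
    freeForm v (symm2 s hab f) = ∑ I : Choice a n, freeForm v (pull (I.equiv hab) f) ∧
    shiftedForm B wn (symm2 s hab f) = ∑ I : Choice a n, shiftedForm B wn (pull (I.equiv hab) f) := by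
  have hft' : ∀ I : Choice a n, pull (I.equiv hab) f ∈ testSubmodule Set.univ := fun I =>
    mem_testSubmodule_univ (hft _)
  have hst : ∀ I : Choice a n, statChar s (I.sign hab) • pull (I.equiv hab) f ∈
      testSubmodule Set.univ := fun I => Submodule.smul_mem _ _ (hft' I)
  have hmem : symm2 s hab f ∈ testSubmodule Set.univ := Submodule.sum_mem _ fun I _ => hst I
  -- The tolerance 1 makes this apply to forward differences as well as to the functions, so at each
  -- point at most one summand contributes to the norm, the gradient or the interaction.
  have huniq : ∀ (I J : Choice a n) (z z' z'' : Fin n → Site 𝒢 d), (∀ j, dist (z j) (z' j) ≤ 1) →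
      (∀ j, dist (z j) (z'' j) ≤ 1) → z' ∈ tsupport (pull (I.equiv hab) f) →
      z'' ∈ tsupport (pull (J.equiv hab) f) → I = J := fun I J z z' z'' h1 h2 h3 h4 =>
    sep_unique hr hsep h1 h2 ((hft _).2.2 h3).1 ((hft _).2.2 h4).2
  have key : ∀ z, ‖symm2 s hab f z‖ ^ 2 = ∑ I : Choice a n, ‖pull (I.equiv hab) f z‖ ^ 2 := by
    intro z
    rw [symm2, Finset.sum_apply, norm_sq_sum_of_disjoint]
    · refine Finset.sum_congr rfl fun I _ => ?_
      rw [Pi.smul_apply, norm_smul, norm_statChar, one_mul]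
    · intro I J hI hJ
      refine huniq I J z z z (fun j => by simp) (fun j => by simp) (subset_tsupport _ ?_)
        (subset_tsupport _ ?_)
      · exact fun h0 => hI (by rw [Pi.smul_apply, h0, smul_zero])
      · exact fun h0 => hJ (by rw [Pi.smul_apply, h0, smul_zero])
  have keyD : ∀ z i l, ‖deriv1 𝒢 d n i l (symm2 s hab f) z‖ ^ 2 =
      ∑ I : Choice a n, ‖deriv1 𝒢 d n i l (pull (I.equiv hab) f) z‖ ^ 2 := by
    intro z i l
    rw [symm2, deriv1_sum _ _ (fun I _ => hst I), Finset.sum_apply, norm_sq_sum_of_disjoint]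
    · refine Finset.sum_congr rfl fun I _ => ?_
      rw [deriv1_smul (hft' I), Pi.smul_apply, norm_smul, norm_statChar, one_mul]
    · intro I J hI hJ
      rw [deriv1_smul (hft' I), Pi.smul_apply] at hI
      rw [deriv1_smul (hft' J), Pi.smul_apply] at hJ
      obtain ⟨z', hz', hd'⟩ := exists_mem_tsupport_of_deriv1_ne (smul_ne_zero_iff.1 hI).2
      obtain ⟨z'', hz'', hd''⟩ := exists_mem_tsupport_of_deriv1_ne (smul_ne_zero_iff.1 hJ).2
      exact huniq I J z z' z'' hd' hd'' hz' hz''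
  refine ⟨hmem, key, ?_, ?_, ?_⟩
  · simp only [normSq, key]
    exact integral_finsetSum _ fun I _ => integrable_normSq (hft' I)
  · rw [freeForm_eq_integral hv hmem]
    have : ∀ z, ∑ i, particleDensity v (symm2 s hab f) z i =
        ∑ I : Choice a n, ∑ i, particleDensity v (pull (I.equiv hab) f) z i := fun z => by
      rw [Finset.sum_comm]
      refine Finset.sum_congr rfl fun i _ => ?_
      simp only [particleDensity, key, keyD, Finset.sum_add_distrib, Finset.mul_sum]
      rw [Finset.sum_comm]
    simp only [this]
    rw [integral_finsetSum _ fun I _ => integrable_finsetSum _ fun i _ =>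
      integrable_particleDensity hv (hft' I) i]
    exact Finset.sum_congr rfl fun I _ => (freeForm_eq_integral hv (hft' I)).symm
  · have hm : ∀ I : Choice a n, Measurable fun z => ‖pull (I.equiv hab) f z‖ₑ ^ 2 := fun I =>
      (continuous_of_mem_test (hft' I)).measurable.enorm.pow_const 2
    have keyE : ∀ z, ‖symm2 s hab f z‖ₑ ^ 2 = ∑ I : Choice a n, ‖pull (I.equiv hab) f z‖ₑ ^ 2 := by
      intro z
      simp only [← ofReal_norm, ← ENNReal.ofReal_pow (norm_nonneg _), key]
      exact ENNReal.ofReal_sum_of_nonneg fun I _ => sq_nonneg _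
    simp only [shiftedForm, keyE, Finset.mul_sum]
    exact lintegral_finsetSum _ fun I _ => by have := hm I; fun_prop

/-- Products of basis vectors are (anti)symmetrised over the choices. The summands have disjoint
supports, so that all forms add over the choices and no dimension is lost. The energy estimate asks
only that all slices of a linear combination lie in `F₁` and `F₂`, not that it is a product. -/
theorem HasTrialSpace.combine (hv : LocallyIntegrable v volume) {e₁ e₂ err r : ℝ} {k₁ k₂ : ℕ}
    (hab : a + b = n) (herr : 0 ≤ err) (hr : 2 < r) (hwa : Measurable wa) (hwb : Measurable wb)
    (hwn : Measurable wn)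
    (hsta : ∀ x, ((-(a * B) : ℝ) : EReal) ≤ wa x) (hstb : ∀ x, ((-(b * B) : ℝ) : EReal) ≤ wb x)
    (hsep : ∀ x ∈ D₁, ∀ y ∈ D₂, ∀ i j, r ≤ dist (x i) (y j))
    (hW : ∀ (I : Choice a n), ∀ x ∈ D₁, ∀ y ∈ D₂,
      wn (merge (I.equiv hab) x y) ≤ wa x + wb y + (err : EReal))
    (hD : ∀ (I : Choice a n), ∀ x ∈ D₁, ∀ y ∈ D₂, merge (I.equiv hab) x y ∈ D)
    (hk₁ : 1 ≤ k₁) (hk₂ : 1 ≤ k₂)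
    (h₁ : HasTrialSpace v wa s B D₁ k₁ e₁) (h₂ : HasTrialSpace v wb s B D₂ k₂ e₂) :
    HasTrialSpace v wn s B D (k₁ * k₂) (e₁ + e₂ + err) := by
  obtain ⟨F₁, hF₁, H₁⟩ := h₁
  obtain ⟨F₂, hF₂, H₂⟩ := h₂
  have : FiniteDimensional ℂ F₁ := Module.finite_of_finrank_pos (by omega)
  have : FiniteDimensional ℂ F₂ := Module.finite_of_finrank_pos (by omega)
  let b₁ := Module.finBasisOfFinrankEq ℂ F₁ hF₁
  let b₂ := Module.finBasisOfFinrankEq ℂ F₂ hF₂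
  let T : (Fin k₁ × Fin k₂ → ℂ) → (Fin a → Site 𝒢 d) → (Fin b → Site 𝒢 d) → ℂ := fun c x y =>
    ∑ p, c p * ((b₁ p.1 : (Fin a → Site 𝒢 d) → ℂ) x * (b₂ p.2 : (Fin b → Site 𝒢 d) → ℂ) y)
  let g : Fin k₁ × Fin k₂ → (Fin n → Site 𝒢 d) → ℂ := fun p => symm2 s hab fun x y =>
    (b₁ p.1 : (Fin a → Site 𝒢 d) → ℂ) x * (b₂ p.2 : (Fin b → Site 𝒢 d) → ℂ) y
  have hT : ∀ c, symm2 s hab (T c) = ∑ p, c p • g p := fun c => by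
    funext z
    simp only [symm2, T, g, pull, Finset.sum_apply, Pi.smul_apply, smul_eq_mul, Finset.mul_sum]
    rw [Finset.sum_comm]
    refine Finset.sum_congr rfl fun p _ => Finset.sum_congr rfl fun I _ => by ring
  have hl : ∀ c, IsTwoGroup F₁ F₂ (T c) := fun c => by
    constructor
    · intro y
      have : (fun x => T c x y) = ∑ p, (c p * (b₂ p.2 : (Fin b → Site 𝒢 d) → ℂ) y) •
          (b₁ p.1 : (Fin a → Site 𝒢 d) → ℂ) := by
        funext x
        simp only [T, Finset.sum_apply, Pi.smul_apply, smul_eq_mul]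
        exact Finset.sum_congr rfl fun p _ => by ring
      rw [this]
      exact Submodule.sum_mem _ fun p _ => Submodule.smul_mem _ _ (b₁ p.1).2
    · intro x
      have : T c x = ∑ p, (c p * (b₁ p.1 : (Fin a → Site 𝒢 d) → ℂ) x) •
          (b₂ p.2 : (Fin b → Site 𝒢 d) → ℂ) := by
        funext y
        simp only [T, Finset.sum_apply, Pi.smul_apply, smul_eq_mul]
        exact Finset.sum_congr rfl fun p _ => by ring
      rw [this]
      exact Submodule.sum_mem _ fun p _ => Submodule.smul_mem _ _ (b₂ p.2).2
  have hft : ∀ c (e : Fin a ⊕ Fin b ≃ Fin n), pull e (T c) ∈ testSubmodule {z : Fin n → Site 𝒢 d |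
      (fun i => z (e (Sum.inl i))) ∈ D₁ ∧ (fun j => z (e (Sum.inr j))) ∈ D₂} := fun c e => by
    have : pull e (T c) = ∑ p, c p • pull e (fun x y =>
        (b₁ p.1 : (Fin a → Site 𝒢 d) → ℂ) x * (b₂ p.2 : (Fin b → Site 𝒢 d) → ℂ) y) := by
      funext z
      simp [T, pull, Finset.sum_apply]
    rw [this]
    exact Submodule.sum_mem _ fun p _ => Submodule.smul_mem _ _
      (tensor_mem e (H₁ _ (b₁ p.1).2).1 (H₂ _ (b₂ p.2).2).1)
  -- By disjointness a vanishing symmetrisation makes each single summand vanish; independence is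
  -- then used in one factor after the other.
  have hinj : ∀ c, symm2 s hab (T c) = 0 → c = 0 := by
    intro c hc
    have hI : Nonempty (Choice a n) := by
      obtain ⟨I, -, hI⟩ := Finset.exists_subset_card_eq (s := (Finset.univ : Finset (Fin n)))
        (n := a) (by rw [Finset.card_univ, Fintype.card_fin]; omega)
      exact ⟨I, hI⟩
    obtain ⟨I⟩ := hI
    have h0 : ∀ x y, T c x y = 0 := fun x y => by
      have h1 := (symm2_energy (s := s) (B := B) hv hab hwn hr hsep (hft c)).2.1
        (merge (I.equiv hab) x y)
      rw [hc, Pi.zero_apply, norm_zero, zero_pow two_ne_zero] at h1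
      have h2 := (Finset.sum_eq_zero_iff_of_nonneg fun _ _ => sq_nonneg _).1 h1.symm I
        (Finset.mem_univ _)
      simpa using h2
    have h3 : ∀ y i, ∑ j, c (i, j) * (b₂ j : (Fin b → Site 𝒢 d) → ℂ) y = 0 := by
      intro y
      refine Fintype.linearIndependent_iff.1 b₁.linearIndependent _ ?_
      refine Subtype.ext (funext fun x => ?_)
      have := h0 x y
      simp only [T, Fintype.sum_prod_type] at this
      simp only [AddSubmonoidClass.coe_finsetSum, Submodule.coe_smul, Finset.sum_apply,
        Pi.smul_apply, smul_eq_mul, ZeroMemClass.coe_zero, Pi.zero_apply, Finset.sum_mul]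
      rw [← this]
      exact Finset.sum_congr rfl fun i _ => Finset.sum_congr rfl fun j _ => by ring
    funext ⟨i, j⟩
    refine Fintype.linearIndependent_iff.1 b₂.linearIndependent (fun j => c (i, j)) ?_ j
    refine Subtype.ext (funext fun y => ?_)
    simpa [Finset.sum_apply] using h3 y i
  have hli : LinearIndependent ℂ g := by
    rw [Fintype.linearIndependent_iff]
    intro c hc i
    rw [← hT] at hc
    rw [hinj c hc]; rfl
  refine ⟨Submodule.span ℂ (Set.range g), ?_, fun Φ hΦ => ?_⟩
  · rw [finrank_span_eq_card hli]; simp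
  obtain ⟨c, hc⟩ := (Submodule.mem_span_range_iff_exists_fun ℂ).1 hΦ
  rw [← hT] at hc
  subst hc
  obtain ⟨hm, hk, hN, hfree, hsh⟩ := symm2_energy (s := s) (B := B) hv hab hwn hr hsep (hft c)
  have hE : ∀ I : Choice a n, _ := fun I => pull_energy_le hv herr hwa hwb hsta hstb H₁ H₂ hab
    (I.equiv hab) (hW I) (hl c) (mem_testSubmodule_univ (hft c _))
  refine ⟨?_, ?_, ?_, ?_⟩
  · refine Submodule.sum_mem _ fun I _ => Submodule.smul_mem _ _
      (testSubmodule_mono (fun z hz => ?_) (hft c (I.equiv hab)))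
    have := hD I _ hz.1 _ hz.2
    rwa [merge_restrict] at this
  · exact hasStatistics_symm2 s hab (fun y => (H₁ _ ((hl c).left y)).2.1)
      fun x => (H₂ _ ((hl c).right x)).2.1
  · rw [hsh]
    exact ENNReal.sum_ne_top.2 fun I _ => (hE I).1
  · rw [hsh, hfree, hN, ENNReal.toReal_sum fun I _ => (hE I).1, ← Finset.sum_add_distrib,
      Finset.mul_sum]
    exact Finset.sum_le_sum fun I _ => (hE I).2

end TwoGroups

end RandomGas

namespace RandomGas

variable {𝒢 : Medium} {d : ℕ}

/-! ### Interactions -/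

/-- The properties of the interactions that both classes of interactions have in common: the
interaction energy of two distant groups of particles is at most the sum of their energies and of
the tails `C |xⁱ - xʲ|^{-λ}`. -/
structure IsTempered (W : (n : ℕ) → (Fin n → Site 𝒢 d) → EReal) (R C lam : ℝ) : Prop where
  tail_nonneg : 0 ≤ C
  decay : (d : ℝ) < lam
  split : ∀ (a b n : ℕ) (hab : a + b = n), 1 ≤ a → 1 ≤ b → ∀ (I : Choice a n)
    (x : Fin a → Site 𝒢 d) (y : Fin b → Site 𝒢 d), (∀ i j, R ≤ dist (x i) (y j)) →
    W n (merge (I.equiv hab) x y) ≤ W a x + W b y +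
      ((∑ i, ∑ j, C * ‖x i - y j‖ ^ (-lam) : ℝ) : EReal)
  one : ∀ x, W 1 x = 0
  shift : ∀ n (γ : Fin d → ℤ) (x : Fin n → Site 𝒢 d), W n (fun i => x i + shift 𝒢 d γ) = W n x

theorem ereal_coe_sum {ι : Type*} (s : Finset ι) (f : ι → ℝ) :
    ((∑ i ∈ s, f i : ℝ) : EReal) = ∑ i ∈ s, (f i : EReal) :=
  map_sum (⟨⟨Real.toEReal, EReal.coe_zero⟩, EReal.coe_add⟩ : ℝ →+ EReal) f s

section Interactions

variable {Ω : Type*} {M : Model 𝒢 d Ω}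

/-- There is no tail, so the constant is 0 and any exponent above `d` will do. -/
theorem isTempered_of_isCompactlySupported (h1 : M.IsCompactlySupported)
    (h2 : M.IsTranslationInvariant) (h3 : M.HasNoSelfInteraction) :
    ∃ R, IsTempered M.interaction R 0 (d + 1) := by
  obtain ⟨R, -, hR⟩ := h1
  have key : ∀ (a b n : ℕ) (I : Finset (Fin n)) (ha : I.card = a) (hb : Iᶜ.card = b),
      1 ≤ a → 1 ≤ b → ∀ x : Fin n → Site 𝒢 d, (∀ i ∈ I, ∀ j ∈ Iᶜ, R ≤ dist (x i) (x j)) →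
      M.interaction n x = M.interaction a (fun i => x (I.orderEmbOfFin ha i)) +
        M.interaction b (fun i => x (Iᶜ.orderEmbOfFin hb i)) := by
    intro a b n I ha hb h1a h1b x hx
    subst ha hb
    exact hR n I (Finset.card_pos.1 h1a) (Finset.card_pos.1 h1b) x hx
  refine ⟨R, le_rfl, by simp, ?_, h3, h2⟩
  intro a b n hab ha hb I x y hxy
  rw [key a b n I.1 I.2 (I.card_compl hab) ha hb]
  · have e1 : ∀ i, merge (I.equiv hab) x y (I.1.orderEmbOfFin I.2 i) = x i := fun i => by
      rw [← merge_inl (I.equiv hab) x y i, Choice.equiv, finSumEquivOfFinset_inl]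
    have e2 : ∀ i, merge (I.equiv hab) x y (I.1ᶜ.orderEmbOfFin (I.card_compl hab) i) = y i :=
      fun i => by rw [← merge_inr (I.equiv hab) x y i, Choice.equiv, finSumEquivOfFinset_inr]
    simp only [e1, e2]
    simp
  · intro i hi j hj
    obtain ⟨i', rfl⟩ := I.exists_inl hab hi
    obtain ⟨j', rfl⟩ := I.exists_inr hab (Finset.mem_compl.1 hj)
    rw [merge_inl, merge_inr]
    exact hxy _ _

/-- The order-preserving numbering respects the order inside each group; for a mixed pair the
symmetry of `u` makes it irrelevant which index is smaller. -/
theorem sum_pairs_merge {X : Type*} {a b n : ℕ} (hab : a + b = n) (I : Choice a n)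
    (u : X → X → EReal) (hu : ∀ p q, u p q = u q p) (x : Fin a → X) (y : Fin b → X) :
    ∑ p : Fin n × Fin n with p.1 < p.2,
        u (merge (I.equiv hab) x y p.1) (merge (I.equiv hab) x y p.2) =
      (∑ p : Fin a × Fin a with p.1 < p.2, u (x p.1) (x p.2)) +
      (∑ p : Fin b × Fin b with p.1 < p.2, u (y p.1) (y p.2)) + ∑ i, ∑ j, u (x i) (y j) := by
  classical
  set e := I.equiv hab with he
  have hin : ∀ i j, e (Sum.inl i) < e (Sum.inl j) ↔ i < j := fun i j => by
    rw [he, Choice.equiv, finSumEquivOfFinset_inl, finSumEquivOfFinset_inl]; simp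
  have hir : ∀ i j, e (Sum.inr i) < e (Sum.inr j) ↔ i < j := fun i j => by
    rw [he, Choice.equiv, finSumEquivOfFinset_inr, finSumEquivOfFinset_inr]; simp
  rw [Finset.sum_filter, Finset.sum_filter, Finset.sum_filter, Fintype.sum_prod_type,
    Fintype.sum_prod_type, Fintype.sum_prod_type, ← Equiv.sum_comp e, Fintype.sum_sum_type]
  simp only [← Equiv.sum_comp e (fun j => ite (_ < j) _ _), Fintype.sum_sum_type, hin, hir,
    merge_inl, merge_inr, Finset.sum_add_distrib]
  have hcross : (∑ i, ∑ j, if e (Sum.inl i) < e (Sum.inr j) then u (x i) (y j) else 0) +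
      (∑ j, ∑ i, if e (Sum.inr j) < e (Sum.inl i) then u (y j) (x i) else 0) =
      ∑ i, ∑ j, u (x i) (y j) := by
    rw [Finset.sum_comm (γ := Fin b), ← Finset.sum_add_distrib]
    refine Finset.sum_congr rfl fun i _ => ?_
    rw [← Finset.sum_add_distrib]
    refine Finset.sum_congr rfl fun j _ => ?_
    have hne : e (Sum.inl i) ≠ e (Sum.inr j) := by simp
    rcases lt_or_gt_of_ne hne with h | h
    · rw [if_pos h, if_neg h.not_gt, add_zero]
    · rw [if_neg h.not_gt, if_pos h, zero_add, hu]
  rw [← hcross]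
  abel

theorem isTempered_of_isTemperedPair (h : M.IsTemperedPair) :
    ∃ R C lam, IsTempered M.interaction R C lam := by
  obtain ⟨U, hU, hW, R, A, lam, -, hlam, hA⟩ := h
  -- The constant `A` carries no sign of its own.
  refine ⟨R, |A|, lam, abs_nonneg A, hlam, ?_, ?_, ?_⟩
  · intro a b n hab ha hb I x y hxy
    rw [hW, hW, hW, sum_pairs_merge hab I (fun p q => U (p - q)) (fun p q => by
      rw [← neg_sub, hU])]
    have : ∀ i j, U (x i - y j) ≤ ((|A| * ‖x i - y j‖ ^ (-lam) : ℝ) : EReal) := fun i j => by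
      refine (hA _ ((hxy i j).trans_eq (dist_eq_norm _ _))).2.trans ?_
      exact EReal.coe_le_coe_iff.2 (mul_le_mul_of_nonneg_right (le_abs_self A)
        (Real.rpow_nonneg (norm_nonneg _) _))
    gcongr
    rw [ereal_coe_sum]
    refine Finset.sum_le_sum fun i _ => ?_
    rw [ereal_coe_sum]
    exact Finset.sum_le_sum fun j _ => this i j
  · intro x
    rw [hW]
    refine Finset.sum_eq_zero fun p hp => ?_
    simp only [Finset.mem_filter] at hp
    have := hp.2
    rw [Subsingleton.elim p.1 p.2] at this
    exact absurd this (lt_irrefl _)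
  · intro n γ x
    rw [hW, hW]
    simp

end Interactions

/-! ### Cells -/

/-- Comparison with the sum of `‖z‖ ^ (-λ)` over a lattice of rank `d`. -/
theorem summable_one_add_norm_rpow {lam : ℝ} (h : (d : ℝ) < lam) :
    Summable fun η : Fin d → ℤ => (1 + ‖η‖) ^ (-lam) := by
  let b := Pi.basisFun ℝ (Fin d)
  let L : Submodule ℤ (Fin d → ℝ) := Submodule.span ℤ (Set.range b)
  have hrank : Module.finrank ℤ L = d := by
    rw [Module.finrank_eq_card_basis (b.restrictScalars ℤ)]; simp
  have hs := ZLattice.summable_norm_rpow L (-lam) (by rw [hrank]; linarith)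
  have hmem : ∀ η : Fin d → ℤ, (fun i => (η i : ℝ)) ∈ L := fun η => by
    have : (fun i => (η i : ℝ)) = ∑ i, η i • b i := by
      funext j
      simp [b, Finset.sum_apply, Pi.single_apply]
    rw [this]
    exact Submodule.sum_mem _ fun i _ => Submodule.smul_mem _ _ (Submodule.subset_span ⟨i, rfl⟩)
  let ι : (Fin d → ℤ) → L := fun η => ⟨fun i => (η i : ℝ), hmem η⟩
  have hι : Function.Injective ι := fun η η' h => by
    have := congr_arg Subtype.val h
    funext i
    exact Int.cast_injective (α := ℝ) (congr_fun this i)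
  have hn : ∀ η, ‖ι η‖ = ‖η‖ := fun η => by
    change ‖(fun i => (η i : ℝ))‖ = ‖η‖
    simp only [Pi.norm_def]
    rfl
  have hs' := hs.comp_injective hι
  -- At the origin the power of the norm takes the default value 0 and is no bound; this term is
  -- supplied by hand.
  have h0 : Summable fun η : Fin d → ℤ => if η = 0 then (1 : ℝ) else 0 :=
    (hasSum_ite_eq (0 : Fin d → ℤ) (1 : ℝ)).summable
  refine Summable.of_nonneg_of_le (fun η => by positivity) (fun η => ?_) (hs'.add h0)
  by_cases hη : η = 0
  · subst hη
    simp only [if_true, norm_zero, add_zero, Real.one_rpow]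
    have : 0 ≤ ((fun z : L => ‖z‖ ^ (-lam)) ∘ ι) 0 := Real.rpow_nonneg (norm_nonneg _) _
    linarith
  · rw [if_neg hη, add_zero]
    simp only [Function.comp, hn]
    have hlam : 0 < lam := lt_of_le_of_lt (Nat.cast_nonneg d) h
    exact Real.rpow_le_rpow_of_nonpos (norm_pos_iff.2 hη) (by linarith) (by linarith)

/-- The lattice sum `∑ (1 + |η|)^{-λ}`. -/
noncomputable def latticeSum (d : ℕ) (lam : ℝ) : ℝ := ∑' η : Fin d → ℤ, (1 + ‖η‖) ^ (-lam)

/-- The cube of side `L` at the corner of the cell `γ` of side `ℓ`. -/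
def cellCube (𝒢 : Medium) (d L ℓ : ℕ) (γ : Fin d → ℤ) : Set (Site 𝒢 d) :=
  {x | x - shift 𝒢 d ((ℓ : ℤ) • γ) ∈ cube 𝒢 d L}

/-- The half-open cell `γ` of side `ℓ`. -/
def cell (𝒢 : Medium) (d ℓ : ℕ) (γ : Fin d → ℤ) : Set (Site 𝒢 d) :=
  box 𝒢 d (fun i => ((ℓ * γ i : ℤ) : ℝ)) (fun i => ((ℓ * (γ i + 1) : ℤ) : ℝ))

theorem coord_of_mem_cube {L : ℕ} {x : Site 𝒢 d} (hx : x ∈ cube 𝒢 d L) (i : Fin d) :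
    0 ≤ coord 𝒢 d x i ∧ coord 𝒢 d x i < L := by
  cases 𝒢
  · have := hx i
    exact ⟨Int.cast_nonneg this.1, (Int.cast_lt (R := ℝ)).2 this.2⟩
  · exact ⟨(hx i).1.le, (hx i).2⟩

theorem coord_of_mem_cellCube {L ℓ : ℕ} {γ : Fin d → ℤ} {x : Site 𝒢 d}
    (hx : x ∈ cellCube 𝒢 d L ℓ γ) (i : Fin d) :
    ℓ * (γ i : ℝ) ≤ coord 𝒢 d x i ∧ coord 𝒢 d x i < ℓ * (γ i : ℝ) + L := by
  have := coord_of_mem_cube hx i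
  rw [coord_sub, coord_shift, Pi.smul_apply, smul_eq_mul] at this
  push_cast at this
  constructor <;> linarith [this.1, this.2]

theorem cellCube_subset_cell {L ℓ : ℕ} (h : L ≤ ℓ) (γ : Fin d → ℤ) :
    cellCube 𝒢 d L ℓ γ ⊆ cell 𝒢 d ℓ γ := fun x hx i => by
  have := coord_of_mem_cellCube hx i
  have h' : (L : ℝ) ≤ ℓ := by exact_mod_cast h
  push_cast
  constructor <;> linarith [this.1, this.2]

/-- The cell that contains a point. -/
noncomputable def cellIndex (ℓ : ℕ) (x : Site 𝒢 d) : Fin d → ℤ := fun i => ⌊coord 𝒢 d x i / ℓ⌋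

theorem mem_cell_iff {ℓ : ℕ} (hℓ : 1 ≤ ℓ) {x : Site 𝒢 d} {γ : Fin d → ℤ} :
    x ∈ cell 𝒢 d ℓ γ ↔ cellIndex ℓ x = γ := by
  have hℓ' : (0 : ℝ) < ℓ := by exact_mod_cast hℓ
  rw [funext_iff]
  refine forall_congr' fun i => ?_
  rw [cellIndex, Int.floor_eq_iff, le_div_iff₀ hℓ', div_lt_iff₀ hℓ']
  push_cast
  rw [mul_comm (ℓ : ℝ), mul_comm (ℓ : ℝ)]

/-- In a coordinate where the cell indices differ by `‖γ - η‖`, only the thickness of one cell can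
be lost. -/
theorem dist_cell_ge {ℓ : ℕ} {x y : Site 𝒢 d} {γ η : Fin d → ℤ}
    (hx : x ∈ cell 𝒢 d ℓ η) (hy : y ∈ cell 𝒢 d ℓ γ) (hd : 1 ≤ d) :
    ℓ * (‖γ - η‖ - 1) ≤ ‖x - y‖ := by
  have : Nonempty (Fin d) := ⟨⟨0, hd⟩⟩
  obtain ⟨i, hi⟩ : ∃ i, ‖(γ - η) i‖ = ‖γ - η‖ := by
    obtain ⟨i, -, hi⟩ := Finset.exists_mem_eq_sup Finset.univ Finset.univ_nonempty
      fun i => ‖(γ - η) i‖₊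
    exact ⟨i, by rw [Pi.norm_def, hi]; rfl⟩
  rw [← hi, Int.norm_eq_abs]
  refine le_trans ?_ (abs_coord_le_norm (x - y) i)
  have h1 := hx i
  have h2 := hy i
  rw [coord_sub]
  push_cast [Pi.sub_apply] at h1 h2 ⊢
  rcases abs_cases ((γ i : ℝ) - η i) with h | h <;> rw [h.1]
  · exact le_trans (by nlinarith) (neg_le_abs _)
  · exact le_trans (by nlinarith) (le_abs_self _)

/-- Each cube occupies only the first `L` of the `L + r` units of its cell, which leaves a corridor
of width `r` between any two. -/
theorem dist_cellCube_ne {L r : ℕ} {x y : Site 𝒢 d} {γ η : Fin d → ℤ} (hne : γ ≠ η)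
    (hx : x ∈ cellCube 𝒢 d L (L + r) γ) (hy : y ∈ cellCube 𝒢 d L (L + r) η) :
    (r : ℝ) ≤ dist x y := by
  obtain ⟨i, hi⟩ := Function.ne_iff.1 hne
  rw [dist_eq_norm]
  refine le_trans ?_ (abs_coord_le_norm (x - y) i)
  have h1 := coord_of_mem_cellCube hx i
  have h2 := coord_of_mem_cellCube hy i
  rw [coord_sub]
  push_cast at h1 h2
  rcases lt_or_gt_of_ne hi with h | h
  · have h3 : (γ i : ℝ) + 1 ≤ η i := by exact_mod_cast h
    exact le_trans (by nlinarith) (neg_le_abs _)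
  · have h3 : (η i : ℝ) + 1 ≤ γ i := by exact_mod_cast h
    exact le_trans (by nlinarith) (le_abs_self _)

/-- The bound for the interaction of one particle with particles in distant cells that hold at
most one particle each. -/
noncomputable def tailBound (d : ℕ) (C lam : ℝ) (r : ℕ) : ℝ :=
  C * (((r : ℝ) / 4) ^ (-lam) * latticeSum d lam)

theorem latticeSum_nonneg (lam : ℝ) : 0 ≤ latticeSum d lam :=
  tsum_nonneg fun _ => by positivity

theorem tailBound_nonneg {C : ℝ} (hC : 0 ≤ C) (lam : ℝ) (r : ℕ) : 0 ≤ tailBound d C lam r :=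
  mul_nonneg hC (mul_nonneg (by positivity) (latticeSum_nonneg lam))

/-- Configurations of particles in cells, at most `m` per cell. -/
def occupation (L ℓ : ℕ) (Γ : Finset (Fin d → ℤ)) (m n : ℕ) : Set (Fin n → Site 𝒢 d) :=
  {x | (∀ i, ∃ γ ∈ Γ, x i ∈ cellCube 𝒢 d L ℓ γ) ∧
    ∀ γ, {i | x i ∈ cellCube 𝒢 d L ℓ γ}.ncard ≤ m}

/-- The particles are grouped by cells, at most `m` in each, and the cells are compared with the
lattice sum centred at the cell of `x`. The resulting bound is uniform in the number of cells. -/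
theorem sum_tail_le {C lam : ℝ} (hC : 0 ≤ C) (hlam : (d : ℝ) < lam) {L r : ℕ} (hr : 1 ≤ r)
    (hd : 1 ≤ d)
    {Γ : Finset (Fin d → ℤ)} {m b : ℕ} (x : Site 𝒢 d) {y : Fin b → Site 𝒢 d}
    (hy : y ∈ occupation L (L + r) Γ m b) (hxy : ∀ j, (r : ℝ) ≤ ‖x - y j‖) :
    ∑ j, C * ‖x - y j‖ ^ (-lam) ≤ m * tailBound d C lam r := by
  classical
  obtain ⟨h1, h2⟩ := hy
  choose γ hγΓ hγ using h1
  set η := cellIndex (L + r) x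
  have hr' : (1 : ℝ) ≤ r := by exact_mod_cast hr
  have hlam0 : 0 < lam := lt_of_le_of_lt (Nat.cast_nonneg d) hlam
  have hxη : x ∈ cell 𝒢 d (L + r) η := (mem_cell_iff (by omega)).2 rfl
  -- For cells at index distance `t ≤ 2` the separation `r` is enough, as `(1 + t) / 4 < 1`; for `t
  -- > 2` the distance of the cells is enough, as `t - 1 ≥ (1 + t) / 4`.
  have hdist : ∀ j, (r : ℝ) / 4 * (1 + ‖γ j - η‖) ≤ ‖x - y j‖ := fun j => by
    have h3 := dist_cell_ge hxη (cellCube_subset_cell (by omega) _ (hγ j)) hd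
    have h4 := hxy j
    push_cast at h3
    have hL : (0 : ℝ) ≤ L := Nat.cast_nonneg L
    rcases le_or_gt ‖γ j - η‖ 2 with h5 | h5
    · nlinarith [norm_nonneg (γ j - η)]
    · nlinarith
  have hterm : ∀ j, C * ‖x - y j‖ ^ (-lam) ≤
      C * (((r : ℝ) / 4) ^ (-lam) * (1 + ‖γ j - η‖) ^ (-lam)) := fun j => by
    rw [← Real.mul_rpow (by positivity) (by positivity)]
    exact mul_le_mul_of_nonneg_left (Real.rpow_le_rpow_of_nonpos (by positivity) (hdist j)
      (by linarith)) hC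
  have hcard : ∀ g, (Finset.univ.filter fun j => γ j = g).card ≤ m := fun g => by
    refine le_trans ?_ (h2 g)
    rw [← Set.ncard_coe_finset]
    refine Set.ncard_le_ncard (fun j hj => ?_) (Set.toFinite _)
    have : γ j = g := by simpa using hj
    exact this ▸ hγ j
  have hsum : ∑ j, (1 + ‖γ j - η‖) ^ (-lam) ≤ m * latticeSum d lam := by
    rw [← Finset.sum_fiberwise_of_maps_to (s := Finset.univ) (t := Γ) (g := γ)
      (fun j _ => hγΓ j)]
    calc ∑ g ∈ Γ, ∑ j ∈ Finset.univ.filter (fun j => γ j = g), (1 + ‖γ j - η‖) ^ (-lam)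
        = ∑ g ∈ Γ, ((Finset.univ.filter fun j => γ j = g).card : ℝ) * (1 + ‖g - η‖) ^ (-lam) := by
          refine Finset.sum_congr rfl fun g _ => ?_
          rw [Finset.sum_congr rfl (g := fun _ => (1 + ‖g - η‖) ^ (-lam)) fun j hj => by
            rw [(Finset.mem_filter.1 hj).2], Finset.sum_const, nsmul_eq_mul]
      _ ≤ ∑ g ∈ Γ, (m : ℝ) * (1 + ‖g - η‖) ^ (-lam) := by
          refine Finset.sum_le_sum fun g _ => ?_
          have : ((Finset.univ.filter fun j => γ j = g).card : ℝ) ≤ m := by exact_mod_cast hcard g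
          exact mul_le_mul_of_nonneg_right this (by positivity)
      _ = m * ∑ g ∈ Γ, (1 + ‖g - η‖) ^ (-lam) := by rw [Finset.mul_sum]
      _ ≤ m * latticeSum d lam := by
          refine mul_le_mul_of_nonneg_left ?_ (Nat.cast_nonneg m)
          have hs := (Equiv.subRight η).summable_iff.2 (summable_one_add_norm_rpow hlam)
          refine (hs.sum_le_tsum Γ fun _ _ => by simp only [Function.comp]; positivity).trans_eq ?_
          exact (Equiv.subRight η).tsum_eq fun η => (1 + ‖η‖) ^ (-lam)
  calc ∑ j, C * ‖x - y j‖ ^ (-lam)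
      ≤ ∑ j, C * (((r : ℝ) / 4) ^ (-lam) * (1 + ‖γ j - η‖) ^ (-lam)) :=
        Finset.sum_le_sum fun j _ => hterm j
    _ = C * (((r : ℝ) / 4) ^ (-lam) * ∑ j, (1 + ‖γ j - η‖) ^ (-lam)) := by
        rw [Finset.mul_sum, Finset.mul_sum]
    _ ≤ C * (((r : ℝ) / 4) ^ (-lam) * (m * latticeSum d lam)) := by gcongr
    _ = _ := by rw [tailBound]; ring

/-! ### Trial spaces for particles in many separated cells -/

section Cells

variable {W : (n : ℕ) → (Fin n → Site 𝒢 d) → EReal} {R C lam B : ℝ} {v : Site 𝒢 d → ℝ}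
  {s : Statistics}

/-- The energy of particles in a set and in distant cells. -/
theorem HasTrialSpace.add_cells (hW : IsTempered W R C lam) (hWm : ∀ n, Measurable (W n))
    (hWs : ∀ (n : ℕ) x, ((-(n * B) : ℝ) : EReal) ≤ W n x) (hv : LocallyIntegrable v volume)
    (hd : 1 ≤ d) {L r : ℕ} (hr : 2 < r) (hrR : R ≤ r) {a b n m k₁ k₂ : ℕ} {e₁ e₂ : ℝ}
    (hab : a + b = n) (ha : 1 ≤ a) (hb : 1 ≤ b) (hk₁ : 1 ≤ k₁) (hk₂ : 1 ≤ k₂)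
    {Γ : Finset (Fin d → ℤ)} {D₁ : Set (Fin a → Site 𝒢 d)} {D : Set (Fin n → Site 𝒢 d)}
    (hsep : ∀ x ∈ D₁, ∀ i, ∀ γ ∈ Γ, ∀ y ∈ cellCube 𝒢 d L (L + r) γ, (r : ℝ) ≤ dist (x i) y)
    (h₁ : HasTrialSpace v (W a) s B D₁ k₁ e₁)
    (h₂ : HasTrialSpace v (W b) s B (occupation L (L + r) Γ m b) k₂ e₂)
    (hD : ∀ (I : Choice a n), ∀ x ∈ D₁, ∀ y ∈ occupation L (L + r) Γ m b,
      merge (I.equiv hab) x y ∈ D) :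
    HasTrialSpace v (W n) s B D (k₁ * k₂) (e₁ + e₂ + a * (m * tailBound d C lam r)) := by
  have hr' : (2 : ℝ) < r := by exact_mod_cast hr
  have hsep' : ∀ x ∈ D₁, ∀ y ∈ occupation L (L + r) Γ m b, ∀ i j, (r : ℝ) ≤ dist (x i) (y j) := by
    intro x hx y hy i j
    obtain ⟨γ, hγ, hyγ⟩ := hy.1 j
    exact hsep x hx i γ hγ _ hyγ
  have htn := tailBound_nonneg (d := d) hW.tail_nonneg lam r
  refine HasTrialSpace.combine hv hab (by positivity) hr' (hWm a) (hWm b) (hWm n) (hWs a) (hWs b)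
    hsep' (fun I x hx y hy => ?_) hD hk₁ hk₂ h₁ h₂
  refine (hW.split a b n hab ha hb I x y fun i j => hrR.trans (hsep' x hx y hy i j)).trans ?_
  gcongr
  calc ∑ i, ∑ j, C * ‖x i - y j‖ ^ (-lam) ≤ ∑ _i : Fin a, m * tailBound d C lam r :=
        Finset.sum_le_sum fun i _ => sum_tail_le hW.tail_nonneg hW.decay (by omega) hd (x i) hy
          fun j => (hsep' x hx y hy i j).trans_eq (dist_eq_norm _ _)
    _ = a * (m * tailBound d C lam r) := by simp

/-- Cells are added one at a time. The bound on the occupation is carried through the induction,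
since it is what controls the tail felt by the next cell. -/
theorem HasTrialSpace.cells (hW : IsTempered W R C lam) (hWm : ∀ n, Measurable (W n))
    (hWs : ∀ (n : ℕ) x, ((-(n * B) : ℝ) : EReal) ≤ W n x) (hv : LocallyIntegrable v volume)
    (hd : 1 ≤ d) {L r : ℕ} (hr : 2 < r) (hrR : R ≤ r) {m : ℕ}
    {Γ : Finset (Fin d → ℤ)} (hΓ : Γ.Nonempty) {N K : (Fin d → ℤ) → ℕ} {E : (Fin d → ℤ) → ℝ}
    (hN : ∀ γ ∈ Γ, 1 ≤ N γ ∧ N γ ≤ m) (hK : ∀ γ ∈ Γ, 1 ≤ K γ)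
    (h : ∀ γ ∈ Γ, HasTrialSpace v (W (N γ)) s B {x | ∀ i, x i ∈ cellCube 𝒢 d L (L + r) γ}
      (K γ) (E γ)) :
    HasTrialSpace v (W (∑ γ ∈ Γ, N γ)) s B (occupation L (L + r) Γ m (∑ γ ∈ Γ, N γ))
      (∏ γ ∈ Γ, K γ) (∑ γ ∈ Γ, E γ + (∑ γ ∈ Γ, N γ : ℕ) * (m * tailBound d C lam r)) := by
  have htn := tailBound_nonneg (d := d) hW.tail_nonneg lam r
  induction hΓ using Finset.Nonempty.cons_induction with
  | singleton γ =>
    simp only [Finset.sum_singleton, Finset.prod_singleton]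
    -- A single cell has no tail to pay for; the tail term is only nonnegative slack here.
    refine ((h γ (by simp)).mono_energy (by
      have : 0 ≤ (N γ : ℝ) * (m * tailBound d C lam r) := by positivity
      linarith)).mono_set fun x hx => ⟨fun i => ⟨γ, by simp, hx i⟩, fun g => ?_⟩
    refine le_trans (Set.ncard_le_ncard (Set.subset_univ _) Set.finite_univ) ?_
    rw [Set.ncard_univ, Nat.card_eq_fintype_card, Fintype.card_fin]
    exact (hN γ (by simp)).2
  | cons γ Γ hγ hne ih =>
    have ih' := ih (fun g hg => hN g (Finset.mem_cons_of_mem hg))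
      (fun g hg => hK g (Finset.mem_cons_of_mem hg)) fun g hg => h g (Finset.mem_cons_of_mem hg)
    have hneg : ∀ g ∈ Γ, γ ≠ g := fun g hg h => hγ (h ▸ hg)
    have hγm := Finset.mem_cons_self (h := hγ)
    obtain ⟨g0, hg0⟩ := hne
    have hb : 1 ≤ ∑ γ ∈ Γ, N γ := (hN g0 (Finset.mem_cons_of_mem hg0)).1.trans
      (Finset.single_le_sum (f := N) (fun _ _ => Nat.zero_le _) hg0)
    have hkp : 1 ≤ ∏ γ ∈ Γ, K γ := Nat.one_le_iff_ne_zero.2 (Finset.prod_ne_zero_iff.2 fun g hg =>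
      (Nat.one_le_iff_ne_zero.1 (hK g (Finset.mem_cons_of_mem hg))))
    rw [Finset.prod_cons]
    refine HasTrialSpace.mono_energy (e := E γ + (∑ γ ∈ Γ, E γ +
      (∑ γ ∈ Γ, N γ : ℕ) * (m * tailBound d C lam r)) + N γ * (m * tailBound d C lam r)) ?_ ?_
    -- The new cell is the first group, so only its `N γ` particles are charged, each with `m *
    -- tailBound`. After all cells every particle has been charged at most once.
    · refine HasTrialSpace.add_cells hW hWm hWs hv hd hr hrR (Finset.sum_cons hγ).symm (hN γ hγm).1
        hb (hK γ hγm) hkp (Γ := Γ) (m := m) ?_ (h γ hγm) ih' ?_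
      · intro x hx i g hg y hy
        exact dist_cellCube_ne (hneg g hg) (hx i) hy
      · intro I x hx y hy
        set e := I.equiv (Finset.sum_cons hγ).symm
        have hdisj : ∀ g ∈ Γ, Disjoint (cellCube 𝒢 d L (L + r) γ) (cellCube 𝒢 d L (L + r) g) := by
          intro g hg
          refine Set.disjoint_left.2 fun z h1 h2 => ?_
          have := dist_cellCube_ne (hneg g hg) h1 h2
          rw [dist_self] at this
          have : r = 0 := by exact_mod_cast le_antisymm this (Nat.cast_nonneg r)
          omega
        constructor
        · intro i
          obtain ⟨t, rfl⟩ := e.surjective i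
          cases t with
          | inl i => exact ⟨γ, hγm, by rw [merge_inl]; exact hx i⟩
          | inr j =>
            obtain ⟨g, hg, hyg⟩ := hy.1 j
            exact ⟨g, Finset.mem_cons_of_mem hg, by rw [merge_inr]; exact hyg⟩
        · intro g
          by_cases hgγ : g = γ
          · subst hgγ
            have hsub : {i | merge e x y i ∈ cellCube 𝒢 d L (L + r) g} ⊆
                Set.range fun i => e (Sum.inl i) := by
              intro i hi
              obtain ⟨t, rfl⟩ := e.surjective i
              cases t with
              | inl i => exact ⟨i, rfl⟩
              | inr j =>
                obtain ⟨g', hg', hyg⟩ := hy.1 j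
                have hi' : merge e x y (e (Sum.inr j)) ∈ cellCube 𝒢 d L (L + r) g := hi
                rw [merge_inr] at hi'
                exact absurd hyg (Set.disjoint_left.1 (hdisj g' hg') hi')
            refine (Set.ncard_le_ncard hsub (Set.toFinite _)).trans ?_
            rw [← Set.image_univ]
            refine (Set.ncard_image_le (Set.toFinite _)).trans ?_
            rw [Set.ncard_univ, Nat.card_eq_fintype_card, Fintype.card_fin]
            exact (hN g hγm).2
          · have hsub : {i | merge e x y i ∈ cellCube 𝒢 d L (L + r) g} ⊆
                (fun j => e (Sum.inr j)) '' {j | y j ∈ cellCube 𝒢 d L (L + r) g} := by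
              intro i hi
              obtain ⟨t, rfl⟩ := e.surjective i
              cases t with
              | inl i =>
                have hi' : merge e x y (e (Sum.inl i)) ∈ cellCube 𝒢 d L (L + r) g := hi
                rw [merge_inl] at hi'
                have := dist_cellCube_ne (Ne.symm hgγ) (hx i) hi'
                rw [dist_self] at this
                have : r = 0 := by exact_mod_cast le_antisymm this (Nat.cast_nonneg r)
                omega
              | inr j =>
                have hi' : merge e x y (e (Sum.inr j)) ∈ cellCube 𝒢 d L (L + r) g := hi
                rw [merge_inr] at hi'
                exact ⟨j, hi', rfl⟩
            exact ((Set.ncard_le_ncard hsub (Set.toFinite _)).trans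
              (Set.ncard_image_le (Set.toFinite _))).trans (hy.2 g)
    · rw [Finset.sum_cons, Finset.sum_cons]
      push_cast
      linarith

end Cells

/-! ### Translations -/

/-- All the forms are invariant under a translation of the whole configuration. With covariance of
the potential this trades a shift of the domain for a shift of `ω`. -/
theorem HasTrialSpace.translate {n k : ℕ} {v v' : Site 𝒢 d → ℝ}
    {w : (Fin n → Site 𝒢 d) → EReal} {s : Statistics} {B e : ℝ} {D : Set (Fin n → Site 𝒢 d)}
    (c : Site 𝒢 d) (hv : ∀ x, v' x = v (x + c)) (hw : ∀ x, w (fun i => x i + c) = w x)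
    (h : HasTrialSpace v' w s B D k e) :
    HasTrialSpace v w s B {x | (fun i => x i - c) ∈ D} k e := by
  obtain ⟨F, hF, H⟩ := h
  let τ : (Fin n → Site 𝒢 d) ≃ (Fin n → Site 𝒢 d) := Equiv.addRight (fun _ => -c)
  have hτ : ∀ x, τ x = fun i => x i - c := fun x => by
    funext i; exact (sub_eq_add_neg _ _).symm
  let T := LinearEquiv.funCongrLeft ℂ ℂ τ
  have hT : ∀ φ x, T φ x = φ (fun i => x i - c) := fun φ x => by
    rw [← hτ]; rfl
  refine ⟨F.map T.toLinearMap, (LinearEquiv.finrank_map_eq T F).trans hF, ?_⟩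
  rintro _ ⟨φ, hφ, rfl⟩
  obtain ⟨h1, h2, h3, h4⟩ := H φ hφ
  have hcomp : (T φ) = φ ∘ fun x => fun i => x i - c := funext fun x => hT φ x
  have hcont : Continuous fun (x : Fin n → Site 𝒢 d) => fun i => x i - c := by fun_prop
  have hmem : T φ ∈ testSubmodule {x : Fin n → Site 𝒢 d | (fun i => x i - c) ∈ D} := by
    rw [hcomp]
    refine ⟨?_, ?_, (tsupport_comp_subset_preimage φ hcont).trans fun x hx => h1.2.2 hx⟩
    · cases 𝒢
      · trivial
      · refine isSmooth_continuum_iff.2 ((isSmooth_continuum_iff.1 h1.1).comp ?_)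
        exact contDiff_pi.2 fun i => (contDiff_apply ℝ _ i).sub contDiff_const
    · exact h1.2.1.comp_homeomorph (Homeomorph.subRight (fun _ : Fin n => c))
  have hmp : MeasurePreserving (fun (x : Fin n → Site 𝒢 d) => fun i => x i - c) :=
    measurePreserving_sub_right volume (fun _ : Fin n => c)
  have hme : MeasurableEmbedding (fun (x : Fin n → Site 𝒢 d) => fun i => x i - c) :=
    (MeasurableEquiv.subRight (fun _ : Fin n => c)).measurableEmbedding
  have hD : ∀ i l x, deriv1 𝒢 d n i l (T φ) x = deriv1 𝒢 d n i l φ (fun i => x i - c) := by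
    intro i l x
    refine deriv1_eq_of_line hmem.1 h1.1 i i l _ _ fun u => ?_
    rw [hT]
    congr 1
    funext j
    simp only [Pi.add_apply]
    abel
  have hN : normSq (T φ) = normSq φ := by
    simp only [normSq, hT]
    exact hmp.integral_comp hme fun x => ‖φ x‖ ^ 2
  have hfree : freeForm v (T φ) = freeForm v' φ := by
    simp only [freeForm, gradSq_eq, hT, hD]
    congr 1
    · exact hmp.integral_comp hme fun x => ∑ i, ∑ l, ‖deriv1 𝒢 d n i l φ x‖ ^ 2
    · rw [← hmp.integral_comp hme fun x => (∑ i, v' (x i)) * ‖φ x‖ ^ 2]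
      simp only [hv, sub_add_cancel]
  have hsh : shiftedForm B w (T φ) = shiftedForm B w φ := by
    simp only [shiftedForm, hT]
    rw [← hmp.lintegral_comp_emb hme fun x => (w x + ((n * B : ℝ) : EReal)).toENNReal * ‖φ x‖ₑ ^ 2]
    congr 1
    funext x
    rw [← hw fun i => x i - c]
    simp only [sub_add_cancel]
  refine ⟨hmem, ?_, ?_, ?_⟩
  · change HasStatistics (T φ) s
    cases s with
    | boltzmann => trivial
    | bose => exact fun π x => by simp only [hT]; exact h2 π fun i => x i - c
    | fermi => exact fun π x => by simp only [hT]; exact h2 π fun i => x i - c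
  · change shiftedForm B w (T φ) ≠ ⊤
    rw [hsh]; exact h3
  · change freeForm v (T φ) + (shiftedForm B w (T φ)).toReal ≤ _ * normSq (T φ)
    rw [hsh, hfree, hN]; exact h4

end RandomGas

namespace RandomGas

variable {𝒢 : Medium} {d : ℕ}

/-! ### Positive definiteness on finite-dimensional spaces of test functions -/

theorem pos_of_pos_sphere {Y : Type*} [AddCommGroup Y] [Module ℂ Y] {k : ℕ} {q : Y → ℝ}
    (hq2 : ∀ (c : ℂ) y, q (c • y) = ‖c‖ ^ 2 * q y) (y : Fin k → Y)
    (h : ∀ c ∈ Metric.sphere (0 : Fin k → ℂ) 1, 0 < q (∑ i, c i • y i)) (c : Fin k → ℂ)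
    (hc : c ≠ 0) : 0 < q (∑ i, c i • y i) := by
  have hn : (0 : ℝ) < ‖c‖ := norm_pos_iff.2 hc
  have h1 := h (((‖c‖⁻¹ : ℝ) : ℂ) • c) (by
    rw [mem_sphere_zero_iff_norm, norm_smul, Complex.norm_real, norm_inv, norm_norm,
      inv_mul_cancel₀ hn.ne'])
  have h2 : ∑ i, (((‖c‖⁻¹ : ℝ) : ℂ) • c) i • y i = ((‖c‖⁻¹ : ℝ) : ℂ) • ∑ i, c i • y i := by
    simp only [Pi.smul_apply, smul_eq_mul, mul_smul, Finset.smul_sum]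
  rw [h2, hq2] at h1
  exact pos_of_mul_pos_right h1 (sq_nonneg _)

theorem nonneg_of_nonneg_sphere {Y : Type*} [AddCommGroup Y] [Module ℂ Y] {k : ℕ} {q : Y → ℝ}
    (hq2 : ∀ (c : ℂ) y, q (c • y) = ‖c‖ ^ 2 * q y) (y : Fin k → Y)
    (h : ∀ c ∈ Metric.sphere (0 : Fin k → ℂ) 1, 0 ≤ q (∑ i, c i • y i)) (c : Fin k → ℂ) :
    0 ≤ q (∑ i, c i • y i) := by
  by_cases hc : c = 0
  · have h0 : ∑ i, c i • y i = (0 : ℂ) • (0 : Y) := by simp [hc]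
    rw [h0, hq2]
    simp
  · have hn : (0 : ℝ) < ‖c‖ := norm_pos_iff.2 hc
    have h1 := h (((‖c‖⁻¹ : ℝ) : ℂ) • c) (by
      rw [mem_sphere_zero_iff_norm, norm_smul, Complex.norm_real, norm_inv, norm_norm,
        inv_mul_cancel₀ hn.ne'])
    have h2 : ∑ i, (((‖c‖⁻¹ : ℝ) : ℂ) • c) i • y i = ((‖c‖⁻¹ : ℝ) : ℂ) • ∑ i, c i • y i := by
      simp only [Pi.smul_apply, smul_eq_mul, mul_smul, Finset.smul_sum]
    rw [h2, hq2] at h1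
    refine nonneg_of_mul_nonneg_right h1 ?_
    rw [Complex.norm_real]
    exact pow_pos (norm_pos_iff.2 (inv_ne_zero hn.ne')) 2

/-- A nontrivial relation would give a nonzero coefficient vector at which the positive form
vanishes. -/
theorem linearIndependent_of_posDef {Y E : Type*} [AddCommGroup Y] [Module ℂ Y] [AddCommGroup E]
    [Module ℂ E] {k : ℕ} {q : Y → ℝ} (hq2 : ∀ (c : ℂ) y, q (c • y) = ‖c‖ ^ 2 * q y)
    (T : E →ₗ[ℂ] Y) (y : Fin k → E)
    (h : ∀ c ∈ Metric.sphere (0 : Fin k → ℂ) 1, 0 < q (∑ i, c i • T (y i))) :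
    LinearIndependent ℂ y := by
  rw [Fintype.linearIndependent_iff]
  intro c hc
  by_contra! hne
  have hc0 : c ≠ 0 := fun h0 => by
    obtain ⟨i, hi⟩ := hne
    exact hi (by rw [h0]; rfl)
  have h1 := pos_of_pos_sphere hq2 (fun i => T (y i)) h c hc0
  have h2 : ∑ i, c i • T (y i) = (0 : ℂ) • (0 : Y) := by
    simp only [← map_smul, ← map_sum, hc, map_zero, smul_zero]
  rw [h2, hq2] at h1
  simp at h1

section PosDef

variable {Y : Type*} [AddCommGroup Y] [Module ℂ Y] [TopologicalSpace Y] [ContinuousAdd Y]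
  [ContinuousSMul ℂ Y] {k : ℕ}

theorem continuous_sum_smul :
    Continuous fun p : (Fin k → ℂ) × (Fin k → Y) => ∑ i, p.1 i • p.2 i := by
  fun_prop

/-- Positivity has to be checked only on the compact unit sphere of coefficients, hence persists
under small changes of the tuple. -/
theorem isOpen_posDef {q : Y → ℝ} (hq : Continuous q) :
    IsOpen {y : Fin k → Y | ∀ c ∈ Metric.sphere (0 : Fin k → ℂ) 1, 0 < q (∑ i, c i • y i)} := by
  rw [isOpen_iff_mem_nhds]
  intro y hy
  have hc : Continuous fun p : (Fin k → Y) × (Fin k → ℂ) => q (∑ i, p.2 i • p.1 i) := by fun_prop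
  refine (isCompact_sphere (0 : Fin k → ℂ) 1).eventually_forall_of_forall_eventually
    fun c hcs => ?_
  exact hc.continuousAt.eventually (lt_mem_nhds (hy c hcs))

/-- A positive definite difference of quadratic forms stays nonnegative definite when a small
multiple of the subtracted form is added. -/
theorem exists_gap {Y : Type*} [AddCommGroup Y] [Module ℂ Y] [TopologicalSpace Y] [ContinuousAdd Y]
    [ContinuousSMul ℂ Y] {k : ℕ} (hk : 1 ≤ k) {q N : Y → ℝ} (hq : Continuous q) (hN : Continuous N)
    (hN0 : ∀ y, 0 ≤ N y) (hq2 : ∀ (c : ℂ) y, q (c • y) = ‖c‖ ^ 2 * q y)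
    (hN2 : ∀ (c : ℂ) y, N (c • y) = ‖c‖ ^ 2 * N y) (y : Fin k → Y)
    (h : ∀ c ∈ Metric.sphere (0 : Fin k → ℂ) 1, 0 < q (∑ i, c i • y i)) :
    ∃ ε > 0, ∀ c : Fin k → ℂ, ε * N (∑ i, c i • y i) ≤ q (∑ i, c i • y i) := by
  have hkne : Nonempty (Fin k) := ⟨⟨0, hk⟩⟩
  have hsne : (Metric.sphere (0 : Fin k → ℂ) 1).Nonempty :=
    NormedSpace.sphere_nonempty.2 zero_le_one
  have hcs : Continuous fun c : Fin k → ℂ => ∑ i, c i • y i := by fun_prop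
  obtain ⟨c₀, hc₀, hmin⟩ := (isCompact_sphere (0 : Fin k → ℂ) 1).exists_isMinOn hsne
    (hq.comp hcs).continuousOn
  obtain ⟨c₁, hc₁, hmax⟩ := (isCompact_sphere (0 : Fin k → ℂ) 1).exists_isMaxOn hsne
    (hN.comp hcs).continuousOn
  set ε := q (∑ i, c₀ i • y i) with hε
  set A := N (∑ i, c₁ i • y i) with hA
  have hε0 : 0 < ε := h c₀ hc₀
  have hA0 : 0 ≤ A := hN0 _
  refine ⟨ε / (A + 1), by positivity, fun c => ?_⟩
  have key := nonneg_of_nonneg_sphere (q := fun z => q z - ε / (A + 1) * N z)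
    (fun c z => by simp only [hq2, hN2]; ring) y (fun c hc => ?_) c
  · exact sub_nonneg.1 key
  · have h1 : ε ≤ q (∑ i, c i • y i) := hmin hc
    have h2 : N (∑ i, c i • y i) ≤ A := hmax hc
    have h4 : ε / (A + 1) * N (∑ i, c i • y i) ≤ ε := by
      calc _ ≤ ε / (A + 1) * A := by gcongr
        _ ≤ ε / (A + 1) * (A + 1) := by gcongr; linarith
        _ = ε := by field_simp
    linarith

theorem exists_gap_span {Y E : Type*} [AddCommGroup Y] [Module ℂ Y] [TopologicalSpace Y]
    [ContinuousAdd Y] [ContinuousSMul ℂ Y] [AddCommGroup E] [Module ℂ E] {k : ℕ} (hk : 1 ≤ k)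
    {q N : Y → ℝ} (hq : Continuous q) (hN : Continuous N) (hN0 : ∀ y, 0 ≤ N y)
    (hq2 : ∀ (c : ℂ) y, q (c • y) = ‖c‖ ^ 2 * q y) (hN2 : ∀ (c : ℂ) y, N (c • y) = ‖c‖ ^ 2 * N y)
    (T : E →ₗ[ℂ] Y) (y : Fin k → E)
    (h : ∀ c ∈ Metric.sphere (0 : Fin k → ℂ) 1, 0 < q (∑ i, c i • T (y i))) :
    ∃ ε > 0, ∀ ψ ∈ Submodule.span ℂ (Set.range y), ε * N (T ψ) ≤ q (T ψ) := by
  obtain ⟨ε, hε, hgap⟩ := exists_gap hk hq hN hN0 hq2 hN2 (fun i => T (y i)) h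
  refine ⟨ε, hε, fun ψ hψ => ?_⟩
  obtain ⟨c, rfl⟩ := (Submodule.mem_span_range_iff_exists_fun ℂ).1 hψ
  have := hgap c
  simpa only [← map_smul, ← map_sum] using this

/-- Among the tuples in a given set it suffices to consider those of a countable dense set. -/
theorem exists_countable_posDef [SecondCountableTopology Y] (A : Set (Fin k → Y)) :
    ∃ S : Set (Fin k → Y), S ⊆ A ∧ S.Countable ∧ ∀ q : Y → ℝ, Continuous q →
      (∃ y ∈ A, ∀ c ∈ Metric.sphere (0 : Fin k → ℂ) 1, 0 < q (∑ i, c i • y i)) →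
      ∃ y ∈ S, ∀ c ∈ Metric.sphere (0 : Fin k → ℂ) 1, 0 < q (∑ i, c i • y i) := by
  obtain ⟨S, hS, hd⟩ := TopologicalSpace.exists_countable_dense A
  refine ⟨Subtype.val '' S, ?_, hS.image _, ?_⟩
  · rintro _ ⟨y, -, rfl⟩; exact y.2
  · rintro q hq ⟨y, hyA, hy⟩
    obtain ⟨z, hz, hzS⟩ := hd.inter_open_nonempty _
      ((isOpen_posDef (k := k) hq).preimage continuous_subtype_val) ⟨⟨y, hyA⟩, hy⟩
    exact ⟨z, ⟨z, hzS, rfl⟩, hz⟩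

/-- By compactness positivity on the sphere holds with a margin `1 / (j + 1)`, and a closed
inequality can be tested on a countable dense set of coefficients. -/
theorem measurableSet_posDef {Ω : Type*} [MeasurableSpace Ω] {q : Ω → Y → ℝ}
    (hq : ∀ ω, Continuous (q ω)) (y : Fin k → Y)
    (hm : ∀ c : Fin k → ℂ, Measurable fun ω => q ω (∑ i, c i • y i)) :
    MeasurableSet {ω | ∀ c ∈ Metric.sphere (0 : Fin k → ℂ) 1, 0 < q ω (∑ i, c i • y i)} := by
  obtain ⟨S, hS, hd⟩ := TopologicalSpace.exists_countable_dense (Metric.sphere (0 : Fin k → ℂ) 1)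
  have hcomp : CompactSpace (Metric.sphere (0 : Fin k → ℂ) 1) :=
    isCompact_iff_compactSpace.1 (isCompact_sphere _ _)
  have : {ω | ∀ c ∈ Metric.sphere (0 : Fin k → ℂ) 1, 0 < q ω (∑ i, c i • y i)} =
      ⋃ j : ℕ, ⋂ c ∈ S, {ω | 1 / ((j : ℝ) + 1) ≤ q ω (∑ i, (c : Fin k → ℂ) i • y i)} := by
    ext ω
    have hcont : Continuous fun c : Metric.sphere (0 : Fin k → ℂ) 1 =>
        q ω (∑ i, (c : Fin k → ℂ) i • y i) := by
      exact (hq ω).comp (continuous_sum_smul.comp (by fun_prop : Continuous fun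
        c : Metric.sphere (0 : Fin k → ℂ) 1 => ((c : Fin k → ℂ), y)))
    simp only [Set.mem_ofPred_eq, Set.mem_iUnion, Set.mem_iInter]
    constructor
    · intro h
      obtain ⟨ε, hε, h'⟩ : ∃ ε > 0, ∀ c : Metric.sphere (0 : Fin k → ℂ) 1,
          ε ≤ q ω (∑ i, (c : Fin k → ℂ) i • y i) := by
        rcases isEmpty_or_nonempty (Metric.sphere (0 : Fin k → ℂ) 1) with he | hne
        · exact ⟨1, one_pos, fun c => he.elim c⟩
        · obtain ⟨c0, -, hc0⟩ := isCompact_univ.exists_isMinOn Set.univ_nonempty hcont.continuousOn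
          exact ⟨_, h c0 c0.2, fun c => hc0 (Set.mem_univ c)⟩
      obtain ⟨j, hj⟩ := exists_nat_one_div_lt hε
      exact ⟨j, fun c _ => hj.le.trans (h' c)⟩
    · rintro ⟨j, hj⟩ c hc
      have hcl : IsClosed {c : Metric.sphere (0 : Fin k → ℂ) 1 |
          1 / ((j : ℝ) + 1) ≤ q ω (∑ i, (c : Fin k → ℂ) i • y i)} :=
        isClosed_le continuous_const hcont
      have := hcl.closure_subset_iff.2 (fun c hc => hj c hc : S ⊆ _) (hd ⟨c, hc⟩)
      exact lt_of_lt_of_le (by positivity) this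
  rw [this]
  exact MeasurableSet.iUnion fun j => MeasurableSet.biInter hS fun c _ =>
    measurableSet_le measurable_const (hm c)

end PosDef

/-! ### Measurability of the eigenvalues -/

section Measurability

variable {n : ℕ}

/-- The test functions in `Λ` with finite interaction energy. -/
def trialSubmodule (w : (Fin n → Site 𝒢 d) → EReal) (s : Statistics) (B : ℝ)
    (D : Set (Fin n → Site 𝒢 d)) (hw : Measurable w) : Submodule ℂ ((Fin n → Site 𝒢 d) → ℂ) where
  carrier := {φ | φ ∈ testSubmodule D ∧ HasStatistics φ s ∧ shiftedForm B w φ ≠ ⊤}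
  add_mem' := by
    rintro φ ψ ⟨h1, h2, h3⟩ ⟨h4, h5, h6⟩
    refine ⟨Submodule.add_mem _ h1 h4, ?_, ?_⟩
    · cases s with
      | boltzmann => trivial
      | bose => exact fun π x => congr_arg₂ (· + ·) (h2 π x) (h5 π x)
      | fermi => exact fun π x => (congr_arg₂ (· + ·) (h2 π x) (h5 π x)).trans (mul_add _ _ _).symm
    · have hφ := (continuous_of_mem_test h1).measurable
      have hψ := (continuous_of_mem_test h4).measurable
      have : shiftedForm B w (φ + ψ) ≤ 2 * shiftedForm B w φ + 2 * shiftedForm B w ψ := by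
        simp only [shiftedForm]
        rw [← lintegral_const_mul _ (by fun_prop), ← lintegral_const_mul _ (by fun_prop),
          ← lintegral_add_left (by fun_prop)]
        refine lintegral_mono fun x => ?_
        have h : ‖φ x + ψ x‖ₑ ^ 2 ≤ 2 * ‖φ x‖ₑ ^ 2 + 2 * ‖ψ x‖ₑ ^ 2 := by
          simp only [← ofReal_norm, ← ENNReal.ofReal_pow (norm_nonneg _)]
          rw [← ENNReal.ofReal_ofNat 2, ← ENNReal.ofReal_mul (by norm_num),
            ← ENNReal.ofReal_mul (by norm_num), ← ENNReal.ofReal_add (by positivity) (by positivity)]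
          refine ENNReal.ofReal_le_ofReal ?_
          have := norm_add_le (φ x) (ψ x)
          nlinarith [sq_nonneg (‖φ x‖ - ‖ψ x‖), norm_nonneg (φ x + ψ x)]
        calc _ ≤ (w x + ((n * B : ℝ) : EReal)).toENNReal * (2 * ‖φ x‖ₑ ^ 2 + 2 * ‖ψ x‖ₑ ^ 2) := by
              gcongr; exact h
          _ = _ := by ring
      refine (this.trans_lt ?_).ne
      exact ENNReal.add_lt_top.2 ⟨ENNReal.mul_lt_top (by simp) h3.lt_top,
        ENNReal.mul_lt_top (by simp) h6.lt_top⟩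
  zero_mem' := by
    refine ⟨Submodule.zero_mem _, ?_, ?_⟩
    · cases s with
      | boltzmann => trivial
      | bose => exact fun π x => rfl
      | fermi => exact fun π x => (mul_zero _).symm
    · simp [shiftedForm]
  smul_mem' := by
    rintro c φ ⟨h1, h2, h3⟩
    refine ⟨Submodule.smul_mem _ _ h1, ?_, ?_⟩
    · cases s with
      | boltzmann => trivial
      | bose => exact fun π x => congr_arg (c * ·) (h2 π x)
      | fermi => exact fun π x => (congr_arg (c * ·) (h2 π x)).trans (mul_left_comm _ _ _)
    · have hφ := (continuous_of_mem_test h1).measurable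
      have : shiftedForm B w (c • φ) = ‖c‖ₑ ^ 2 * shiftedForm B w φ := by
        simp only [shiftedForm]
        rw [← lintegral_const_mul _ (by fun_prop)]
        congr 1
        funext x
        rw [Pi.smul_apply, smul_eq_mul, enorm_mul, mul_pow]
        ring
      rw [this]
      exact ENNReal.mul_ne_top (by simp) h3

theorem mem_testSubmodule_of_trial {w : (Fin n → Site 𝒢 d) → EReal} {s : Statistics} {B : ℝ}
    {D : Set (Fin n → Site 𝒢 d)} {hw : Measurable w} {φ : (Fin n → Site 𝒢 d) → ℂ}
    (h : φ ∈ trialSubmodule w s B D hw) : φ ∈ testSubmodule Set.univ :=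
  mem_testSubmodule_univ h.1

theorem normSq_pos {φ : (Fin n → Site 𝒢 d) → ℂ} (hφ : φ ∈ testSubmodule Set.univ) (h : φ ≠ 0) :
    0 < normSq φ := by
  obtain ⟨x, hx⟩ := Function.ne_iff.1 h
  have hc := continuous_of_mem_test hφ
  refine Continuous.integral_pos_of_hasCompactSupport_nonneg_nonzero (x := x) (by fun_prop) ?_
    (fun _ => sq_nonneg _) ?_
  · exact hφ.2.1.comp_left (g := fun z : ℂ => ‖z‖ ^ 2) (by simp)
  · simpa using hx

/-- In the compact-open topology the functions close to `f₀` are uniformly bounded on `K`, and `u`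
supplies an integrable majorant. Thus a merely locally integrable potential gives a continuous form
on continuous functions. -/
theorem continuous_setIntegral_normSq {X : Type*} [TopologicalSpace X] [SecondCountableTopology X]
    [LocallyCompactSpace X] [MeasurableSpace X] [BorelSpace X] {μ : Measure X} {K : Set X}
    (hK : IsCompact K) (hKm : MeasurableSet K) {u : X → ℝ} (hu : IntegrableOn u K μ) :
    Continuous fun f : C(X, ℂ) => ∫ x in K, u x * ‖f x‖ ^ 2 ∂μ := by
  refine continuous_iff_continuousAt.2 fun f₀ => ?_
  obtain ⟨R, hR⟩ := (hK.image f₀.continuous).isBounded.subset_ball 0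
  have hev : ∀ᶠ f : C(X, ℂ) in 𝓝 f₀, Set.MapsTo f K (Metric.ball 0 R) :=
    (ContinuousMap.isOpen_setOfPred_mapsTo hK Metric.isOpen_ball).mem_nhds
      fun x hx => hR ⟨x, hx, rfl⟩
  refine continuousAt_of_dominated (bound := fun x => ‖u x‖ * R ^ 2) ?_ ?_ ?_ ?_
  · exact Eventually.of_forall fun f => hu.aestronglyMeasurable.mul
      (by fun_prop : Continuous fun x => ‖f x‖ ^ 2).aestronglyMeasurable
  · filter_upwards [hev] with f hf
    filter_upwards [ae_restrict_mem hKm] with x hx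
    rw [norm_mul, norm_pow, norm_norm]
    have := mem_ball_zero_iff.1 (hf hx)
    gcongr
  · exact hu.norm.mul_const _
  · refine Eventually.of_forall fun x => ?_
    have : Continuous fun f : C(X, ℂ) => u x * ‖f x‖ ^ 2 := by
      have : Continuous fun f : C(X, ℂ) => f x := continuous_eval_const x
      fun_prop
    exact this.continuousAt

/-- The space in which test functions of finite interaction energy are embedded: the function, its
derivatives and the function weighted with the root of the interaction. -/
def FormSpace (𝒢 : Medium) (d n : ℕ) : Type :=
  C(Fin n → Site 𝒢 d, ℂ) × (Fin n → Fin d → C(Fin n → Site 𝒢 d, ℂ)) ×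
    Lp ℂ 2 (volume : Measure (Fin n → Site 𝒢 d))

noncomputable instance (n : ℕ) : AddCommGroup (FormSpace 𝒢 d n) :=
  inferInstanceAs (AddCommGroup (C(Fin n → Site 𝒢 d, ℂ) × (Fin n → Fin d →
    C(Fin n → Site 𝒢 d, ℂ)) × Lp ℂ 2 (volume : Measure (Fin n → Site 𝒢 d))))

noncomputable instance (n : ℕ) : Module ℂ (FormSpace 𝒢 d n) :=
  inferInstanceAs (Module ℂ (C(Fin n → Site 𝒢 d, ℂ) × (Fin n → Fin d →
    C(Fin n → Site 𝒢 d, ℂ)) × Lp ℂ 2 (volume : Measure (Fin n → Site 𝒢 d))))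

noncomputable instance (n : ℕ) : TopologicalSpace (FormSpace 𝒢 d n) :=
  inferInstanceAs (TopologicalSpace (C(Fin n → Site 𝒢 d, ℂ) × (Fin n → Fin d →
    C(Fin n → Site 𝒢 d, ℂ)) × Lp ℂ 2 (volume : Measure (Fin n → Site 𝒢 d))))

instance (n : ℕ) : ContinuousAdd (FormSpace 𝒢 d n) :=
  inferInstanceAs (ContinuousAdd (C(Fin n → Site 𝒢 d, ℂ) × (Fin n → Fin d →
    C(Fin n → Site 𝒢 d, ℂ)) × Lp ℂ 2 (volume : Measure (Fin n → Site 𝒢 d))))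

instance (n : ℕ) : ContinuousSMul ℂ (FormSpace 𝒢 d n) :=
  inferInstanceAs (ContinuousSMul ℂ (C(Fin n → Site 𝒢 d, ℂ) × (Fin n → Fin d →
    C(Fin n → Site 𝒢 d, ℂ)) × Lp ℂ 2 (volume : Measure (Fin n → Site 𝒢 d))))

instance (n : ℕ) : SecondCountableTopology (FormSpace 𝒢 d n) :=
  have : Fact ((2 : ℝ≥0∞) ≠ ⊤) := ⟨ENNReal.ofNat_ne_top⟩
  inferInstanceAs (SecondCountableTopology (C(Fin n → Site 𝒢 d, ℂ) × (Fin n → Fin d →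
    C(Fin n → Site 𝒢 d, ℂ)) × Lp ℂ 2 (volume : Measure (Fin n → Site 𝒢 d))))

variable {w : (Fin n → Site 𝒢 d) → EReal} {s : Statistics} {B : ℝ} {D : Set (Fin n → Site 𝒢 d)}

/-- The root of the shifted interaction. -/
noncomputable def rootWeight (B : ℝ) (w : (Fin n → Site 𝒢 d) → EReal) (x : Fin n → Site 𝒢 d) : ℝ :=
  √((w x + ((n * B : ℝ) : EReal)).toENNReal.toReal)

/-- Passing to real values loses the value `∞` of the interaction, but a function of finite energy
vanishes almost everywhere on that set. -/
theorem enorm_rootWeight_mul (hw : Measurable w) {φ : (Fin n → Site 𝒢 d) → ℂ}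
    (hφ : φ ∈ testSubmodule Set.univ) (h : shiftedForm B w φ ≠ ⊤) :
    ∀ᵐ x, ‖(rootWeight B w x : ℂ) * φ x‖ₑ ^ 2 =
      (w x + ((n * B : ℝ) : EReal)).toENNReal * ‖φ x‖ₑ ^ 2 := by
  have hm := (continuous_of_mem_test hφ).measurable
  filter_upwards [ae_lt_top (by fun_prop) h] with x hx
  by_cases h0 : φ x = 0
  · simp [h0]
  · have hfin : (w x + ((n * B : ℝ) : EReal)).toENNReal ≠ ⊤ := by
      intro htop
      rw [htop, ENNReal.top_mul (by simpa using h0)] at hx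
      exact lt_irrefl _ hx
    rw [enorm_mul, mul_pow]
    congr 1
    rw [rootWeight, ← ofReal_norm, Complex.norm_real, Real.norm_of_nonneg (Real.sqrt_nonneg _),
      ← ENNReal.ofReal_pow (Real.sqrt_nonneg _), Real.sq_sqrt ENNReal.toReal_nonneg,
      ENNReal.ofReal_toReal hfin]

theorem measurable_rootWeight (hw : Measurable w) : Measurable (rootWeight B w) := by
  unfold rootWeight
  fun_prop

theorem lintegral_rootWeight (hw : Measurable w) {φ : (Fin n → Site 𝒢 d) → ℂ}
    (hφ : φ ∈ testSubmodule Set.univ) (h : shiftedForm B w φ ≠ ⊤) :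
    ∫⁻ x, ‖(rootWeight B w x : ℂ) * φ x‖ₑ ^ 2 = shiftedForm B w φ :=
  lintegral_congr_ae (enorm_rootWeight_mul hw hφ h)

theorem memLp_rootWeight (hw : Measurable w) {φ : (Fin n → Site 𝒢 d) → ℂ}
    (hφ : φ ∈ testSubmodule Set.univ) (h : shiftedForm B w φ ≠ ⊤) :
    MemLp (fun x => (rootWeight B w x : ℂ) * φ x) 2 volume := by
  have hm := (continuous_of_mem_test hφ).measurable
  have hr := measurable_rootWeight (B := B) hw
  refine ⟨(by fun_prop : Measurable _).aestronglyMeasurable, ?_⟩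
  rw [eLpNorm_lt_top_iff_lintegral_rpow_enorm_lt_top two_ne_zero ENNReal.ofNat_ne_top]
  have := lintegral_rootWeight hw hφ h
  simp only [ENNReal.toReal_ofNat, ENNReal.rpow_ofNat]
  rw [this]
  exact h.lt_top

/-- The embedding of the test functions. -/
noncomputable def formEmbedding (w : (Fin n → Site 𝒢 d) → EReal) (s : Statistics) (B : ℝ)
    (D : Set (Fin n → Site 𝒢 d)) (hw : Measurable w) :
    trialSubmodule w s B D hw →ₗ[ℂ] FormSpace 𝒢 d n where
  toFun φ := (⟨φ, continuous_of_mem_test φ.2.1⟩,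
    fun i l => ⟨deriv1 𝒢 d n i l φ, continuous_deriv1 φ.2.1 i l⟩,
    (memLp_rootWeight (B := B) hw (mem_testSubmodule_of_trial φ.2) φ.2.2.2).toLp _)
  map_add' φ ψ := by
    refine Prod.ext (ContinuousMap.ext fun x => rfl) (Prod.ext ?_ ?_)
    · funext i l
      exact ContinuousMap.ext fun x => congr_fun (deriv1_add φ.2.1 ψ.2.1 i l) x
    · exact (MemLp.toLp_congr (memLp_rootWeight (B := B) hw
        (mem_testSubmodule_of_trial (φ + ψ).2) (φ + ψ).2.2.2) _
        (ae_of_all _ fun x => mul_add _ _ _)).trans (MemLp.toLp_add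
        (memLp_rootWeight (B := B) hw (mem_testSubmodule_of_trial φ.2) φ.2.2.2)
        (memLp_rootWeight (B := B) hw (mem_testSubmodule_of_trial ψ.2) ψ.2.2.2))
  map_smul' c φ := by
    refine Prod.ext (ContinuousMap.ext fun x => rfl) (Prod.ext ?_ ?_)
    · funext i l
      exact ContinuousMap.ext fun x => congr_fun (deriv1_smul φ.2.1 c i l) x
    · exact (MemLp.toLp_congr (memLp_rootWeight (B := B) hw
        (mem_testSubmodule_of_trial (c • φ).2) (c • φ).2.2.2) _
        (ae_of_all _ fun x => mul_left_comm _ _ _)).trans (MemLp.toLp_const_smul c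
        (memLp_rootWeight (B := B) hw (mem_testSubmodule_of_trial φ.2) φ.2.2.2))

/-- The form `(e + n B) ‖φ‖² - ⟨φ, (H + n B) φ⟩` on the space `FormSpace`. -/
noncomputable def gapForm (K : Set (Fin n → Site 𝒢 d)) (v : Site 𝒢 d → ℝ) (e : ℝ)
    (y : FormSpace 𝒢 d n) : ℝ :=
  e * (∫ x in K, 1 * ‖y.1 x‖ ^ 2) - (∑ i, ∑ l, ∫ x in K, 1 * ‖y.2.1 i l x‖ ^ 2) -
    (∫ x in K, (∑ i, v (x i)) * ‖y.1 x‖ ^ 2) - ‖y.2.2‖ ^ 2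

theorem continuous_gapForm {K : Set (Fin n → Site 𝒢 d)} (hK : IsCompact K)
    {v : Site 𝒢 d → ℝ} (hv : LocallyIntegrable v volume) (e : ℝ) :
    Continuous (gapForm (n := n) K v e) := by
  have hKm := hK.measurableSet
  have h1 := continuous_setIntegral_normSq (μ := volume) hK hKm (u := fun _ => (1 : ℝ))
    (integrableOn_const hK.measure_lt_top.ne)
  have h2 := continuous_setIntegral_normSq (μ := volume) hK hKm
    (u := fun x : Fin n → Site 𝒢 d => ∑ i, v (x i)) (integrable_finsetSum _ fun i _ =>
      (locallyIntegrable_comp_eval hv i).integrableOn_isCompact hK)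
  unfold gapForm
  have h3 : Continuous fun y : FormSpace 𝒢 d n => y.1 := continuous_fst
  have h4 : Continuous fun y : FormSpace 𝒢 d n => y.2.2 := continuous_snd.comp continuous_snd
  have h5 : Continuous fun y : FormSpace 𝒢 d n => y.2.1 := continuous_fst.comp continuous_snd
  refine (((continuous_const.mul (h1.comp h3)).sub ?_).sub (h2.comp h3)).sub (h4.norm.pow 2)
  exact continuous_finsetSum _ fun i _ => continuous_finsetSum _ fun l _ =>
    h1.comp ((continuous_apply_apply i l).comp h5)

theorem gapForm_smul (K : Set (Fin n → Site 𝒢 d)) (v : Site 𝒢 d → ℝ) (e : ℝ) (c : ℂ)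
    (y : FormSpace 𝒢 d n) : gapForm K v e (c • y) = ‖c‖ ^ 2 * gapForm K v e y := by
  have h : ∀ (u : (Fin n → Site 𝒢 d) → ℝ) (f : C(Fin n → Site 𝒢 d, ℂ)),
      ∫ x in K, u x * ‖(c • f) x‖ ^ 2 = ‖c‖ ^ 2 * ∫ x in K, u x * ‖f x‖ ^ 2 := fun u f => by
    rw [← integral_const_mul]
    congr 1
    funext x
    rw [ContinuousMap.smul_apply, norm_smul, mul_pow]
    ring
  have h1 : (c • y).1 = c • y.1 := rfl
  have h2 : (c • y).2.1 = c • y.2.1 := rfl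
  have h3 : (c • y).2.2 = c • y.2.2 := rfl
  simp only [gapForm, h1, h2, h3, Pi.smul_apply, h, norm_smul, mul_pow, ← Finset.mul_sum]
  ring

/-- The norm of the function component of an element of `FormSpace`, on `K`. -/
noncomputable def localNormSq (K : Set (Fin n → Site 𝒢 d)) (y : FormSpace 𝒢 d n) : ℝ :=
  ∫ x in K, 1 * ‖y.1 x‖ ^ 2

theorem continuous_localNormSq {K : Set (Fin n → Site 𝒢 d)} (hK : IsCompact K) :
    Continuous (localNormSq K) :=
  (continuous_setIntegral_normSq hK hK.measurableSet
    (integrableOn_const hK.measure_lt_top.ne)).comp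
    (continuous_fst : Continuous fun y : FormSpace 𝒢 d n => y.1)

theorem localNormSq_smul (K : Set (Fin n → Site 𝒢 d)) (c : ℂ) (y : FormSpace 𝒢 d n) :
    localNormSq K (c • y) = ‖c‖ ^ 2 * localNormSq K y := by
  rw [localNormSq, localNormSq, ← integral_const_mul]
  congr 1
  funext x
  have h1 : (c • y).1 = c • y.1 := rfl
  rw [h1, ContinuousMap.smul_apply, norm_smul, mul_pow]
  ring

theorem gapForm_sub (K : Set (Fin n → Site 𝒢 d)) (v : Site 𝒢 d → ℝ) (e ε e₀ : ℝ)
    (y : FormSpace 𝒢 d n) :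
    gapForm K v (e - ε + e₀) y = gapForm K v (e + e₀) y - ε * localNormSq K y := by
  simp only [gapForm, localNormSq]
  ring

/-- The radius `R + 1` leaves room for forward differences just outside the support. -/
theorem gapForm_formEmbedding (hw : Measurable w) {v : Site 𝒢 d → ℝ}
    {R : ℝ} (hD : D ⊆ Metric.closedBall 0 R) (e : ℝ) (φ : trialSubmodule w s B D hw) :
    gapForm (Metric.closedBall 0 (R + 1)) v e (formEmbedding w s B D hw φ) =
      e * normSq (φ : (Fin n → Site 𝒢 d) → ℂ) -
        (freeForm v (φ : (Fin n → Site 𝒢 d) → ℂ) + (shiftedForm B w φ).toReal) := by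
  have ht := φ.2.1
  have hsup : ∀ x, x ∉ Metric.closedBall (0 : Fin n → Site 𝒢 d) (R + 1) →
      (φ : (Fin n → Site 𝒢 d) → ℂ) x = 0 := fun x hx => by
    by_contra h
    exact hx (Metric.closedBall_subset_closedBall (by linarith) (hD (ht.2.2 (subset_tsupport _ h))))
  have hsupD : ∀ i l x, x ∉ Metric.closedBall (0 : Fin n → Site 𝒢 d) (R + 1) →
      deriv1 𝒢 d n i l φ x = 0 := fun i l x hx => by
    by_contra h
    obtain ⟨z, hz, hzx⟩ := exists_mem_tsupport_of_deriv1_ne h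
    have h1 := hD (ht.2.2 hz)
    have h2 : dist x z ≤ 1 := (dist_pi_le_iff zero_le_one).2 hzx
    rw [Metric.mem_closedBall] at h1 hx
    exact hx ((dist_triangle x z 0).trans (by linarith))
  have e1 : ∫ x in Metric.closedBall 0 (R + 1), 1 * ‖(formEmbedding w s B D hw φ).1 x‖ ^ 2 =
      normSq (φ : (Fin n → Site 𝒢 d) → ℂ) := by
    rw [setIntegral_eq_integral_of_forall_compl_eq_zero]
    · simp only [one_mul]; rfl
    · intro x hx
      change 1 * ‖(φ : (Fin n → Site 𝒢 d) → ℂ) x‖ ^ 2 = 0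
      rw [hsup x hx]; simp
  have e2 : ∑ i, ∑ l, ∫ x in Metric.closedBall 0 (R + 1),
      1 * ‖(formEmbedding w s B D hw φ).2.1 i l x‖ ^ 2 = ∫ x, gradSq 𝒢 d n φ x := by
    simp only [gradSq_eq]
    rw [integral_finsetSum _ fun i _ => integrable_finsetSum _ fun l _ =>
      integrable_normSq_of_hasCompactSupport (continuous_deriv1 ht i l)
        (hasCompactSupport_deriv1 ht i l)]
    refine Finset.sum_congr rfl fun i _ => ?_
    rw [integral_finsetSum _ fun l _ =>
      integrable_normSq_of_hasCompactSupport (continuous_deriv1 ht i l)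
        (hasCompactSupport_deriv1 ht i l)]
    refine Finset.sum_congr rfl fun l _ => ?_
    rw [setIntegral_eq_integral_of_forall_compl_eq_zero]
    · simp only [one_mul]; rfl
    · intro x hx
      change 1 * ‖deriv1 𝒢 d n i l φ x‖ ^ 2 = 0
      rw [hsupD i l x hx]; simp
  have e3 : ∫ x in Metric.closedBall 0 (R + 1),
      (∑ i, v (x i)) * ‖(formEmbedding w s B D hw φ).1 x‖ ^ 2 =
      ∫ x, (∑ i, v (x i)) * ‖(φ : (Fin n → Site 𝒢 d) → ℂ) x‖ ^ 2 := by
    rw [setIntegral_eq_integral_of_forall_compl_eq_zero]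
    · rfl
    · intro x hx
      change (∑ i, v (x i)) * ‖(φ : (Fin n → Site 𝒢 d) → ℂ) x‖ ^ 2 = 0
      rw [hsup x hx]; simp
  have e4 : ‖(formEmbedding w s B D hw φ).2.2‖ ^ 2 = (shiftedForm B w φ).toReal := by
    change ‖(memLp_rootWeight (B := B) hw (mem_testSubmodule_of_trial φ.2) φ.2.2.2).toLp _‖ ^ 2 = _
    rw [Lp.norm_toLp, eLpNorm_eq_lintegral_rpow_enorm_toReal two_ne_zero ENNReal.ofNat_ne_top]
    simp only [ENNReal.toReal_ofNat, ENNReal.rpow_ofNat]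
    rw [lintegral_rootWeight hw (mem_testSubmodule_of_trial φ.2) φ.2.2.2, ← ENNReal.toReal_pow,
      ← ENNReal.rpow_natCast, ← ENNReal.rpow_mul]
    norm_num
  rw [gapForm, e1, e2, e3, e4, freeForm]
  ring

theorem sum_smul_formEmbedding (hw : Measurable w) {k : ℕ}
    (φ : Fin k → trialSubmodule w s B D hw) (c : Fin k → ℂ) :
    ∑ i, c i • formEmbedding w s B D hw (φ i) = formEmbedding w s B D hw (∑ i, c i • φ i) := by
  rw [map_sum]; simp only [map_smul]

/-- The strict inequality `e' < e` turns a nonpositive form into a definite one. With the converse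
below, an eigenvalue is less than `e` if and only if some tuple makes `gapForm` positive definite,
which is an open condition. -/
theorem HasTrialSpace.exists_gapForm_pos (hw : Measurable w) {v : Site 𝒢 d → ℝ}
    {R : ℝ} (hD : D ⊆ Metric.closedBall 0 R) {e e' : ℝ} {k : ℕ} (hk : 1 ≤ k) (he : e' < e)
    (h : HasTrialSpace v w s B D k e') :
    ∃ φ : Fin k → trialSubmodule w s B D hw, ∀ c ∈ Metric.sphere (0 : Fin k → ℂ) 1,
      0 < gapForm (Metric.closedBall 0 (R + 1)) v (e + n * B)
        (∑ i, c i • formEmbedding w s B D hw (φ i)) := by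
  obtain ⟨F, hF, H⟩ := h
  have : FiniteDimensional ℂ F := Module.finite_of_finrank_pos (by omega)
  let b := Module.finBasisOfFinrankEq ℂ F hF
  have hb : ∀ i, (b i : (Fin n → Site 𝒢 d) → ℂ) ∈ trialSubmodule w s B D hw := fun i =>
    ⟨(H _ (b i).2).1, (H _ (b i).2).2.1, (H _ (b i).2).2.2.1⟩
  refine ⟨fun i => ⟨b i, hb i⟩, fun c hc => ?_⟩
  rw [sum_smul_formEmbedding, gapForm_formEmbedding hw hD]
  have hcoe : ((∑ i, c i • (⟨b i, hb i⟩ : trialSubmodule w s B D hw) :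
      trialSubmodule w s B D hw) : (Fin n → Site 𝒢 d) → ℂ) =
      ((∑ i, c i • b i : F) : (Fin n → Site 𝒢 d) → ℂ) := by
    simp
  rw [hcoe]
  have hc0 : c ≠ 0 := by
    rintro rfl
    simp at hc
  have hne : (∑ i, c i • b i : F) ≠ 0 := fun h0 => hc0 (funext fun i =>
    Fintype.linearIndependent_iff.1 b.linearIndependent c h0 i)
  obtain ⟨h1, -, -, h4⟩ := H _ (∑ i, c i • b i : F).2
  have hpos := normSq_pos (mem_testSubmodule_univ h1) (fun h0 => hne (Subtype.ext h0))
  nlinarith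

/-- Positivity on the compact sphere leaves a margin `ε`, by which the energy can be lowered. -/
theorem exists_hasTrialSpace_of_gapForm_pos (hw : Measurable w) {v : Site 𝒢 d → ℝ}
    (hv : LocallyIntegrable v volume) {R : ℝ} (hD : D ⊆ Metric.closedBall 0 R) (e : ℝ) {k : ℕ}
    (hk : 1 ≤ k) (φ : Fin k → trialSubmodule w s B D hw)
    (hφ : ∀ c ∈ Metric.sphere (0 : Fin k → ℂ) 1,
      0 < gapForm (Metric.closedBall 0 (R + 1)) v (e + n * B)
        (∑ i, c i • formEmbedding w s B D hw (φ i))) :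
    ∃ e' < e, HasTrialSpace v w s B D k e' := by
  have hK : IsCompact (Metric.closedBall (0 : Fin n → Site 𝒢 d) (R + 1)) := isCompact_closedBall _ _
  have hli : LinearIndependent ℂ φ := linearIndependent_of_posDef
    (q := gapForm (Metric.closedBall 0 (R + 1)) v (e + n * B))
    (fun c y => gapForm_smul _ v _ c y) (formEmbedding w s B D hw) φ hφ
  obtain ⟨ε, hε, hgap⟩ := exists_gap_span hk (continuous_gapForm hK hv (e + n * B))
    (continuous_localNormSq hK) (fun y => integral_nonneg fun x => by positivity)
    (fun c y => gapForm_smul _ v _ c y) (localNormSq_smul _) (formEmbedding w s B D hw) φ hφ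
  refine ⟨e - ε, by linarith, (Submodule.span ℂ (Set.range φ)).map
    (trialSubmodule w s B D hw).subtype, ?_, ?_⟩
  · rw [Submodule.finrank_map_subtype_eq, finrank_span_eq_card hli, Fintype.card_fin]
  · rintro _ ⟨ψ, hψ, rfl⟩
    refine ⟨ψ.2.1, ψ.2.2.1, ψ.2.2.2, ?_⟩
    have h5 := hgap ψ hψ
    rw [← sub_nonneg, ← gapForm_sub, gapForm_formEmbedding hw hD] at h5
    rw [Submodule.subtype_apply]
    linarith

/-- The eigenvalues are measurable functions of the integrals of the potential. -/
theorem measurable_eigenvalue {Ω : Type*} [MeasurableSpace Ω] (M : Model 𝒢 d Ω) {B : ℝ}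
    (hB : 0 ≤ B) {n : ℕ} (hw : Measurable (M.interaction n))
    (hst : ∀ x, ((-(n * B) : ℝ) : EReal) ≤ M.interaction n x)
    (hv : ∀ ω, LocallyIntegrable (M.potential ω) volume) {Λ : Set (Site 𝒢 d)}
    (hΛ : Bornology.IsBounded Λ) {k : ℕ} (hk : 1 ≤ k)
    (H : ∀ φ ∈ testSubmodule {x : Fin n → Site 𝒢 d | ∀ i, x i ∈ Λ},
      Measurable fun ω => ∫ x, (∑ i, M.potential ω (x i)) * ‖φ x‖ ^ 2) :
    Measurable fun ω => M.eigenvalue Λ n k ω := by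
  obtain ⟨R, hR0, hR⟩ := hΛ.subset_closedBall_lt 0 0
  have hD : {x : Fin n → Site 𝒢 d | ∀ i, x i ∈ Λ} ⊆ Metric.closedBall 0 R := fun x hx => by
    rw [mem_closedBall_zero_iff, pi_norm_le_iff_of_nonneg hR0.le]
    exact fun i => mem_closedBall_zero_iff.1 (hR (hx i))
  have hK : IsCompact (Metric.closedBall (0 : Fin n → Site 𝒢 d) (R + 1)) := isCompact_closedBall _ _
  set D := {x : Fin n → Site 𝒢 d | ∀ i, x i ∈ Λ} with hDdef
  let T := formEmbedding (M.interaction n) M.statistics B D hw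
  -- The countable set of tuples is chosen once for all `ω` and all energies, so that the event
  -- below is a countable union.
  obtain ⟨S, hSA, hSc, hS⟩ := exists_countable_posDef
    {y : Fin k → FormSpace 𝒢 d n | ∃ φ : Fin k → trialSubmodule (M.interaction n) M.statistics B D hw,
      y = fun i => T (φ i)}
  have key : ∀ q : ℝ, MeasurableSet {ω | M.eigenvalue Λ n k ω < (q : EReal)} := by
    intro q
    have : {ω | M.eigenvalue Λ n k ω < (q : EReal)} = ⋃ y ∈ S, {ω | ∀ c ∈ Metric.sphere
        (0 : Fin k → ℂ) 1, 0 < gapForm (Metric.closedBall 0 (R + 1)) (M.potential ω) (q + n * B)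
          (∑ i, c i • y i)} := by
      ext ω
      simp only [Set.mem_ofPred_eq, Set.mem_iUnion, exists_prop]
      rw [eigenvalue_eq_iInf M hB hw hst]
      constructor
      · intro h
        obtain ⟨e, he⟩ := iInf_lt_iff.1 h
        obtain ⟨he1, he2⟩ := iInf_lt_iff.1 he
        obtain ⟨φ, hφ⟩ := he1.exists_gapForm_pos hw hD hk (EReal.coe_lt_coe_iff.1 he2)
        exact hS _ (continuous_gapForm hK (hv ω) _) ⟨_, ⟨φ, rfl⟩, hφ⟩
      · rintro ⟨y, hy, h⟩
        obtain ⟨φ, rfl⟩ := hSA hy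
        obtain ⟨e', he', ht⟩ := exists_hasTrialSpace_of_gapForm_pos hw (hv ω) hD q hk φ h
        exact (iInf₂_le e' ht).trans_lt (EReal.coe_lt_coe_iff.2 he')
    rw [this]
    refine MeasurableSet.biUnion hSc fun y hy => ?_
    obtain ⟨φ, rfl⟩ := hSA hy
    refine measurableSet_posDef (fun ω => continuous_gapForm hK (hv ω) _) _ fun c => ?_
    simp only [T, sum_smul_formEmbedding, gapForm_formEmbedding hw hD, freeForm]
    have := H _ (∑ i, c i • φ i : trialSubmodule (M.interaction n) M.statistics B D hw).2.1
    fun_prop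
  refine measurable_of_Iio fun a => ?_
  have : (fun ω => M.eigenvalue Λ n k ω) ⁻¹' Set.Iio a =
      ⋃ q : {q : ℚ // ((q : ℝ) : EReal) ≤ a}, {ω | M.eigenvalue Λ n k ω < (((q : ℚ) : ℝ) : EReal)} := by
    ext ω
    simp only [Set.mem_preimage, Set.mem_Iio, Set.mem_iUnion, Set.mem_ofPred_eq]
    constructor
    · intro h
      obtain ⟨q, h1, h2⟩ := EReal.lt_iff_exists_rat_btwn.1 h
      exact ⟨⟨q, h2.le⟩, h1⟩
    · rintro ⟨q, hq⟩
      exact hq.trans_le q.2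
  rw [this]
  exact MeasurableSet.iUnion fun q => key _

end Measurability

end RandomGas

namespace RandomGas

variable {𝒢 : Medium} {d : ℕ}

/-! ### Independence of the eigenvalues of distant domains -/

/-- An integral is almost surely a limit of averages at fixed points, by the strong law of large
numbers. -/
theorem exists_tendsto_average {Ω X : Type*} [MeasurableSpace Ω] [MeasurableSpace X]
    (P : Measure Ω) [IsProbabilityMeasure P] (ν : Measure X) [IsProbabilityMeasure ν]
    {f : Ω → X → ℝ} (hf : Measurable (Function.uncurry f)) (hi : ∀ ω, Integrable (f ω) ν) :
    ∃ y : ℕ → X, ∀ᵐ ω ∂P, Tendsto (fun N : ℕ => (∑ i ∈ Finset.range N, f ω (y i)) / N) atTop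
      (𝓝 (∫ x, f ω x ∂ν)) := by
  let μ : Measure (ℕ → X) := Measure.infinitePi fun _ => ν
  -- For fixed `ω` this is the strong law for independent sample points with law `ν`.
  have h1 : ∀ ω, ∀ᵐ y ∂μ, Tendsto (fun N : ℕ => (∑ i ∈ Finset.range N, f ω (y i)) / N) atTop
      (𝓝 (∫ x, f ω x ∂ν)) := by
    intro ω
    have hfω : Measurable (f ω) := hf.comp measurable_prodMk_left
    have hmp : ∀ i, MeasurePreserving (Function.eval i) μ ν :=
      fun i => measurePreserving_eval_infinitePi _ i
    have h2 : Integrable (fun y : ℕ → X => f ω (y 0)) μ := (hmp 0).integrable_comp_of_integrable (hi ω)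
    have h3 := strong_law_ae_real (μ := μ) (fun i y => f ω (y i)) h2
      (fun i j hij => (iIndepFun_infinitePi (P := fun _ : ℕ => ν) (X := fun _ => f ω)
        (fun _ => hfω)).indepFun hij) (fun i => ?_)
    · have h4 : ∫ y, f ω (y 0) ∂μ = ∫ x, f ω x ∂ν :=
        by
        rw [← (hmp 0).map_eq, integral_map (hmp 0).measurable.aemeasurable
          hfω.aestronglyMeasurable]
      rw [h4] at h3
      exact h3
    · refine ⟨(hfω.comp (measurable_pi_apply i)).aemeasurable,
        (hfω.comp (measurable_pi_apply 0)).aemeasurable, ?_⟩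
      have := fun i => (Measure.map_map hfω (measurable_pi_apply i) (μ := μ)).symm.trans
        (congr_arg _ (hmp i).map_eq)
      exact (this i).trans (this 0).symm
  have hF : Measurable fun ω => ∫ x, f ω x ∂ν :=
    (hf.stronglyMeasurable.integral_prod_right (ν := ν)).measurable
  have hmeas : MeasurableSet {p : Ω × (ℕ → X) | Tendsto
      (fun N : ℕ => (∑ i ∈ Finset.range N, f p.1 (p.2 i)) / N) atTop (𝓝 (∫ x, f p.1 x ∂ν))} := by
    refine measurableSet_tendsto_fun (fun N => ?_) (hF.comp measurable_fst)
    refine Measurable.div_const (Finset.measurable_sum _ fun i _ => ?_) _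
    exact hf.comp (measurable_fst.prodMk (g := fun p : Ω × (ℕ → X) => p.2 i)
      ((measurable_pi_apply i).comp measurable_snd))
  -- Fubini exchanges the two almost sure quantifiers, so one sample serves almost every `ω`.
  have h2 : ∀ᵐ y ∂μ, ∀ᵐ ω ∂P, Tendsto (fun N : ℕ => (∑ i ∈ Finset.range N, f ω (y i)) / N) atTop
      (𝓝 (∫ x, f ω x ∂ν)) := (Measure.ae_ae_comm hmeas).1 (Eventually.of_forall h1)
  exact h2.exists

/-- An integral with respect to `x` is, up to a null set, measurable with respect to any
σ-algebra for which the integrand is measurable at each `x`. -/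
theorem exists_measurable_ae_eq_integral {Ω X : Type*} {m₀ : MeasurableSpace Ω} [MeasurableSpace X]
    (P : Measure Ω) [IsProbabilityMeasure P] (ν : Measure X) [IsProbabilityMeasure ν]
    {f : Ω → X → ℝ} (hf : Measurable (Function.uncurry f)) (hi : ∀ ω, Integrable (f ω) ν)
    (m : MeasurableSpace Ω) (hm : ∀ x, Measurable[m] fun ω => f ω x) :
    ∃ G : Ω → ℝ, Measurable[m] G ∧ (fun ω => ∫ x, f ω x ∂ν) =ᵐ[P] G := by
  obtain ⟨y, hy⟩ := @exists_tendsto_average Ω X m₀ _ P _ ν _ f hf hi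
  -- The upper limit is measurable whether or not the averages converge.
  refine ⟨fun ω => limsup (fun N : ℕ => (∑ i ∈ Finset.range N, f ω (y i)) / N) atTop, ?_, ?_⟩
  · exact Measurable.limsup fun N => Measurable.div_const (Finset.measurable_sum _ fun i _ => hm _) _
  · filter_upwards [hy] with ω hω
    exact hω.limsup_eq.symm

variable {Ω : Type*} [MeasurableSpace Ω]

/-- The standing assumptions, with their constants. -/
structure Model.IsRegular [AddAction (Fin d → ℤ) Ω] (M : Model 𝒢 d Ω) (P : Measure Ω)
    (K : Ω → ℝ) (B C₀ r₀ C lam : ℝ) : Prop where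
  dim_pos : 1 ≤ d
  measurable : Measurable (Function.uncurry M.potential)
  loc : ∀ ω, LocallyIntegrable (M.potential ω) volume
  memLp : MemLp K 2 P
  potential_le : ∀ ω, ∀ x ∈ unitCell 𝒢 d, M.potential ω x ≤ K ω
  covariant : M.IsCovariant
  indep : ∀ A B : Set (Site 𝒢 d), (∀ x ∈ A, ∀ y ∈ B, r₀ < dist x y) →
    IndepFun (fun ω (x : A) => M.potential ω x) (fun ω (y : B) => M.potential ω y) P
  measurable_interaction : ∀ n, Measurable (M.interaction n)
  lower : ∀ ω, ∀ φ : (Fin 1 → Site 𝒢 d) → ℂ, IsTestFunction Set.univ 1 φ →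
    -C₀ * normSq φ ≤ freeForm (M.potential ω) φ
  lower_nonneg : 0 ≤ C₀
  stable : ∀ (n : ℕ) x, ((-(n * B) : ℝ) : EReal) ≤ M.interaction n x
  stable_nonneg : 0 ≤ B
  tempered : IsTempered M.interaction r₀ C lam
  two_lt : 2 < r₀

section Regular

variable [AddAction (Fin d → ℤ) Ω] {M : Model 𝒢 d Ω} {P : Measure Ω} {K : Ω → ℝ}
  {B C₀ r₀ C lam : ℝ} {Λ : Set (Site 𝒢 d)} {n k : ℕ}

theorem measurable_sum_mul {Ω : Type*} {m : MeasurableSpace Ω} {f : Fin n → Ω → ℝ}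
    (h : ∀ i, Measurable (f i)) (c : ℝ) : Measurable fun ω => (∑ i, f i ω) * c :=
  (Finset.measurable_sum _ fun i _ => h i).mul_const c

theorem measurable_mul_left_of_measurable {Ω : Type*} {m : MeasurableSpace Ω} {f : Ω → ℝ}
    (h : Measurable f) (c : ℝ) : Measurable fun ω => c * f ω :=
  h.const_mul c

/-- The events that depend on the potential in `Λ`. -/
@[reducible] def Model.localEvents {Ω : Type*} (M : Model 𝒢 d Ω) (Λ : Set (Site 𝒢 d)) : MeasurableSpace Ω :=
  MeasurableSpace.comap (fun ω (x : Λ) => M.potential ω x) inferInstance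

theorem Model.measurable_potential_local {Ω : Type*} (M : Model 𝒢 d Ω) {x : Site 𝒢 d} (hx : x ∈ Λ) :
    Measurable[M.localEvents Λ] fun ω => M.potential ω x :=
  (measurable_pi_apply (⟨x, hx⟩ : Λ)).comp (comap_measurable fun ω (x : Λ) => M.potential ω x)

theorem measurable_uncurry_potentialDensity (hM : M.IsRegular P K B C₀ r₀ C lam)
    {φ : (Fin n → Site 𝒢 d) → ℂ} (hφ : Continuous φ) :
    Measurable (Function.uncurry fun (ω : Ω) (x : Fin n → Site 𝒢 d) =>
      (∑ i, M.potential ω (x i)) * ‖φ x‖ ^ 2) := by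
  have h1 := hφ.measurable
  refine Measurable.mul (Finset.measurable_sum _ fun i _ => ?_) (by fun_prop)
  exact hM.measurable.comp (measurable_fst.prodMk ((measurable_pi_apply i).comp measurable_snd))

theorem Model.IsRegular.measurable_eigenvalue (hM : M.IsRegular P K B C₀ r₀ C lam)
    (hΛ : Bornology.IsBounded Λ) (hk : 1 ≤ k) : Measurable fun ω => M.eigenvalue Λ n k ω :=
  RandomGas.measurable_eigenvalue M hM.stable_nonneg (hM.measurable_interaction n) (hM.stable n)
    hM.loc hΛ hk fun _ hφ => ((measurable_uncurry_potentialDensity hM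
      (continuous_of_mem_test hφ)).stronglyMeasurable.integral_prod_right (ν := volume)).measurable

/-- Independence is assumed for the point values of the potential, whereas the eigenvalues see its
integrals against `‖φ‖²`. These integrals agree almost surely with limits of sums of point values in
`Λ`, so the eigenvalues are measurable with respect to the local events completed by null sets. -/
theorem Model.IsRegular.measurable_eigenvalue_comap [IsProbabilityMeasure P]
    (hM : M.IsRegular P K B C₀ r₀ C lam) (hΛ : Bornology.IsBounded Λ) (hk : 1 ≤ k) :
    Measurable[eventuallyMeasurableSpace (M.localEvents Λ) (ae P)]
      fun ω => M.eigenvalue Λ n k ω := by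
  refine @RandomGas.measurable_eigenvalue 𝒢 d Ω (eventuallyMeasurableSpace (M.localEvents Λ) (ae P)) M B
    hM.stable_nonneg n (hM.measurable_interaction n) (hM.stable n) hM.loc Λ hΛ k hk
    fun φ hφ => ?_
  have hφc := continuous_of_mem_test hφ
  obtain ⟨R, hR0, hR⟩ := hΛ.subset_closedBall_lt 0 0
  -- The sampling lemma wants a probability measure: normalised volume on a ball that contains the
  -- support.
  set Q : Set (Fin n → Site 𝒢 d) := Metric.closedBall 0 R with hQ
  have hQc : IsCompact Q := isCompact_closedBall _ _
  have hQpos : volume Q ≠ 0 := (Metric.measure_closedBall_pos _ _ hR0).ne'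
  have hprob : IsProbabilityMeasure ((volume Q)⁻¹ • (volume : Measure (Fin n → Site 𝒢 d)).restrict Q) :=
    ⟨by simp [ENNReal.inv_mul_cancel hQpos hQc.measure_lt_top.ne]⟩
  obtain ⟨G, hG, hGe⟩ := exists_measurable_ae_eq_integral P
    ((volume Q)⁻¹ • (volume : Measure (Fin n → Site 𝒢 d)).restrict Q)
    (measurable_uncurry_potentialDensity hM hφc)
    (fun ω => (integrable_potential (hM.loc ω) hφ).restrict.smul_measure
      (ENNReal.inv_ne_top.2 hQpos)) (M.localEvents Λ) (fun x => by
      by_cases hx : φ x = 0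
      · simp [hx]
      · have hxΛ := hφ.2.2 (subset_tsupport _ hx)
        exact measurable_sum_mul (fun i => M.measurable_potential_local (hxΛ i)) _)
  refine Measurable.eventuallyMeasurable_of_eventuallyEq (m := M.localEvents Λ)
    (f := fun ω => (volume Q).toReal * G ω) (measurable_mul_left_of_measurable hG _) ?_
  filter_upwards [hGe] with ω hω
  rw [← hω, integral_smul_measure, setIntegral_eq_integral_of_forall_compl_eq_zero]
  · rw [smul_eq_mul, ← mul_assoc, ← ENNReal.toReal_mul,
      ENNReal.mul_inv_cancel hQpos hQc.measure_lt_top.ne, ENNReal.toReal_one, one_mul]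
  · intro x hx
    have : φ x = 0 := by
      by_contra h
      refine hx ?_
      have := hφ.2.2 (subset_tsupport _ h)
      rw [hQ, mem_closedBall_zero_iff, pi_norm_le_iff_of_nonneg hR0.le]
      exact fun i => mem_closedBall_zero_iff.1 (hR (this i))
    simp [this]

/-- The events differ from local ones by null sets, which do not affect the product formula. -/
theorem Model.IsRegular.indepFun_eigenvalue [IsProbabilityMeasure P]
    (hM : M.IsRegular P K B C₀ r₀ C lam) {Λ' : Set (Site 𝒢 d)} {n' k' : ℕ}
    (hΛ : Bornology.IsBounded Λ) (hΛ' : Bornology.IsBounded Λ') (hk : 1 ≤ k) (hk' : 1 ≤ k')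
    (hsep : ∀ x ∈ Λ, ∀ y ∈ Λ', r₀ < dist x y) :
    IndepFun (fun ω => M.eigenvalue Λ n k ω) (fun ω => M.eigenvalue Λ' n' k' ω) P := by
  rw [IndepFun_iff]
  rintro _ _ ⟨s, hs, rfl⟩ ⟨s', hs', rfl⟩
  obtain ⟨t, ht, hst⟩ := hM.measurable_eigenvalue_comap (n := n) hΛ hk hs
  obtain ⟨t', ht', hst'⟩ := hM.measurable_eigenvalue_comap (n := n') hΛ' hk' hs'
  rw [measure_congr hst, measure_congr hst', measure_congr (hst.inter hst')]
  exact (IndepFun_iff _ _ _).1 (hM.indep Λ Λ' hsep) t t' ht ht'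

end Regular

end RandomGas

namespace RandomGas

variable {𝒢 : Medium} {d : ℕ}

/-! ### Finiteness and moments of the eigenvalues -/

section TrialSpace

variable {n k : ℕ} {v v' : Site 𝒢 d → ℝ} {w : (Fin n → Site 𝒢 d) → EReal} {s : Statistics}
  {B e : ℝ} {D : Set (Fin n → Site 𝒢 d)} {Λ : Set (Site 𝒢 d)}

theorem freeForm_le_of_le (hv : LocallyIntegrable v volume) (hv' : LocallyIntegrable v' volume)
    {κ : ℝ} (hle : ∀ x ∈ Λ, v x ≤ v' x + κ) {φ : (Fin n → Site 𝒢 d) → ℂ}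
    (hφ : φ ∈ testSubmodule {x : Fin n → Site 𝒢 d | ∀ i, x i ∈ Λ}) :
    freeForm v φ ≤ freeForm v' φ + n * κ * normSq φ := by
  rw [freeForm, freeForm, normSq, ← integral_const_mul, add_assoc,
    ← integral_add (integrable_potential hv' hφ)
      ((integrable_normSq_of_hasCompactSupport (continuous_of_mem_test hφ) hφ.2.1).const_mul _)]
  refine add_le_add_right (integral_mono (integrable_potential hv hφ)
    ((integrable_potential hv' hφ).add ((integrable_normSq_of_hasCompactSupport
      (continuous_of_mem_test hφ) hφ.2.1).const_mul _)) fun x => ?_) _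
  simp only [Pi.add_apply]
  by_cases h : φ x = 0
  · simp [h]
  · have hx := hφ.2.2 (subset_tsupport _ h)
    rw [← add_mul]
    refine mul_le_mul_of_nonneg_right ?_ (sq_nonneg _)
    calc ∑ i, v (x i) ≤ ∑ i, (v' (x i) + κ) := Finset.sum_le_sum fun i _ => hle _ (hx i)
      _ = _ := by simp [Finset.sum_add_distrib]

theorem HasTrialSpace.of_potential_le (hv : LocallyIntegrable v volume)
    (hv' : LocallyIntegrable v' volume) {κ : ℝ} (hle : ∀ x ∈ Λ, v x ≤ v' x + κ)
    (h : HasTrialSpace v' w s B {x | ∀ i, x i ∈ Λ} k e) :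
    HasTrialSpace v w s B {x | ∀ i, x i ∈ Λ} k (e + n * κ) := by
  obtain ⟨F, hF, H⟩ := h
  refine ⟨F, hF, fun φ hφ => ⟨(H φ hφ).1, (H φ hφ).2.1, (H φ hφ).2.2.1, ?_⟩⟩
  have h1 := freeForm_le_of_le hv hv' hle (H φ hφ).1
  have h2 := (H φ hφ).2.2.2
  nlinarith

/-- On a finite-dimensional space of test functions all the quadratic forms are bounded. -/
theorem HasTrialSpace.exists_of_potential (hw : Measurable w) (hD : Bornology.IsBounded D)
    (hk : 1 ≤ k) (hv' : LocallyIntegrable v' volume) (h : HasTrialSpace v w s B D k e) :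
    ∃ e', HasTrialSpace v' w s B D k e' := by
  obtain ⟨R, hR⟩ := hD.subset_closedBall 0
  have hK : IsCompact (Metric.closedBall (0 : Fin n → Site 𝒢 d) (R + 1)) := isCompact_closedBall _ _
  obtain ⟨F, hF, H⟩ := h
  have : FiniteDimensional ℂ F := Module.finite_of_finrank_pos (by omega)
  let b := Module.finBasisOfFinrankEq ℂ F hF
  have hb : ∀ i, (b i : (Fin n → Site 𝒢 d) → ℂ) ∈ trialSubmodule w s B D hw := fun i =>
    ⟨(H _ (b i).2).1, (H _ (b i).2).2.1, (H _ (b i).2).2.2.1⟩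
  let φ : Fin k → trialSubmodule w s B D hw := fun i => ⟨b i, hb i⟩
  let T := formEmbedding w s B D hw
  let y : (Fin k → ℂ) → FormSpace 𝒢 d n := fun c => ∑ i, c i • T (φ i)
  have hy : Continuous y := by fun_prop
  have hkne : Nonempty (Fin k) := ⟨⟨0, hk⟩⟩
  have hsne : (Metric.sphere (0 : Fin k → ℂ) 1).Nonempty :=
    NormedSpace.sphere_nonempty.2 zero_le_one
  obtain ⟨c₀, hc₀, hmin⟩ := (isCompact_sphere (0 : Fin k → ℂ) 1).exists_isMinOn hsne
    ((continuous_localNormSq hK).comp hy).continuousOn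
  obtain ⟨c₁, hc₁, hmax⟩ := (isCompact_sphere (0 : Fin k → ℂ) 1).exists_isMinOn hsne
    ((continuous_gapForm hK hv' 0).comp hy).continuousOn
  have hpos : ∀ c ∈ Metric.sphere (0 : Fin k → ℂ) 1,
      0 < localNormSq (Metric.closedBall 0 (R + 1)) (y c) := by
    intro c hc
    have hc0 : c ≠ 0 := by
      rintro rfl
      simp at hc
    -- The norm is recovered as the difference of the gap forms at the energies 1 and 0.
    have h1 : localNormSq (Metric.closedBall 0 (R + 1)) (y c) =
        normSq ((∑ i, c i • b i : F) : (Fin n → Site 𝒢 d) → ℂ) := by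
      have h2 := gapForm_formEmbedding (v := v') hw hR 0 (∑ i, c i • φ i)
      have h3 := gapForm_formEmbedding (v := v') hw hR 1 (∑ i, c i • φ i)
      have h4 := gapForm_sub (Metric.closedBall 0 (R + 1)) v' 1 1 0 (y c)
      have h5 : y c = T (∑ i, c i • φ i) := sum_smul_formEmbedding hw φ c
      rw [h5] at h4 ⊢
      have h6 : ((∑ i, c i • φ i : trialSubmodule w s B D hw) : (Fin n → Site 𝒢 d) → ℂ) =
        ((∑ i, c i • b i : F) : (Fin n → Site 𝒢 d) → ℂ) := by simp [φ]
      rw [h6] at h2 h3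
      simp only [sub_self, add_zero] at h4
      change gapForm _ v' 0 (T _) = _ at h2
      change gapForm _ v' 1 (T _) = _ at h3
      linarith
    rw [h1]
    have hne : (∑ i, c i • b i : F) ≠ 0 := fun h0 => hc0 (funext fun i =>
      Fintype.linearIndependent_iff.1 b.linearIndependent c h0 i)
    exact normSq_pos (mem_testSubmodule_univ (H _ (∑ i, c i • b i : F).2).1)
      (fun h0 => hne (Subtype.ext h0))
  set ν := localNormSq (Metric.closedBall 0 (R + 1)) (y c₀) with hν
  set g := gapForm (Metric.closedBall 0 (R + 1)) v' 0 (y c₁) with hg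
  have hν0 : 0 < ν := hpos c₀ hc₀
  -- On the sphere the norm is at least `ν` and the gap form at energy 0 at least `g ≥ -|g|`, so the
  -- energy `(|g| + 1) / ν` makes the form positive. Subtracting `n * B` undoes the shift.
  obtain ⟨e', -, he'⟩ := exists_hasTrialSpace_of_gapForm_pos hw hv' hR
    ((|g| + 1) / ν - n * B) hk φ (fun c hc => by
      have h1 : ν ≤ localNormSq (Metric.closedBall 0 (R + 1)) (y c) := hmin hc
      have h2 : g ≤ gapForm (Metric.closedBall 0 (R + 1)) v' 0 (y c) := hmax hc
      have h3 := gapForm_sub (Metric.closedBall 0 (R + 1)) v' ((|g| + 1) / ν) ((|g| + 1) / ν) 0 (y c)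
      rw [sub_self, add_zero, add_zero] at h3
      rw [sub_add_cancel]
      change 0 < gapForm _ _ _ (y c)
      have h4 : |g| + 1 ≤ (|g| + 1) / ν * localNormSq (Metric.closedBall 0 (R + 1)) (y c) := by
        rw [div_mul_eq_mul_div, le_div_iff₀ hν0]
        gcongr
      have := neg_abs_le g
      linarith)
  exact ⟨e', he'⟩

/-- A trial space of positive dimension contains a nonzero function, whose shifted interaction
energy is nonnegative. -/
theorem HasTrialSpace.lower_bound (hv : LocallyIntegrable v volume) {C : ℝ}
    (hC : ∀ φ : (Fin 1 → Site 𝒢 d) → ℂ, IsTestFunction Set.univ 1 φ → -C * normSq φ ≤ freeForm v φ)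
    (hk : 1 ≤ k) (h : HasTrialSpace v w s B D k e) : -(n * (C + B)) ≤ e := by
  obtain ⟨F, hF, H⟩ := h
  have : Nontrivial F := Module.nontrivial_of_finrank_pos (R := ℂ) (by omega)
  obtain ⟨φ, hφ⟩ := exists_ne (0 : F)
  obtain ⟨h1, -, -, h4⟩ := H φ φ.2
  have h5 := freeForm_lower_bound hv hC n _ (mem_testSubmodule_univ h1)
  have h6 := normSq_pos (mem_testSubmodule_univ h1) (fun h0 => hφ (Subtype.ext h0))
  have h7 : 0 ≤ (shiftedForm B w (φ : (Fin n → Site 𝒢 d) → ℂ)).toReal := ENNReal.toReal_nonneg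
  by_contra! hlt
  nlinarith

end TrialSpace

theorem isBounded_pow {n : ℕ} {Λ : Set (Site 𝒢 d)} (hΛ : Bornology.IsBounded Λ) :
    Bornology.IsBounded {x : Fin n → Site 𝒢 d | ∀ i, x i ∈ Λ} := by
  have := Bornology.IsBounded.pi (S := fun _ : Fin n => Λ) fun _ => hΛ
  refine this.subset fun x hx i _ => hx i

variable {Ω : Type*}

/-- There are trial spaces of dimension `k` for `n` particles in `Λ`. -/
def Model.IsAttainable (M : Model 𝒢 d Ω) (B : ℝ) (Λ : Set (Site 𝒢 d)) (n k : ℕ) : Prop :=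
  ∃ e, HasTrialSpace 0 (M.interaction n) M.statistics B {x | ∀ i, x i ∈ Λ} k e

variable [MeasurableSpace Ω] [AddAction (Fin d → ℤ) Ω] {M : Model 𝒢 d Ω} {P : Measure Ω}
  {K : Ω → ℝ} {B C₀ r₀ C lam : ℝ} {Λ : Set (Site 𝒢 d)} {n k : ℕ}

namespace Model.IsRegular

theorem eigenvalue_le (hM : M.IsRegular P K B C₀ r₀ C lam) {ω : Ω} {e : ℝ}
    (h : HasTrialSpace (M.potential ω) (M.interaction n) M.statistics B {x | ∀ i, x i ∈ Λ} k e) :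
    M.eigenvalue Λ n k ω ≤ e := by
  rw [eigenvalue_eq_iInf M hM.stable_nonneg (hM.measurable_interaction n) (hM.stable n)]
  exact iInf₂_le e h

theorem hasTrialSpace_of_lt (hM : M.IsRegular P K B C₀ r₀ C lam) {ω : Ω} {e : EReal}
    (h : M.eigenvalue Λ n k ω < e) : ∃ e' : ℝ, (e' : EReal) < e ∧
      HasTrialSpace (M.potential ω) (M.interaction n) M.statistics B {x | ∀ i, x i ∈ Λ} k e' := by
  rw [eigenvalue_eq_iInf M hM.stable_nonneg (hM.measurable_interaction n) (hM.stable n)] at h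
  obtain ⟨e', he'⟩ := iInf_lt_iff.1 h
  obtain ⟨h1, h2⟩ := iInf_lt_iff.1 he'
  exact ⟨e', h2, h1⟩

theorem le_eigenvalue (hM : M.IsRegular P K B C₀ r₀ C lam) (hk : 1 ≤ k) (ω : Ω) :
    ((-(n * (C₀ + B)) : ℝ) : EReal) ≤ M.eigenvalue Λ n k ω := by
  rw [eigenvalue_eq_iInf M hM.stable_nonneg (hM.measurable_interaction n) (hM.stable n)]
  exact le_iInf₂ fun e he => EReal.coe_le_coe_iff.2 (he.lower_bound (hM.loc ω) (hM.lower ω) hk)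

theorem eigenvalue_ne_bot (hM : M.IsRegular P K B C₀ r₀ C lam) (hk : 1 ≤ k) (ω : Ω) :
    M.eigenvalue Λ n k ω ≠ ⊥ :=
  ((EReal.bot_lt_coe _).trans_le (hM.le_eigenvalue hk ω)).ne'

theorem isAttainable_of_hasTrialSpace (hM : M.IsRegular P K B C₀ r₀ C lam)
    (hΛ : Bornology.IsBounded Λ) (hk : 1 ≤ k) {v : Site 𝒢 d → ℝ} {e : ℝ}
    (h : HasTrialSpace v (M.interaction n) M.statistics B {x | ∀ i, x i ∈ Λ} k e) :
    M.IsAttainable B Λ n k :=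
  h.exists_of_potential (hM.measurable_interaction n) (isBounded_pow hΛ) hk
    (locallyIntegrable_const (0 : ℝ))

/-- Whether a trial space exists depends on the hard part of the interaction and not on the
potential, which is bounded as a form on each finite-dimensional space. Finiteness is therefore the
same for all `ω`. -/
theorem eigenvalue_lt_top_iff (hM : M.IsRegular P K B C₀ r₀ C lam) (hΛ : Bornology.IsBounded Λ)
    (hk : 1 ≤ k) (ω : Ω) : M.eigenvalue Λ n k ω < ⊤ ↔ M.IsAttainable B Λ n k := by
  constructor
  · intro h
    obtain ⟨e, -, he⟩ := hM.hasTrialSpace_of_lt h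
    exact hM.isAttainable_of_hasTrialSpace hΛ hk he
  · rintro ⟨e, he⟩
    obtain ⟨e', he'⟩ := he.exists_of_potential (hM.measurable_interaction n) (isBounded_pow hΛ) hk
      (hM.loc ω)
    exact (hM.eigenvalue_le he').trans_lt (EReal.coe_lt_top _)

theorem coe_toReal_eigenvalue (hM : M.IsRegular P K B C₀ r₀ C lam) (hΛ : Bornology.IsBounded Λ)
    (hk : 1 ≤ k) (h : M.IsAttainable B Λ n k) (ω : Ω) :
    (((M.eigenvalue Λ n k ω).toReal : ℝ) : EReal) = M.eigenvalue Λ n k ω :=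
  EReal.coe_toReal ((hM.eigenvalue_lt_top_iff hΛ hk ω).2 h).ne (hM.eigenvalue_ne_bot hk ω)

theorem hasTrialSpace_add (hM : M.IsRegular P K B C₀ r₀ C lam) (hΛ : Bornology.IsBounded Λ)
    (hk : 1 ≤ k) (h : M.IsAttainable B Λ n k) (ω : Ω) {ε : ℝ} (hε : 0 < ε) :
    HasTrialSpace (M.potential ω) (M.interaction n) M.statistics B {x | ∀ i, x i ∈ Λ} k
      ((M.eigenvalue Λ n k ω).toReal + ε) := by
  obtain ⟨e', h1, h2⟩ := hM.hasTrialSpace_of_lt (Λ := Λ) (n := n) (k := k) (ω := ω)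
    (e := (((M.eigenvalue Λ n k ω).toReal + ε : ℝ) : EReal)) (by
      nth_rw 1 [← hM.coe_toReal_eigenvalue hΛ hk h ω]
      exact EReal.coe_lt_coe_iff.2 (by linarith))
  exact h2.mono_energy (EReal.coe_lt_coe_iff.1 h1).le

/-- Finitely many unit cells cover `Λ`, and covariance moves each of them to the origin, where `K`
is a bound. -/
theorem potential_le_sum (hM : M.IsRegular P K B C₀ r₀ C lam) (hΛ : Bornology.IsBounded Λ) :
    ∃ Γ : Finset (Fin d → ℤ), ∀ ω, ∀ x ∈ Λ, M.potential ω x ≤ ∑ γ ∈ Γ, |K (γ +ᵥ ω)| := by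
  obtain ⟨R, hR⟩ := hΛ.subset_closedBall 0
  have hfin : (Metric.closedBall (0 : Fin d → ℤ) (R + 1)).Finite :=
    (isCompact_closedBall _ _).finite_of_discrete
  refine ⟨hfin.toFinset, fun ω x hx => ?_⟩
  have hxR : ‖x‖ ≤ R := mem_closedBall_zero_iff.1 (hR hx)
  set γ : Fin d → ℤ := cellIndex 1 x with hγ
  have hγi : ∀ i, (γ i : ℝ) ≤ coord 𝒢 d x i ∧ coord 𝒢 d x i < γ i + 1 := fun i => by
    rw [hγ, cellIndex, Nat.cast_one, div_one]
    exact ⟨Int.floor_le _, Int.lt_floor_add_one _⟩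
  have hmem : γ ∈ hfin.toFinset := by
    rw [Set.Finite.mem_toFinset, mem_closedBall_zero_iff,
      pi_norm_le_iff_of_nonneg (by linarith [norm_nonneg x])]
    intro i
    have h1 := abs_le.1 ((abs_coord_le_norm x i).trans hxR)
    rw [Int.norm_eq_abs, abs_le]
    constructor <;> linarith [h1.1, h1.2, (hγi i).1, (hγi i).2]
  have hcell : x - shift 𝒢 d γ ∈ unitCell 𝒢 d := fun i => by
    rw [coord_sub, coord_shift]
    constructor <;> linarith [(hγi i).1, (hγi i).2]
  have h1 := hM.covariant γ ω (x - shift 𝒢 d γ)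
  rw [sub_add_cancel] at h1
  rw [← h1]
  refine (hM.potential_le _ _ hcell).trans ((le_abs_self _).trans ?_)
  exact Finset.single_le_sum (f := fun γ => |K (γ +ᵥ ω)|) (fun _ _ => abs_nonneg _) hmem

/-- A trial space without potential costs at most its energy plus `n` times the sup of the
potential, which is square integrable; from below stability gives a constant. -/
theorem memLp_eigenvalue [IsProbabilityMeasure P] [MeasurableConstVAdd (Fin d → ℤ) Ω]
    [VAddInvariantMeasure (Fin d → ℤ) Ω P] (hM : M.IsRegular P K B C₀ r₀ C lam)
    (hΛ : Bornology.IsBounded Λ) (hk : 1 ≤ k) (h : M.IsAttainable B Λ n k) :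
    MemLp (fun ω => (M.eigenvalue Λ n k ω).toReal) 2 P := by
  obtain ⟨Γ, hΓ⟩ := hM.potential_le_sum hΛ
  obtain ⟨e, he⟩ := h
  have hmeas := (hM.measurable_eigenvalue (n := n) hΛ hk).ereal_toReal
  have hg : MemLp (fun ω => |e| + n * ∑ γ ∈ Γ, |K (γ +ᵥ ω)| + n * (C₀ + B)) 2 P := by
    have h1 : ∀ γ ∈ Γ, MemLp (fun ω => |K (γ +ᵥ ω)|) 2 P := fun γ _ =>
      (hM.memLp.comp_measurePreserving (measurePreserving_vadd γ P)).abs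
    have h2 : MemLp (fun ω => ∑ γ ∈ Γ, |K (γ +ᵥ ω)|) 2 P := memLp_finsetSum Γ h1
    exact ((memLp_const |e|).add (h2.const_mul (n : ℝ))).add (memLp_const (n * (C₀ + B)))
  refine hg.of_le hmeas.aestronglyMeasurable (Eventually.of_forall fun ω => ?_)
  have h1 := he.of_potential_le (hM.loc ω) (locallyIntegrable_const (0 : ℝ)) (Λ := Λ)
    (κ := ∑ γ ∈ Γ, |K (γ +ᵥ ω)|) (fun x hx => by
      simpa using hΓ ω x hx)
  have h2 := hM.eigenvalue_le h1
  have h3 := hM.le_eigenvalue (Λ := Λ) (n := n) hk ω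
  rw [← hM.coe_toReal_eigenvalue hΛ hk ⟨e, he⟩ ω, EReal.coe_le_coe_iff] at h2 h3
  have h4 : 0 ≤ (n : ℝ) * ∑ γ ∈ Γ, |K (γ +ᵥ ω)| :=
    mul_nonneg (Nat.cast_nonneg _) (Finset.sum_nonneg fun _ _ => abs_nonneg _)
  have h5 : 0 ≤ (n : ℝ) * (C₀ + B) :=
    mul_nonneg (Nat.cast_nonneg _) (add_nonneg hM.lower_nonneg hM.stable_nonneg)
  rw [Real.norm_eq_abs, Real.norm_of_nonneg (by positivity), abs_le]
  have h6 := le_abs_self e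
  have h7 := abs_nonneg e
  constructor <;> linarith

/-- Trial spaces are translated in both directions. -/
theorem eigenvalue_translate (hM : M.IsRegular P K B C₀ r₀ C lam) (γ : Fin d → ℤ) (ω : Ω) :
    M.eigenvalue {x | x - shift 𝒢 d γ ∈ Λ} n k ω = M.eigenvalue Λ n k (γ +ᵥ ω) := by
  rw [eigenvalue_eq_iInf M hM.stable_nonneg (hM.measurable_interaction n) (hM.stable n),
    eigenvalue_eq_iInf M hM.stable_nonneg (hM.measurable_interaction n) (hM.stable n)]
  congr 1
  funext e
  refine iInf_congr_Prop ⟨fun h => ?_, fun h => ?_⟩ fun _ => rfl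
  · have := HasTrialSpace.translate (v' := M.potential ω) (v := M.potential (γ +ᵥ ω))
      (-shift 𝒢 d γ) (fun x => ?_) (fun x => ?_) h
    · refine this.mono_set fun x hx i => ?_
      simpa using hx i
    · rw [hM.covariant γ ω, neg_add_cancel_right]
    · have := hM.tempered.shift n γ (fun i => x i + -shift 𝒢 d γ)
      simpa using this.symm
  · exact HasTrialSpace.translate (v := M.potential ω) (v' := M.potential (γ +ᵥ ω))
      (shift 𝒢 d γ) (fun x => hM.covariant γ ω x) (fun x => hM.tempered.shift n γ x) h

end Model.IsRegular

end RandomGas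

namespace RandomGas

variable {𝒢 : Medium} {d : ℕ}

/-! ### Energies of unions of cells -/

theorem isBounded_cube (𝒢 : Medium) (d L : ℕ) : Bornology.IsBounded (cube 𝒢 d L) := by
  rcases Nat.eq_zero_or_pos d with rfl | hd
  · refine (Metric.isBounded_closedBall (x := (0 : Site 𝒢 0)) (r := 0)).subset fun x _ => ?_
    cases 𝒢
    · exact mem_closedBall_zero_iff.2 (by rw [Subsingleton.elim (α := Fin 0 → ℤ) x 0]; exact norm_zero.le)
    · exact mem_closedBall_zero_iff.2
        (by rw [Subsingleton.elim (α := EuclideanSpace ℝ (Fin 0)) x 0]; exact norm_zero.le)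
  · refine (Metric.isBounded_closedBall (x := (0 : Site 𝒢 d)) (r := d * L)).subset fun x hx => ?_
    refine mem_closedBall_zero_iff.2 (norm_le_of_abs_coord_le x (fun i => ?_) hd)
    have := coord_of_mem_cube hx i
    rw [abs_of_nonneg this.1]
    exact this.2.le

theorem isBounded_preimage_sub {Λ : Set (Site 𝒢 d)} (hΛ : Bornology.IsBounded Λ) (c : Site 𝒢 d) :
    Bornology.IsBounded {x | x - c ∈ Λ} := by
  obtain ⟨R, hR⟩ := hΛ.subset_closedBall 0
  refine (Metric.isBounded_closedBall (x := c) (r := R)).subset fun x hx => ?_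
  rw [Metric.mem_closedBall, dist_eq_norm]
  exact mem_closedBall_zero_iff.1 (hR hx)

theorem isBounded_cellCube (𝒢 : Medium) (d L ℓ : ℕ) (γ : Fin d → ℤ) :
    Bornology.IsBounded (cellCube 𝒢 d L ℓ γ) :=
  isBounded_preimage_sub (isBounded_cube 𝒢 d L) _

variable {Ω : Type*}

/-- The real value of the eigenvalue. -/
noncomputable def Model.energy (M : Model 𝒢 d Ω) (Λ : Set (Site 𝒢 d)) (n k : ℕ) (ω : Ω) : ℝ :=
  (M.eigenvalue Λ n k ω).toReal

variable [MeasurableSpace Ω] [AddAction (Fin d → ℤ) Ω] {M : Model 𝒢 d Ω} {P : Measure Ω}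
  {K : Ω → ℝ} {B C₀ r₀ C lam : ℝ} {Λ : Set (Site 𝒢 d)} {n k : ℕ}

/-- The mean energy. -/
noncomputable def Model.meanEnergy (M : Model 𝒢 d Ω) (P : Measure Ω) (Λ : Set (Site 𝒢 d))
    (n k : ℕ) : ℝ := ∫ ω, M.energy Λ n k ω ∂P

theorem HasTrialSpace.isAttainable {v : Site 𝒢 d → ℝ} {e : ℝ}
    (hM : M.IsRegular P K B C₀ r₀ C lam) (hΛ : Bornology.IsBounded Λ) (hk : 1 ≤ k)
    (h : HasTrialSpace v (M.interaction n) M.statistics B {x | ∀ i, x i ∈ Λ} k e) :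
    M.IsAttainable B Λ n k := hM.isAttainable_of_hasTrialSpace hΛ hk h

namespace Model.IsRegular

theorem energy_le (hM : M.IsRegular P K B C₀ r₀ C lam) (hk : 1 ≤ k) {ω : Ω} {e : ℝ}
    (h : HasTrialSpace (M.potential ω) (M.interaction n) M.statistics B {x | ∀ i, x i ∈ Λ} k e) :
    M.energy Λ n k ω ≤ e := by
  have h1 := hM.eigenvalue_le h
  rw [Model.energy, ← EReal.coe_le_coe_iff, EReal.coe_toReal (h1.trans_lt (EReal.coe_lt_top _)).ne
    (hM.eigenvalue_ne_bot hk ω)]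
  exact h1

theorem neg_le_energy (hM : M.IsRegular P K B C₀ r₀ C lam) (hΛ : Bornology.IsBounded Λ)
    (hk : 1 ≤ k) (h : M.IsAttainable B Λ n k) (ω : Ω) : -(n * (C₀ + B)) ≤ M.energy Λ n k ω := by
  have h3 := hM.le_eigenvalue (Λ := Λ) (n := n) hk ω
  rwa [← hM.coe_toReal_eigenvalue hΛ hk h ω, EReal.coe_le_coe_iff] at h3

theorem energy_cellCube (hM : M.IsRegular P K B C₀ r₀ C lam) (L ℓ : ℕ) (γ : Fin d → ℤ) (ω : Ω) :
    M.energy (cellCube 𝒢 d L ℓ γ) n k ω = M.energy (cube 𝒢 d L) n k (((ℓ : ℤ) • γ) +ᵥ ω) :=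
  congr_arg EReal.toReal (hM.eigenvalue_translate ((ℓ : ℤ) • γ) ω)

theorem hasTrialSpace_cellCube (hM : M.IsRegular P K B C₀ r₀ C lam) {L ℓ : ℕ} (γ : Fin d → ℤ)
    (hk : 1 ≤ k) (h : M.IsAttainable B (cube 𝒢 d L) n k) (ω : Ω) {ε : ℝ} (hε : 0 < ε) :
    HasTrialSpace (M.potential ω) (M.interaction n) M.statistics B
      {x | ∀ i, x i ∈ cellCube 𝒢 d L ℓ γ} k
      (M.energy (cube 𝒢 d L) n k (((ℓ : ℤ) • γ) +ᵥ ω) + ε) :=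
  HasTrialSpace.translate (v := M.potential ω) (v' := M.potential (((ℓ : ℤ) • γ) +ᵥ ω))
    (shift 𝒢 d ((ℓ : ℤ) • γ)) (fun x => hM.covariant _ ω x) (fun x => hM.tempered.shift n _ x)
    (hM.hasTrialSpace_add (isBounded_cube 𝒢 d L) hk h (((ℓ : ℤ) • γ) +ᵥ ω) hε)

section Cells

variable {L r m : ℕ} {Γ : Finset (Fin d → ℤ)} {N κ : (Fin d → ℤ) → ℕ}

theorem hasTrialSpace_cells (hM : M.IsRegular P K B C₀ r₀ C lam) (hr : r₀ < r) (hΓ : Γ.Nonempty)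
    (hN : ∀ γ ∈ Γ, 1 ≤ N γ ∧ N γ ≤ m) (hκ : ∀ γ ∈ Γ, 1 ≤ κ γ)
    (h : ∀ γ ∈ Γ, M.IsAttainable B (cube 𝒢 d L) (N γ) (κ γ)) (hn : ∑ γ ∈ Γ, N γ = n) (ω : Ω)
    {ε : ℝ} (hε : 0 < ε) :
    HasTrialSpace (M.potential ω) (M.interaction n) M.statistics B
      (occupation L (L + r) Γ m n) (∏ γ ∈ Γ, κ γ)
      (∑ γ ∈ Γ, M.energy (cube 𝒢 d L) (N γ) (κ γ) (((L + r : ℕ) : ℤ) • γ +ᵥ ω) +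
        n * (m * tailBound d C lam r) + ε) := by
  subst hn
  have hr2 : 2 < r := by exact_mod_cast hM.two_lt.trans hr
  have hcard : (0 : ℝ) < Γ.card := by exact_mod_cast hΓ.card_pos
  refine (HasTrialSpace.cells hM.tempered hM.measurable_interaction hM.stable (hM.loc ω) hM.dim_pos
    hr2 hr.le hΓ hN hκ fun γ hγ => hM.hasTrialSpace_cellCube (ℓ := L + r) γ (hκ γ hγ) (h γ hγ) ω
      (div_pos hε hcard)).mono_energy ?_
  rw [Finset.sum_add_distrib, Finset.sum_const, nsmul_eq_mul, mul_div_cancel₀ _ hcard.ne']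
  linarith

/-- The infimum defining an eigenvalue need not be attained by a trial space; a total error `ε` is
spread over the cells and removed at the end. -/
theorem energy_cells_le [IsProbabilityMeasure P] (hM : M.IsRegular P K B C₀ r₀ C lam) (hr : r₀ < r) (hΓ : Γ.Nonempty)
    (hN : ∀ γ ∈ Γ, 1 ≤ N γ ∧ N γ ≤ m) (hκ : ∀ γ ∈ Γ, 1 ≤ κ γ)
    (h : ∀ γ ∈ Γ, M.IsAttainable B (cube 𝒢 d L) (N γ) (κ γ)) (hΛ : Bornology.IsBounded Λ)
    (hsub : ∀ γ ∈ Γ, cellCube 𝒢 d L (L + r) γ ⊆ Λ) (hk : 1 ≤ k) (hkκ : k ≤ ∏ γ ∈ Γ, κ γ)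
    (hn : ∑ γ ∈ Γ, N γ = n) :
    M.IsAttainable B Λ n k ∧ ∀ ω, M.energy Λ n k ω ≤
      ∑ γ ∈ Γ, M.energy (cube 𝒢 d L) (N γ) (κ γ) (((L + r : ℕ) : ℤ) • γ +ᵥ ω) +
        n * (m * tailBound d C lam r) := by
  subst hn
  have key : ∀ ω (ε : ℝ), 0 < ε → HasTrialSpace (M.potential ω) (M.interaction (∑ γ ∈ Γ, N γ))
      M.statistics B {x | ∀ i, x i ∈ Λ} k
      (∑ γ ∈ Γ, M.energy (cube 𝒢 d L) (N γ) (κ γ) (((L + r : ℕ) : ℤ) • γ +ᵥ ω) +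
        (∑ γ ∈ Γ, N γ : ℕ) * (m * tailBound d C lam r) + ε) := fun ω ε hε =>
    ((hM.hasTrialSpace_cells hr hΓ hN hκ h rfl ω hε).mono_index hkκ).mono_set fun x hx i => by
      obtain ⟨γ, hγ, hxγ⟩ := hx.1 i
      exact hsub γ hγ hxγ
  obtain ⟨ω₀⟩ := P.nonempty_of_neZero
  exact ⟨(key ω₀ 1 one_pos).isAttainable hM hΛ hk,
    fun ω => le_of_forall_pos_le_add fun ε hε => hM.energy_le hk (key ω ε hε)⟩

/-- Nothing is known about the distribution of the particles in `Λ₀`, so they form the first group: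
each is charged with the tail of the cells, whose occupation is bounded. -/
theorem energy_add_cells_le (hM : M.IsRegular P K B C₀ r₀ C lam) (hr : r₀ < r) (hΓ : Γ.Nonempty)
    {n₀ k₀ : ℕ} (hn₀ : 1 ≤ n₀) (hk₀ : 1 ≤ k₀) {Λ₀ : Set (Site 𝒢 d)}
    (hΛ₀ : Bornology.IsBounded Λ₀) (h₀ : M.IsAttainable B Λ₀ n₀ k₀)
    {m' κ' : ℕ} (hm' : 1 ≤ m') (hκ' : 1 ≤ κ') (h : M.IsAttainable B (cube 𝒢 d L) m' κ')
    (hΛ : Bornology.IsBounded Λ) (hsub₀ : Λ₀ ⊆ Λ) (hsub : ∀ γ ∈ Γ, cellCube 𝒢 d L (L + r) γ ⊆ Λ)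
    (hsep : ∀ x ∈ Λ₀, ∀ γ ∈ Γ, ∀ y ∈ cellCube 𝒢 d L (L + r) γ, (r : ℝ) ≤ dist x y) (ω : Ω) :
    M.IsAttainable B Λ (n₀ + Γ.card * m') (k₀ * κ' ^ Γ.card) ∧
    M.energy Λ (n₀ + Γ.card * m') (k₀ * κ' ^ Γ.card) ω ≤ M.energy Λ₀ n₀ k₀ ω +
      ∑ γ ∈ Γ, M.energy (cube 𝒢 d L) m' κ' (((L + r : ℕ) : ℤ) • γ +ᵥ ω) +
        (n₀ + Γ.card * m' : ℕ) * (m' * tailBound d C lam r) := by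
  have hr2 : 2 < r := by exact_mod_cast hM.two_lt.trans hr
  have hpos : 1 ≤ k₀ * κ' ^ Γ.card := Nat.mul_pos hk₀ (pow_pos hκ' _)
  have key : ∀ (ε : ℝ), 0 < ε → HasTrialSpace (M.potential ω) (M.interaction (n₀ + Γ.card * m'))
      M.statistics B {x | ∀ i, x i ∈ Λ} (k₀ * κ' ^ Γ.card)
      (M.energy Λ₀ n₀ k₀ ω +
      ∑ γ ∈ Γ, M.energy (cube 𝒢 d L) m' κ' (((L + r : ℕ) : ℤ) • γ +ᵥ ω) +
        (n₀ + Γ.card * m' : ℕ) * (m' * tailBound d C lam r) + ε) := by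
    intro ε hε
    have h1 := hM.hasTrialSpace_cells (N := fun _ => m') (κ := fun _ => κ') (m := m') hr hΓ
      (fun _ _ => ⟨hm', le_rfl⟩) (fun _ _ => hκ') (fun _ _ => h)
      (Finset.sum_const_nat fun _ _ => rfl) ω (half_pos hε)
    rw [Finset.prod_const] at h1
    have h2 := HasTrialSpace.add_cells hM.tempered hM.measurable_interaction hM.stable (hM.loc ω)
      hM.dim_pos hr2 hr.le rfl hn₀ (Nat.mul_pos hΓ.card_pos hm') hk₀
      (Nat.one_le_pow _ _ hκ') (D₁ := {x | ∀ i, x i ∈ Λ₀}) (D := {x | ∀ i, x i ∈ Λ})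
      (fun x hx i γ hγ y hy => hsep (x i) (hx i) γ hγ y hy)
      (hM.hasTrialSpace_add hΛ₀ hk₀ h₀ ω (half_pos hε)) h1 (fun I x hx y hy i => by
        rcases (I.equiv rfl).surjective i with ⟨j | j, rfl⟩
        · rw [merge_inl]; exact hsub₀ (hx j)
        · rw [merge_inr]
          obtain ⟨γ, hγ, hyγ⟩ := hy.1 j
          exact hsub γ hγ hyγ)
    refine h2.mono_energy (le_of_eq ?_)
    push_cast
    rw [Model.energy]
    ring
  exact ⟨(key 1 one_pos).isAttainable hM hΛ hpos,
    le_of_forall_pos_le_add fun ε hε => hM.energy_le hpos (key ε hε)⟩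

end Cells

/-- A single particle has no interaction, so any nonzero test function will do. This accommodates
the particles left over when `n` is not a multiple of the block size. -/
theorem isAttainable_one (hM : M.IsRegular P K B C₀ r₀ C lam) {L : ℕ} (hL : 1 ≤ L) :
    M.IsAttainable B (cube 𝒢 d L) 1 1 := by
  obtain ⟨φ, hφ, hne⟩ : ∃ φ ∈ testSubmodule {x : Fin 1 → Site 𝒢 d | ∀ i, x i ∈ cube 𝒢 d L},
      φ ≠ 0 := by
    cases 𝒢
    · have h0 : Function.support (Set.indicator {0} fun _ => (1 : ℂ) :
          (Fin 1 → Site .lattice d) → ℂ) ⊆ {0} := Set.support_indicator_subset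
      have h1 := closure_minimal h0 isClosed_singleton
      refine ⟨Set.indicator {0} fun _ => 1, ⟨trivial, isCompact_singleton.of_isClosed_subset
        (isClosed_tsupport _) h1, h1.trans ?_⟩, fun h => ?_⟩
      · rintro _ rfl i
        exact fun l => ⟨le_rfl, Int.natCast_pos.2 hL⟩
      · have := congr_fun h 0
        simp at this
    · have hopen : IsOpen {x : Fin 1 → EuclideanSpace ℝ (Fin d) | ∀ i, ∀ l, 0 < x i l ∧ x i l < L} := by
        simp only [Set.ofPred_forall, Set.ofPred_and]
        refine isOpen_iInter_of_finite fun i => isOpen_iInter_of_finite fun l => ?_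
        exact (isOpen_lt (by fun_prop) (by fun_prop)).inter (isOpen_lt (by fun_prop) (by fun_prop))
      have hL' : (1 : ℝ) ≤ L := by exact_mod_cast hL
      obtain ⟨f, h1, h2, h3, -, h4⟩ := exists_contDiff_tsupport_subset (n := ((⊤ : ℕ∞)))
        (hopen.mem_nhds (x := fun _ => WithLp.toLp 2 fun _ => (1 / 2 : ℝ)) fun i l =>
          ⟨by simp, by simp; linarith⟩)
      refine ⟨fun x => (f x : ℂ), ⟨?_, ?_, ?_⟩, fun h => ?_⟩
      · exact isSmooth_continuum_iff.2 (Complex.ofRealCLM.contDiff.comp h3)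
      · exact h2.comp_left (g := Complex.ofReal) Complex.ofReal_zero
      · refine Set.Subset.trans (closure_mono fun x hx => ?_) h1
        exact fun h => hx (by simp [h])
      · have := congr_fun h (fun _ => WithLp.toLp 2 fun _ => (1 / 2 : ℝ))
        simp only [h4] at this
        exact one_ne_zero (Complex.ofReal_one.symm.trans this)
  have hs : HasStatistics φ M.statistics := by
    cases M.statistics with
    | boltzmann => trivial
    | bose => intro π x; rw [Subsingleton.elim π 1]; rfl
    | fermi => intro π x; rw [Subsingleton.elim π 1]; simp
  have hc := continuous_of_mem_test hφ
  have hJ : shiftedForm B (M.interaction 1) φ ≠ ⊤ := by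
    have h1 : M.interaction 1 = fun _ => 0 := funext hM.tempered.one
    rw [h1, shiftedForm]
    simp only [zero_add]
    rw [lintegral_const_mul _ (by have := hc.measurable; fun_prop)]
    refine ENNReal.mul_ne_top (by simp) ?_
    rw [lintegral_enorm_sq (mem_testSubmodule_univ hφ)]
    exact ENNReal.ofReal_ne_top
  have hK : Bornology.IsBounded {x : Fin 1 → Site 𝒢 d | ∀ i, x i ∈ cube 𝒢 d L} :=
    isBounded_pow (isBounded_cube 𝒢 d L)
  obtain ⟨R, hR⟩ := hK.subset_closedBall 0
  let ψ : trialSubmodule (M.interaction 1) M.statistics B {x | ∀ i, x i ∈ cube 𝒢 d L}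
    (hM.measurable_interaction 1) := ⟨φ, hφ, hs, hJ⟩
  have hN := normSq_pos (mem_testSubmodule_univ hφ) hne
  set a := freeForm (0 : Site 𝒢 d → ℝ) φ + (shiftedForm B (M.interaction 1) φ).toReal with ha
  -- The energy exceeds the Rayleigh quotient `a / normSq φ` of this one function; `(1 : ℕ) * B`
  -- undoes the shift.
  obtain ⟨e', -, he'⟩ := exists_hasTrialSpace_of_gapForm_pos (hM.measurable_interaction 1)
    (v := (0 : Site 𝒢 d → ℝ)) (locallyIntegrable_const (0 : ℝ)) hR ((|a| + 1) / normSq φ - (1 : ℕ) * B)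
    le_rfl (fun _ => ψ) (fun c hc => by
      rw [sub_add_cancel, Fin.sum_univ_one, gapForm_smul, gapForm_formEmbedding _ hR]
      have h1 : ‖c 0‖ = 1 := by
        rw [mem_sphere_zero_iff_norm] at hc
        rw [← hc, Pi.norm_def]
        simp
      rw [h1]
      change 0 < 1 ^ 2 * ((|a| + 1) / normSq φ * normSq φ - a)
      rw [div_mul_cancel₀ _ hN.ne']
      have := le_abs_self a
      linarith)
  exact ⟨e', he'⟩

end Model.IsRegular

end RandomGas

namespace RandomGas

variable {𝒢 : Medium} {d : ℕ}

/-! ### Geometry of cubes and cells -/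

theorem volume_cube (𝒢 : Medium) (d L : ℕ) : volume (cube 𝒢 d L) = ENNReal.ofReal ((L : ℝ) ^ d) := by
  have h := volume_box_int (𝒢 := 𝒢) (d := d) (fun _ => 0) (fun _ => (L : ℤ)) fun _ => by positivity
  simp only [Int.cast_natCast, Int.cast_zero, sub_zero, Finset.prod_const, Finset.card_univ,
    Fintype.card_fin] at h
  cases 𝒢
  · rw [← h]
    congr 1
    refine Set.ext fun (x : Fin d → ℤ) => forall_congr' fun i => ?_
    change 0 ≤ x i ∧ x i < L ↔ (0 : ℝ) ≤ (x i : ℝ) ∧ (x i : ℝ) < L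
    exact_mod_cast Iff.rfl
  · have h := (PiLp.volume_preserving_ofLp (Fin d)).measure_preimage
      (s := Set.univ.pi fun i => Set.Ioo (0 : ℝ) L)
      (MeasurableSet.univ_pi fun i => measurableSet_Ioo).nullMeasurableSet
    rw [Real.volume_pi_Ioo] at h
    simp only [sub_zero, Finset.prod_const, Finset.card_univ, Fintype.card_fin] at h
    rw [ENNReal.ofReal_pow (Nat.cast_nonneg _), ← h]
    congr 1
    ext x
    exact ⟨fun h i _ => h i, fun h i => h i (Set.mem_univ i)⟩

theorem volume_cell (ℓ : ℕ) (γ : Fin d → ℤ) :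
    volume (cell 𝒢 d ℓ γ) = ENNReal.ofReal ((ℓ : ℝ) ^ d) := by
  rw [cell, volume_box_int _ _ fun i => by nlinarith [(Int.natCast_nonneg ℓ)]]
  congr 1
  refine (Finset.prod_eq_pow_card (b := (ℓ : ℝ)) fun i _ => ?_).trans (by simp)
  push_cast
  ring

theorem measurableSet_cell (ℓ : ℕ) (γ : Fin d → ℤ) : MeasurableSet (cell 𝒢 d ℓ γ) :=
  measurableSet_box _ _

theorem dist_le_of_mem_cell (hd : 1 ≤ d) {ℓ : ℕ} {γ : Fin d → ℤ} {x y : Site 𝒢 d}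
    (hx : x ∈ cell 𝒢 d ℓ γ) (hy : y ∈ cell 𝒢 d ℓ γ) : dist x y ≤ d * ℓ := by
  rw [dist_eq_norm]
  refine norm_le_of_abs_coord_le _ (fun i => ?_) hd
  rw [coord_sub, abs_le]
  have h1 := hx i
  have h2 := hy i
  push_cast at h1 h2
  constructor <;> linarith [h1.1, h1.2, h2.1, h2.2]

theorem finite_cells_meeting {ℓ : ℕ} (hℓ : 1 ≤ ℓ) {S : Set (Site 𝒢 d)}
    (hS : Bornology.IsBounded S) : {γ | (cell 𝒢 d ℓ γ ∩ S).Nonempty}.Finite := by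
  obtain ⟨R, hR⟩ := hS.subset_closedBall 0
  refine Set.Finite.subset (isCompact_closedBall (0 : Fin d → ℤ) (R + 1)).finite_of_discrete
    fun γ ⟨x, hx, hxS⟩ => ?_
  have hxR : ‖x‖ ≤ R := mem_closedBall_zero_iff.1 (hR hxS)
  have hℓ' : (1 : ℝ) ≤ ℓ := by exact_mod_cast hℓ
  rw [mem_closedBall_zero_iff, pi_norm_le_iff_of_nonneg (by linarith [norm_nonneg x])]
  intro i
  have h1 := abs_le.1 ((abs_coord_le_norm x i).trans hxR)
  have h2 := hx i
  push_cast at h2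
  rw [Int.norm_eq_abs, abs_le]
  constructor
  · by_contra! h
    nlinarith [h1.1, h2.2, norm_nonneg x]
  · by_contra! h
    nlinarith [h1.2, h2.1, norm_nonneg x]

theorem pairwiseDisjoint_cell {ℓ : ℕ} (hℓ : 1 ≤ ℓ) (s : Set (Fin d → ℤ)) :
    s.PairwiseDisjoint (cell 𝒢 d ℓ) := fun _ _ _ _ hne =>
  Set.disjoint_left.2 fun _ hx hy => hne (((mem_cell_iff hℓ).1 hx).symm.trans ((mem_cell_iff hℓ).1 hy))

theorem isBounded_collar {h : ℝ} {Λ : Set (Site 𝒢 d)} (hΛ : Bornology.IsBounded Λ) :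
    Bornology.IsBounded (collar h Λ) :=
  hΛ.thickening.subset Set.inter_subset_left

theorem volume_ne_top_of_isBounded {Λ : Set (Site 𝒢 d)} (hΛ : Bornology.IsBounded Λ) :
    volume Λ ≠ ⊤ := hΛ.measure_lt_top.ne

/-- The cells inside `Λ` cover `Λ` up to the collar. -/
theorem exists_inner_cells (hd : 1 ≤ d) {ℓ : ℕ} (hℓ : 1 ≤ ℓ) {Λ : Set (Site 𝒢 d)}
    (hΛ : Bornology.IsBounded Λ) : ∃ Γ : Finset (Fin d → ℤ), (∀ γ ∈ Γ, cell 𝒢 d ℓ γ ⊆ Λ) ∧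
      (volume Λ).toReal ≤ Γ.card * (ℓ : ℝ) ^ d + (volume (collar (d * ℓ + 1) Λ)).toReal := by
  classical
  refine ⟨(finite_cells_meeting hℓ hΛ).toFinset.filter fun γ => cell 𝒢 d ℓ γ ⊆ Λ,
    fun γ hγ => (Finset.mem_filter.1 hγ).2, ?_⟩
  set Γ := (finite_cells_meeting hℓ hΛ).toFinset.filter fun γ => cell 𝒢 d ℓ γ ⊆ Λ
  have hsub : Λ ⊆ (⋃ γ ∈ Γ, cell 𝒢 d ℓ γ) ∪ collar (d * ℓ + 1) Λ := by
    intro x hx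
    have hxc := (mem_cell_iff hℓ).2 (rfl : cellIndex ℓ x = _)
    by_cases hin : cell 𝒢 d ℓ (cellIndex ℓ x) ⊆ Λ
    · refine Or.inl (Set.mem_biUnion (x := cellIndex ℓ x) ?_ hxc)
      simp only [Γ, Finset.coe_filter, Set.Finite.mem_toFinset, Set.mem_ofPred_eq]
      exact ⟨⟨x, hxc, hx⟩, hin⟩
    -- A cell that leaves `Λ` has a point outside at distance at most `d * ℓ`; the extra 1 in the
    -- collar makes the inequality strict.
    · obtain ⟨y, hy, hyΛ⟩ := Set.not_subset.1 hin
      refine Or.inr ⟨Metric.self_subset_thickening (by positivity) _ hx,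
        Metric.mem_thickening_iff.2 ⟨y, hyΛ, ?_⟩⟩
      linarith [dist_le_of_mem_cell hd hxc hy]
  have hU : volume (⋃ γ ∈ Γ, cell 𝒢 d ℓ γ) ≤ ENNReal.ofReal (Γ.card * (ℓ : ℝ) ^ d) := by
    refine (measure_biUnion_finset_le _ _).trans ?_
    simp only [volume_cell, Finset.sum_const, nsmul_eq_mul]
    rw [ENNReal.ofReal_mul (Nat.cast_nonneg _), ENNReal.ofReal_natCast]
  have h1 := (measure_mono hsub).trans ((measure_union_le _ _).trans (add_le_add_left hU _))
  have hc := volume_ne_top_of_isBounded (isBounded_collar (h := d * ℓ + 1) hΛ)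
  have h2 := ENNReal.toReal_mono (ENNReal.add_ne_top.2 ⟨ENNReal.ofReal_ne_top, hc⟩) h1
  rwa [ENNReal.toReal_add ENNReal.ofReal_ne_top hc, ENNReal.toReal_ofReal (by positivity)] at h2

/-- The cells near `Λ` are covered by `Λ` and its collar. -/
theorem exists_outer_cells (hd : 1 ≤ d) {ℓ : ℕ} (hℓ : 1 ≤ ℓ) {Λ : Set (Site 𝒢 d)}
    (hΛ : Bornology.IsBounded Λ) (s : ℝ) : ∃ Γ : Finset (Fin d → ℤ),
      (∀ γ ∉ Γ, ∀ y ∈ cell 𝒢 d ℓ γ, ∀ x ∈ Λ, s ≤ dist x y) ∧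
      (∀ γ ∈ Γ, ∃ y ∈ cell 𝒢 d ℓ γ, ∃ x ∈ Λ, dist x y < s) ∧
      Γ.card * (ℓ : ℝ) ^ d ≤ (volume Λ).toReal + (volume (collar (s + d * ℓ) Λ)).toReal := by
  set Γ := (finite_cells_meeting hℓ (hΛ.thickening (δ := s))).toFinset with hΓ
  have hmem : ∀ γ ∈ Γ, ∃ y ∈ cell 𝒢 d ℓ γ, ∃ x ∈ Λ, dist x y < s := fun γ hγ => by
    obtain ⟨y, hy, hyΛ⟩ := (Set.Finite.mem_toFinset _).1 hγ
    obtain ⟨x, hx, hxy⟩ := Metric.mem_thickening_iff.1 hyΛ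
    exact ⟨y, hy, x, hx, by rwa [dist_comm]⟩
  refine ⟨Γ, fun γ hγ y hy x hx => ?_, hmem, ?_⟩
  · by_contra! h
    refine hγ ((Set.Finite.mem_toFinset _).2 ⟨y, hy, Metric.mem_thickening_iff.2 ⟨x, hx, ?_⟩⟩)
    rwa [dist_comm]
  · have hsub : (⋃ γ ∈ Γ, cell 𝒢 d ℓ γ) ⊆ Λ ∪ collar (s + d * ℓ) Λ := by
      refine Set.iUnion₂_subset fun γ hγ z hz => ?_
      obtain ⟨y, hy, x, hx, hxy⟩ := hmem γ hγ
      by_cases hzΛ : z ∈ Λ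
      · exact Or.inl hzΛ
      · have h1 := dist_le_of_mem_cell hd hz hy
        have h3 := dist_nonneg (x := x) (y := y)
        refine Or.inr ⟨Metric.mem_thickening_iff.2 ⟨x, hx, ?_⟩,
          Metric.self_subset_thickening ?_ _ hzΛ⟩
        · have := dist_triangle z y x
          rw [dist_comm y x] at this
          linarith
        · have : (0 : ℝ) ≤ d * ℓ := by positivity
          linarith
    have hU : volume (⋃ γ ∈ Γ, cell 𝒢 d ℓ γ) = ENNReal.ofReal (Γ.card * (ℓ : ℝ) ^ d) := by
      rw [measure_biUnion_finset (pairwiseDisjoint_cell hℓ _) fun γ _ => measurableSet_cell ℓ γ]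
      simp only [volume_cell, Finset.sum_const, nsmul_eq_mul]
      rw [ENNReal.ofReal_mul (Nat.cast_nonneg _), ENNReal.ofReal_natCast]
    have h1 := (measure_mono (μ := volume) hsub).trans (measure_union_le _ _)
    have hc := volume_ne_top_of_isBounded (isBounded_collar (h := s + d * ℓ) hΛ)
    have hΛt := volume_ne_top_of_isBounded hΛ
    have h2 := ENNReal.toReal_mono (ENNReal.add_ne_top.2 ⟨hΛt, hc⟩) h1
    rwa [ENNReal.toReal_add hΛt hc, hU, ENNReal.toReal_ofReal (by positivity)] at h2

/-! ### Consequences of Fisher's condition, and cubes as an example -/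

section Fisher

variable {Λ : ℕ → Set (Site 𝒢 d)}

theorem collar_mono {h h' : ℝ} (hh : h ≤ h') (S : Set (Site 𝒢 d)) : collar h S ⊆ collar h' S :=
  Set.inter_subset_inter (Metric.thickening_mono hh _) (Metric.thickening_mono hh _)

/-- Otherwise the domains would fit into balls of bounded volume. -/
theorem TendsToInfinity.tendsto_diam (hΛ : TendsToInfinity Λ) :
    Tendsto (fun j => Metric.diam (Λ j)) atTop atTop := by
  refine tendsto_atTop.2 fun b => ?_
  filter_upwards [hΛ.volume_tendsto.eventually_gt_atTop
    (volume (Metric.closedBall (0 : Site 𝒢 d) b)).toReal] with j hj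
  by_contra! hlt
  obtain ⟨x, hx⟩ := hΛ.nonempty j
  have hsub : Λ j ⊆ Metric.closedBall x b := fun y hy =>
    (Metric.dist_le_diam_of_mem (hΛ.isBounded j) hy hx).trans hlt.le
  have h1 := measure_mono (μ := volume) hsub
  rw [Measure.addHaar_closedBall_center] at h1
  exact hj.not_ge (ENNReal.toReal_mono (isCompact_closedBall _ _).measure_lt_top.ne h1)

/-- A fixed width `h` is eventually below `α * diam`, for every fixed `α`, and `π α` is as small as
desired. -/
theorem TendsToInfinity.tendsto_collar (hΛ : TendsToInfinity Λ) (h : ℝ) :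
    Tendsto (fun j => (volume (collar h (Λ j))).toReal / (volume (Λ j)).toReal) atTop (𝓝 0) := by
  obtain ⟨π, hπ, α₀, hα₀, hα⟩ := hΛ.shape
  refine Metric.tendsto_nhds.2 fun ε hε => ?_
  obtain ⟨α, h1, h2⟩ := ((hπ.eventually (gt_mem_nhds hε)).and
    (Ioo_mem_nhdsGT hα₀)).exists
  filter_upwards [hΛ.tendsto_diam.eventually_ge_atTop (h / α),
    hΛ.volume_tendsto.eventually_gt_atTop 0] with j hj hpos
  rw [Real.dist_0_eq_abs, abs_of_nonneg (by positivity), div_lt_iff₀ hpos]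
  rw [div_le_iff₀ h2.1, mul_comm] at hj
  have h3 := (measure_mono (collar_mono hj (Λ j))).trans (hα α h2.1 h2.2 j)
  have h4 := ENNReal.toReal_mono (ENNReal.mul_ne_top ENNReal.ofReal_ne_top
    (volume_ne_top_of_isBounded (hΛ.isBounded j))) h3
  rw [ENNReal.toReal_mul] at h4
  refine h4.trans_lt ((mul_lt_mul_iff_left₀ hpos).2 ?_)
  rcases le_total 0 (π α) with h5 | h5
  · rwa [ENNReal.toReal_ofReal h5]
  · rwa [ENNReal.ofReal_of_nonpos h5, ENNReal.toReal_zero]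

/-- Walk from a point of `S` in unit steps until `S` is left for the first time. This replaces a
boundary point, which does not exist on the lattice. -/
theorem exists_boundary_pair (hd : 1 ≤ d) {S : Set (Site 𝒢 d)} (hS : Bornology.IsBounded S)
    (hne : S.Nonempty) : ∃ p ∈ S, ∃ q ∉ S, dist p q ≤ 1 := by
  classical
  obtain ⟨x, hx⟩ := hne
  obtain ⟨R, hR⟩ := hS.subset_closedBall 0
  let u := unitVec 𝒢 d ⟨0, hd⟩
  have hu : ‖u‖ = 1 := norm_unitVec _
  have hcoord : ∀ m : ℕ, x + m • u ∉ S ∨ |coord 𝒢 d x ⟨0, hd⟩ + m| ≤ R := by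
    intro m
    by_contra! h
    have h1 := (abs_coord_le_norm _ (⟨0, hd⟩ : Fin d)).trans (mem_closedBall_zero_iff.1 (hR h.1))
    have h2 : coord 𝒢 d (m • u) ⟨0, hd⟩ = m := by
      cases 𝒢
      · change (((m • (Pi.single ⟨0, hd⟩ 1 : Fin d → ℤ)) ⟨0, hd⟩ : ℤ) : ℝ) = m
        simp
      · change ((m • (EuclideanSpace.single ⟨0, hd⟩ (1 : ℝ)) : EuclideanSpace ℝ (Fin d))) ⟨0, hd⟩ = m
        simp
    rw [coord_add, h2] at h1
    exact absurd h1 (not_le.2 h.2)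
  have hex : ∃ m : ℕ, x + m • u ∉ S := by
    obtain ⟨m, hm⟩ := exists_nat_gt (R - coord 𝒢 d x ⟨0, hd⟩)
    refine ⟨m, (hcoord m).resolve_right fun h => ?_⟩
    linarith [(abs_le.1 h).2]
  have hspec := Nat.find_spec hex
  have h0 : Nat.find hex ≠ 0 := fun h => by
    rw [h, zero_smul, add_zero] at hspec
    exact hspec hx
  obtain ⟨m, hm⟩ := Nat.exists_eq_succ_of_ne_zero h0
  refine ⟨x + m • u, not_not.1 (Nat.find_min hex (m := m) (by omega)), _, hspec, ?_⟩
  rw [hm, dist_add_left, Nat.succ_eq_add_one, add_smul, one_smul, dist_self_add_right, hu]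

/-- A collar of width `α * diam` contains a ball of almost that radius around a boundary pair. If `π
α < 1`, its volume is at most that of `Λ`. This keeps the cube that completes `Λ` in the lower bound
comparable with `Λ`. -/
theorem TendsToInfinity.exists_diam_pow_le (hd : 1 ≤ d) (hΛ : TendsToInfinity Λ) :
    ∃ c > 0, ∀ᶠ j in atTop, c * Metric.diam (Λ j) ^ d ≤ (volume (Λ j)).toReal := by
  obtain ⟨π, hπ, α₀, hα₀, hα⟩ := hΛ.shape
  obtain ⟨α, h1, h2⟩ := ((hπ.eventually (gt_mem_nhds one_pos)).and
    (Ioo_mem_nhdsGT hα₀)).exists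
  have hd' : (1 : ℝ) ≤ d := by exact_mod_cast hd
  refine ⟨(α / (8 * d)) ^ d, pow_pos (div_pos h2.1 (by positivity)) _, ?_⟩
  filter_upwards [hΛ.tendsto_diam.eventually_ge_atTop (8 * d / α)] with j hj
  set R := α * Metric.diam (Λ j) with hRdef
  rw [div_le_iff₀ h2.1, mul_comm (Metric.diam _), ← hRdef] at hj
  obtain ⟨p, hp, q, hq, hpq⟩ := exists_boundary_pair hd (hΛ.isBounded j) (hΛ.nonempty j)
  have hsub : Metric.ball p (R - 1) ⊆ collar R (Λ j) := fun x hx => by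
    rw [Metric.mem_ball] at hx
    refine ⟨Metric.mem_thickening_iff.2 ⟨p, hp, by linarith⟩,
      Metric.mem_thickening_iff.2 ⟨q, hq, ?_⟩⟩
    have := dist_triangle x p q
    linarith
  -- An integer side for which `volume_cell` applies: at most `R / (4 d)`, so that the cell fits
  -- into the ball, and at least `R / (8 d)` despite the rounding.
  set s := ⌊R / (4 * d)⌋₊ with hs
  have hR4 : 2 ≤ R / (4 * d) := by rw [le_div_iff₀ (by positivity)]; linarith
  have hs1 : R / (8 * d) ≤ s := by
    have h3 := Nat.lt_floor_add_one (R / (4 * d))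
    have h4 : R / (8 * d) = R / (4 * d) / 2 := by field_simp; ring
    rw [h4]
    linarith
  have hs2 : (s : ℝ) ≤ R / (4 * d) := Nat.floor_le (by linarith)
  have hball : cell 𝒢 d s 0 ⊆ Metric.ball 0 (R - 1) := fun x hx => by
    rw [mem_ball_zero_iff]
    refine (norm_le_of_abs_coord_le x (M := s) (fun i => ?_) hd).trans_lt ?_
    · have := hx i
      simp only [Pi.zero_apply, mul_zero, Int.cast_zero, zero_add, mul_one, Int.cast_natCast] at this
      rw [abs_of_nonneg this.1]
      exact this.2.le
    · rw [le_div_iff₀ (by positivity)] at hs2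
      nlinarith
  have h3 := (measure_mono (μ := volume) hball)
  rw [volume_cell, ← Measure.addHaar_ball_center volume p] at h3
  have h4 := h3.trans ((measure_mono hsub).trans (hα α h2.1 h2.2 j))
  have h5 : ENNReal.ofReal (π α) * volume (Λ j) ≤ volume (Λ j) := by
    calc _ ≤ 1 * volume (Λ j) := by gcongr; exact ENNReal.ofReal_le_one.2 h1.le
      _ = _ := one_mul _
  have h6 := ENNReal.toReal_mono (volume_ne_top_of_isBounded (hΛ.isBounded j)) (h4.trans h5)
  rw [ENNReal.toReal_ofReal (by positivity)] at h6
  refine le_trans ?_ h6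
  rw [← mul_pow]
  refine pow_le_pow_left₀ (by have := Metric.diam_nonneg (s := Λ j); have := h2.1; positivity) ?_ d
  rwa [div_mul_eq_mul_div]

theorem of_notMem_cube {L : ℕ} {x : Site 𝒢 d} (hx : x ∉ cube 𝒢 d L) :
    ∃ i, coord 𝒢 d x i ≤ 0 ∨ L ≤ coord 𝒢 d x i := by
  by_contra! h
  refine hx ?_
  cases 𝒢
  · intro i
    have := h i
    change 0 < ((x i : ℤ) : ℝ) ∧ ((x i : ℤ) : ℝ) < L at this
    exact ⟨(by exact_mod_cast this.1.le), by exact_mod_cast this.2⟩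
  · exact fun i => h i

/-- The neighbourhood of the two faces of the cube that are orthogonal to the `i`-th axis. -/
theorem collar_cube_subset (L : ℕ) (h : ℝ) : collar h (cube 𝒢 d L) ⊆ ⋃ p : Fin d × Bool,
    box 𝒢 d (fun l => if l = p.1 then (if p.2 then (L : ℝ) else 0) - h else -h)
      (fun l => if l = p.1 then (if p.2 then (L : ℝ) else 0) + h else L + h) := by
  rintro x ⟨hx1, hx2⟩
  obtain ⟨y, hy, hxy⟩ := Metric.mem_thickening_iff.1 hx1
  obtain ⟨z, hz, hxz⟩ := Metric.mem_thickening_iff.1 hx2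
  have habs : ∀ {u : Site 𝒢 d}, dist x u < h → ∀ i, |coord 𝒢 d x i - coord 𝒢 d u i| < h := by
    intro u hu i
    rw [← coord_sub]
    exact (abs_coord_le_norm _ _).trans_lt (by rwa [← dist_eq_norm])
  have hall : ∀ l, -h < coord 𝒢 d x l ∧ coord 𝒢 d x l < L + h := fun l => by
    have h1 := abs_lt.1 (habs hxy l)
    have h2 := coord_of_mem_cube hy l
    constructor <;> linarith [h1.1, h1.2, h2.1, h2.2]
  obtain ⟨i, hi⟩ := of_notMem_cube hz
  have h1 := abs_lt.1 (habs hxz i)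
  have h2 := hall i
  rw [Set.mem_iUnion]
  rcases hi with hi | hi
  · refine ⟨(i, false), fun l => ?_⟩
    by_cases hl : l = i
    · subst hl
      simp only [if_true, Bool.false_eq_true, if_false]
      constructor <;> linarith [h1.1, h1.2]
    · simp only [hl, if_false]
      exact ⟨(hall l).1.le, (hall l).2⟩
  · refine ⟨(i, true), fun l => ?_⟩
    by_cases hl : l = i
    · subst hl
      simp only [if_true]
      constructor <;> linarith [h1.1, h1.2]
    · simp only [hl, if_false]
      exact ⟨(hall l).1.le, (hall l).2⟩

/-- The number of integers in `[a, b)` can exceed `b - a`, but by less than 1. -/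
theorem volume_box_le {a b w : Fin d → ℝ} (h : ∀ i, b i - a i ≤ w i)
    (h' : 𝒢 = .lattice → ∀ i, b i - a i + 1 ≤ w i) :
    volume (box 𝒢 d a b) ≤ ∏ i, ENNReal.ofReal (w i) := by
  cases 𝒢
  · rw [volume_box_lattice]
    refine Finset.prod_le_prod' fun i _ => ?_
    rw [← ENNReal.ofReal_natCast]
    refine ENNReal.ofReal_le_ofReal_iff'.2 ?_
    by_cases h0 : ⌈b i⌉ - ⌈a i⌉ ≤ 0
    · right
      rw [Int.toNat_of_nonpos h0]
      simp
    · left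
      have h1 : (((⌈b i⌉ - ⌈a i⌉).toNat : ℤ) : ℝ) = ⌈b i⌉ - ⌈a i⌉ := by
        rw [Int.toNat_of_nonneg (by omega)]
        push_cast; rfl
      rw [Int.cast_natCast] at h1
      rw [h1]
      have := h' rfl i
      linarith [Int.ceil_lt_add_one (b i), Int.le_ceil (a i)]
  · rw [volume_box_continuum]
    exact Finset.prod_le_prod' fun i _ => ENNReal.ofReal_le_ofReal (h i)

/-- Distinct lattice points have distance at least 1. This settles thin collars, for which an
additional 1 in the thickness could not be absorbed. -/
theorem collar_eq_empty_of_le_one {h : ℝ} (hh : h ≤ 1) (S : Set (Site .lattice d)) :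
    collar h S = ∅ := by
  have key : ∀ x y : Site .lattice d, dist x y < h → x = y := fun x y hxy => by
    by_contra hne
    obtain ⟨i, hi⟩ := Function.ne_iff.1 hne
    have h1 := (abs_coord_le_norm (x - y) i)
    rw [← dist_eq_norm, coord_sub] at h1
    have h2 : (1 : ℤ) ≤ |x i - y i| := Int.one_le_abs (sub_ne_zero.2 hi)
    have h3 : (1 : ℝ) ≤ |(x i : ℝ) - (y i : ℝ)| := by exact_mod_cast h2
    exact absurd (h3.trans h1) (by linarith)
  refine Set.eq_empty_of_forall_notMem fun x ⟨h1, h2⟩ => ?_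
  obtain ⟨y, hy, hxy⟩ := Metric.mem_thickening_iff.1 h1
  obtain ⟨z, hz, hxz⟩ := Metric.mem_thickening_iff.1 h2
  exact hz ((key x z hxz).symm.trans (key x y hxy) ▸ hy)

/-- The neighbourhood of each of the `2 d` faces has thickness `2 h`. Counting lattice points adds
at most 1, which is below `h` unless the collar is empty; hence `3 h`. -/
theorem volume_collar_cube_le {L : ℕ} {h : ℝ} (hh : 0 ≤ h) :
    volume (collar h (cube 𝒢 d L)) ≤
      ENNReal.ofReal (2 * d * (3 * h * (L + 3 * h) ^ (d - 1))) := by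
  by_cases hc : 𝒢 = .lattice ∧ h ≤ 1
  · obtain ⟨rfl, h1⟩ := hc
    rw [collar_eq_empty_of_le_one h1]
    simp
  refine (measure_mono (collar_cube_subset L h)).trans ((measure_iUnion_fintype_le _ _).trans ?_)
  have hbox : ∀ p : Fin d × Bool, volume (box 𝒢 d
      (fun l => if l = p.1 then (if p.2 then (L : ℝ) else 0) - h else -h)
      (fun l => if l = p.1 then (if p.2 then (L : ℝ) else 0) + h else L + h)) ≤
      ENNReal.ofReal (3 * h * (L + 3 * h) ^ (d - 1)) := by
    intro p
    refine (volume_box_le (w := fun l => if l = p.1 then 3 * h else L + 3 * h) (fun l => ?_)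
      (fun h𝒢 l => ?_)).trans (le_of_eq ?_)
    · split_ifs <;> linarith
    · have : 1 < h := by
        by_contra! h1
        exact hc ⟨h𝒢, h1⟩
      split_ifs <;> linarith
    · rw [← Finset.mul_prod_erase _ _ (Finset.mem_univ p.1), if_pos rfl,
        ENNReal.ofReal_mul (p := 3 * h) (by positivity), ENNReal.ofReal_pow (by positivity)]
      congr 1
      refine (Finset.prod_eq_pow_card (b := ENNReal.ofReal (L + 3 * h)) fun l hl => ?_).trans (by simp)
      rw [if_neg (Finset.ne_of_mem_erase hl)]
  refine (Finset.sum_le_sum fun p _ => hbox p).trans (le_of_eq ?_)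
  rw [Finset.sum_const, nsmul_eq_mul, ENNReal.ofReal_mul (p := 2 * d) (by positivity)]
  congr 1
  simp [Fintype.card_prod, mul_comm]

theorem isOpen_cube (𝒢 : Medium) (d L : ℕ) : IsOpen (cube 𝒢 d L) := by
  cases 𝒢
  · exact isOpen_discrete _
  · have : IsOpen {x : EuclideanSpace ℝ (Fin d) | ∀ l, 0 < x l ∧ x l < L} := by
      simp only [Set.ofPred_forall, Set.ofPred_and]
      refine isOpen_iInter_of_finite fun l => ?_
      exact (isOpen_lt (by fun_prop) (by fun_prop)).inter (isOpen_lt (by fun_prop) (by fun_prop))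
    exact this

theorem toReal_volume_cube (𝒢 : Medium) (d L : ℕ) : (volume (cube 𝒢 d L)).toReal = (L : ℝ) ^ d := by
  rw [volume_cube, ENNReal.toReal_ofReal (by positivity)]

theorem diam_cube_le (hd : 1 ≤ d) (L : ℕ) : Metric.diam (cube 𝒢 d L) ≤ d * L := by
  refine Metric.diam_le_of_forall_dist_le (by positivity) fun x hx y hy => ?_
  rw [dist_eq_norm]
  refine norm_le_of_abs_coord_le _ (fun i => ?_) hd
  have h1 := coord_of_mem_cube hx i
  have h2 := coord_of_mem_cube hy i
  rw [coord_sub, abs_le]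
  constructor <;> linarith [h1.1, h1.2, h2.1, h2.2]

/-- Growing cubes tend to infinity in the sense of Fisher. -/
theorem tendsToInfinity_cube (hd : 1 ≤ d) {L : ℕ → ℕ} (hL : Tendsto L atTop atTop)
    (hL1 : ∀ j, 1 ≤ L j) : TendsToInfinity fun j => cube 𝒢 d (L j) where
  isOpen j := isOpen_cube 𝒢 d (L j)
  isBounded j := isBounded_cube 𝒢 d (L j)
  nonempty j := by
    refine nonempty_of_measure_ne_zero (μ := volume) ?_
    rw [volume_cube]
    have : (0 : ℝ) < L j := by exact_mod_cast hL1 j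
    exact (ENNReal.ofReal_pos.2 (by positivity)).ne'
  volume_tendsto := by
    simp only [toReal_volume_cube]
    exact (tendsto_pow_atTop (by omega)).comp (tendsto_natCast_atTop_atTop.comp hL)
  shape := by
    refine ⟨fun α => 2 * d * (3 * (α * d) * (1 + 3 * (α * d)) ^ (d - 1)), ?_, 1, one_pos,
      fun α hα _ j => ?_⟩
    · have : Tendsto (fun α : ℝ => 2 * d * (3 * (α * d) * (1 + 3 * (α * d)) ^ (d - 1))) (𝓝 0)
          (𝓝 (2 * d * (3 * (0 * d) * (1 + 3 * (0 * d)) ^ (d - 1)))) :=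
        (by fun_prop : Continuous _).tendsto 0
      simp only [zero_mul, mul_zero] at this
      exact this.mono_left nhdsWithin_le_nhds
    · have hdiam := diam_cube_le (𝒢 := 𝒢) hd (L j)
      have h0 := Metric.diam_nonneg (s := cube 𝒢 d (L j))
      refine (volume_collar_cube_le (by positivity)).trans ?_
      rw [volume_cube, ← ENNReal.ofReal_mul (by positivity)]
      refine ENNReal.ofReal_le_ofReal ?_
      have h1 : α * Metric.diam (cube 𝒢 d (L j)) ≤ α * d * L j := by
        rw [mul_assoc]; gcongr
      have hpow : (L j : ℝ) ^ d = L j * (L j : ℝ) ^ (d - 1) := by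
        rw [← pow_succ', Nat.sub_add_cancel hd]
      calc 2 * d * (3 * (α * Metric.diam (cube 𝒢 d (L j))) *
          (L j + 3 * (α * Metric.diam (cube 𝒢 d (L j)))) ^ (d - 1))
          ≤ 2 * d * (3 * (α * d * L j) * (L j + 3 * (α * d * L j)) ^ (d - 1)) := by gcongr
        _ = _ := by
          rw [hpow, show (L j + 3 * (α * d * L j) : ℝ) = (1 + 3 * (α * d)) * L j by ring, mul_pow]
          ring

end Fisher

end RandomGas

namespace RandomGas

variable {𝒢 : Medium} {d : ℕ}

/-! ### Upper bounds for the energy density from blocks of cubes -/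

/-- The only place where `λ > d` matters beyond summability: with corridors proportional to the
side, the tail per pair of blocks decays like `L ^ (-λ)` and beats the number of particles, of order
`L ^ d`. -/
theorem tendsto_pow_mul_tailBound {C lam : ℝ} (hC : 0 ≤ C) (hlam : (d : ℝ) < lam) {θ : ℝ} (hθ : 0 < θ) :
    Tendsto (fun L : ℕ => (L : ℝ) ^ d * tailBound d C lam ⌊θ * L⌋₊) atTop (𝓝 0) := by
  have hlam0 : 0 < lam := (Nat.cast_nonneg d).trans_lt hlam
  have h1 : Tendsto (fun L : ℕ => C * ((θ / 8) ^ (-lam) * latticeSum d lam) *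
      (L : ℝ) ^ (-(lam - d))) atTop (𝓝 (C * ((θ / 8) ^ (-lam) * latticeSum d lam) * 0)) :=
    ((tendsto_rpow_neg_atTop (sub_pos.2 hlam)).comp tendsto_natCast_atTop_atTop).const_mul _
  rw [mul_zero] at h1
  refine squeeze_zero' (Eventually.of_forall fun L =>
    mul_nonneg (by positivity) (tailBound_nonneg hC lam _)) ?_ h1
  filter_upwards [(tendsto_natCast_atTop_atTop (R := ℝ)).eventually_ge_atTop (2 / θ)] with L hL
  have hL0 : (0 : ℝ) < L := lt_of_lt_of_le (by positivity) hL
  rw [div_le_iff₀ hθ] at hL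
  -- Rounding costs at most half of `θ L` once `θ L ≥ 2`.
  have h2 : θ / 8 * L ≤ (⌊θ * L⌋₊ : ℝ) / 4 := by
    have := Nat.lt_floor_add_one (θ * L)
    nlinarith
  have h3 : ((⌊θ * L⌋₊ : ℝ) / 4) ^ (-lam) ≤ (θ / 8 * L) ^ (-lam) :=
    Real.rpow_le_rpow_of_nonpos (by positivity) h2 (by linarith)
  rw [Real.mul_rpow (by positivity) hL0.le] at h3
  calc (L : ℝ) ^ d * tailBound d C lam ⌊θ * L⌋₊
      ≤ (L : ℝ) ^ d * (C * ((θ / 8) ^ (-lam) * (L : ℝ) ^ (-lam) * latticeSum d lam)) := by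
        rw [tailBound]
        have := latticeSum_nonneg (d := d) lam
        gcongr
    _ = C * ((θ / 8) ^ (-lam) * latticeSum d lam) * ((L : ℝ) ^ (d : ℝ) * (L : ℝ) ^ (-lam)) := by
        rw [Real.rpow_natCast]; ring
    _ = _ := by rw [← Real.rpow_add hL0]; congr 2; ring

variable {Ω : Type*}

/-- There are trial spaces of dimension `k` for `m` particles in the cube of side `L`. -/
structure Model.IsBlock (M : Model 𝒢 d Ω) (B : ℝ) (L m k : ℕ) : Prop where
  side_pos : 1 ≤ L
  particles_pos : 1 ≤ m
  index_pos : 1 ≤ k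
  attainable : M.IsAttainable B (cube 𝒢 d L) m k

variable [MeasurableSpace Ω]

/-- There is a block of density larger than `ρ` and entropy per particle larger than `σ` whose energy
per particle, increased by a bound for the interaction with other blocks, is less than `g`. -/
def Model.HasBound (M : Model 𝒢 d Ω) (P : Measure Ω) (B r₀ C lam ρ σ g : ℝ) : Prop :=
  ∃ L r m k : ℕ, r₀ < r ∧ M.IsBlock B L m k ∧ ρ * ((L : ℝ) + r) ^ d < m ∧ σ * m < Real.log k ∧
    M.meanEnergy P (cube 𝒢 d L) m k / m + m * tailBound d C lam r < g

variable {M : Model 𝒢 d Ω} {P : Measure Ω} {K : Ω → ℝ} {B C₀ r₀ C lam ρ σ g : ℝ}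

theorem Model.HasBound.mono {ρ' σ' g' : ℝ} (h : M.HasBound P B r₀ C lam ρ σ g) (hρ : ρ' ≤ ρ)
    (hσ : σ' ≤ σ) (hg : g ≤ g') : M.HasBound P B r₀ C lam ρ' σ' g' := by
  obtain ⟨L, r, m, k, h1, h2, h3, h4, h5⟩ := h
  exact ⟨L, r, m, k, h1, h2, lt_of_le_of_lt (by gcongr) h3, lt_of_le_of_lt (by gcongr) h4,
    h5.trans_le hg⟩

/-- All inequalities that define a bound are strict. This openness yields upper semicontinuity of
the energy density and provides the slack for all later approximations. -/
theorem Model.HasBound.exists_lt (h : M.HasBound P B r₀ C lam ρ σ g) :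
    ∃ ρ' > ρ, ∃ σ' > σ, ∃ g' < g, M.HasBound P B r₀ C lam ρ' σ' g' := by
  obtain ⟨L, r, m, k, h1, h2, h3, h4, h5⟩ := h
  have hL : (1 : ℝ) ≤ L := by exact_mod_cast h2.side_pos
  have hm : (0 : ℝ) < m := by exact_mod_cast h2.particles_pos
  have hv : (0 : ℝ) < ((L : ℝ) + r) ^ d := by positivity
  obtain ⟨g', hg1, hg2⟩ := exists_between h5
  rw [← lt_div_iff₀ hv] at h3
  rw [← lt_div_iff₀ hm] at h4
  obtain ⟨ρ', hρ1, hρ2⟩ := exists_between h3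
  obtain ⟨σ', hσ1, hσ2⟩ := exists_between h4
  exact ⟨ρ', hρ1, σ', hσ1, g', hg2, L, r, m, k, h1, h2, (lt_div_iff₀ hv).1 hρ2,
    (lt_div_iff₀ hm).1 hσ2, hg1⟩

variable [AddAction (Fin d → ℤ) Ω] [MeasurableConstVAdd (Fin d → ℤ) Ω]
  [VAddInvariantMeasure (Fin d → ℤ) Ω P]

theorem integral_vadd_eq (f : Ω → ℝ) (γ : Fin d → ℤ) : ∫ ω, f (γ +ᵥ ω) ∂P = ∫ ω, f ω ∂P :=
  (measurePreserving_vadd γ P).integral_comp (MeasurableEquiv.vadd γ).measurableEmbedding f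

variable [IsProbabilityMeasure P]

namespace Model.IsRegular

theorem memLp_energy (hM : M.IsRegular P K B C₀ r₀ C lam) {Λ : Set (Site 𝒢 d)} {n k : ℕ}
    (hΛ : Bornology.IsBounded Λ) (hk : 1 ≤ k) (h : M.IsAttainable B Λ n k) :
    MemLp (M.energy Λ n k) 2 P := hM.memLp_eigenvalue hΛ hk h

theorem memLp_energy_vadd (hM : M.IsRegular P K B C₀ r₀ C lam) {Λ : Set (Site 𝒢 d)} {n k : ℕ}
    (hΛ : Bornology.IsBounded Λ) (hk : 1 ≤ k) (h : M.IsAttainable B Λ n k) (γ : Fin d → ℤ) :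
    MemLp (fun ω => M.energy Λ n k (γ +ᵥ ω)) 2 P :=
  (hM.memLp_eigenvalue hΛ hk h).comp_measurePreserving (measurePreserving_vadd γ P)

theorem neg_le_meanEnergy_div (hM : M.IsRegular P K B C₀ r₀ C lam) {Λ : Set (Site 𝒢 d)} {n k : ℕ}
    (hΛ : Bornology.IsBounded Λ) (hk : 1 ≤ k) (h : M.IsAttainable B Λ n k) (hn : 1 ≤ n) :
    -(C₀ + B) ≤ M.meanEnergy P Λ n k / n := by
  have hn' : (0 : ℝ) < n := by exact_mod_cast hn
  rw [le_div_iff₀ hn', Model.meanEnergy]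
  have h1 := integral_mono (μ := P) (integrable_const (-(n * (C₀ + B))))
    ((hM.memLp_energy hΛ hk h).integrable one_le_two) (hM.neg_le_energy hΛ hk h)
  simp only [integral_const, probReal_univ, one_smul] at h1
  linarith

theorem neg_lt_of_hasBound (hM : M.IsRegular P K B C₀ r₀ C lam)
    (h : M.HasBound P B r₀ C lam ρ σ g) : -(C₀ + B) < g := by
  obtain ⟨L, r, m, k, h1, h2, h3, h4, h5⟩ := h
  have h6 := hM.neg_le_meanEnergy_div (isBounded_cube 𝒢 d L) h2.index_pos h2.attainable
    h2.particles_pos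
  have h7 : 0 ≤ m * tailBound d C lam r :=
    mul_nonneg (Nat.cast_nonneg _) (tailBound_nonneg hM.tempered.tail_nonneg lam r)
  linarith

theorem cellCube_subset_cube {L ℓ N : ℕ} (hL : L ≤ ℓ) {γ : Fin d → ℤ}
    (hγ : ∀ i, 0 ≤ γ i ∧ γ i < N) : cellCube 𝒢 d L ℓ γ ⊆ cube 𝒢 d (N * ℓ) := by
  intro x hx
  cases 𝒢
  · intro i
    have h1 := hx i
    change 0 ≤ x i - ((ℓ : ℤ) • γ) i ∧ x i - ((ℓ : ℤ) • γ) i < L at h1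
    rw [Pi.smul_apply, smul_eq_mul] at h1
    have h2 := hγ i
    have h3 : (L : ℤ) ≤ ℓ := by exact_mod_cast hL
    push_cast
    constructor
    · nlinarith
    · nlinarith
  · intro i
    have h1 := hx i
    change 0 < coord .continuum d (x - shift .continuum d ((ℓ : ℤ) • γ)) i ∧
      coord .continuum d (x - shift .continuum d ((ℓ : ℤ) • γ)) i < L at h1
    change 0 < coord .continuum d x i ∧ coord .continuum d x i < (N * ℓ : ℕ)
    rw [coord_sub, coord_shift, Pi.smul_apply, smul_eq_mul] at h1
    push_cast at h1 ⊢
    have h2 : (0 : ℝ) ≤ γ i := by exact_mod_cast (hγ i).1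
    have h4 : (γ i : ℝ) + 1 ≤ N := by exact_mod_cast (hγ i).2
    have h3 : (L : ℝ) ≤ ℓ := by exact_mod_cast hL
    constructor
    · nlinarith
    · nlinarith

/-- Blocks of two types fill a larger cube. -/
theorem isBlock_mix (hM : M.IsRegular P K B C₀ r₀ C lam) {L r m m₁ m₂ k₁ k₂ N q₁ q₂ : ℕ}
    (hr : r₀ < r) (h₁ : M.IsBlock B L m₁ k₁) (h₂ : M.IsBlock B L m₂ k₂) (hm₁ : m₁ ≤ m)
    (hm₂ : m₂ ≤ m) (hN : 1 ≤ N) (hq : q₁ + q₂ = N ^ d) :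
    M.IsBlock B (N * (L + r)) (q₁ * m₁ + q₂ * m₂) (k₁ ^ q₁ * k₂ ^ q₂) ∧
    M.meanEnergy P (cube 𝒢 d (N * (L + r))) (q₁ * m₁ + q₂ * m₂) (k₁ ^ q₁ * k₂ ^ q₂) ≤
      q₁ * M.meanEnergy P (cube 𝒢 d L) m₁ k₁ + q₂ * M.meanEnergy P (cube 𝒢 d L) m₂ k₂ +
        (q₁ * m₁ + q₂ * m₂) * (m * tailBound d C lam r) := by
  classical
  let Γ : Finset (Fin d → ℤ) := Fintype.piFinset fun _ => Finset.Ico 0 (N : ℤ)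
  have hΓ : Γ.card = N ^ d := by simp [Γ]
  obtain ⟨Γ₁, hΓ₁, hc₁⟩ := Finset.exists_subset_card_eq (s := Γ) (n := q₁) (by omega)
  have hc₂ : (Γ \ Γ₁).card = q₂ := by rw [Finset.card_sdiff_of_subset hΓ₁]; omega
  have hmem : ∀ γ ∈ Γ, ∀ i, 0 ≤ γ i ∧ γ i < N := fun γ hγ i =>
    Finset.mem_Ico.1 (Fintype.mem_piFinset.1 hγ i)
  have hNd : 1 ≤ N ^ d := Nat.one_le_pow _ _ hN
  have hne : Γ.Nonempty := Finset.card_pos.1 (by omega)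
  have hsplit : ∀ {A : Type} [CommMonoid A] (f g : (Fin d → ℤ) → A),
      ∏ γ ∈ Γ, (if γ ∈ Γ₁ then f γ else g γ) = (∏ γ ∈ Γ₁, f γ) * ∏ γ ∈ Γ \ Γ₁, g γ := by
    intro A _ f g
    rw [← Finset.prod_sdiff hΓ₁, mul_comm]
    congr 1
    · exact Finset.prod_congr rfl fun γ hγ => if_pos hγ
    · exact Finset.prod_congr rfl fun γ hγ => if_neg (Finset.mem_sdiff.1 hγ).2
  have hsplit' : ∀ {A : Type} [AddCommMonoid A] (f g : (Fin d → ℤ) → A),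
      ∑ γ ∈ Γ, (if γ ∈ Γ₁ then f γ else g γ) = (∑ γ ∈ Γ₁, f γ) + ∑ γ ∈ Γ \ Γ₁, g γ := by
    intro A _ f g
    exact hsplit (A := Multiplicative A) f g
  have hn : ∑ γ ∈ Γ, (if γ ∈ Γ₁ then m₁ else m₂) = q₁ * m₁ + q₂ * m₂ := by
    rw [hsplit']
    simp [hc₁, hc₂]
  have hk : ∏ γ ∈ Γ, (if γ ∈ Γ₁ then k₁ else k₂) = k₁ ^ q₁ * k₂ ^ q₂ := by
    rw [hsplit]
    simp [hc₁, hc₂]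
  have hkpos : 1 ≤ k₁ ^ q₁ * k₂ ^ q₂ :=
    Nat.mul_pos (pow_pos h₁.index_pos _) (pow_pos h₂.index_pos _)
  have hnpos : 1 ≤ q₁ * m₁ + q₂ * m₂ := by
    have := h₁.particles_pos
    have := h₂.particles_pos
    nlinarith
  obtain ⟨h3, h4⟩ := hM.energy_cells_le (m := m) (N := fun γ => if γ ∈ Γ₁ then m₁ else m₂)
    (κ := fun γ => if γ ∈ Γ₁ then k₁ else k₂) hr hne
    (fun γ _ => by
      split_ifs
      exacts [⟨h₁.particles_pos, hm₁⟩, ⟨h₂.particles_pos, hm₂⟩])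
    (fun γ _ => by
      split_ifs
      exacts [h₁.index_pos, h₂.index_pos])
    (fun γ _ => by
      split_ifs
      exacts [h₁.attainable, h₂.attainable])
    (isBounded_cube 𝒢 d (N * (L + r)))
    (fun γ hγ => cellCube_subset_cube (Nat.le_add_right L r) (hmem γ hγ)) hkpos hk.ge hn
  refine ⟨⟨Nat.mul_pos hN (h₁.side_pos.trans (Nat.le_add_right _ _)), hnpos, hkpos, h3⟩, ?_⟩
  have h5 : ∀ ω, M.energy (cube 𝒢 d (N * (L + r))) (q₁ * m₁ + q₂ * m₂) (k₁ ^ q₁ * k₂ ^ q₂) ω ≤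
      ∑ γ ∈ Γ₁, M.energy (cube 𝒢 d L) m₁ k₁ (((L + r : ℕ) : ℤ) • γ +ᵥ ω) +
      ∑ γ ∈ Γ \ Γ₁, M.energy (cube 𝒢 d L) m₂ k₂ (((L + r : ℕ) : ℤ) • γ +ᵥ ω) +
        ((q₁ * m₁ + q₂ * m₂ : ℕ) : ℝ) * (m * tailBound d C lam r) := fun ω => by
    refine (h4 ω).trans (le_of_eq ?_)
    rw [← hsplit']
    congr 1
    refine Finset.sum_congr rfl fun γ _ => ?_
    split_ifs <;> rfl
  have hi₁ : ∀ γ ∈ Γ₁, Integrable (fun ω => M.energy (cube 𝒢 d L) m₁ k₁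
      (((L + r : ℕ) : ℤ) • γ +ᵥ ω)) P := fun γ _ => (hM.memLp_energy_vadd (isBounded_cube 𝒢 d L)
      h₁.index_pos h₁.attainable _).integrable one_le_two
  have hi₂ : ∀ γ ∈ Γ \ Γ₁, Integrable (fun ω => M.energy (cube 𝒢 d L) m₂ k₂
      (((L + r : ℕ) : ℤ) • γ +ᵥ ω)) P := fun γ _ => (hM.memLp_energy_vadd (isBounded_cube 𝒢 d L)
      h₂.index_pos h₂.attainable _).integrable one_le_two
  have h6 := integral_mono (μ := P) ((hM.memLp_energy (isBounded_cube 𝒢 d (N * (L + r))) hkpos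
    h3).integrable one_le_two) (((integrable_finsetSum _ hi₁).add (integrable_finsetSum _ hi₂)).add
      (integrable_const _)) h5
  refine h6.trans (le_of_eq ?_)
  rw [integral_add' ((integrable_finsetSum _ hi₁).add (integrable_finsetSum _ hi₂))
    (integrable_const _), integral_add' (integrable_finsetSum _ hi₁) (integrable_finsetSum _ hi₂),
    integral_finsetSum _ hi₁, integral_finsetSum _ hi₂]
  simp only [integral_vadd_eq (P := P) (M.energy (cube 𝒢 d L) _ _), Finset.sum_const, hc₁, hc₂,
    integral_const, probReal_univ, one_smul, nsmul_eq_mul, Model.meanEnergy]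
  push_cast
  rfl

/-- Blocks that realise a given bound, in cubes of any large side in an arithmetic progression. -/
theorem exists_block_of_hasBound (hM : M.IsRegular P K B C₀ r₀ C lam) (hρ : 0 ≤ ρ)
    (h : M.HasBound P B r₀ C lam ρ σ g) {ε : ℝ} (hε : 0 < ε) :
    ∃ L₀ ≥ 1, ∃ θ₀ > 0, ∀ θ : ℝ, 0 < θ → θ < θ₀ → ∀ᶠ N : ℕ in atTop,
      r₀ < ⌊θ * (N * L₀ : ℕ)⌋₊ ∧ ∃ m k, M.IsBlock B (N * L₀) m k ∧
        ρ * (((N * L₀ : ℕ) : ℝ) + ⌊θ * (N * L₀ : ℕ)⌋₊) ^ d < m ∧ σ * m < Real.log k ∧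
        M.meanEnergy P (cube 𝒢 d (N * L₀)) m k / m < g ∧
        m * tailBound d C lam ⌊θ * (N * L₀ : ℕ)⌋₊ < ε := by
  obtain ⟨L, r, m, k, h1, h2, h3, h4, h5⟩ := h
  have hm : (0 : ℝ) < m := by exact_mod_cast h2.particles_pos
  have hℓ : 1 ≤ L + r := h2.side_pos.trans (Nat.le_add_right _ _)
  have hℓ' : (0 : ℝ) < ((L + r : ℕ) : ℝ) := by exact_mod_cast hℓ
  have hcont : Tendsto (fun θ : ℝ => ρ * ((L : ℝ) + r) ^ d * (1 + θ) ^ d) (𝓝 0)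
      (𝓝 (ρ * ((L : ℝ) + r) ^ d * (1 + 0) ^ d)) := (by fun_prop : Continuous _).tendsto 0
  rw [add_zero, one_pow, mul_one] at hcont
  -- Corridors of relative width `θ` around the enlarged block dilute the density by `(1 + θ) ^ d`;
  -- the strict density inequality allows this for small `θ`.
  obtain ⟨θ₀, hθ₀, hball⟩ := Metric.eventually_nhds_iff.1 (hcont.eventually (gt_mem_nhds h3))
  refine ⟨L + r, hℓ, θ₀, hθ₀, fun θ hθ hθθ => ?_⟩
  have hdens : ρ * ((L : ℝ) + r) ^ d * (1 + θ) ^ d < m :=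
    hball (by rwa [Real.dist_0_eq_abs, abs_of_pos hθ])
  have hD : Tendsto (fun N : ℕ => N * (L + r)) atTop atTop :=
    tendsto_id.atTop_mul_const' hℓ
  have hDr : Tendsto (fun N : ℕ => ((N * (L + r) : ℕ) : ℝ)) atTop atTop :=
    tendsto_natCast_atTop_atTop.comp hD
  have htail := ((tendsto_pow_mul_tailBound hM.tempered.tail_nonneg hM.tempered.decay hθ).comp
    hD).const_mul (m / ((L + r : ℕ) : ℝ) ^ d)
  rw [mul_zero] at htail
  filter_upwards [eventually_ge_atTop 1, htail.eventually (gt_mem_nhds hε),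
    (tendsto_nat_floor_atTop.comp (hDr.const_mul_atTop hθ)).eventually_gt_atTop ⌈r₀⌉₊]
    with N hN h6 h7
  refine ⟨(Nat.le_ceil r₀).trans_lt (by exact_mod_cast h7), ?_⟩
  -- The enlarged block consists of `N ^ d` copies of one block.
  obtain ⟨h8, h9⟩ := hM.isBlock_mix (m := m) h1 h2 h2 le_rfl le_rfl hN (add_zero (N ^ d))
  simp only [zero_mul, add_zero, pow_zero, mul_one, Nat.cast_zero] at h8 h9
  have hN' : (0 : ℝ) < (N : ℝ) ^ d := by
    have : (0 : ℝ) < N := by exact_mod_cast hN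
    positivity
  refine ⟨_, _, h8, ?_, ?_, ?_, ?_⟩
  · have hfl : (⌊θ * (N * (L + r) : ℕ)⌋₊ : ℝ) ≤ θ * (N * (L + r) : ℕ) :=
      Nat.floor_le (by positivity)
    calc ρ * (((N * (L + r) : ℕ) : ℝ) + ⌊θ * (N * (L + r) : ℕ)⌋₊) ^ d
        ≤ ρ * (((N * (L + r) : ℕ) : ℝ) + θ * (N * (L + r) : ℕ)) ^ d := by gcongr
      _ = N ^ d * (ρ * ((L : ℝ) + r) ^ d * (1 + θ) ^ d) := by
        push_cast
        rw [show (N : ℝ) * (L + r) + θ * (N * (L + r)) = N * ((L + r) * (1 + θ)) by ring, mul_pow,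
          mul_pow]
        ring
      _ < N ^ d * m := by gcongr
      _ = _ := by push_cast; ring
  · push_cast
    rw [Real.log_pow]
    push_cast
    calc σ * (N ^ d * m) = N ^ d * (σ * m) := by ring
      _ < N ^ d * Real.log k := by gcongr
  · refine lt_of_le_of_lt ?_ h5
    have hpos : (0 : ℝ) < ((N ^ d * m : ℕ) : ℝ) := by push_cast; positivity
    rw [div_le_iff₀ hpos]
    refine h9.trans (le_of_eq ?_)
    push_cast
    field_simp
  · refine lt_of_le_of_lt (le_of_eq ?_) h6
    have hid : ∀ t : ℝ, ((N ^ d * m : ℕ) : ℝ) * t =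
        m / ((L + r : ℕ) : ℝ) ^ d * (((N * (L + r) : ℕ) : ℝ) ^ d * t) := fun t => by
      rw [Nat.cast_mul N (L + r), mul_pow, Nat.cast_mul, Nat.cast_pow]
      generalize ((L + r : ℕ) : ℝ) = y at hℓ'
      field_simp
    exact hid _

end Model.IsRegular

end RandomGas

namespace RandomGas

variable {𝒢 : Medium} {d : ℕ}

/-! ### Convexity of the bounds -/

section Mix

variable {Ω : Type*} [MeasurableSpace Ω] {M : Model 𝒢 d Ω} {P : Measure Ω} {K : Ω → ℝ}
  {B C₀ r₀ C lam ρ σ g : ℝ}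
  [AddAction (Fin d → ℤ) Ω] [MeasurableConstVAdd (Fin d → ℤ) Ω]
  [VAddInvariantMeasure (Fin d → ℤ) Ω P] [IsProbabilityMeasure P]

namespace Model.IsRegular

/-- A large cube is filled with blocks of two kinds such that a fraction `a` of the particles, not
of the cells, sits in the first kind. Energy and entropy per particle are then averaged with weights
`a`, `b`, and so is the volume per particle, which is why convexity holds in `ρ⁻¹`. -/
theorem hasBound_of_blocks (hM : M.IsRegular P K B C₀ r₀ C lam) {D r m₁ m₂ k₁ k₂ : ℕ} {a b : ℝ}
    (hr : r₀ < r) (h₁ : M.IsBlock B D m₁ k₁) (h₂ : M.IsBlock B D m₂ k₂) (ha : 0 < a) (hb : 0 < b)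
    (hab : a + b = 1) (hρ : 0 < ρ) (hdens : ρ * ((D : ℝ) + r) ^ d * (a / m₁ + b / m₂) < 1)
    (hent : σ < a * (Real.log k₁ / m₁) + b * (Real.log k₂ / m₂))
    (hen : a * (M.meanEnergy P (cube 𝒢 d D) m₁ k₁ / m₁) +
      b * (M.meanEnergy P (cube 𝒢 d D) m₂ k₂ / m₂) + max m₁ m₂ * tailBound d C lam r < g) :
    M.HasBound P B r₀ C lam ρ σ g := by
  have hd := hM.dim_pos
  set E₁ := M.meanEnergy P (cube 𝒢 d D) m₁ k₁
  set E₂ := M.meanEnergy P (cube 𝒢 d D) m₂ k₂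
  have hm₁ : (0 : ℝ) < m₁ := by exact_mod_cast h₁.particles_pos
  have hm₂ : (0 : ℝ) < m₂ := by exact_mod_cast h₂.particles_pos
  have hℓ : 1 ≤ D + r := h₁.side_pos.trans (Nat.le_add_right _ _)
  have hℓ' : (0 : ℝ) < ((D + r : ℕ) : ℝ) := by exact_mod_cast hℓ
  have hv : 0 < ((D : ℝ) + r) ^ d := by rw [← Nat.cast_add]; positivity
  set s : ℝ := a / m₁ + b / m₂ with hs
  have hs0 : 0 < s := by positivity
  -- The fraction of cells of the first kind: a cell of that kind holds `m₁` particles, so cells are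
  -- weighted with `a / m₁`. On average a cell then holds `s⁻¹` particles.
  set p : ℝ := a / m₁ / s with hp
  have hp0 : 0 ≤ p := by positivity
  have hq : 1 - p = b / m₂ / s := by
    rw [hp, eq_div_iff hs0.ne', sub_mul, div_mul_cancel₀ _ hs0.ne', hs]; ring
  have hp1 : p ≤ 1 := by
    have : 0 ≤ b / m₂ / s := by positivity
    linarith
  have hpm : p * m₁ + (1 - p) * m₂ = s⁻¹ := by
    rw [hq, hp]
    field_simp
    exact hab
  have hD : Tendsto (fun N : ℕ => N * (D + r)) atTop atTop := tendsto_id.atTop_mul_const' hℓ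
  have hDr : Tendsto (fun N : ℕ => ((N * (D + r) : ℕ) : ℝ)) atTop atTop :=
    tendsto_natCast_atTop_atTop.comp hD
  have hNd : Tendsto (fun N : ℕ => (N : ℝ) ^ d) atTop atTop :=
    (tendsto_pow_atTop (by omega)).comp tendsto_natCast_atTop_atTop
  -- The fraction `p` is only approximated; the strict inequalities survive for large `N`.
  let q : ℕ → ℕ := fun N => ⌊p * (N : ℝ) ^ d⌋₊
  have hqle : ∀ N, q N ≤ N ^ d := fun N => by
    refine Nat.floor_le_of_le ?_
    push_cast
    exact mul_le_of_le_one_left (by positivity) hp1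
  let x : ℕ → ℝ := fun N => q N / (N : ℝ) ^ d
  have hx : Tendsto x atTop (𝓝 p) := (tendsto_nat_floor_mul_div_atTop hp0).comp hNd
  have hy : Tendsto (fun N => 1 - x N) atTop (𝓝 (1 - p)) := hx.const_sub 1
  have hlin : ∀ u v : ℝ, Tendsto (fun N => x N * u + (1 - x N) * v) atTop
      (𝓝 (p * u + (1 - p) * v)) := fun u v => (hx.mul_const u).add (hy.mul_const v)
  have hn := hlin m₁ m₂
  rw [hpm] at hn
  have hcont : Tendsto (fun θ : ℝ => ρ * ((D : ℝ) + r) ^ d * (1 + θ) ^ d) (𝓝[>] 0)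
      (𝓝 (ρ * ((D : ℝ) + r) ^ d * (1 + 0) ^ d)) :=
    ((by fun_prop : Continuous _).tendsto 0).mono_left nhdsWithin_le_nhds
  rw [add_zero, one_pow, mul_one] at hcont
  obtain ⟨θ, hθd, hθ⟩ := ((hcont.eventually (gt_mem_nhds
    (by rwa [← one_div, lt_div_iff₀ hs0] :
      ρ * ((D : ℝ) + r) ^ d < s⁻¹))).and self_mem_nhdsWithin).exists
  have hθ : 0 < θ := hθ
  have htail := ((tendsto_pow_mul_tailBound hM.tempered.tail_nonneg hM.tempered.decay hθ).comp
    hD).const_mul (1 / ((D + r : ℕ) : ℝ) ^ d)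
  rw [mul_zero] at htail
  have hgap : Tendsto (fun N => x N * Real.log k₁ + (1 - x N) * Real.log k₂ -
      σ * (x N * m₁ + (1 - x N) * m₂)) atTop
      (𝓝 (p * Real.log k₁ + (1 - p) * Real.log k₂ - σ * s⁻¹)) := (hlin _ _).sub (hn.const_mul σ)
  have hgap0 : 0 < p * Real.log k₁ + (1 - p) * Real.log k₂ - σ * s⁻¹ := by
    have : p * Real.log k₁ + (1 - p) * Real.log k₂ - σ * s⁻¹ =
        (a * (Real.log k₁ / m₁) + b * (Real.log k₂ / m₂) - σ) * s⁻¹ := by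
      rw [hq, hp]; field_simp
    rw [this]
    exact mul_pos (sub_pos.2 hent) (inv_pos.2 hs0)
  -- Energy per particle, tail between the small blocks, and tail of the new block in its own
  -- corridor, of which the last vanishes.
  have hE : Tendsto (fun N => (x N * E₁ + (1 - x N) * E₂) / (x N * m₁ + (1 - x N) * m₂) +
      max m₁ m₂ * tailBound d C lam r + (x N * m₁ + (1 - x N) * m₂) *
        (1 / ((D + r : ℕ) : ℝ) ^ d * (((N * (D + r) : ℕ) : ℝ) ^ d *
          tailBound d C lam ⌊θ * (N * (D + r) : ℕ)⌋₊))) atTop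
      (𝓝 ((p * E₁ + (1 - p) * E₂) / s⁻¹ + max m₁ m₂ * tailBound d C lam r + s⁻¹ * 0)) :=
    (((hlin _ _).div hn (inv_ne_zero hs0.ne')).add_const _).add (hn.mul htail)
  have hE0 : (p * E₁ + (1 - p) * E₂) / s⁻¹ + max m₁ m₂ * tailBound d C lam r + s⁻¹ * 0 < g := by
    refine lt_of_eq_of_lt ?_ hen
    rw [hq, hp]; field_simp; ring
  obtain ⟨N, hN1, hNn, hNr, hNk, hNE⟩ := ((eventually_ge_atTop 1).and
    ((hn.eventually (lt_mem_nhds hθd)).and (((tendsto_nat_floor_atTop.comp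
      (hDr.const_mul_atTop hθ)).eventually_gt_atTop ⌈r₀⌉₊).and
    ((hgap.eventually (lt_mem_nhds hgap0)).and (hE.eventually (gt_mem_nhds hE0)))))).exists
  have hNpos : (0 : ℝ) < (N : ℝ) ^ d := by
    have : (0 : ℝ) < N := by exact_mod_cast hN1
    positivity
  obtain ⟨h3, h4⟩ := hM.isBlock_mix (m := max m₁ m₂) (q₁ := q N) (q₂ := N ^ d - q N) hr h₁ h₂
    (le_max_left _ _) (le_max_right _ _) hN1 (Nat.add_sub_of_le (hqle N))
  have hxq : (q N : ℝ) = x N * (N : ℝ) ^ d := (div_mul_cancel₀ _ hNpos.ne').symm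
  have hyq : ((N ^ d - q N : ℕ) : ℝ) = (1 - x N) * (N : ℝ) ^ d := by
    rw [Nat.cast_sub (hqle N), hxq]; push_cast; ring
  have hcast : ((q N * m₁ + (N ^ d - q N) * m₂ : ℕ) : ℝ) =
      (x N * m₁ + (1 - x N) * m₂) * (N : ℝ) ^ d := by
    rw [Nat.cast_add, Nat.cast_mul, Nat.cast_mul, hyq, hxq]; ring
  have hnpos : 0 < x N * m₁ + (1 - x N) * m₂ := lt_of_le_of_lt (by positivity) hNn
  refine ⟨N * (D + r), ⌊θ * (N * (D + r) : ℕ)⌋₊, _, _, (Nat.le_ceil r₀).trans_lt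
    (by exact_mod_cast hNr), h3, ?_, ?_, ?_⟩
  · rw [hcast]
    have hfl : (⌊θ * (N * (D + r) : ℕ)⌋₊ : ℝ) ≤ θ * (N * (D + r) : ℕ) :=
      Nat.floor_le (by positivity)
    calc ρ * (((N * (D + r) : ℕ) : ℝ) + ⌊θ * (N * (D + r) : ℕ)⌋₊) ^ d
        ≤ ρ * (((N * (D + r) : ℕ) : ℝ) + θ * (N * (D + r) : ℕ)) ^ d := by gcongr
      _ = (ρ * ((D : ℝ) + r) ^ d * (1 + θ) ^ d) * N ^ d := by
        push_cast
        rw [show (N : ℝ) * (D + r) + θ * (N * (D + r)) = N * ((D + r) * (1 + θ)) by ring, mul_pow,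
          mul_pow]
        ring
      _ < _ := by gcongr
  · have hk₁ : (k₁ : ℝ) ≠ 0 := by have := h₁.index_pos; positivity
    have hk₂ : (k₂ : ℝ) ≠ 0 := by have := h₂.index_pos; positivity
    rw [hcast, Nat.cast_mul, Nat.cast_pow, Nat.cast_pow, Real.log_mul (pow_ne_zero _ hk₁)
      (pow_ne_zero _ hk₂), Real.log_pow, Real.log_pow, hyq, hxq]
    nlinarith
  · refine lt_of_le_of_lt ?_ hNE
    have h5 : M.meanEnergy P (cube 𝒢 d (N * (D + r))) (q N * m₁ + (N ^ d - q N) * m₂)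
        (k₁ ^ q N * k₂ ^ (N ^ d - q N)) ≤ ((x N * E₁ + (1 - x N) * E₂) +
          (x N * m₁ + (1 - x N) * m₂) * (max m₁ m₂ * tailBound d C lam r)) * (N : ℝ) ^ d := by
      refine h4.trans (le_of_eq ?_)
      rw [hyq, hxq]
      push_cast
      ring
    rw [hcast]
    refine add_le_add ?_ (le_of_eq ?_)
    · rw [div_le_iff₀ (by positivity)]
      refine h5.trans (le_of_eq ?_)
      have hid : ∀ A n T w : ℝ, n ≠ 0 → (A + n * T) * w = (A / n + T) * (n * w) := by
        intro A n T w hn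
        field_simp
      exact hid _ _ _ _ hnpos.ne'
    · rw [Nat.cast_mul N (D + r), mul_pow]
      generalize ((D + r : ℕ) : ℝ) = z at hℓ'
      field_simp

theorem hasBound_mix (hM : M.IsRegular P K B C₀ r₀ C lam) {ρ₁ ρ₂ σ₁ σ₂ g₁ g₂ a b : ℝ}
    (hρ₁ : 0 < ρ₁) (hρ₂ : 0 < ρ₂) (ha : 0 < a) (hb : 0 < b) (hab : a + b = 1)
    (h₁ : M.HasBound P B r₀ C lam ρ₁ σ₁ g₁) (h₂ : M.HasBound P B r₀ C lam ρ₂ σ₂ g₂) :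
    M.HasBound P B r₀ C lam (a * ρ₁⁻¹ + b * ρ₂⁻¹)⁻¹ (a * σ₁ + b * σ₂) (a * g₁ + b * g₂) := by
  obtain ⟨ρ₁', hρ₁', σ₁', hσ₁', g₁', hg₁, h₁'⟩ := h₁.exists_lt
  obtain ⟨ρ₂', hρ₂', σ₂', hσ₂', g₂', hg₂, h₂'⟩ := h₂.exists_lt
  -- The improvement available by openness pays for the tail between blocks.
  set ε := a * (g₁ - g₁') + b * (g₂ - g₂') with hε
  have hε0 : 0 < ε := add_pos (mul_pos ha (sub_pos.2 hg₁)) (mul_pos hb (sub_pos.2 hg₂))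
  obtain ⟨L₁, hL₁, θ₁, hθ₁, H₁⟩ := hM.exists_block_of_hasBound hρ₁.le
    (h₁'.mono hρ₁'.le hσ₁'.le le_rfl) hε0
  obtain ⟨L₂, hL₂, θ₂, hθ₂, H₂⟩ := hM.exists_block_of_hasBound hρ₂.le
    (h₂'.mono hρ₂'.le hσ₂'.le le_rfl) hε0
  have hθ : 0 < min θ₁ θ₂ := lt_min hθ₁ hθ₂
  have h3 := (tendsto_id.atTop_mul_const' hL₂).eventually
    (H₁ (min θ₁ θ₂ / 2) (half_pos hθ) ((half_lt_self hθ).trans_le (min_le_left _ _)))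
  have h4 := (tendsto_id.atTop_mul_const' hL₁).eventually
    (H₂ (min θ₁ θ₂ / 2) (half_pos hθ) ((half_lt_self hθ).trans_le (min_le_right _ _)))
  obtain ⟨N, e₁, e₂⟩ := (h3.and h4).exists
  simp only [id] at e₁ e₂
  -- Blocks of both kinds exist in cubes of the common side `N * L₂ * L₁`, and equal `θ` gives them
  -- equal corridors.
  rw [Nat.mul_right_comm] at e₂
  set D := N * L₂ * L₁
  set r := ⌊min θ₁ θ₂ / 2 * (D : ℝ)⌋₊
  obtain ⟨hr, m₁, k₁, hb₁, hd₁, hs₁, he₁, ht₁⟩ := e₁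
  obtain ⟨-, m₂, k₂, hb₂, hd₂, hs₂, he₂, ht₂⟩ := e₂
  have hm₁ : (0 : ℝ) < m₁ := by exact_mod_cast hb₁.particles_pos
  have hm₂ : (0 : ℝ) < m₂ := by exact_mod_cast hb₂.particles_pos
  have hD : (1 : ℝ) ≤ D := by exact_mod_cast hb₁.side_pos
  have hv : (0 : ℝ) < ((D : ℝ) + r) ^ d := by positivity
  have hsum : 0 < a * ρ₁⁻¹ + b * ρ₂⁻¹ := by positivity
  refine hM.hasBound_of_blocks hr hb₁ hb₂ ha hb hab (inv_pos.2 hsum) ?_ ?_ ?_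
  · rw [mul_assoc, inv_mul_lt_iff₀ hsum, mul_one, mul_add]
    refine add_lt_add ?_ ?_
    · rw [mul_div_assoc', div_lt_iff₀ hm₁]
      calc ((D : ℝ) + r) ^ d * a = a * ρ₁⁻¹ * (ρ₁ * ((D : ℝ) + r) ^ d) := by field_simp
        _ < _ := by gcongr
    · rw [mul_div_assoc', div_lt_iff₀ hm₂]
      calc ((D : ℝ) + r) ^ d * b = b * ρ₂⁻¹ * (ρ₂ * ((D : ℝ) + r) ^ d) := by field_simp
        _ < _ := by gcongr
  · rw [← lt_div_iff₀ hm₁] at hs₁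
    rw [← lt_div_iff₀ hm₂] at hs₂
    gcongr
  · have hmax : (max (m₁ : ℝ) m₂) * tailBound d C lam r < ε := by
      rcases max_choice (m₁ : ℝ) m₂ with h | h <;> rw [h] <;> assumption
    have := mul_lt_mul_of_pos_left he₁ ha
    have := mul_lt_mul_of_pos_left he₂ hb
    rw [hε] at hmax
    push_cast
    linarith

end Model.IsRegular

end Mix

end RandomGas

namespace RandomGas

variable {𝒢 : Medium} {d : ℕ}

/-! ### The upper bound in the thermodynamic limit -/

section Upper

variable {Ω : Type*} [MeasurableSpace Ω] {M : Model 𝒢 d Ω} {P : Measure Ω} {K : Ω → ℝ}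
  {B C₀ r₀ C lam ρ σ g : ℝ}
  [AddAction (Fin d → ℤ) Ω] [MeasurableConstVAdd (Fin d → ℤ) Ω]
  [VAddInvariantMeasure (Fin d → ℤ) Ω P] [IsProbabilityMeasure P]

namespace Model.IsRegular

section Sum

variable {L r : ℕ} {Γ : Finset (Fin d → ℤ)} {N κ : (Fin d → ℤ) → ℕ}

theorem memLp_sum_cells (hM : M.IsRegular P K B C₀ r₀ C lam) (ℓ : ℕ) (hκ : ∀ γ ∈ Γ, 1 ≤ κ γ)
    (h : ∀ γ ∈ Γ, M.IsAttainable B (cube 𝒢 d L) (N γ) (κ γ)) :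
    MemLp (∑ γ ∈ Γ, fun ω => M.energy (cube 𝒢 d L) (N γ) (κ γ) ((ℓ : ℤ) • γ +ᵥ ω)) 2 P :=
  memLp_finsetSum' Γ fun γ hγ =>
    hM.memLp_energy_vadd (isBounded_cube 𝒢 d L) (hκ γ hγ) (h γ hγ) _

/-- The variance of a sum over distant cells is of the order of the number of cells. -/
theorem variance_sum_cells_le (hM : M.IsRegular P K B C₀ r₀ C lam) (hr : r₀ < r)
    (hκ : ∀ γ ∈ Γ, 1 ≤ κ γ) (h : ∀ γ ∈ Γ, M.IsAttainable B (cube 𝒢 d L) (N γ) (κ γ)) :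
    variance (∑ γ ∈ Γ, fun ω => M.energy (cube 𝒢 d L) (N γ) (κ γ) (((L + r : ℕ) : ℤ) • γ +ᵥ ω)) P ≤
      ∑ γ ∈ Γ, ∫ ω, M.energy (cube 𝒢 d L) (N γ) (κ γ) ω ^ 2 ∂P := by
  have hmem : ∀ γ ∈ Γ, MemLp (fun ω => M.energy (cube 𝒢 d L) (N γ) (κ γ)
      (((L + r : ℕ) : ℤ) • γ +ᵥ ω)) 2 P := fun γ hγ =>
    hM.memLp_energy_vadd (isBounded_cube 𝒢 d L) (hκ γ hγ) (h γ hγ) _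
  rw [IndepFun.variance_sum hmem]
  · refine Finset.sum_le_sum fun γ hγ => ?_
    refine (variance_le_expectation_sq (hmem γ hγ).aestronglyMeasurable).trans (le_of_eq ?_)
    exact integral_vadd_eq (P := P) (fun ω => M.energy (cube 𝒢 d L) (N γ) (κ γ) ω ^ 2)
      (((L + r : ℕ) : ℤ) • γ)
  · intro γ hγ η hη hne
    have h1 := hM.indepFun_eigenvalue (n := N γ) (n' := N η) (isBounded_cellCube 𝒢 d L (L + r) γ)
      (isBounded_cellCube 𝒢 d L (L + r) η) (hκ γ hγ) (hκ η hη)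
      -- Corridors are wider than the range of dependence, so the energies in different cells are
      -- independent and variances add.
      fun x hx y hy => hr.trans_le (dist_cellCube_ne hne hx hy)
    have h2 := h1.comp (φ := EReal.toReal) (ψ := EReal.toReal) (by fun_prop) (by fun_prop)
    have e1 := fun γ => funext (hM.energy_cellCube (n := N γ) (k := κ γ) L (L + r) γ)
    have : IndepFun (M.energy (cellCube 𝒢 d L (L + r) γ) (N γ) (κ γ))
      (M.energy (cellCube 𝒢 d L (L + r) η) (N η) (κ η)) P := h2
    rwa [e1, e1] at this

end Sum

/-- Blocks and single particles fill `Λ`. -/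
theorem energy_le_blocks (hM : M.IsRegular P K B C₀ r₀ C lam) {L r m κ n k q s : ℕ}
    (hr : r₀ < r) (hb : M.IsBlock B L m κ) {Γ₁ Γ₂ : Finset (Fin d → ℤ)} (hdisj : Disjoint Γ₁ Γ₂)
    (hq : Γ₁.card = q) (hs : Γ₂.card = s) (hq1 : 1 ≤ q) (hn : q * m + s = n) (hk : 1 ≤ k)
    (hkκ : k ≤ κ ^ q) {Λ : Set (Site 𝒢 d)} (hΛ : Bornology.IsBounded Λ)
    (hsub : ∀ γ ∈ Γ₁ ∪ Γ₂, cellCube 𝒢 d L (L + r) γ ⊆ Λ) :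
    M.IsAttainable B Λ n k ∧ ∃ S : Ω → ℝ, MemLp S 2 P ∧
      ∫ ω, S ω ∂P = q * M.meanEnergy P (cube 𝒢 d L) m κ + s * M.meanEnergy P (cube 𝒢 d L) 1 1 ∧
      variance S P ≤ q * (∫ ω, M.energy (cube 𝒢 d L) m κ ω ^ 2 ∂P) +
        s * (∫ ω, M.energy (cube 𝒢 d L) 1 1 ω ^ 2 ∂P) ∧
      ∀ ω, M.energy Λ n k ω ≤ S ω + n * (m * tailBound d C lam r) := by
  classical
  have hone := hM.isAttainable_one hb.side_pos
  have hsplit : ∀ {A : Type} [CommMonoid A] (f g : (Fin d → ℤ) → A),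
      ∏ γ ∈ Γ₁ ∪ Γ₂, (if γ ∈ Γ₁ then f γ else g γ) = (∏ γ ∈ Γ₁, f γ) * ∏ γ ∈ Γ₂, g γ := by
    intro A _ f g
    rw [Finset.prod_union hdisj]
    congr 1
    · exact Finset.prod_congr rfl fun γ hγ => if_pos hγ
    · exact Finset.prod_congr rfl fun γ hγ => if_neg (Finset.disjoint_right.1 hdisj hγ)
  have hsplit' : ∀ {A : Type} [AddCommMonoid A] (f g : (Fin d → ℤ) → A),
      ∑ γ ∈ Γ₁ ∪ Γ₂, (if γ ∈ Γ₁ then f γ else g γ) = (∑ γ ∈ Γ₁, f γ) + ∑ γ ∈ Γ₂, g γ := by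
    intro A _ f g
    exact hsplit (A := Multiplicative A) f g
  let N : (Fin d → ℤ) → ℕ := fun γ => if γ ∈ Γ₁ then m else 1
  let k' : (Fin d → ℤ) → ℕ := fun γ => if γ ∈ Γ₁ then κ else 1
  have hN : ∀ γ, 1 ≤ N γ ∧ N γ ≤ m := fun γ => by
    dsimp only [N]
    split_ifs
    exacts [⟨hb.particles_pos, le_rfl⟩, ⟨le_rfl, hb.particles_pos⟩]
  have hk' : ∀ γ, 1 ≤ k' γ := fun γ => by
    dsimp only [k']
    split_ifs
    exacts [hb.index_pos, le_rfl]
  have hatt : ∀ γ, M.IsAttainable B (cube 𝒢 d L) (N γ) (k' γ) := fun γ => by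
    dsimp only [N, k']
    split_ifs
    exacts [hb.attainable, hone]
  have hF : ∀ F : ℕ → ℕ → ℝ, ∑ γ ∈ Γ₁ ∪ Γ₂, F (N γ) (k' γ) = q * F m κ + s * F 1 1 := fun F => by
    have : ∀ γ, F (N γ) (k' γ) = if γ ∈ Γ₁ then F m κ else F 1 1 := fun γ => by
      dsimp only [N, k']
      split_ifs <;> rfl
    simp only [this]
    rw [hsplit']
    simp [hq, hs]
  have hne : (Γ₁ ∪ Γ₂).Nonempty := (Finset.card_pos.1 (by omega : 0 < Γ₁.card)).mono
    Finset.subset_union_left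
  obtain ⟨h1, h2⟩ := hM.energy_cells_le (n := n) (k := k) hr hne (fun γ _ => hN γ) (fun γ _ => hk' γ)
    (fun γ _ => hatt γ) hΛ hsub hk (by
      have : ∏ γ ∈ Γ₁ ∪ Γ₂, k' γ = κ ^ q := by
        dsimp only [k']
        rw [hsplit]
        simp [hq]
      rwa [this]) (by
      dsimp only [N]
      rw [hsplit']
      simp [hq, hs, hn])
  refine ⟨h1, _, hM.memLp_sum_cells (Γ := Γ₁ ∪ Γ₂) (L + r) (fun γ _ => hk' γ) fun γ _ => hatt γ, ?_,
    (hM.variance_sum_cells_le hr (fun γ _ => hk' γ) fun γ _ => hatt γ).trans_eq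
      (hF fun a b => ∫ ω, M.energy (cube 𝒢 d L) a b ω ^ 2 ∂P), fun ω => ?_⟩
  · simp only [Finset.sum_apply]
    rw [integral_finsetSum _ fun γ _ => (hM.memLp_energy_vadd (isBounded_cube 𝒢 d L) (hk' γ)
      (hatt γ) _).integrable one_le_two]
    simp only [integral_vadd_eq (P := P) (M.energy (cube 𝒢 d L) _ _)]
    exact hF fun a b => M.meanEnergy P (cube 𝒢 d L) a b
  · rw [Finset.sum_apply]
    exact h2 ω

theorem tendsto_particles {Λ : ℕ → Set (Site 𝒢 d)} {n k : ℕ → ℕ} (hρ : 0 < ρ)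
    (hΛ : IsThermodynamicSequence Λ n k ρ σ) : Tendsto (fun j => (n j : ℝ)) atTop atTop := by
  have h1 := hΛ.density.pos_mul_atTop hρ hΛ.domains.volume_tendsto
  refine h1.congr' ?_
  filter_upwards [hΛ.domains.volume_tendsto.eventually_gt_atTop 0] with j hj
  exact div_mul_cancel₀ _ hj.ne'

/-- The upper bound for the energy per particle: it is bounded by random variables that converge in
mean square to a number below `g`. -/
theorem exists_upper_bound (hM : M.IsRegular P K B C₀ r₀ C lam) (hρ : 0 < ρ)
    (h : M.HasBound P B r₀ C lam ρ σ g) {Λ : ℕ → Set (Site 𝒢 d)} {n k : ℕ → ℕ}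
    (hΛ : IsThermodynamicSequence Λ n k ρ σ) : ∃ y < g, ∃ Y : ℕ → Ω → ℝ,
      (∀ᶠ j in atTop, M.IsAttainable B (Λ j) (n j) (k j) ∧ MemLp (Y j) 2 P ∧
        ∀ ω, M.energy (Λ j) (n j) (k j) ω / n j ≤ Y j ω) ∧
      Tendsto (fun j => ∫ ω, (Y j ω - y) ^ 2 ∂P) atTop (𝓝 0) := by
  have hd := hM.dim_pos
  obtain ⟨L, r, m, κ, hr, hb, hdens, hent, hen⟩ := h
  have hm : (0 : ℝ) < m := by exact_mod_cast hb.particles_pos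
  have hL : (1 : ℝ) ≤ L := by exact_mod_cast hb.side_pos
  have hℓ : 1 ≤ L + r := hb.side_pos.trans (Nat.le_add_right _ _)
  have hn := tendsto_particles hρ hΛ
  set v := fun j => (volume (Λ j)).toReal with hv
  have hvt : Tendsto v atTop atTop := hΛ.domains.volume_tendsto
  set E₁ := M.meanEnergy P (cube 𝒢 d L) m κ
  set E₂ := M.meanEnergy P (cube 𝒢 d L) 1 1
  set A₁ := ∫ ω, M.energy (cube 𝒢 d L) m κ ω ^ 2 ∂P
  set A₂ := ∫ ω, M.energy (cube 𝒢 d L) 1 1 ω ^ 2 ∂P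
  have hA₁ : 0 ≤ A₁ := integral_nonneg fun _ => sq_nonneg _
  have hA₂ : 0 ≤ A₂ := integral_nonneg fun _ => sq_nonneg _
  choose Γ hΓin hΓ using fun j => exists_inner_cells (𝒢 := 𝒢) hd hℓ (hΛ.domains.isBounded j)
  -- Division with remainder: `q` cells receive a block of `m` particles, and each of the `s < m`
  -- remaining particles a cell of its own.
  let q : ℕ → ℕ := fun j => n j / m
  let s : ℕ → ℕ := fun j => n j % m
  have hqs : ∀ j, q j * m + s j = n j := fun j => Nat.div_add_mod' (n j) m
  have hsm : ∀ j, (s j : ℝ) ≤ m := fun j => by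
    exact_mod_cast (Nat.mod_lt (n j) hb.particles_pos).le
  have hqs' : ∀ j, (q j : ℝ) * m + s j = n j := fun j => by exact_mod_cast hqs j
  have hs0 : Tendsto (fun j => (s j : ℝ) / n j) atTop (𝓝 0) := by
    refine squeeze_zero (fun j => by positivity) (fun j => ?_)
      (tendsto_const_nhds.div_atTop hn : Tendsto (fun j => (m : ℝ) / n j) atTop (𝓝 0))
    have := hsm j
    gcongr
  have hq0 : Tendsto (fun j => (q j : ℝ) / n j) atTop (𝓝 (1 / m)) := by
    have h1 : Tendsto (fun j => (1 - (s j : ℝ) / n j) / m) atTop (𝓝 ((1 - 0) / m)) :=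
      (hs0.const_sub 1).div_const _
    rw [sub_zero] at h1
    refine h1.congr' ?_
    filter_upwards [hn.eventually_gt_atTop 0] with j hj
    rw [← hqs' j] at hj ⊢
    field_simp
    ring
  -- There are enough cells because the block with its corridor is denser than `ρ`, while the collar
  -- and the bounded number of single particles are negligible.
  have hcard : ∀ᶠ j in atTop, q j + s j ≤ (Γ j).card := by
    have h1 : Tendsto (fun j => ((n j : ℝ) / v j / m + m / v j) * ((L + r : ℕ) : ℝ) ^ d +
        (volume (collar (d * (L + r : ℕ) + 1) (Λ j))).toReal / v j) atTop
        (𝓝 ((ρ / m + 0) * ((L + r : ℕ) : ℝ) ^ d + 0)) :=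
      (((hΛ.density.div_const _).add (tendsto_const_nhds.div_atTop hvt)).mul_const _).add
        (hΛ.domains.tendsto_collar _)
    have h2 : (ρ / m + 0) * ((L + r : ℕ) : ℝ) ^ d + 0 < 1 := by
      rw [add_zero, add_zero, div_mul_eq_mul_div, div_lt_one hm]
      exact_mod_cast hdens
    filter_upwards [h1.eventually (gt_mem_nhds h2), hvt.eventually_gt_atTop 0] with j hj hvj
    have h3 : ((n j : ℝ) / m + m) * ((L + r : ℕ) : ℝ) ^ d +
        (volume (collar (d * (L + r : ℕ) + 1) (Λ j))).toReal < v j := by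
      have h4 := mul_lt_mul_of_pos_right hj hvj
      rw [one_mul, add_mul, div_mul_cancel₀ _ hvj.ne', mul_right_comm, add_mul _ _ (v j),
        div_mul_cancel₀ _ hvj.ne', div_right_comm, div_mul_cancel₀ _ hvj.ne'] at h4
      exact h4
    have h4 := hΓ j
    have h5 : (0 : ℝ) < ((L + r : ℕ) : ℝ) ^ d := by positivity
    have h6 : ((n j : ℝ) / m + m) < (Γ j).card := by
      by_contra! h7
      have := mul_le_mul_of_nonneg_right h7 h5.le
      linarith
    have h8 : (q j : ℝ) ≤ n j / m := by
      rw [le_div_iff₀ hm]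
      have := hqs' j
      have : (0 : ℝ) ≤ s j := Nat.cast_nonneg _
      linarith
    have h9 : ((q j + s j : ℕ) : ℝ) ≤ (Γ j).card := by
      push_cast
      linarith [hsm j]
    exact_mod_cast h9
  -- The block has more entropy per particle than `σ`, so its copies provide sufficiently many
  -- dimensions.
  have hindex : ∀ᶠ j in atTop, k j ≤ κ ^ q j := by
    have h1 : Tendsto (fun j => (q j : ℝ) / n j * Real.log κ - Real.log (k j) / n j) atTop
        (𝓝 (1 / m * Real.log κ - σ)) := (hq0.mul_const _).sub hΛ.entropy
    have h2 : 0 < 1 / m * Real.log κ - σ := by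
      rw [sub_pos, one_div_mul_eq_div, lt_div_iff₀ hm]
      exact hent
    filter_upwards [h1.eventually (lt_mem_nhds h2), hn.eventually_gt_atTop 0] with j hj hnj
    have hkj : (0 : ℝ) < k j := by exact_mod_cast hΛ.index_pos j
    have hκ : (0 : ℝ) < κ := by exact_mod_cast hb.index_pos
    have h3 : Real.log (k j) ≤ Real.log ((κ : ℝ) ^ q j) := by
      rw [Real.log_pow]
      rw [div_mul_eq_mul_div, ← sub_div, div_pos_iff_of_pos_right hnj] at hj
      linarith
    rw [Real.log_le_log_iff hkj (by positivity)] at h3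
    exact_mod_cast h3
  have hq1 : ∀ᶠ j in atTop, 1 ≤ q j := by
    filter_upwards [hn.eventually_ge_atTop m] with j hj
    exact (Nat.one_le_div_iff hb.particles_pos).2 (by exact_mod_cast hj)
  have key : ∀ j, ∃ Y : Ω → ℝ, (q j + s j ≤ (Γ j).card ∧ k j ≤ κ ^ q j ∧ 1 ≤ q j →
      M.IsAttainable B (Λ j) (n j) (k j) ∧ MemLp Y 2 P ∧
      (∀ ω, M.energy (Λ j) (n j) (k j) ω / n j ≤ Y ω) ∧
      ∫ ω, (Y ω - (E₁ / m + m * tailBound d C lam r)) ^ 2 ∂P ≤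
        2 * ((A₁ + A₂) / n j) + 2 * ((q j : ℝ) / n j * E₁ + (s j : ℝ) / n j * E₂ - E₁ / m) ^ 2) := by
    intro j
    by_cases hj : q j + s j ≤ (Γ j).card ∧ k j ≤ κ ^ q j ∧ 1 ≤ q j
    swap
    · exact ⟨0, fun h => absurd h hj⟩
    obtain ⟨hc, hkj, hqj⟩ := hj
    obtain ⟨Γ', hΓ', hc'⟩ := Finset.exists_subset_card_eq hc
    obtain ⟨Γ₁, hΓ₁, hc₁⟩ := Finset.exists_subset_card_eq (s := Γ') (n := q j) (by omega)
    obtain ⟨h1, S, hS, hSm, hSv, hSe⟩ := hM.energy_le_blocks (n := n j) (k := k j) hr hb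
      (Finset.disjoint_sdiff (s := Γ₁) (t := Γ')) hc₁
      (show (Γ' \ Γ₁).card = s j by rw [Finset.card_sdiff_of_subset hΓ₁]; omega) hqj (hqs j)
      (hΛ.index_pos j) hkj (hΛ.domains.isBounded j) (fun γ hγ => by
        rw [Finset.union_sdiff_of_subset hΓ₁] at hγ
        exact (cellCube_subset_cell (Nat.le_add_right L r) γ).trans (hΓin j γ (hΓ' hγ)))
    have hnj : (0 : ℝ) < n j := by
      rw [← hqs' j]
      have : (1 : ℝ) ≤ q j := by exact_mod_cast hqj
      positivity
    refine ⟨fun ω => S ω / n j + m * tailBound d C lam r, fun _ => ⟨h1, ?_, fun ω => ?_, ?_⟩⟩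
    · exact (hS.mul_const ((n j : ℝ)⁻¹)).add (memLp_const _)
    · rw [div_le_iff₀ hnj, add_mul, div_mul_cancel₀ _ hnj.ne']
      linarith [hSe ω]
    · have hSi : Integrable (fun ω => (S ω - ∫ ω, S ω ∂P) ^ 2) P :=
        (hS.sub (memLp_const _)).integrable_sq
      have h2 : ∀ ω, (S ω / n j + m * tailBound d C lam r - (E₁ / m + m * tailBound d C lam r)) ^ 2 ≤
          2 / (n j : ℝ) ^ 2 * (S ω - ∫ ω, S ω ∂P) ^ 2 +
            2 * ((∫ ω, S ω ∂P) / n j - E₁ / m) ^ 2 := by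
        intro ω
        have h3 : 2 / (n j : ℝ) ^ 2 * (S ω - ∫ ω, S ω ∂P) ^ 2 =
            2 * (S ω / n j - (∫ ω, S ω ∂P) / n j) ^ 2 := by field_simp
        rw [h3]
        nlinarith [sq_nonneg ((S ω / n j - (∫ ω, S ω ∂P) / n j) - ((∫ ω, S ω ∂P) / n j - E₁ / m))]
      have h4 : Integrable (fun ω => 2 / (n j : ℝ) ^ 2 * (S ω - ∫ ω, S ω ∂P) ^ 2 +
          2 * ((∫ ω, S ω ∂P) / n j - E₁ / m) ^ 2) P := (hSi.const_mul _).add (integrable_const _)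
      refine (integral_mono_of_nonneg (Eventually.of_forall fun _ => sq_nonneg _) h4
        (Eventually.of_forall h2)).trans ?_
      rw [integral_add (hSi.const_mul _) (integrable_const _), integral_const_mul,
        ← variance_eq_integral hS.aestronglyMeasurable.aemeasurable]
      simp only [integral_const, probReal_univ, one_smul]
      refine add_le_add ?_ (le_of_eq ?_)
      · have h5 : variance S P ≤ n j * (A₁ + A₂) := by
          refine hSv.trans ?_
          have h6 : (q j : ℝ) ≤ n j := by exact_mod_cast Nat.div_le_self _ _
          have h7 : (s j : ℝ) ≤ n j := by exact_mod_cast Nat.mod_le _ _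
          rw [mul_add]
          gcongr
        calc 2 / (n j : ℝ) ^ 2 * variance S P ≤ 2 / (n j : ℝ) ^ 2 * (n j * (A₁ + A₂)) := by gcongr
          _ = _ := by field_simp
      · rw [hSm]
        congr 2
        ring
  choose Y hY using key
  refine ⟨_, hen, Y, ?_, ?_⟩
  · filter_upwards [hcard, hindex, hq1] with j h1 h2 h3
    obtain ⟨h4, h5, h6, -⟩ := hY j ⟨h1, h2, h3⟩
    exact ⟨h4, h5, h6⟩
  · have h1 : Tendsto (fun j => 2 * ((A₁ + A₂) / n j) +
        2 * ((q j : ℝ) / n j * E₁ + (s j : ℝ) / n j * E₂ - E₁ / m) ^ 2) atTop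
        (𝓝 (2 * 0 + 2 * (1 / m * E₁ + 0 * E₂ - E₁ / m) ^ 2)) :=
      ((tendsto_const_nhds.div_atTop hn).const_mul 2).add
        (((((hq0.mul_const _).add (hs0.mul_const _)).sub_const _).pow 2).const_mul 2)
    have h2 : 2 * 0 + 2 * (1 / m * E₁ + 0 * E₂ - E₁ / m) ^ 2 = 0 := by ring
    rw [h2] at h1
    refine squeeze_zero' (Eventually.of_forall fun j => integral_nonneg fun _ => sq_nonneg _) ?_ h1
    filter_upwards [hcard, hindex, hq1] with j h1 h2 h3
    exact (hY j ⟨h1, h2, h3⟩).2.2.2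

end Model.IsRegular

end Upper

end RandomGas

namespace RandomGas

variable {𝒢 : Medium} {d : ℕ}

/-! ### The lower bound in the thermodynamic limit -/

section Lower

variable {Ω : Type*} [MeasurableSpace Ω] {M : Model 𝒢 d Ω} {P : Measure Ω} {K : Ω → ℝ}
  {B C₀ r₀ C lam ρ σ g : ℝ}
  [AddAction (Fin d → ℤ) Ω] [MeasurableConstVAdd (Fin d → ℤ) Ω]
  [VAddInvariantMeasure (Fin d → ℤ) Ω P] [IsProbabilityMeasure P]

/-- A bounded set lies in a cube made of cells, many of which are far from the set. -/
theorem exists_cells_around (hd : 1 ≤ d) {ℓ r c : ℕ} (hℓ : 1 ≤ ℓ) {Λ : Set (Site 𝒢 d)}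
    (hΛ : Bornology.IsBounded Λ) (hne : Λ.Nonempty) (hc : Metric.diam Λ + r < ℓ * ((c : ℝ) - 1)) :
    ∃ (τ : Fin d → ℤ) (Γ : Finset (Fin d → ℤ)), Γ.Nonempty ∧
      Λ ⊆ {x | x - shift 𝒢 d ((ℓ : ℤ) • τ) ∈ cube 𝒢 d (2 * c * ℓ)} ∧
      (∀ γ ∈ Γ, ∀ i, 0 ≤ (γ - τ) i ∧ (γ - τ) i < (2 * c : ℕ)) ∧
      (∀ γ ∈ Γ, ∀ y ∈ cell 𝒢 d ℓ γ, ∀ x ∈ Λ, (r : ℝ) ≤ dist x y) ∧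
      ((2 * c * ℓ : ℕ) : ℝ) ^ d ≤ Γ.card * (ℓ : ℝ) ^ d + (volume Λ).toReal +
        (volume (collar (r + d * ℓ) Λ)).toReal := by
  classical
  obtain ⟨x₀, hx₀⟩ := hne
  obtain ⟨Γ₀, h1, h2, h3⟩ := exists_outer_cells hd hℓ hΛ r
  have hℓ' : (1 : ℝ) ≤ ℓ := by exact_mod_cast hℓ
  have hr0 : (0 : ℝ) ≤ r := Nat.cast_nonneg r
  set η := cellIndex ℓ x₀ with hη
  have hx₀η : x₀ ∈ cell 𝒢 d ℓ η := (mem_cell_iff hℓ).2 rfl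
  have hcoord : ∀ x ∈ Λ, ∀ i, ℓ * (η i : ℝ) - Metric.diam Λ ≤ coord 𝒢 d x i ∧
      coord 𝒢 d x i ≤ ℓ * ((η i : ℝ) + 1) + Metric.diam Λ := fun x hx i => by
    have h4 := (abs_coord_le_norm (x - x₀) i)
    rw [← dist_eq_norm, coord_sub] at h4
    have h5 := abs_le.1 (h4.trans (Metric.dist_le_diam_of_mem hΛ hx hx₀))
    have h6 := hx₀η i
    push_cast at h6
    constructor <;> linarith [h5.1, h5.2, h6.1, h6.2]
  -- The corner of a cube of `2 c` cells per side around the cell `η` of the point `x₀`.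
  set τ : Fin d → ℤ := fun i => η i - c with hτ
  let Γ₁ : Finset (Fin d → ℤ) := Fintype.piFinset fun i => Finset.Ico (τ i) (τ i + (2 * c : ℕ))
  have hcard : Γ₁.card = (2 * c) ^ d := by
    have : (2 * (c : ℤ)).toNat = 2 * c := by omega
    simp [Γ₁, this]
  have hc1 : 1 ≤ c := by
    by_contra! h
    have : (c : ℝ) = 0 := by exact_mod_cast Nat.lt_one_iff.1 h
    rw [this] at hc
    nlinarith [Metric.diam_nonneg (s := Λ)]
  -- By the choice of `c` the corner cell is at distance more than `r` from `Λ`; so at least one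
  -- cell is free.
  have hτ0 : τ ∉ Γ₀ := fun h => by
    obtain ⟨y, hy, x, hx, hxy⟩ := h2 τ h
    have h4 := (hcoord x hx ⟨0, hd⟩).1
    have h5 := (hy ⟨0, hd⟩).2
    have h6 := abs_coord_le_norm (x - y) ⟨0, hd⟩
    rw [← dist_eq_norm, coord_sub] at h6
    have h7 := (le_abs_self _).trans h6
    push_cast [hτ] at h5
    linarith
  refine ⟨τ, Γ₁ \ Γ₀, ⟨τ, Finset.mem_sdiff.2 ⟨Fintype.mem_piFinset.2 fun i =>
    Finset.mem_Ico.2 ⟨le_rfl, by push_cast; omega⟩, hτ0⟩⟩, fun x hx => ?_, fun γ hγ i => ?_,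
    fun γ hγ => h1 γ (Finset.mem_sdiff.1 hγ).2, ?_⟩
  · by_contra hx'
    obtain ⟨i, hi⟩ := of_notMem_cube hx'
    rw [coord_sub, coord_shift, Pi.smul_apply, smul_eq_mul] at hi
    push_cast [hτ] at hi
    have h4 := hcoord x hx i
    rcases hi with hi | hi
    · linarith [h4.1]
    · linarith [h4.2]
  · have := Finset.mem_Ico.1 (Fintype.mem_piFinset.1 (Finset.mem_sdiff.1 hγ).1 i)
    rw [Pi.sub_apply]
    constructor <;> linarith [this.1, this.2]
  · have h4 : ((2 * c) ^ d : ℕ) ≤ (Γ₁ \ Γ₀).card + Γ₀.card := by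
      rw [← hcard]
      have := Finset.le_card_sdiff Γ₀ Γ₁
      omega
    have h5 : ((2 * c : ℕ) : ℝ) ^ d ≤ (Γ₁ \ Γ₀).card + Γ₀.card := by exact_mod_cast h4
    rw [Nat.cast_mul, mul_pow]
    have h6 : (0 : ℝ) ≤ (ℓ : ℝ) ^ d := by positivity
    have := mul_le_mul_of_nonneg_right h5 h6
    linarith

namespace Model.IsRegular

theorem isAttainable_translate_iff (hM : M.IsRegular P K B C₀ r₀ C lam) {Λ : Set (Site 𝒢 d)}
    {n k : ℕ} (hΛ : Bornology.IsBounded Λ) (hk : 1 ≤ k) (γ : Fin d → ℤ) :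
    M.IsAttainable B {x | x - shift 𝒢 d γ ∈ Λ} n k ↔ M.IsAttainable B Λ n k := by
  obtain ⟨ω⟩ := P.nonempty_of_neZero
  rw [← hM.eigenvalue_lt_top_iff hΛ hk (γ +ᵥ ω),
    ← hM.eigenvalue_lt_top_iff (isBounded_preimage_sub hΛ _) hk ω, hM.eigenvalue_translate]

theorem meanEnergy_translate (hM : M.IsRegular P K B C₀ r₀ C lam) (Λ : Set (Site 𝒢 d))
    (n k : ℕ) (γ : Fin d → ℤ) :
    M.meanEnergy P {x | x - shift 𝒢 d γ ∈ Λ} n k = M.meanEnergy P Λ n k := by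
  rw [Model.meanEnergy, Model.meanEnergy, ← integral_vadd_eq (P := P) (M.energy Λ n k) γ]
  exact integral_congr_ae (Eventually.of_forall fun ω =>
    congr_arg EReal.toReal (hM.eigenvalue_translate γ ω))

/-- Blocks complete a domain to a cube. -/
theorem meanEnergy_cube_le (hM : M.IsRegular P K B C₀ r₀ C lam) {L r m κ c n k : ℕ}
    (hr : r₀ < r) (hb : M.IsBlock B L m κ) {Λ : Set (Site 𝒢 d)} (hΛ : Bornology.IsBounded Λ)
    (hne : Λ.Nonempty) (hn : 1 ≤ n) (hk : 1 ≤ k) (h : M.IsAttainable B Λ n k)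
    (hc : Metric.diam Λ + r < (L + r : ℕ) * ((c : ℝ) - 1)) :
    (volume Λ).toReal ≤ ((2 * c * (L + r) : ℕ) : ℝ) ^ d ∧ ∃ N : ℕ, 1 ≤ N ∧
      ((2 * c * (L + r) : ℕ) : ℝ) ^ d ≤ N * ((L + r : ℕ) : ℝ) ^ d + (volume Λ).toReal +
        (volume (collar (r + d * (L + r : ℕ)) Λ)).toReal ∧
      ∀ q : ℕ, 1 ≤ q → q ≤ N → M.IsBlock B (2 * c * (L + r)) (n + q * m) (k * κ ^ q) ∧
        M.meanEnergy P (cube 𝒢 d (2 * c * (L + r))) (n + q * m) (k * κ ^ q) ≤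
          M.meanEnergy P Λ n k + q * M.meanEnergy P (cube 𝒢 d L) m κ +
            (n + q * m : ℕ) * (m * tailBound d C lam r) := by
  have hd := hM.dim_pos
  have hℓ : 1 ≤ L + r := hb.side_pos.trans (Nat.le_add_right _ _)
  obtain ⟨τ, Γ, hΓ, h1, h2, h3, h4⟩ := exists_cells_around hd hℓ hΛ hne hc
  set D := 2 * c * (L + r) with hD
  have hDb := isBounded_cube 𝒢 d D
  have hQb := isBounded_preimage_sub hDb (shift 𝒢 d (((L + r : ℕ) : ℤ) • τ))
  have hQvol : volume {x | x - shift 𝒢 d (((L + r : ℕ) : ℤ) • τ) ∈ cube 𝒢 d D} =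
      volume (cube 𝒢 d D) := by
    simp only [sub_eq_add_neg]
    exact measure_preimage_add_right volume _ _
  have hc1 : 1 ≤ 2 * c := by
    by_contra! h0
    have : (c : ℝ) = 0 := by exact_mod_cast (by omega : c = 0)
    rw [this] at hc
    nlinarith [Metric.diam_nonneg (s := Λ), (Nat.cast_nonneg r : (0 : ℝ) ≤ r),
      (Nat.cast_nonneg (L + r) : (0 : ℝ) ≤ (L + r : ℕ))]
  refine ⟨?_, Γ.card, hΓ.card_pos, h4, fun q hq hqN => ?_⟩
  · rw [← toReal_volume_cube 𝒢 d D, ← hQvol]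
    exact ENNReal.toReal_mono (volume_ne_top_of_isBounded hQb) (measure_mono h1)
  obtain ⟨Γ', hΓ', rfl⟩ := Finset.exists_subset_card_eq hqN
  have hpos : 1 ≤ k * κ ^ Γ'.card := Nat.mul_pos hk (pow_pos hb.index_pos _)
  have key := hM.energy_add_cells_le hr (Finset.card_pos.1 hq) hn hk hΛ h hb.particles_pos
    hb.index_pos hb.attainable hQb h1 (fun γ hγ x hx => by
      have h5 := cellCube_subset_cube (𝒢 := 𝒢) (Nat.le_add_right L r) (h2 γ (hΓ' hγ))
      refine h5 (?_ : x - shift 𝒢 d (((L + r : ℕ) : ℤ) • τ) - shift 𝒢 d _ ∈ cube 𝒢 d L)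
      rw [sub_sub, ← shift_add, ← smul_add, add_sub_cancel]
      exact hx) fun x hx γ hγ y hy =>
        h3 γ (hΓ' hγ) y (cellCube_subset_cell (Nat.le_add_right L r) γ hy) x hx
  obtain ⟨ω₀⟩ := P.nonempty_of_neZero
  have hatt := (hM.isAttainable_translate_iff hDb hpos _).1 (key ω₀).1
  have hi : ∀ γ ∈ Γ', Integrable (fun ω => M.energy (cube 𝒢 d L) m κ
      (((L + r : ℕ) : ℤ) • γ +ᵥ ω)) P := fun γ _ => (hM.memLp_energy_vadd (isBounded_cube 𝒢 d L)
      hb.index_pos hb.attainable _).integrable one_le_two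
  have hiΛ := (hM.memLp_energy hΛ hk h).integrable one_le_two
  refine ⟨⟨Nat.mul_pos hc1 hℓ, hn.trans (Nat.le_add_right _ _), hpos, hatt⟩, ?_⟩
  have h6 := integral_mono (μ := P) ((hM.memLp_energy hQb hpos (key ω₀).1).integrable one_le_two)
    ((hiΛ.add (integrable_finsetSum _ hi)).add (integrable_const _)) fun ω => (key ω).2
  rw [← hM.meanEnergy_translate _ _ _ (((L + r : ℕ) : ℤ) • τ)]
  refine h6.trans (le_of_eq ?_)
  rw [integral_add' (hiΛ.add (integrable_finsetSum _ hi)) (integrable_const _),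
    integral_add' hiΛ (integrable_finsetSum _ hi), integral_finsetSum _ hi]
  simp only [integral_vadd_eq (P := P) (M.energy (cube 𝒢 d L) _ _), Finset.sum_const,
    integral_const, probReal_univ, one_smul, nsmul_eq_mul, Model.meanEnergy]

/-- The lower bound for the mean energy per particle: completing a domain to a cube by efficient
blocks cannot beat a bound that is not attained in cubes. -/
theorem exists_lower_bound (hM : M.IsRegular P K B C₀ r₀ C lam) (hρ : 0 < ρ)
    {Λ : ℕ → Set (Site 𝒢 d)} {n k : ℕ → ℕ} (hΛ : IsThermodynamicSequence Λ n k ρ σ) :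
    ∃ X : ℝ, 0 ≤ X ∧ ∀ {ρ' σ' g h : ℝ}, M.HasBound P B r₀ C lam ρ σ g → 0 < ρ' → ρ' < ρ → σ' < σ →
      ¬ M.HasBound P B r₀ C lam ρ' σ' h → ∀ ε > 0, ∀ᶠ j in atTop,
        M.IsAttainable B (Λ j) (n j) (k j) →
          h - X * (g - h) - ε ≤ M.meanEnergy P (Λ j) (n j) (k j) / n j := by
  have hd := hM.dim_pos
  obtain ⟨c₀, hc₀, hdiam⟩ := hΛ.domains.exists_diam_pow_le hd
  -- This bounds the ratio of added to original particles: the cube has volume at most `4 ^ d / c₀`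
  -- times that of `Λ`, at most twice `ρ` times its volume is added, and `n` is at least half of `ρ`
  -- times the volume of `Λ`. It depends on the sequence alone, so `g` and `h` may be brought
  -- together afterwards.
  refine ⟨4 ^ (d + 1) / c₀, by positivity, fun {ρ' σ' g h} hg hρ'0 hρ' hσ' hh ε hε => ?_⟩
  set X : ℝ := 4 ^ (d + 1) / c₀ with hX
  have hX0 : 0 ≤ X := by positivity
  -- One `ε₁` per particle is spent on the tails inside the cube and one on the tail around it, for
  -- at most `(1 + X) n` particles.
  set ε₁ : ℝ := ε / (2 * (1 + X)) with hε₁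
  have hε₁0 : 0 < ε₁ := by positivity
  have hgh : h ≤ g := by
    by_contra! hlt
    exact hh (hg.mono hρ'.le hσ'.le hlt.le)
  -- the block
  obtain ⟨L, r, m, κ, hr, hb, hdens, hent, hen, htail⟩ : ∃ L r m κ : ℕ, r₀ < r ∧
      M.IsBlock B L m κ ∧ ρ * ((L : ℝ) + r) ^ d < m ∧ σ * m < Real.log κ ∧
      M.meanEnergy P (cube 𝒢 d L) m κ / m < g ∧ m * tailBound d C lam r < ε₁ := by
    -- The given bound controls only the sum of energy and tail; enlarging the block makes the tail
    -- small by itself.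
    obtain ⟨L₀, -, θ₀, hθ₀, hθ⟩ := hM.exists_block_of_hasBound hρ.le hg hε₁0
    obtain ⟨N, h1, m, κ, h2⟩ := (hθ (θ₀ / 2) (by positivity) (by linarith)).exists
    exact ⟨_, _, m, κ, h1, h2⟩
  have hm : (0 : ℝ) < m := by exact_mod_cast hb.particles_pos
  have hℓ : 1 ≤ L + r := hb.side_pos.trans (Nat.le_add_right _ _)
  rw [← Nat.cast_add] at hdens
  set ℓ := L + r with hℓdef
  have hℓ' : (1 : ℝ) ≤ ℓ := by exact_mod_cast hℓ
  rw [div_lt_iff₀ hm] at hen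
  -- the gap in the density
  have hcont : Tendsto (fun θ : ℝ => ρ' * (1 + θ) ^ d) (𝓝[>] 0) (𝓝 (ρ' * (1 + 0) ^ d)) :=
    ((by fun_prop : Continuous _).tendsto 0).mono_left nhdsWithin_le_nhds
  rw [add_zero, one_pow, mul_one] at hcont
  obtain ⟨θ, hθd, hθ⟩ := ((hcont.eventually (gt_mem_nhds hρ')).and self_mem_nhdsWithin).exists
  have hθ : 0 < θ := hθ
  set ρ₂ := ρ' * (1 + θ) ^ d with hρ₂
  -- Half of the density gap covers the deviation of `n / |Λ|` from `ρ`, the other half the collar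
  -- lost around `Λ`.
  set δ := (ρ - ρ₂) / 2 with hδ
  have hδ0 : 0 < δ := by rw [hδ]; linarith
  -- the cubes
  let c : ℕ → ℕ := fun j => ⌊(Metric.diam (Λ j) + r) / ℓ⌋₊ + 2
  let D : ℕ → ℕ := fun j => 2 * c j * ℓ
  have hc : ∀ j, Metric.diam (Λ j) + r < ℓ * ((c j : ℝ) - 1) := fun j => by
    have h1 := Nat.lt_floor_add_one ((Metric.diam (Λ j) + r) / ℓ)
    rw [div_lt_iff₀ (by linarith)] at h1
    refine h1.trans_eq ?_
    push_cast [c]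
    ring
  have hDle : ∀ j, (D j : ℝ) ≤ 2 * Metric.diam (Λ j) + (2 * r + 4 * ℓ) := fun j => by
    have h1 := Nat.floor_le (div_nonneg (add_nonneg (Metric.diam_nonneg (s := Λ j))
      (Nat.cast_nonneg r)) (Nat.cast_nonneg ℓ))
    rw [le_div_iff₀ (by linarith)] at h1
    push_cast [D, c]
    linarith
  have hDge : ∀ j, Metric.diam (Λ j) ≤ D j := fun j => by
    have h1 := hc j
    have h2 : (0 : ℝ) ≤ c j * ℓ := by positivity
    have h3 : (0 : ℝ) ≤ r := Nat.cast_nonneg r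
    push_cast [D]
    linarith
  have hDr : Tendsto (fun j => (D j : ℝ)) atTop atTop :=
    tendsto_atTop_mono hDge hΛ.domains.tendsto_diam
  have hDt : Tendsto D atTop atTop := tendsto_natCast_atTop_iff.1 hDr
  have htailD := ((tendsto_pow_mul_tailBound hM.tempered.tail_nonneg hM.tempered.decay hθ).comp
    hDt).const_mul (3 * ρ + 1)
  rw [mul_zero] at htailD
  have hDpow : Tendsto (fun j => ρ * (D j : ℝ) ^ d) atTop atTop :=
    ((tendsto_pow_atTop (by omega)).comp hDr).const_mul_atTop hρ
  have hcol := (hΛ.domains.tendsto_collar (r + d * ℓ)).const_mul ρ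
  rw [mul_zero] at hcol
  filter_upwards [hdiam, hΛ.domains.tendsto_diam.eventually_ge_atTop (r + 2 * ℓ),
    htailD.eventually (gt_mem_nhds hε₁0), hDpow.eventually_ge_atTop (m : ℝ),
    hcol.eventually (gt_mem_nhds hδ0), hΛ.density.eventually (lt_mem_nhds (by linarith : ρ - δ < ρ)),
    hΛ.density.eventually (lt_mem_nhds (half_lt_self hρ)),
    hΛ.density.eventually (gt_mem_nhds (lt_add_one ρ)), hΛ.entropy.eventually (lt_mem_nhds hσ'),
    hΛ.domains.volume_tendsto.eventually_gt_atTop 0,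
    (tendsto_particles hρ hΛ).eventually_ge_atTop 1,
    (tendsto_nat_floor_atTop.comp (hDr.const_mul_atTop hθ)).eventually_gt_atTop ⌈r₀⌉₊]
    with j h1 h2 h3 h4 h5 h6 h7 h8 h9 hv hn hrD hatt
  set v := (volume (Λ j)).toReal
  set col := (volume (collar (r + d * ℓ) (Λ j))).toReal
  have hn1 : 1 ≤ n j := by exact_mod_cast hn
  have hk := hΛ.index_pos j
  have hn0 : (0 : ℝ) < n j := by linarith
  obtain ⟨hvD, N, hN1, hN, hq⟩ := hM.meanEnergy_cube_le hr hb (hΛ.domains.isBounded j)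
    (hΛ.domains.nonempty j) hn1 hk hatt (hc j)
  change v ≤ (D j : ℝ) ^ d at hvD
  change (D j : ℝ) ^ d ≤ N * (ℓ : ℝ) ^ d + v + col at hN
  rw [lt_div_iff₀ hv] at h6 h7
  rw [div_lt_iff₀ hv] at h8
  rw [lt_div_iff₀ hn0] at h9
  rw [mul_div_assoc', div_lt_iff₀ hv] at h5
  have hD0 : (0 : ℝ) < (D j : ℝ) ^ d := hv.trans_le hvD
  -- The ceiling would bring the whole cube to density `ρ` by blocks alone. More blocks are never
  -- used, which keeps the number of added particles under control.
  set q := min N ⌈ρ * (D j : ℝ) ^ d / m⌉₊ with hqdef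
  have hq1 : 1 ≤ q := le_min hN1 (Nat.one_le_ceil_iff.2 (by positivity))
  obtain ⟨hblock, henergy⟩ := hq q hq1 (min_le_left _ _)
  have hqm : (q : ℝ) * m ≤ 2 * (ρ * (D j : ℝ) ^ d) := by
    have h10 : (q : ℝ) ≤ ⌈ρ * (D j : ℝ) ^ d / m⌉₊ := Nat.cast_le.2 (min_le_right _ _)
    have h11 := Nat.ceil_lt_add_one (div_nonneg (by positivity) hm.le : 0 ≤ ρ * (D j : ℝ) ^ d / m)
    have h12 : (q : ℝ) * m ≤ (ρ * (D j : ℝ) ^ d / m + 1) * m := by gcongr; linarith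
    rw [add_mul, div_mul_cancel₀ _ hm.ne'] at h12
    linarith
  have hqX : (q : ℝ) * m ≤ X * n j := by
    have h10 : (D j : ℝ) ^ d ≤ 4 ^ d * Metric.diam (Λ j) ^ d := by
      rw [← mul_pow]
      gcongr
      linarith [hDle j]
    have h11 : c₀ * (D j : ℝ) ^ d ≤ 4 ^ d * v := by
      calc c₀ * (D j : ℝ) ^ d ≤ c₀ * (4 ^ d * Metric.diam (Λ j) ^ d) := by gcongr
        _ = 4 ^ d * (c₀ * Metric.diam (Λ j) ^ d) := by ring
        _ ≤ _ := by gcongr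
    rw [hX, div_mul_eq_mul_div, le_div_iff₀ hc₀]
    calc (q : ℝ) * m * c₀ ≤ 2 * (ρ * (D j : ℝ) ^ d) * c₀ := by gcongr
      _ = 2 * ρ * (c₀ * (D j : ℝ) ^ d) := by ring
      _ ≤ 2 * ρ * (4 ^ d * v) := by gcongr
      _ = 4 ^ (d + 1) * (ρ / 2 * v) := by ring
      _ ≤ _ := by gcongr
  -- If all `N` free cells are used, they have density at least `ρ` outside `Λ` and its collar, and
  -- `Λ` itself has density close to `ρ`. Otherwise the blocks alone suffice.
  have hnD : ρ₂ * (D j : ℝ) ^ d < n j + q * m := by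
    rcases min_choice N ⌈ρ * (D j : ℝ) ^ d / m⌉₊ with h10 | h10
    · rw [hqdef, h10]
      have h11 : ρ * (N * (ℓ : ℝ) ^ d) ≤ N * m := by
        calc ρ * (N * (ℓ : ℝ) ^ d) = N * (ρ * (ℓ : ℝ) ^ d) := by ring
          _ ≤ _ := by gcongr
      have h12 : ρ * (D j : ℝ) ^ d ≤ ρ * (N * (ℓ : ℝ) ^ d + v + col) := by gcongr
      have h13 : ρ₂ = ρ - 2 * δ := by rw [hδ]; ring
      have h14 : δ * v ≤ δ * (D j : ℝ) ^ d := by gcongr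
      rw [h13]
      linarith
    · rw [hqdef, h10]
      have h11 := mul_le_mul_of_nonneg_right (Nat.le_ceil (ρ * (D j : ℝ) ^ d / m)) hm.le
      rw [div_mul_cancel₀ _ hm.ne'] at h11
      have h12 : ρ₂ * (D j : ℝ) ^ d ≤ ρ * (D j : ℝ) ^ d := by gcongr
      linarith
  have hcast : ((n j + q * m : ℕ) : ℝ) = n j + q * m := by push_cast; ring
  have hnD0 : (0 : ℝ) < n j + q * m := by positivity
  -- The completed cube has density above `ρ'` and entropy above `σ'`; if its energy were smaller,
  -- it would be a block for the excluded bound `h`.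
  have hcube : h ≤ M.meanEnergy P (cube 𝒢 d (D j)) (n j + q * m) (k j * κ ^ q) /
      (n j + q * m : ℕ) + (n j + q * m : ℕ) * tailBound d C lam ⌊θ * D j⌋₊ := by
    by_contra! hlt
    refine hh ⟨D j, ⌊θ * D j⌋₊, _, _, (Nat.le_ceil r₀).trans_lt (by exact_mod_cast hrD), hblock,
      ?_, ?_, hlt⟩
    · have hfl : (⌊θ * D j⌋₊ : ℝ) ≤ θ * D j := Nat.floor_le (by positivity)
      rw [hcast]
      calc ρ' * ((D j : ℝ) + ⌊θ * D j⌋₊) ^ d ≤ ρ' * ((D j : ℝ) + θ * D j) ^ d := by gcongr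
        _ = ρ₂ * (D j : ℝ) ^ d := by
          rw [hρ₂, show (D j : ℝ) + θ * D j = (1 + θ) * D j by ring, mul_pow]; ring
        _ < _ := hnD
    · have hk0 : (k j : ℝ) ≠ 0 := by positivity
      have hκ0 : (κ : ℝ) ≠ 0 := by have := hb.index_pos; positivity
      rw [hcast, Nat.cast_mul, Nat.cast_pow, Real.log_mul hk0 (pow_ne_zero _ hκ0), Real.log_pow]
      have h10 : (q : ℝ) * (σ * m) ≤ q * Real.log κ := by gcongr
      have h11 : σ' * (q * m) ≤ σ * (q * m) := by gcongr
      linarith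
  have htail0 := tailBound_nonneg hM.tempered.tail_nonneg (d := d) lam
  have htD : ((n j + q * m : ℕ) : ℝ) * tailBound d C lam ⌊θ * D j⌋₊ ≤ ε₁ := by
    refine le_trans ?_ h3.le
    simp only [Function.comp_apply]
    rw [← mul_assoc, hcast]
    have h10 : (n j : ℝ) ≤ (ρ + 1) * (D j : ℝ) ^ d := h8.le.trans (by gcongr)
    have h11 : (n j : ℝ) + q * m ≤ (3 * ρ + 1) * (D j : ℝ) ^ d := by linarith
    exact mul_le_mul_of_nonneg_right h11 (htail0 _)
  have hE1 : (h - ε₁) * (n j + q * m) ≤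
      M.meanEnergy P (cube 𝒢 d (D j)) (n j + q * m) (k j * κ ^ q) := by
    rw [← le_div_iff₀ hnD0, ← hcast]
    linarith
  have hE2 : (h - ε₁) * (n j + q * m) ≤ M.meanEnergy P (Λ j) (n j) (k j) + q * (g * m) +
      (n j + q * m) * ε₁ := by
    refine hE1.trans (henergy.trans ?_)
    rw [hcast]
    gcongr
  rw [le_div_iff₀ hn0]
  have h10 : q * m * (g - h + 2 * ε₁) ≤ X * n j * (g - h + 2 * ε₁) := by
    gcongr
  have h11 : ε = 2 * ε₁ * (1 + X) := by
    rw [hε₁]; field_simp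
  rw [h11]
  linarith

end Model.IsRegular

end Lower

end RandomGas

namespace RandomGas

variable {𝒢 : Medium} {d : ℕ}

/-! ### Existence of the thermodynamic limit -/

/-! ### A one-sided criterion for mean-square convergence -/

section Squares

variable {Ω : Type*} [MeasurableSpace Ω] {P : Measure Ω}

theorem tendsto_eLpNorm_two {f : ℕ → Ω → ℝ} (hf : ∀ᶠ j in atTop, MemLp (f j) 2 P)
    (h : Tendsto (fun j => ∫ ω, f j ω ^ 2 ∂P) atTop (𝓝 0)) :
    Tendsto (fun j => eLpNorm (f j) 2 P) atTop (𝓝 0) := by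
  have h1 : Tendsto (fun j => ENNReal.ofReal (√(∫ ω, f j ω ^ 2 ∂P))) atTop
      (𝓝 (ENNReal.ofReal (√0))) :=
    (ENNReal.continuous_ofReal.tendsto _).comp ((Real.continuous_sqrt.tendsto 0).comp h)
  rw [Real.sqrt_zero, ENNReal.ofReal_zero] at h1
  refine h1.congr' ?_
  filter_upwards [hf] with j hj
  rw [hj.eLpNorm_eq_integral_rpow_norm two_ne_zero ENNReal.ofNat_ne_top, Real.sqrt_eq_rpow]
  simp

/-- Random variables that are bounded above by variables converging in mean square to constants close
to `e`, and whose means are asymptotically at least `e`, converge in mean square to `e`. -/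
theorem tendsto_integral_sub_sq [IsProbabilityMeasure P] {X : ℕ → Ω → ℝ} {e c : ℝ}
    (hX : ∀ᶠ j in atTop, MemLp (X j) 2 P ∧ ∀ ω, -c ≤ X j ω)
    (hup : ∀ g > e, ∃ y < g, ∃ Y : ℕ → Ω → ℝ,
      (∀ᶠ j in atTop, MemLp (Y j) 2 P ∧ ∀ ω, X j ω ≤ Y j ω) ∧
      Tendsto (fun j => ∫ ω, (Y j ω - y) ^ 2 ∂P) atTop (𝓝 0))
    (hmean : ∀ ε > 0, ∀ᶠ j in atTop, e - ε ≤ ∫ ω, X j ω ∂P) :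
    Tendsto (fun j => ∫ ω, (X j ω - e) ^ 2 ∂P) atTop (𝓝 0) := by
  set b := |c + e| with hb
  have hb0 : 0 ≤ b := abs_nonneg _
  refine tendsto_order.2 ⟨fun a ha => Eventually.of_forall fun j =>
    ha.trans_le (integral_nonneg fun _ => sq_nonneg _), fun η hη => ?_⟩
  obtain ⟨ε, hε, hε1, hεη⟩ : ∃ ε : ℝ, 0 < ε ∧ ε ≤ 1 ∧ (3 + 3 * b) * ε < η := by
    refine ⟨min 1 (η / (2 * (3 + 3 * b))), by positivity, min_le_left _ _, ?_⟩
    have h1 : (3 + 3 * b) * min 1 (η / (2 * (3 + 3 * b))) ≤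
        (3 + 3 * b) * (η / (2 * (3 + 3 * b))) := by
      gcongr
      exact min_le_right _ _
    have h2 : (3 + 3 * b) * (η / (2 * (3 + 3 * b))) = η / 2 := by field_simp
    linarith
  obtain ⟨y, hy, Y, hY, hYt⟩ := hup (e + ε) (by linarith)
  have h0 := hYt.const_mul (2 + b / ε)
  rw [mul_zero] at h0
  filter_upwards [hX, hY, hmean ε hε, h0.eventually (gt_mem_nhds hε)] with j ⟨h1, h2⟩ ⟨h3, h4⟩ h5 h6
  have hz : MemLp (fun ω => Y j ω - y) 2 P := h3.sub (memLp_const y)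
  -- With `u = X - e` and `z = Y - y`, positive `u` is at most `ε + |z|`. Negative `u` is at least
  -- `-b`, so there the square is at most `-b u`, which is linear: its mean is controlled by the
  -- lower bound for the means. The term `|z|` is absorbed by `z² / ε + ε`.
  have hpt : ∀ ω, (X j ω - e) ^ 2 ≤
      (2 + b / ε) * (Y j ω - y) ^ 2 + (2 * ε ^ 2 + 2 * b * ε + b * e) - b * X j ω := by
    intro ω
    set z := Y j ω - y with hzdef
    set u := X j ω - e with hu
    have hu1 : u ≤ ε + |z| := by
      have := h4 ω
      have := le_abs_self z
      linarith
    have hu2 : -b ≤ u := by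
      have := h2 ω
      have := neg_abs_le (c + e)
      have h7 : -(c + e) ≤ u := by linarith
      have := le_abs_self (c + e)
      linarith
    have hz1 : |z| ≤ z ^ 2 / ε + ε := by
      rw [← sq_abs z]
      have h7 : |z| * ε ≤ |z| ^ 2 + ε * ε := by nlinarith [sq_nonneg (|z| - ε), abs_nonneg z]
      have h8 : (|z| ^ 2 / ε + ε) * ε = |z| ^ 2 + ε * ε := by field_simp
      rw [← h8] at h7
      exact le_of_mul_le_mul_right h7 hε
    have h9 : u ^ 2 ≤ 2 * ε ^ 2 + 2 * z ^ 2 + b * (ε + |z| - u) := by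
      have h10 : 0 ≤ b * (ε + |z| - u) := mul_nonneg hb0 (by linarith)
      rcases le_total 0 u with h | h
      · have : u ^ 2 ≤ (ε + |z|) ^ 2 := by gcongr
        nlinarith [sq_nonneg (ε - |z|), sq_abs z]
      · have h11 : 0 ≤ b * (ε + |z|) := by positivity
        nlinarith [sq_nonneg z, sq_nonneg ε]
    have h12 : b * |z| ≤ b / ε * z ^ 2 + b * ε := by
      calc b * |z| ≤ b * (z ^ 2 / ε + ε) := by gcongr
        _ = _ := by ring
    have h13 : b * u = b * X j ω - b * e := by rw [hu]; ring
    linarith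
  have hi1 : Integrable (fun ω => (2 + b / ε) * (Y j ω - y) ^ 2 +
      (2 * ε ^ 2 + 2 * b * ε + b * e)) P :=
    (hz.integrable_sq.const_mul _).add (integrable_const _)
  have hi2 : Integrable (fun ω => b * X j ω) P := (h1.integrable one_le_two).const_mul b
  have h7 := integral_mono (μ := P) (h1.sub (memLp_const e)).integrable_sq (hi1.sub hi2) hpt
  refine h7.trans_lt ?_
  rw [integral_sub' hi1 hi2, integral_add (hz.integrable_sq.const_mul _) (integrable_const _),
    integral_const_mul, integral_const_mul]
  simp only [integral_const, probReal_univ, one_smul]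
  have h8 : b * (e - ε) ≤ b * ∫ ω, X j ω ∂P := by gcongr
  nlinarith

end Squares

section Limit

variable {Ω : Type*} [MeasurableSpace Ω] {M : Model 𝒢 d Ω} {P : Measure Ω} {K : Ω → ℝ}
  {B C₀ r₀ C lam ρ σ g : ℝ}

/-- The best bound for the energy per particle. -/
noncomputable def Model.bound (M : Model 𝒢 d Ω) (P : Measure Ω) (B r₀ C lam ρ σ : ℝ) : ℝ :=
  sInf {g | M.HasBound P B r₀ C lam ρ σ g}

variable [AddAction (Fin d → ℤ) Ω] [MeasurableConstVAdd (Fin d → ℤ) Ω]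
  [VAddInvariantMeasure (Fin d → ℤ) Ω P] [IsProbabilityMeasure P]

namespace Model.IsRegular

theorem bddBelow_hasBound (hM : M.IsRegular P K B C₀ r₀ C lam) (ρ σ : ℝ) :
    BddBelow {g | M.HasBound P B r₀ C lam ρ σ g} :=
  ⟨-(C₀ + B), fun _ hg => (hM.neg_lt_of_hasBound hg).le⟩

theorem bound_le (hM : M.IsRegular P K B C₀ r₀ C lam) (h : M.HasBound P B r₀ C lam ρ σ g) :
    M.bound P B r₀ C lam ρ σ ≤ g := csInf_le (hM.bddBelow_hasBound ρ σ) h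

theorem hasBound_of_bound_lt (h : ∃ g, M.HasBound P B r₀ C lam ρ σ g)
    (hg : M.bound P B r₀ C lam ρ σ < g) : M.HasBound P B r₀ C lam ρ σ g := by
  obtain ⟨g', hg', hlt⟩ := exists_lt_of_csInf_lt h hg
  exact Model.HasBound.mono hg' le_rfl le_rfl hlt.le

/-- The best bound is continuous from the left. -/
theorem exists_not_hasBound (hM : M.IsRegular P K B C₀ r₀ C lam) (hρ : 0 < ρ)
    (hfin : ∃ g, M.HasBound P B r₀ C lam ρ σ g) {h : ℝ} (hh : h < M.bound P B r₀ C lam ρ σ) :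
    ∃ ρ', 0 < ρ' ∧ ρ' < ρ ∧ ∃ σ' < σ, ¬ M.HasBound P B r₀ C lam ρ' σ' h := by
  by_contra! hall
  obtain ⟨G₀, hG₀⟩ := hfin
  obtain ⟨ρ₁, hρ₁, σ₁, hσ₁, G, -, hG⟩ := hG₀.exists_lt
  -- If the bound `h` held at all points to the lower left, then `(ρ, σ)` would be a mixture of such
  -- a point, with weight `1 - b`, and of the upper right point `(ρ₁, σ₁)`. For small `b` the mixed
  -- bound would still be below the infimum.
  have hcont : Tendsto (fun b : ℝ => (1 - b) * h + b * G) (𝓝[>] 0) (𝓝 ((1 - 0) * h + 0 * G)) :=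
    ((by fun_prop : Continuous _).tendsto 0).mono_left nhdsWithin_le_nhds
  rw [sub_zero, one_mul, zero_mul, add_zero] at hcont
  obtain ⟨b, hb, hb0, hb1⟩ := ((hcont.eventually (gt_mem_nhds hh)).and
    (Ioo_mem_nhdsGT (zero_lt_one' ℝ))).exists
  have hρ₁0 : 0 < ρ₁ := hρ.trans hρ₁
  have ha : 0 < 1 - b := by linarith
  have hinv : ρ₁⁻¹ < ρ⁻¹ := inv_strictAnti₀ hρ hρ₁
  have hs : 0 < ρ⁻¹ - b * ρ₁⁻¹ := by
    have : 0 < ρ₁⁻¹ := inv_pos.2 hρ₁0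
    nlinarith
  have hρ'0 : 0 < (1 - b) / (ρ⁻¹ - b * ρ₁⁻¹) := div_pos ha hs
  have hρ' : (1 - b) / (ρ⁻¹ - b * ρ₁⁻¹) < ρ := by
    rw [div_lt_iff₀ hs, mul_sub, mul_inv_cancel₀ hρ.ne']
    have : ρ * ρ₁⁻¹ < 1 := by rwa [← div_eq_mul_inv, div_lt_one hρ₁0]
    nlinarith
  have hσ' : (σ - b * σ₁) / (1 - b) < σ := by
    rw [div_lt_iff₀ ha]
    nlinarith
  have h1 := hM.hasBound_mix hρ'0 hρ₁0 ha hb0 (by ring) (hall _ hρ'0 hρ' _ hσ') hG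
  have e1 : ((1 - b) * ((1 - b) / (ρ⁻¹ - b * ρ₁⁻¹))⁻¹ + b * ρ₁⁻¹)⁻¹ = ρ := by
    rw [inv_div, mul_div_cancel₀ _ ha.ne', sub_add_cancel, inv_inv]
  have e2 : (1 - b) * ((σ - b * σ₁) / (1 - b)) + b * σ₁ = σ := by
    rw [mul_div_cancel₀ _ ha.ne', sub_add_cancel]
  rw [e1, e2] at h1
  exact absurd (hM.bound_le h1) (not_le.2 hb)

/-- Upper bounds are available for all `g` above `bound`; lower bounds come from some excluded `h`
just below it, at slightly smaller density and entropy. -/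
theorem tendsto_energy (hM : M.IsRegular P K B C₀ r₀ C lam) (hρ : 0 < ρ)
    (hfin : ∃ g, M.HasBound P B r₀ C lam ρ σ g) {Λ : ℕ → Set (Site 𝒢 d)} {n k : ℕ → ℕ}
    (hΛ : IsThermodynamicSequence Λ n k ρ σ) :
    (∀ᶠ j in atTop, M.IsAttainable B (Λ j) (n j) (k j)) ∧
    Tendsto (fun j => ∫ ω, (M.energy (Λ j) (n j) (k j) ω / n j - M.bound P B r₀ C lam ρ σ) ^ 2 ∂P)
      atTop (𝓝 0) := by
  have hatt : ∀ᶠ j in atTop, M.IsAttainable B (Λ j) (n j) (k j) := by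
    obtain ⟨g, hg⟩ := hfin
    obtain ⟨y, -, Y, hY, -⟩ := hM.exists_upper_bound hρ hg hΛ
    exact hY.mono fun j h => h.1
  refine ⟨hatt, tendsto_integral_sub_sq (c := C₀ + B) ?_ (fun g hg => ?_) fun ε hε => ?_⟩
  · filter_upwards [hatt, (tendsto_particles hρ hΛ).eventually_gt_atTop 0] with j hj hn
    refine ⟨(hM.memLp_energy (hΛ.domains.isBounded j) (hΛ.index_pos j) hj).mul_const (n j : ℝ)⁻¹,
      fun ω => ?_⟩
    rw [le_div_iff₀ hn]
    have := hM.neg_le_energy (hΛ.domains.isBounded j) (hΛ.index_pos j) hj ω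
    linarith
  · obtain ⟨y, hy, Y, hY, ht⟩ := hM.exists_upper_bound hρ (hasBound_of_bound_lt hfin hg) hΛ
    exact ⟨y, hy, Y, hY.mono fun j h => h.2, ht⟩
  · obtain ⟨X, hX, hlow⟩ := hM.exists_lower_bound hρ hΛ
    set e := M.bound P B r₀ C lam ρ σ
    -- With `h = e - t`, `g = e + t` and error `t` the total loss is `t + 2 t X + t = ε`.
    set t := ε / (2 + 2 * X) with ht
    have ht0 : 0 < t := by positivity
    have hε' : ε = t * (2 + 2 * X) := by rw [ht]; field_simp
    obtain ⟨ρ', hρ'0, hρ', σ', hσ', hnot⟩ := hM.exists_not_hasBound hρ hfin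
      (by linarith : e - t < e)
    filter_upwards [hatt, hlow (hasBound_of_bound_lt hfin (by linarith : e < e + t)) hρ'0 hρ' hσ'
      hnot t ht0] with j hj h1
    rw [integral_div]
    refine le_trans (le_of_eq ?_) (h1 hj)
    rw [hε']
    ring

/-- The thermodynamic limit exists where there is a bound. -/
theorem hasThermodynamicLimit (hM : M.IsRegular P K B C₀ r₀ C lam) (hρ : 0 < ρ)
    (hfin : ∃ g, M.HasBound P B r₀ C lam ρ σ g) :
    M.HasThermodynamicLimit P ρ σ (M.bound P B r₀ C lam ρ σ) := by
  intro Λ n k hΛ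
  obtain ⟨hatt, ht⟩ := hM.tendsto_energy hρ hfin hΛ
  have heq : ∀ᶠ j in atTop, ∀ ω, M.eigenvalue (Λ j) (n j) (k j) ω / ((n j : ℝ) : EReal) =
      ((M.energy (Λ j) (n j) (k j) ω / n j : ℝ) : EReal) := by
    filter_upwards [hatt] with j hj ω
    rw [EReal.coe_div, Model.energy, hM.coe_toReal_eigenvalue (hΛ.domains.isBounded j)
      (hΛ.index_pos j) hj ω]
  refine ⟨heq.mono fun j hj => Eventually.of_forall fun ω => ?_, ?_⟩
  · simp only [hj ω]
    exact ⟨EReal.coe_ne_top _, EReal.coe_ne_bot _⟩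
  · refine (tendsto_eLpNorm_two (f := fun j ω => M.energy (Λ j) (n j) (k j) ω / n j -
      M.bound P B r₀ C lam ρ σ) ?_ ht).congr' ?_
    · filter_upwards [hatt] with j hj
      exact ((hM.memLp_energy (hΛ.domains.isBounded j) (hΛ.index_pos j) hj).mul_const
        (n j : ℝ)⁻¹).sub (memLp_const _)
    · filter_upwards [heq] with j hj
      simp only [hj, EReal.toReal_coe]

end Model.IsRegular

end Limit

end RandomGas

namespace RandomGas

variable {𝒢 : Medium} {d : ℕ}

/-! ### The energy density -/

section Density

variable {Ω : Type*} [MeasurableSpace Ω] {M : Model 𝒢 d Ω} {P : Measure Ω} {K : Ω → ℝ}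
  {B C₀ r₀ C lam ρ σ g : ℝ}

/-- Provides an admissible sequence for every density and entropy, so that a limit is never vacuous.
Rounding up makes each member strictly overfilled, corridor included, so that a finite eigenvalue in
any one cube yields a block. -/
theorem exists_cubes (hd : 1 ≤ d) (hρ : 0 < ρ) (hσ : 0 ≤ σ) (r : ℕ) : ∃ n k : ℕ → ℕ,
    IsThermodynamicSequence (fun j => cube 𝒢 d (j + 1)) n k ρ σ ∧
    ∀ j, ρ * (((j + 1 : ℕ) : ℝ) + r) ^ d < n j ∧ σ * n j < Real.log (k j) := by
  let n : ℕ → ℕ := fun j => ⌊ρ * (((j + 1 : ℕ) : ℝ) + r) ^ d⌋₊ + 1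
  let k : ℕ → ℕ := fun j => ⌊Real.exp (σ * n j)⌋₊ + 1
  have hL : Tendsto (fun j : ℕ => j + 1) atTop atTop := tendsto_add_atTop_nat 1
  have hLr : Tendsto (fun j : ℕ => ((j + 1 : ℕ) : ℝ)) atTop atTop :=
    tendsto_natCast_atTop_atTop.comp hL
  have hn1 : ∀ j, ρ * (((j + 1 : ℕ) : ℝ) + r) ^ d < n j := fun j => by
    have := Nat.lt_floor_add_one (ρ * (((j + 1 : ℕ) : ℝ) + r) ^ d)
    push_cast [n] at this ⊢
    exact this
  have hn2 : ∀ j, (n j : ℝ) ≤ ρ * (((j + 1 : ℕ) : ℝ) + r) ^ d + 1 := fun j => by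
    have := Nat.floor_le (by positivity : 0 ≤ ρ * (((j + 1 : ℕ) : ℝ) + r) ^ d)
    push_cast [n] at this ⊢
    linarith
  have hk1 : ∀ j, σ * n j < Real.log (k j) := fun j => by
    rw [Real.lt_log_iff_exp_lt (by positivity)]
    have := Nat.lt_floor_add_one (Real.exp (σ * n j))
    push_cast [k]
    exact this
  -- As `σ ≥ 0`, rounding up at most doubles the exponential; this adds `log 2`, which is negligible
  -- per particle.
  have hk2 : ∀ j, Real.log (k j) ≤ σ * n j + Real.log 2 := fun j => by
    rw [Real.log_le_iff_le_exp (by positivity), Real.exp_add, Real.exp_log two_pos]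
    have h1 := Nat.floor_le (Real.exp_pos (σ * n j)).le
    have h2 : 1 ≤ Real.exp (σ * n j) := Real.one_le_exp (by positivity)
    push_cast [k]
    linarith
  have hcube := tendsToInfinity_cube (𝒢 := 𝒢) hd hL fun j => Nat.le_add_left 1 j
  have hn0 : ∀ j, (0 : ℝ) < n j := fun j => by positivity
  have hpow : Tendsto (fun j : ℕ => ρ * (1 + r / ((j + 1 : ℕ) : ℝ)) ^ d) atTop
      (𝓝 (ρ * (1 + 0) ^ d)) :=
    (((tendsto_const_nhds.div_atTop hLr).const_add 1).pow d).const_mul ρ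
  rw [add_zero, one_pow, mul_one] at hpow
  have hinv : Tendsto (fun j : ℕ => 1 / ((j + 1 : ℕ) : ℝ) ^ d) atTop (𝓝 0) :=
    tendsto_const_nhds.div_atTop ((tendsto_pow_atTop (by omega)).comp hLr)
  have hid : ∀ j : ℕ, ρ * (((j + 1 : ℕ) : ℝ) + r) ^ d / ((j + 1 : ℕ) : ℝ) ^ d =
      ρ * (1 + r / ((j + 1 : ℕ) : ℝ)) ^ d := fun j => by
    rw [mul_div_assoc, ← div_pow, add_div, div_self (by positivity)]
  have hdens : Tendsto (fun j => (n j : ℝ) / ((j + 1 : ℕ) : ℝ) ^ d) atTop (𝓝 ρ) := by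
    have hup := hpow.add hinv
    rw [add_zero] at hup
    refine tendsto_of_tendsto_of_tendsto_of_le_of_le hpow hup (fun j => ?_) fun j => ?_
    · change ρ * (1 + r / ((j + 1 : ℕ) : ℝ)) ^ d ≤ _
      rw [← hid]
      gcongr
      exact (hn1 j).le
    · change _ ≤ ρ * (1 + r / ((j + 1 : ℕ) : ℝ)) ^ d + 1 / ((j + 1 : ℕ) : ℝ) ^ d
      rw [← hid, ← add_div]
      gcongr
      exact hn2 j
  have hnt : Tendsto (fun j => (n j : ℝ)) atTop atTop := by
    have h1 : Tendsto (fun j : ℕ => ρ * ((j + 1 : ℕ) : ℝ) ^ d) atTop atTop :=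
      ((tendsto_pow_atTop (by omega)).comp hLr).const_mul_atTop hρ
    refine tendsto_atTop_mono (fun j => le_trans ?_ (hn1 j).le) h1
    gcongr
    linarith [(Nat.cast_nonneg r : (0 : ℝ) ≤ r)]
  refine ⟨n, k, ⟨hcube, ?_, fun j => Nat.le_add_left 1 _, ?_⟩, fun j => ⟨hn1 j, hk1 j⟩⟩
  · simp only [toReal_volume_cube]
    exact hdens
  · refine tendsto_of_tendsto_of_tendsto_of_le_of_le tendsto_const_nhds
      (by simpa using (tendsto_const_nhds.div_atTop hnt).const_add σ :
        Tendsto (fun j => σ + Real.log 2 / n j) atTop (𝓝 σ)) (fun j => ?_) fun j => ?_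
    · change σ ≤ _
      rw [le_div_iff₀ (hn0 j)]
      exact (hk1 j).le
    · change _ ≤ σ + Real.log 2 / n j
      rw [div_le_iff₀ (hn0 j), add_mul, div_mul_cancel₀ _ (hn0 j).ne']
      exact hk2 j

theorem toReal_eigenvalue_div (Λ : Set (Site 𝒢 d)) (n k : ℕ) (ω : Ω) :
    (M.eigenvalue Λ n k ω / ((n : ℝ) : EReal)).toReal = M.energy Λ n k ω / n := by
  rw [div_eq_mul_inv, EReal.toReal_mul, ← EReal.coe_inv, EReal.toReal_coe, ← div_eq_mul_inv]
  rfl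

variable [AddAction (Fin d → ℤ) Ω] [MeasurableConstVAdd (Fin d → ℤ) Ω]
  [VAddInvariantMeasure (Fin d → ℤ) Ω P] [IsProbabilityMeasure P]

namespace Model.IsRegular

theorem hasBound_of_eigenvalue_lt_top (hM : M.IsRegular P K B C₀ r₀ C lam) {L r n k : ℕ}
    (hr : r₀ < r) (hL : 1 ≤ L) (hn : 1 ≤ n) (hk : 1 ≤ k) (hdens : ρ * ((L : ℝ) + r) ^ d < n)
    (hent : σ * n < Real.log k) (h : ∀ᵐ ω ∂P, M.eigenvalue (cube 𝒢 d L) n k ω < ⊤) :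
    ∃ g, M.HasBound P B r₀ C lam ρ σ g := by
  obtain ⟨ω, hω⟩ := h.exists
  exact ⟨_, L, r, n, k, hr, ⟨hL, hn, hk, (hM.eigenvalue_lt_top_iff (isBounded_cube 𝒢 d L) hk ω).1
    hω⟩, hdens, hent, lt_add_one _⟩

/-- Convergence includes almost sure finiteness for large `j`; it is applied to overfilled cubes. -/
theorem exists_hasBound_of_limit (hM : M.IsRegular P K B C₀ r₀ C lam) (hρ : 0 < ρ) (hσ : 0 ≤ σ)
    {e : ℝ} (h : M.HasThermodynamicLimit P ρ σ e) : ∃ g, M.HasBound P B r₀ C lam ρ σ g := by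
  obtain ⟨n, k, hΛ, hnk⟩ := exists_cubes (𝒢 := 𝒢) hM.dim_pos hρ hσ (⌊r₀⌋₊ + 1)
  obtain ⟨j, hj⟩ := (h _ n k hΛ).1.exists
  have hn : (0 : ℝ) < n j := lt_of_le_of_lt (by positivity) (hnk j).1
  refine hM.hasBound_of_eigenvalue_lt_top (r := ⌊r₀⌋₊ + 1) (by exact_mod_cast Nat.lt_floor_add_one r₀)
    (Nat.le_add_left 1 j) (by exact_mod_cast hn) (hΛ.index_pos j) (hnk j).1 (hnk j).2 ?_
  filter_upwards [hj] with ω hω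
  refine lt_top_iff_ne_top.2 fun htop => hω.1 ?_
  rw [htop, EReal.top_div_of_pos_ne_top (by exact_mod_cast hn) (EReal.coe_ne_top _)]

/-- Both numbers are limits along the same cubes. This uniqueness is needed since `energyDensity` is
an infimum over all possible limits. -/
theorem eq_of_hasThermodynamicLimit (hM : M.IsRegular P K B C₀ r₀ C lam) (hρ : 0 < ρ) (hσ : 0 ≤ σ)
    {e e' : ℝ} (h : M.HasThermodynamicLimit P ρ σ e) (h' : M.HasThermodynamicLimit P ρ σ e') :
    e = e' := by
  obtain ⟨n, k, hΛ, -⟩ := exists_cubes (𝒢 := 𝒢) hM.dim_pos hρ hσ 0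
  have h1 := (h _ n k hΛ).2
  have h2 := (h' _ n k hΛ).2
  simp only [toReal_eigenvalue_div] at h1 h2
  have hmeas : ∀ j (c : ℝ), AEStronglyMeasurable
      (fun ω => M.energy (cube 𝒢 d (j + 1)) (n j) (k j) ω / n j - c) P := fun j c =>
    (((hM.measurable_eigenvalue (isBounded_cube 𝒢 d (j + 1)) (hΛ.index_pos j)).ereal_toReal.div_const
      _).sub_const c).aestronglyMeasurable
  have h3 := h1.add h2
  rw [add_zero] at h3
  have h4 : ∀ j, eLpNorm (fun _ : Ω => e' - e) 2 P ≤
      eLpNorm (fun ω => M.energy (cube 𝒢 d (j + 1)) (n j) (k j) ω / n j - e) 2 P +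
      eLpNorm (fun ω => M.energy (cube 𝒢 d (j + 1)) (n j) (k j) ω / n j - e') 2 P := fun j => by
    refine le_trans (le_of_eq ?_) (eLpNorm_sub_le (hmeas j e) (hmeas j e') one_le_two)
    congr 1
    funext ω
    simp
  have h5 := le_antisymm (ge_of_tendsto' h3 h4) bot_le
  rw [eLpNorm_const _ two_ne_zero (NeZero.ne P), measure_univ, ENNReal.one_rpow, mul_one,
    enorm_eq_zero] at h5
  linarith

theorem energyDensity_eq_bound (hM : M.IsRegular P K B C₀ r₀ C lam) (hρ : 0 < ρ) (hσ : 0 ≤ σ)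
    (h : ∃ g, M.HasBound P B r₀ C lam ρ σ g) :
    M.energyDensity P ρ σ = M.bound P B r₀ C lam ρ σ := by
  have h1 := hM.hasThermodynamicLimit hρ h
  refine le_antisymm (iInf₂_le _ h1) (le_iInf₂ fun e he => ?_)
  rw [hM.eq_of_hasThermodynamicLimit hρ hσ h1 he]

theorem energyDensity_lt_top_iff (hM : M.IsRegular P K B C₀ r₀ C lam) (hρ : 0 < ρ) (hσ : 0 ≤ σ) :
    M.energyDensity P ρ σ < ⊤ ↔ ∃ g, M.HasBound P B r₀ C lam ρ σ g := by
  refine ⟨fun h => ?_, fun h => ?_⟩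
  · obtain ⟨e, he⟩ := iInf_lt_iff.1 h
    obtain ⟨he, -⟩ := iInf_lt_iff.1 he
    exact hM.exists_hasBound_of_limit hρ hσ he
  · rw [hM.energyDensity_eq_bound hρ hσ h]
    exact EReal.coe_lt_top _

theorem energyDensity_ne_bot (hM : M.IsRegular P K B C₀ r₀ C lam) (hρ : 0 < ρ) (hσ : 0 ≤ σ) :
    M.energyDensity P ρ σ ≠ ⊥ := by
  intro h
  have h1 := (hM.energyDensity_lt_top_iff hρ hσ).1 (h ▸ bot_lt_top)
  rw [hM.energyDensity_eq_bound hρ hσ h1] at h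
  exact EReal.coe_ne_bot _ h

/-- The excess `ρ' > ρ` pays for a corridor of fixed width once the cube is large. -/
theorem exists_hasBound_of_cubes (hM : M.IsRegular P K B C₀ r₀ C lam) (hρ : 0 < ρ)
    {ρ' σ' : ℝ} (hρ' : ρ < ρ') (hσ' : σ < σ') {L n k : ℕ → ℕ}
    (hΛ : IsThermodynamicSequence (fun j => cube 𝒢 d (L j)) n k ρ' σ')
    (h : ∀ j, ∀ᵐ ω ∂P, M.eigenvalue (cube 𝒢 d (L j)) (n j) (k j) ω < ⊤) :
    ∃ g, M.HasBound P B r₀ C lam ρ σ g := by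
  have hd := hM.dim_pos
  set r := ⌊r₀⌋₊ + 1 with hr
  have hvol := hΛ.domains.volume_tendsto
  have hdens := hΛ.density
  simp only [toReal_volume_cube] at hvol hdens
  have hLt : Tendsto (fun j => (L j : ℝ)) atTop atTop := by
    refine tendsto_atTop.2 fun b => ?_
    filter_upwards [hvol.eventually_ge_atTop (|b| ^ d)] with j hj
    exact (le_abs_self b).trans ((pow_le_pow_iff_left₀ (abs_nonneg b) (Nat.cast_nonneg _)
      (by omega)).1 hj)
  have hpow : Tendsto (fun j : ℕ => ρ * (1 + r / (L j : ℝ)) ^ d) atTop (𝓝 (ρ * (1 + 0) ^ d)) :=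
    (((tendsto_const_nhds.div_atTop hLt).const_add 1).pow d).const_mul ρ
  rw [add_zero, one_pow, mul_one] at hpow
  obtain ⟨j, hj1, hj2, hj3, hj4⟩ := ((hpow.eventually_lt hdens hρ').and
    ((hLt.eventually_ge_atTop 1).and ((hΛ.entropy.eventually (lt_mem_nhds hσ')).and
      ((tendsto_particles (hρ.trans hρ') hΛ).eventually_ge_atTop 1)))).exists
  have hL0 : (0 : ℝ) < L j := by linarith
  refine hM.hasBound_of_eigenvalue_lt_top (r := r) (by exact_mod_cast Nat.lt_floor_add_one r₀)
    (by exact_mod_cast hj2) (by exact_mod_cast hj4) (hΛ.index_pos j) ?_ ?_ (h j)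
  · rw [lt_div_iff₀ (by positivity)] at hj1
    refine lt_of_eq_of_lt ?_ hj1
    rw [mul_assoc, ← mul_pow, add_mul, one_mul, div_mul_cancel₀ _ hL0.ne']
  · rwa [lt_div_iff₀ (by linarith)] at hj3

theorem energyDensity_mono (hM : M.IsRegular P K B C₀ r₀ C lam) {ρ₁ ρ₂ σ₁ σ₂ : ℝ} (hρ₁ : 0 < ρ₁)
    (hρ : ρ₁ ≤ ρ₂) (hσ₁ : 0 ≤ σ₁) (hσ : σ₁ ≤ σ₂) :
    M.energyDensity P ρ₁ σ₁ ≤ M.energyDensity P ρ₂ σ₂ := by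
  rcases eq_top_or_lt_top (M.energyDensity P ρ₂ σ₂) with h | h
  · rw [h]
    exact le_top
  have h2 := (hM.energyDensity_lt_top_iff (hρ₁.trans_le hρ) (hσ₁.trans hσ)).1 h
  have h1 : ∃ g, M.HasBound P B r₀ C lam ρ₁ σ₁ g := h2.imp fun g hg => hg.mono hρ hσ le_rfl
  rw [hM.energyDensity_eq_bound hρ₁ hσ₁ h1,
    hM.energyDensity_eq_bound (hρ₁.trans_le hρ) (hσ₁.trans hσ) h2, EReal.coe_le_coe_iff]
  exact csInf_le_csInf (hM.bddBelow_hasBound _ _) h2 fun g hg =>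
    Model.HasBound.mono hg hρ hσ le_rfl

/-- The value `-∞` does not occur, so an infinite value on the right makes the inequality trivial;
the finite case is the mixing of bounds. -/
theorem energyDensity_convex (hM : M.IsRegular P K B C₀ r₀ C lam) {ρ₁ ρ₂ σ₁ σ₂ a b : ℝ}
    (hρ₁ : 0 < ρ₁) (hρ₂ : 0 < ρ₂) (hσ₁ : 0 ≤ σ₁) (hσ₂ : 0 ≤ σ₂) (ha : 0 < a) (hb : 0 < b)
    (hab : a + b = 1) :
    M.energyDensity P (a * ρ₁⁻¹ + b * ρ₂⁻¹)⁻¹ (a * σ₁ + b * σ₂) ≤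
      (a : EReal) * M.energyDensity P ρ₁ σ₁ + (b : EReal) * M.energyDensity P ρ₂ σ₂ := by
  have hnb₁ := hM.energyDensity_ne_bot hρ₁ hσ₁
  have hnb₂ := hM.energyDensity_ne_bot hρ₂ hσ₂
  have hmul : ∀ {c : ℝ} {x : EReal}, 0 < c → x ≠ ⊥ → (c : EReal) * x ≠ ⊥ := by
    intro c x hc hx
    induction x with
    | bot => exact absurd rfl hx
    | coe x => rw [← EReal.coe_mul]; exact EReal.coe_ne_bot _
    | top => rw [EReal.coe_mul_top_of_pos hc]; exact top_ne_bot
  rcases eq_top_or_lt_top (M.energyDensity P ρ₁ σ₁) with h₁ | h₁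
  · rw [h₁, EReal.coe_mul_top_of_pos ha, EReal.top_add_of_ne_bot (hmul hb hnb₂)]
    exact le_top
  rcases eq_top_or_lt_top (M.energyDensity P ρ₂ σ₂) with h₂ | h₂
  · rw [h₂, EReal.coe_mul_top_of_pos hb, EReal.add_top_of_ne_bot (hmul ha hnb₁)]
    exact le_top
  have hF₁ := (hM.energyDensity_lt_top_iff hρ₁ hσ₁).1 h₁
  have hF₂ := (hM.energyDensity_lt_top_iff hρ₂ hσ₂).1 h₂
  have hmix : ∀ g₁ g₂, M.HasBound P B r₀ C lam ρ₁ σ₁ g₁ → M.HasBound P B r₀ C lam ρ₂ σ₂ g₂ →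
      M.HasBound P B r₀ C lam (a * ρ₁⁻¹ + b * ρ₂⁻¹)⁻¹ (a * σ₁ + b * σ₂) (a * g₁ + b * g₂) :=
    fun g₁ g₂ => hM.hasBound_mix hρ₁ hρ₂ ha hb hab
  have hF : ∃ g, M.HasBound P B r₀ C lam (a * ρ₁⁻¹ + b * ρ₂⁻¹)⁻¹ (a * σ₁ + b * σ₂) g := by
    obtain ⟨g₁, h1⟩ := hF₁
    obtain ⟨g₂, h2⟩ := hF₂
    exact ⟨_, hmix _ _ h1 h2⟩
  rw [hM.energyDensity_eq_bound hρ₁ hσ₁ hF₁, hM.energyDensity_eq_bound hρ₂ hσ₂ hF₂,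
    hM.energyDensity_eq_bound (by positivity) (by positivity) hF, ← EReal.coe_mul, ← EReal.coe_mul,
    ← EReal.coe_add, EReal.coe_le_coe_iff]
  refine le_of_forall_pos_le_add fun ε hε => ?_
  refine (hM.bound_le (hmix _ _ (hasBound_of_bound_lt hF₁ (lt_add_of_pos_right _ hε))
    (hasBound_of_bound_lt hF₂ (lt_add_of_pos_right _ hε)))).trans (le_of_eq ?_)
  rw [mul_add, mul_add, add_add_add_comm, ← add_mul, hab, one_mul]

/-- By monotonicity a bound that fails at a point to the lower left fails at all points near `(ρ,
σ)`, and a bound that holds at a point to the upper right holds at all of them. Neither half needs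
an interior point, so the whole set of finiteness is covered. -/
theorem energyDensity_continuousOn (hM : M.IsRegular P K B C₀ r₀ C lam) :
    ContinuousOn (fun p : ℝ × ℝ => M.energyDensity P p.1 p.2)
      {p | 0 < p.1 ∧ 0 ≤ p.2 ∧ M.energyDensity P p.1 p.2 < ⊤} := by
  rintro ⟨ρ, σ⟩ ⟨hρ, hσ, hfin⟩
  have hF := (hM.energyDensity_lt_top_iff hρ hσ).1 hfin
  have hS : ∀ᶠ p : ℝ × ℝ in 𝓝[{p | 0 < p.1 ∧ 0 ≤ p.2 ∧ M.energyDensity P p.1 p.2 < ⊤}] (ρ, σ),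
      (∃ g, M.HasBound P B r₀ C lam p.1 p.2 g) ∧
        M.energyDensity P p.1 p.2 = M.bound P B r₀ C lam p.1 p.2 := by
    filter_upwards [self_mem_nhdsWithin] with p hp
    have h1 := (hM.energyDensity_lt_top_iff hp.1 hp.2.1).1 hp.2.2
    exact ⟨h1, hM.energyDensity_eq_bound hp.1 hp.2.1 h1⟩
  change Tendsto _ _ (𝓝 (M.energyDensity P ρ σ))
  rw [hM.energyDensity_eq_bound hρ hσ hF]
  refine tendsto_order.2 ⟨fun a ha => ?_, fun a ha => ?_⟩
  · obtain ⟨h, hah, hh⟩ := EReal.lt_iff_exists_real_btwn.1 ha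
    obtain ⟨ρ', -, hρ', σ', hσ', hnot⟩ := hM.exists_not_hasBound hρ hF (EReal.coe_lt_coe_iff.1 hh)
    filter_upwards [hS, nhdsWithin_le_nhds (prod_mem_nhds (Ioi_mem_nhds hρ') (Ioi_mem_nhds hσ'))]
      with p ⟨h1, h2⟩ h3
    rw [h2]
    refine hah.trans_le (EReal.coe_le_coe_iff.2 ?_)
    by_contra! hlt
    exact hnot ((hasBound_of_bound_lt h1 hlt).mono (le_of_lt h3.1) (le_of_lt h3.2) le_rfl)
  · obtain ⟨h, hh, hha⟩ := EReal.lt_iff_exists_real_btwn.1 ha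
    obtain ⟨ρ', hρ', σ', hσ', g, hg, hb⟩ :=
      (hasBound_of_bound_lt hF (EReal.coe_lt_coe_iff.1 hh)).exists_lt
    filter_upwards [hS, nhdsWithin_le_nhds (prod_mem_nhds (Iio_mem_nhds hρ') (Iio_mem_nhds hσ'))]
      with p ⟨h1, h2⟩ h3
    rw [h2]
    refine lt_of_le_of_lt (EReal.coe_le_coe_iff.2 ?_) hha
    exact (hM.bound_le (hb.mono (le_of_lt h3.1) (le_of_lt h3.2) le_rfl)).trans hg.le

/-- Some larger density belongs to the set that defines the supremum, and monotonicity in `ρ` does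
the rest. -/
theorem energyDensity_lt_top_of_lt (hM : M.IsRegular P K B C₀ r₀ C lam) (hρ : 0 < ρ) (hσ : 0 ≤ σ)
    (h : ENNReal.ofReal ρ < M.criticalDensity P) : M.energyDensity P ρ σ < ⊤ := by
  obtain ⟨_, ⟨ρ', hρ', rfl, h1⟩, h2⟩ := lt_sSup_iff.1 h
  exact (hM.energyDensity_mono hρ ((ENNReal.ofReal_lt_ofReal_iff hρ').1 h2).le hσ le_rfl).trans_lt
    (h1 σ hσ)

end Model.IsRegular

theorem IsTempered.mono {W : (n : ℕ) → (Fin n → Site 𝒢 d) → EReal} {R R' C lam : ℝ}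
    (h : IsTempered W R C lam) (hR : R ≤ R') : IsTempered W R' C lam :=
  ⟨h.tail_nonneg, h.decay, fun a b n hab ha hb I x y hxy =>
    h.split a b n hab ha hb I x y fun i j => hR.trans (hxy i j), h.one, h.shift⟩

end Density

end RandomGas

/-! ### The main theorem -/

theorem mainTheorem3 (𝒢 : Medium) (d : ℕ) (hd : 1 ≤ d)
    {Ω : Type*} [MeasurableSpace Ω] (P : Measure Ω) [IsProbabilityMeasure P]
    [AddAction (Fin d → ℤ) Ω] [MeasurableConstVAdd (Fin d → ℤ) Ω] [ErgodicVAdd (Fin d → ℤ) Ω P]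
    (M : Model 𝒢 d Ω)
    (hV_meas : Measurable (Function.uncurry M.potential))
    (hV_loc : ∀ ω, LocallyIntegrable (M.potential ω) volume)
    (hV_mom : ∃ K : Ω → ℝ, MemLp K 2 P ∧ ∀ ω, ∀ x ∈ unitCell 𝒢 d, M.potential ω x ≤ K ω)
    (hV_cov : M.IsCovariant)
    (hV_iad : M.IsIndependentAtDistance P)
    (hW_meas : ∀ n, Measurable (M.interaction n))
    (hLB : M.IsLowerBounded)
    (hSI : M.IsStable)
    (hW : M.IsTemperedPair ∨
      (M.IsCompactlySupported ∧ M.IsTranslationInvariant ∧ M.HasNoSelfInteraction)) :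
    -- the limit exists and is finite below densities and entropies that are attained in cubes
    (∀ ρ σ : ℝ, 0 < ρ → 0 ≤ σ →
      (∃ ρ' > ρ, ∃ σ' > σ, ∃ L n k : ℕ → ℕ,
        IsThermodynamicSequence (fun j => cube 𝒢 d (L j)) n k ρ' σ' ∧
        ∀ j, ∀ᵐ ω ∂P, M.eigenvalue (cube 𝒢 d (L j)) (n j) (k j) ω < ⊤) →
      ∃ e : ℝ, M.HasThermodynamicLimit P ρ σ e ∧ M.energyDensity P ρ σ = e) ∧
    -- convexity in `(ρ⁻¹, σ)`
    (∀ ρ₁ ρ₂ σ₁ σ₂ a b : ℝ, 0 < ρ₁ → 0 < ρ₂ → 0 ≤ σ₁ → 0 ≤ σ₂ → 0 < a → 0 < b → a + b = 1 →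
      M.energyDensity P (a * ρ₁⁻¹ + b * ρ₂⁻¹)⁻¹ (a * σ₁ + b * σ₂) ≤
        (a : EReal) * M.energyDensity P ρ₁ σ₁ + (b : EReal) * M.energyDensity P ρ₂ σ₂) ∧
    -- monotonicity in `ρ` and in `σ`
    (∀ ρ₁ ρ₂ σ₁ σ₂ : ℝ, 0 < ρ₁ → ρ₁ ≤ ρ₂ → 0 ≤ σ₁ → σ₁ ≤ σ₂ →
      M.energyDensity P ρ₁ σ₁ ≤ M.energyDensity P ρ₂ σ₂) ∧
    -- continuity below the critical density, and on the whole set where the density is finite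
    ContinuousOn (fun p : ℝ × ℝ => M.energyDensity P p.1 p.2)
      {p | 0 < p.1 ∧ ENNReal.ofReal p.1 < M.criticalDensity P ∧ 0 ≤ p.2} ∧
    ContinuousOn (fun p : ℝ × ℝ => M.energyDensity P p.1 p.2)
      {p | 0 < p.1 ∧ 0 ≤ p.2 ∧ M.energyDensity P p.1 p.2 < ⊤} := by
  obtain ⟨K, hK, hVK⟩ := hV_mom
  obtain ⟨R₁, -, hind⟩ := hV_iad
  obtain ⟨C₀, hC₀, hlow⟩ := hLB
  obtain ⟨B, hB, hstab⟩ := hSI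
  obtain ⟨R, C, lam, hW⟩ : ∃ R C lam, IsTempered M.interaction R C lam := by
    rcases hW with h | ⟨h1, h2, h3⟩
    · exact isTempered_of_isTemperedPair h
    · obtain ⟨R, hR⟩ := isTempered_of_isCompactlySupported h1 h2 h3
      exact ⟨R, _, _, hR⟩
  -- One separation serves all purposes: `R` for the interaction, `R₁` for independence, and 3,
  -- which exceeds the 2 needed to keep forward differences disjoint.
  have hM : M.IsRegular P K B C₀ (max R (max R₁ 3)) C lam :=
    { dim_pos := hd
      measurable := hV_meas
      loc := hV_loc
      memLp := hK
      potential_le := hVK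
      covariant := hV_cov
      indep := fun S T hST => hind S T fun x hx y hy =>
        ((le_max_left R₁ 3).trans (le_max_right R _)).trans_lt (hST x hx y hy)
      measurable_interaction := hW_meas
      lower := hlow
      lower_nonneg := hC₀.le
      stable := hstab
      stable_nonneg := hB.le
      tempered := hW.mono (le_max_left _ _)
      two_lt := lt_of_lt_of_le (by norm_num) ((le_max_right R₁ 3).trans (le_max_right R _)) }
  refine ⟨?_, ?_, ?_, ?_, hM.energyDensity_continuousOn⟩
  · rintro ρ σ hρ hσ ⟨ρ', hρ', σ', hσ', L, n, k, hΛ, hfin⟩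
    have h := hM.exists_hasBound_of_cubes hρ hρ' hσ' hΛ hfin
    exact ⟨_, hM.hasThermodynamicLimit hρ h, hM.energyDensity_eq_bound hρ hσ h⟩
  · intro ρ₁ ρ₂ σ₁ σ₂ a b h₁ h₂ h₃ h₄ ha hb hab
    exact hM.energyDensity_convex h₁ h₂ h₃ h₄ ha hb hab
  · intro ρ₁ ρ₂ σ₁ σ₂ h₁ h₂ h₃ h₄
    exact hM.energyDensity_mono h₁ h₂ h₃ h₄
  · exact hM.energyDensity_continuousOn.mono fun p hp =>
      ⟨hp.1, hp.2.2, hM.energyDensity_lt_top_of_lt hp.1 hp.2.2 hp.2.1⟩
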